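/- Let $d\ge 2$, $\Lambda=(-1,1)\times\mathbb T^{d-1}$ with $\mathbb T=\mathbb R/\mathbb Z$, $\overline\Lambda=[-1,1]\times\mathbb T^{d-1}$, $\Gamma=\{u\in\overline\Lambda: u_1=\pm1\}$ with surface measure $dS$, and $\mathbf n_1(u)=u_1$ for $u\in\Gamma$. Fix $T>0$ and $\beta\ge 0$. Let $b:\Gamma\to(0,1)$ be the restriction to $\Gamma$ of a $C^2$ function $\theta$ defined on a neighbourhood of $\overline\Lambda$ in $\mathbb R\times\mathbb T^{d-1}$ with $c\le\theta\le C$ for some constants $0<c\le C<1$. Let $J:(\mathbb R\times\mathbb T^{d-1})^2\to[0,1]$ satisfy $J(u,v)=J(v,u)=J(0,v-u)$, $J(0,\cdot)\in C^1$, $J(0,u)=0$ if $|u_1|>1$, and $\int J(u,v)\,dv=1$ for all $u$. For $u,v\in\overline\Lambda$ put $$J^{\rm neum}(u,v)=J(u,v)+J(u,v+2(1-v_1)e_1)+J(u,v-2(1+v_1)e_1),$$ and $(J^{\rm neum}\star m)(u)=\int_\Lambda J^{\rm neum}(u,v)m(v)\,dv$. Let $\sigma(m)=2m(1-m)$. Let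 $\mathcal M$ be the space of finite signed Borel measures on $\overline\Lambda$ with the weak topology (generated by $m\mapsto\langle m,F\rangle=\int F\,dm$, $F\in C(\overline\Lambda)$) and the associated linear uniformity, and let $\mathcal F^1\subset\mathcal M$ be the set of measures $\rho(u)\,du$ with $0\le\rho\le1$ a.e. For $E=\mathcal M$ or $E=\mathcal M^{d+1}=\mathcal M^d\times\mathcal M$, let $D([0,T],E)$ be the set of right continuous trajectories with left limits in $E$, with the Skorohod ($J_1$) topology: a base of neighbourhoods of $x$ is given by the sets of all $y$ for which there is an increasing bijection $\tau$ of $[0,T]$ with $\sup_t|\tau(t)-t|<\varepsilon$ and $(x_t,y_{\tau(t)})\in V$ for all $t$, where $\varepsilon>0$ and $V$ is an entourage of $E$. $C^{n,m}([0,T]\times\Lambda)$ denotes the functions with $n$ time derivatives and $m$ space derivatives that are continuous on $[0,T]\times\overline\Lambda$; the subscript $0$ means vanishing on $\Gamma$; $C^m_0(\Lambda)$ is the space of functions in $C^m(\overline\Lambda)$ vanishing on $\Gamma$. For functions $f,g$ on $\Lambda$ write $\langle f,g\rangle=\int_\Lambda fg\,du$. For a trajectory $\pi$ with values in $\mathcal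 F^1$ write $\pi_t(du)=\rho_t(u)\,du$ and set $$\mathcal Q(\pi)=\sum_{k=1}^d\ \sup_{H\in C_c^\infty([0,T]\times\Lambda)}\Big\{\int_0^T\langle\rho_t,\partial_kH_t\rangle\,dt-2\int_0^T\!\!\int_\Lambda\sigma(\rho_t(u))H_t(u)^2\,du\,dt\Big\}.$$ Fix $\gamma\in\mathcal F^1$. For $F\in C_0^{1,2}([0,T]\times\Lambda)$ let $$\begin{aligned}\widehat{\mathbb I}_F(\pi)=\ &\langle\pi_T,F_T\rangle-\langle\gamma,F_0\rangle-\int_0^T\langle\pi_t,\partial_tF_t+\Delta F_t\rangle dt+\int_0^T\!\!\int_\Gamma b\,\mathbf n_1\,\partial_1F_t\,dS\,dt\\&-\beta\int_0^T\langle\sigma(\rho_t),\nabla F_t\cdot\nabla(J^{\rm neum}\star\rho_t)\rangle dt-\tfrac12\int_0^T\langle\sigma(\rho_t),|\nabla F_t|^2\rangle dt,\end{aligned}$$ and define $\mathcal I_T^\gamma:D([0,T],\mathcal M)\to[0,\infty]$ by $\mathcal I_T^\gamma(\pi)=\sup_{F\in C_0^{1,2}([0,T]\times\Lambda)}\widehat{\mathbb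 I}_F(\pi)$ if $\pi_t\in\mathcal F^1$ for all $t$ and $\mathcal Q(\pi)<\infty$, and $\mathcal I_T^\gamma(\pi)=+\infty$ otherwise. For $\mathbf V=(V_1,\dots,V_d)\in (C^{1,1}([0,T]\times\Lambda))^d$ let $$\begin{aligned}\widehat{\mathbb J}_{\mathbf V}(\mathbf W,\pi)=\ &\langle\mathbf W_T,\mathbf V_T\rangle-\int_0^T\langle\mathbf W_t,\partial_t\mathbf V_t\rangle dt-\int_0^T\langle\pi_t,\nabla\cdot\mathbf V_t\rangle dt+\int_0^T\!\!\int_\Gamma b\,\mathbf n_1V_1(t,\cdot)\,dS\,dt\\&-\beta\int_0^T\langle\sigma(\rho_t),\mathbf V_t\cdot\nabla(J^{\rm neum}\star\rho_t)\rangle dt-\tfrac12\int_0^T\langle\sigma(\rho_t),\mathbf V_t\cdot\mathbf V_t\rangle dt,\end{aligned}$$ where $\langle\mathbf W,\mathbf G\rangle=\sum_k\langle W_k,G_k\rangle$, and define $\mathcal J_T^\gamma:D([0,T],\mathcal M^{d+1})\to[0,\infty]$ by $\mathcal J_T^\gamma(\mathbf W,\pi)=\sup_{\mathbf V\in (C^{1,1}([0,T]\times\Lambda))^d}\widehat{\mathbb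 J}_{\mathbf V}(\mathbf W,\pi)$ if $\pi_t\in\mathcal F^1$ for all $t$, $\mathcal Q(\pi)<\infty$, and $$\langle\pi_t,G\rangle-\langle\gamma,G\rangle=\langle\mathbf W_t,\nabla G\rangle\qquad\text{for all }t\in[0,T],\ G\in C_0^1(\Lambda),$$ and $\mathcal J_T^\gamma(\mathbf W,\pi)=+\infty$ otherwise. **Proposition.** For every $\gamma\in\mathcal F^1$, the functional $\mathcal J_T^\gamma$ is lower semicontinuous on $D([0,T],\mathcal M^{d+1})$, and the functional $\mathcal I_T^\gamma$ is lower semicontinuous on $D([0,T],\mathcal M)$ with compact level sets, i.e. $\{\pi\in D([0,T],\mathcal M):\mathcal I_T^\gamma(\pi)\le a\}$ is compact for every $a\in\mathbb R$. -/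

import Mathlib

open MeasureTheory Set Filter Topology
open scoped ContDiff Uniformity SetRel

noncomputable section

namespace KawasakiKac

/-! ### Geometry

The dimension is `d = n + 1`; coordinate `0` is the axial one, coordinates `i.succ` are periodic. -/

/-- The infinite cylinder `S_d = ℝ × 𝕋^{d-1}` (the torus has side `1`). -/
abbrev InfCyl (n : ℕ) : Type := ℝ × (Fin n → UnitAddCircle)

/-- The closed cylinder `[-1,1] × 𝕋^{d-1}`, the closure of `Λ = (-1,1) × 𝕋^{d-1}`. Its `volume` is
Lebesgue measure, of total mass `2`; the boundary is a null set. -/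
abbrev Cyl (n : ℕ) : Type := Icc (-1 : ℝ) 1 × (Fin n → UnitAddCircle)

/-- The time interval `[0,T]`. -/
abbrev TimeI (T : ℝ) : Type := Icc (0 : ℝ) T

/-- Lebesgue measure on a compact interval. -/
instance iccMeasureSpace (a c : ℝ) : MeasureSpace (Icc a c) := Measure.Subtype.measureSpace

instance iccIsFiniteMeasure (a c : ℝ) : IsFiniteMeasure (volume : Measure (Icc a c)) := by
  refine ⟨?_⟩
  change Measure.comap Subtype.val volume univ < ⊤
  rw [comap_subtype_coe_apply measurableSet_Icc, image_univ, Subtype.range_coe, Real.volume_Icc]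
  exact ENNReal.ofReal_lt_top

/-- The initial time `0 ∈ [0,T]`. -/
def t0 (T : ℝ) [h : Fact (0 < T)] : TimeI T := ⟨0, le_rfl, h.out.le⟩

/-- The final time `T ∈ [0,T]`. -/
def t1 (T : ℝ) [h : Fact (0 < T)] : TimeI T := ⟨T, h.out.le, le_rfl⟩

/-- The closed cylinder inside the infinite one. -/
def Cyl.emb {n : ℕ} (u : Cyl n) : InfCyl n := ((u.1 : ℝ), u.2)

/-- The covering map `ℝ × ℝ^{d-1} → ℝ × 𝕋^{d-1}`. -/
def cover {n : ℕ} (x : ℝ × (Fin n → ℝ)) : InfCyl n := (x.1, fun i => (x.2 i : UnitAddCircle))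

/-- The boundary `Γ = {u : u₁ = ±1}`. -/
def bdry (n : ℕ) : Set (Cyl n) := {u | (u.1 : ℝ) = -1 ∨ (u.1 : ℝ) = 1}

/-- The point `(1, y)` of `Γ`. -/
def rightPt {n : ℕ} (y : Fin n → UnitAddCircle) : bdry n :=
  ⟨(⟨1, by norm_num, le_rfl⟩, y), Or.inr rfl⟩

/-- The point `(-1, y)` of `Γ`. -/
def leftPt {n : ℕ} (y : Fin n → UnitAddCircle) : bdry n :=
  ⟨(⟨-1, le_rfl, by norm_num⟩, y), Or.inl rfl⟩

/-- Surface integral `∫_Γ f dS`: the two components of `Γ` are copies of `𝕋^{d-1}`. -/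
def surfaceIntegral {n : ℕ} (f : bdry n → ℝ) : ℝ :=
  (∫ y, f (rightPt y)) + ∫ y, f (leftPt y)

/-- First component of the outward unit normal at `r ∈ Γ`, i.e. `±1` at `r₁ = ±1`. -/
def normal1 {n : ℕ} (r : bdry n) : ℝ := (r.1.1 : ℝ)

/-! ### Derivatives and classes of functions on `[0,T] × Λ̄` -/

/-- `F` has a partial derivative in direction `k` at `u` (one-sided if `k = 0` and `u ∈ Γ`). -/
def HasPartialAt {n : ℕ} (k : Fin (n + 1)) (F : Cyl n → ℝ) (u : Cyl n) : Prop :=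
  Fin.cases (motive := fun _ => Prop)
    (DifferentiableWithinAt ℝ (fun s : ℝ => F (projIcc (-1) 1 (by norm_num) s, u.2))
      (Icc (-1) 1) (u.1 : ℝ))
    (fun i => DifferentiableAt ℝ
      (fun s : ℝ => F (u.1, u.2 + Pi.single i (s : UnitAddCircle))) 0) k

/-- The partial derivative `∂_k F (u)` (one-sided if `k = 0` and `u ∈ Γ`). -/
def pderiv {n : ℕ} (k : Fin (n + 1)) (F : Cyl n → ℝ) (u : Cyl n) : ℝ :=
  Fin.cases (motive := fun _ => ℝ)
    (derivWithin (fun s : ℝ => F (projIcc (-1) 1 (by norm_num) s, u.2)) (Icc (-1) 1) (u.1 : ℝ))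
    (fun i => deriv (fun s : ℝ => F (u.1, u.2 + Pi.single i (s : UnitAddCircle))) 0) k

/-- The Laplacian. -/
def laplacian {n : ℕ} (F : Cyl n → ℝ) (u : Cyl n) : ℝ := ∑ k, pderiv k (pderiv k F) u

/-- The time derivative `∂_t F_t(u)` on `[0,T]` (one-sided at the end points). -/
def tderiv {n : ℕ} {T : ℝ} [h : Fact (0 < T)] (F : TimeI T → Cyl n → ℝ) (t : TimeI T)
    (u : Cyl n) : ℝ :=
  derivWithin (fun s : ℝ => F (projIcc 0 T h.out.le s) u) (Icc 0 T) (t : ℝ)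

/-- `F_x(u)` has all partial derivatives of order at most `m` in `u`, and these are jointly
continuous in the parameter `x` and in `u`, up to the boundary. -/
def IsCSpace {n : ℕ} {X : Type} [TopologicalSpace X] : ℕ → (X → Cyl n → ℝ) → Prop
  | 0, F => Continuous (Function.uncurry F)
  | m + 1, F => Continuous (Function.uncurry F) ∧
      ∀ k : Fin (n + 1), (∀ x u, HasPartialAt k (F x) u) ∧
        IsCSpace m (fun x u => pderiv k (F x) u)

/-- `F_t(u)` has time derivatives up to order `l`, jointly continuous on `[0,T] × Λ̄`. -/
def IsCTime {n : ℕ} {T : ℝ} [h : Fact (0 < T)] : ℕ → (TimeI T → Cyl n → ℝ) → Prop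
  | 0, F => Continuous (Function.uncurry F)
  | l + 1, F => Continuous (Function.uncurry F) ∧
      (∀ (t : TimeI T) (u : Cyl n), DifferentiableWithinAt ℝ
        (fun s : ℝ => F (projIcc 0 T h.out.le s) u) (Icc 0 T) (t : ℝ)) ∧
      IsCTime l (tderiv F)

/-- The space `C^{l,m}([0,T] × Λ)`: `l` derivatives in time and `m` in space, continuous up to the
boundary. -/
def IsC {n : ℕ} {T : ℝ} [Fact (0 < T)] (l m : ℕ) (F : TimeI T → Cyl n → ℝ) : Prop :=
  IsCTime l F ∧ IsCSpace m F

/-- The space `C^{l,m}_0([0,T] × Λ)` of functions vanishing on `Γ`. -/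
def IsC₀ {n : ℕ} {T : ℝ} [Fact (0 < T)] (l m : ℕ) (F : TimeI T → Cyl n → ℝ) : Prop :=
  IsC l m F ∧ ∀ t, ∀ u ∈ bdry n, F t u = 0

/-- The space `C^m_0(Λ)` of `m` times continuously differentiable functions on `Λ̄` vanishing on
`Γ`. -/
def IsC₀Space {n : ℕ} (m : ℕ) (G : Cyl n → ℝ) : Prop :=
  IsCSpace m (fun _ : Unit => G) ∧ ∀ u ∈ bdry n, G u = 0

/-- The space `C^∞_c([0,T] × Λ)`: jointly smooth, periodic in the torus coordinates, with compact
support in `[0,T] × Λ` (i.e. the closed support does not meet `[0,T] × Γ`). -/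
def IsSmoothCompact {n : ℕ} {T : ℝ} [h : Fact (0 < T)] (H : TimeI T → Cyl n → ℝ) : Prop :=
  ContDiffOn ℝ ∞ (fun p : ℝ × ℝ × (Fin n → ℝ) =>
      H (projIcc 0 T h.out.le p.1)
        (projIcc (-1) 1 (by norm_num) p.2.1, fun i => (p.2.2 i : UnitAddCircle)))
    (Icc 0 T ×ˢ Icc (-1) 1 ×ˢ univ) ∧
  tsupport (Function.uncurry H) ⊆ {p | p.2 ∉ bdry n}

/-! ### Data of the model -/

/-- A Kac interaction on `S_d`: a symmetric, translation invariant probability kernel of range `1`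
with values in `[0,1]`, such that `J(0,·)` is continuously differentiable. -/
structure KacKernel (n : ℕ) where
  toFun : InfCyl n → InfCyl n → ℝ
  mem_unit : ∀ u v, 0 ≤ toFun u v ∧ toFun u v ≤ 1
  symm : ∀ u v, toFun u v = toFun v u
  transl : ∀ u v, toFun u v = toFun 0 (v - u)
  contDiff : ContDiff ℝ 1 (fun x : ℝ × (Fin n → ℝ) => toFun 0 (cover x))
  range_one : ∀ u : InfCyl n, 1 < |u.1| → toFun 0 u = 0
  integral_one : ∀ u, ∫ v, toFun u v = 1

/-- The kernel `J^neum` on `Λ̄`, obtained from `J` by adding the interactions with the images of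
`v` under the reflections `v₁ ↦ 2 - v₁` and `v₁ ↦ -2 - v₁`. -/
def KacKernel.neum {n : ℕ} (J : KacKernel n) (u v : Cyl n) : ℝ :=
  J.toFun u.emb v.emb
    + J.toFun u.emb (v.emb + (2 * (1 - (v.1 : ℝ)), 0))
    + J.toFun u.emb (v.emb - (2 * (1 + (v.1 : ℝ)), 0))

/-- `(J^neum ⋆ m)(u) = ∫_Λ J^neum(u,v) m(v) dv`. -/
def KacKernel.star {n : ℕ} (J : KacKernel n) (m : Cyl n → ℝ) (u : Cyl n) : ℝ :=
  ∫ v, J.neum u v * m v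

/-- Boundary data: `b` is the restriction to `Γ` of a `C²` function `θ`, defined on a neighbourhood
of `Λ̄` and bounded away from `0` and `1`. -/
def AdmissibleBoundary {n : ℕ} (b : bdry n → ℝ) : Prop :=
  ∃ (V : Set (InfCyl n)) (θ : InfCyl n → ℝ) (c C : ℝ),
    IsOpen V ∧ (∀ u : Cyl n, u.emb ∈ V) ∧ 0 < c ∧ C < 1 ∧ (∀ u ∈ V, c ≤ θ u ∧ θ u ≤ C) ∧
    ContDiffOn ℝ 2 (fun x => θ (cover x)) (cover ⁻¹' V) ∧
    ∀ r : bdry n, θ r.1.emb = b r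

/-- The mobility `σ(m) = 2 m (1 - m)`. -/
def mobility (m : ℝ) : ℝ := 2 * (m * (1 - m))

/-! ### Measures and paths -/

/-- The space `M` of finite signed (Borel) measures on `Λ̄`. -/
def Meas (n : ℕ) : Type := SignedMeasure (Cyl n)

/-- The underlying signed measure. -/
def Meas.toSigned {n : ℕ} (m : Meas n) : SignedMeasure (Cyl n) := m

/-- `⟨m, F⟩ = ∫ F dm`. -/
def Meas.pair {n : ℕ} (m : Meas n) (F : Cyl n → ℝ) : ℝ :=
  VectorMeasure.integral m.toSigned F (ContinuousLinearMap.lsmul ℝ ℝ)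

/-- The weak topology on `M`, with its linear uniformity: the coarsest one that makes all maps
`m ↦ ⟨m, F⟩` with `F` continuous on `Λ̄` uniformly continuous. -/
instance Meas.uniformSpace (n : ℕ) : UniformSpace (Meas n) :=
  UniformSpace.comap (fun (m : Meas n) (F : C(Cyl n, ℝ)) => m.pair F) inferInstance

/-- `M^{d+1} = M^d × M`. -/
abbrev MeasVec (n : ℕ) : Type := (Fin (n + 1) → Meas n) × Meas n

/-- The set `F¹` of absolutely continuous measures with density between `0` and `1`. -/
def F1 (n : ℕ) : Set (Meas n) :=
  {m | ∃ ρ : Cyl n → ℝ, Measurable ρ ∧ (∀ᵐ u, 0 ≤ ρ u ∧ ρ u ≤ 1) ∧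
    m.toSigned = (volume : Measure (Cyl n)).withDensityᵥ ρ}

/-- The Lebesgue density `ρ` of `m(du) = ρ(u) du`. -/
def Meas.density {n : ℕ} (m : Meas n) : Cyl n → ℝ := m.toSigned.rnDeriv volume

/-- The set `D([0,T],E)` of right continuous trajectories with left limits. -/
structure Path (T : ℝ) (E : Type) [TopologicalSpace E] where
  toFun : TimeI T → E
  right_cont : ∀ t, ContinuousWithinAt toFun (Ici t) t
  left_lim : ∀ t, ∃ l, Tendsto toFun (𝓝[<] t) (𝓝 l)

instance {T : ℝ} {E : Type} [TopologicalSpace E] : CoeFun (Path T E) (fun _ => TimeI T → E) :=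
  ⟨Path.toFun⟩

/-- Pairs of paths that are `V`-close uniformly in time, after a time change which is uniformly
`ε`-close to the identity. Time changes are the increasing bijections of `[0,T]`. -/
def skorohodEntourage {T : ℝ} {E : Type} [TopologicalSpace E] (ε : ℝ) (V : Set (E × E)) :
    Set (Path T E × Path T E) :=
  {p | ∃ τ : TimeI T ≃o TimeI T, (∀ t, |(τ t : ℝ) - t| < ε) ∧ ∀ t, (p.1 t, p.2 (τ t)) ∈ V}

/-- The sets `skorohodEntourage ε V` form a filter basis. -/
def skorohodBasis (T : ℝ) (E : Type) [UniformSpace E] : FilterBasis (Path T E × Path T E) where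
  sets := {S | ∃ ε : ℝ, 0 < ε ∧ ∃ V ∈ 𝓤 E, S = skorohodEntourage ε V}
  nonempty := ⟨_, 1, one_pos, univ, univ_mem, rfl⟩
  inter_sets := by
    rintro _ _ ⟨ε, hε, V, hV, rfl⟩ ⟨δ, hδ, W, hW, rfl⟩
    refine ⟨_, ⟨min ε δ, lt_min hε hδ, V ∩ W, inter_mem hV hW, rfl⟩, ?_⟩
    rintro p ⟨τ, h1, h2⟩
    exact ⟨⟨τ, fun t => (h1 t).trans_le (min_le_left _ _), fun t => (h2 t).1⟩,
      ⟨τ, fun t => (h1 t).trans_le (min_le_right _ _), fun t => (h2 t).2⟩⟩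

/-- The Skorohod (`J₁`) topology on `D([0,T],E)`, for a uniform space `E`; for metric `E` it is the
usual one. -/
instance Path.uniformSpace (T : ℝ) (E : Type) [UniformSpace E] : UniformSpace (Path T E) :=
  UniformSpace.ofCore <| UniformSpace.Core.mkOfBasis (skorohodBasis T E)
    (by
      rintro _ ⟨ε, hε, V, hV, rfl⟩ x
      exact ⟨OrderIso.refl _, fun t => by simpa using hε, fun t => refl_mem_uniformity hV⟩)
    (by
      rintro _ ⟨ε, hε, V, hV, rfl⟩
      refine ⟨_, ⟨ε, hε, Prod.swap ⁻¹' V, symm_le_uniformity hV, rfl⟩, ?_⟩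
      rintro p ⟨τ, h1, h2⟩
      refine ⟨τ.symm, fun t => ?_, fun t => ?_⟩
      · have := h1 (τ.symm t)
        rw [OrderIso.apply_symm_apply, abs_sub_comm] at this
        exact this
      · have := h2 (τ.symm t)
        rw [OrderIso.apply_symm_apply] at this
        exact this)
    (by
      rintro _ ⟨ε, hε, V, hV, rfl⟩
      obtain ⟨W, hW, hWV⟩ := comp_mem_uniformity_sets hV
      refine ⟨_, ⟨ε / 2, half_pos hε, W, hW, rfl⟩, ?_⟩
      rintro ⟨x, z⟩ ⟨y, ⟨τ, h1, h2⟩, ⟨μ, h3, h4⟩⟩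
      refine ⟨τ.trans μ, fun t => ?_, fun t => hWV ⟨_, h2 t, h4 (τ t)⟩⟩
      have ha := abs_lt.1 (h1 t)
      have hb := abs_lt.1 (h3 (τ t))
      rw [OrderIso.trans_apply, abs_lt]
      constructor <;> linarith [ha.1, ha.2, hb.1, hb.2])

/-! ### The rate functionals -/

section Functionals

open Classical

variable {n : ℕ} {T : ℝ} [Fact (0 < T)]

/-- Continuity equation: `⟨π_t, G⟩ - ⟨γ, G⟩ = ⟨W_t, ∇G⟩` for all `t` and all `G ∈ C¹₀(Λ)`. -/
def ContinuityEq (γ : Meas n) (W : TimeI T → Fin (n + 1) → Meas n) (π : TimeI T → Meas n) :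
    Prop :=
  ∀ t, ∀ G : Cyl n → ℝ, IsC₀Space 1 G →
    (π t).pair G - γ.pair G = ∑ k, (W t k).pair (pderiv k G)

/-- The energy `Q(π)`, for a trajectory with densities `ρ_t`. -/
def energyQ (π : TimeI T → Meas n) : EReal :=
  ∑ k : Fin (n + 1), ⨆ H : {H : TimeI T → Cyl n → ℝ // IsSmoothCompact H},
    (((∫ t, ∫ u, (π t).density u * pderiv k (H.1 t) u)
      - 2 * ∫ t, ∫ u, mobility ((π t).density u) * (H.1 t u) ^ 2 : ℝ) : EReal)

/-- The energy functional `E^γ(W,π)`. -/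
def energy (γ : Meas n) (W : TimeI T → Fin (n + 1) → Meas n) (π : TimeI T → Meas n) : EReal :=
  if ContinuityEq γ W π ∧ ∀ t, π t ∈ F1 n then energyQ π else ⊤

/-- The linear functional `L_V^β(W,π)`. -/
def linearL (β : ℝ) (J : KacKernel n) (b : bdry n → ℝ) (V : Fin (n + 1) → TimeI T → Cyl n → ℝ)
    (W : TimeI T → Fin (n + 1) → Meas n) (π : TimeI T → Meas n) : ℝ :=
  (∑ k, (W (t1 T) k).pair (V k (t1 T)))
    - (∫ t, ∑ k, (W t k).pair (tderiv (V k) t))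
    - (∫ t, (π t).pair (fun u => ∑ k, pderiv k (V k t) u))
    + (∫ t, surfaceIntegral (fun r => b r * normal1 r * V 0 t r.1))
    - β * ∫ t, ∫ u, mobility ((π t).density u)
        * ∑ k, V k t u * pderiv k (J.star (π t).density) u

/-- The functional `Ĵ_V(W,π)`. -/
def hatJ (β : ℝ) (J : KacKernel n) (b : bdry n → ℝ) (V : Fin (n + 1) → TimeI T → Cyl n → ℝ)
    (W : TimeI T → Fin (n + 1) → Meas n) (π : TimeI T → Meas n) : ℝ :=
  linearL β J b V W π
    - 1 / 2 * ∫ t, ∫ u, mobility ((π t).density u) * ∑ k, V k t u * V k t u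

/-- The rate functional `𝒥_T^γ` on `D([0,T], M^{d+1})`. -/
def rateJ (β : ℝ) (J : KacKernel n) (b : bdry n → ℝ) (γ : Meas n) (x : Path T (MeasVec n)) :
    EReal :=
  if energy γ (fun t => (x t).1) (fun t => (x t).2) < ⊤ then
    ⨆ V : {V : Fin (n + 1) → TimeI T → Cyl n → ℝ // ∀ k, IsC 1 1 (V k)},
      (hatJ β J b V.1 (fun t => (x t).1) (fun t => (x t).2) : EReal)
  else ⊤

/-- The weak form `ℓ_F^β(ρ|γ)` of the hydrodynamic equation. -/
def ell (β : ℝ) (J : KacKernel n) (b : bdry n → ℝ) (γ : Meas n) (F : TimeI T → Cyl n → ℝ)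
    (π : TimeI T → Meas n) : ℝ :=
  (π (t1 T)).pair (F (t1 T)) - γ.pair (F (t0 T))
    - (∫ t, (π t).pair (tderiv F t))
    - (∫ t, (π t).pair (laplacian (F t)))
    + (∫ t, surfaceIntegral (fun r => b r * normal1 r * pderiv 0 (F t) r.1))
    - β * ∫ t, ∫ u, mobility ((π t).density u)
        * ∑ k, pderiv k (F t) u * pderiv k (J.star (π t).density) u

/-- The functional `Î_F^γ(π)`. -/
def hatI (β : ℝ) (J : KacKernel n) (b : bdry n → ℝ) (γ : Meas n) (F : TimeI T → Cyl n → ℝ)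
    (π : TimeI T → Meas n) : ℝ :=
  ell β J b γ F π
    - 1 / 2 * ∫ t, ∫ u, mobility ((π t).density u) * ∑ k, pderiv k (F t) u * pderiv k (F t) u

/-- The rate functional `ℐ_T^γ` on `D([0,T], M)`. -/
def rateI (β : ℝ) (J : KacKernel n) (b : bdry n → ℝ) (γ : Meas n) (π : Path T (Meas n)) :
    EReal :=
  if (∀ t, π t ∈ F1 n) ∧ energyQ π.toFun < ⊤ then
    ⨆ F : {F : TimeI T → Cyl n → ℝ // IsC₀ 1 2 F}, (hatI β J b γ F.1 π.toFun : EReal)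
  else ⊤

end Functionals

end KawasakiKac

end

noncomputable section

namespace KawasakiKac

/-! ### Signed measures with the weak topology. -/

section MeasSpace

variable {n : ℕ}

/-! Everything follows from an a priori estimate that is uniform over sublevel sets. Let `P_N` be an
explicit smoothing operator with Dirichlet condition on `Γ` (`mop N (-1) 0`), and suppose that `π`
is weakly right continuous with values in `F1` and that the functional of `ℐ` is at most `a` on the
tests `F = P_N A` alone; this is `Good`. If `ℐ(π) ≤ a`, this holds by definition. If `𝒥(W, π) ≤ a`,
it holds for `π` because with `V = ∇F` the continuity equation turns the functional of `𝒥` into that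
of `ℐ` (`hatJ_eq_hatI`). So one theory serves both functionals.

Time regularity. Tests `φ(t) P_N g(u)` with `φ` a smoothed indicator of `[s,t]`, scaled by a free
factor `l`, give `l (⟨π_t, P_N g⟩ - ⟨π_s, P_N g⟩) ≤ a + C (|l| + l²)(t - s)`. A large `l` yields a
modulus of continuity that depends only on `a` and the data (`Good.modulus`); a test concentrated at
time `0` yields `π_0 = γ` (`Good.initial`).

Energy. Let `θ` be a `C¹` extension of `b`, `ρ^N = P_N(ρ - θ) + θ`, and `g_δ` the entropy
regularized by `δ`. Test with `κ P_N(g_δ'(ρ^N) - g_δ'(θ))`, smoothed in time by a Steklov average.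
Convexity of `g_δ` bounds the time part below. In space, symmetry of `P_N` turns the linear part
into `κ ∫ g_δ''(ρ^N) |∇ρ^N|²` up to a commutator that vanishes as `N → ∞`. Jensen's inequality for
the concave `σ`, together with boundedness of `σ g_δ''`, makes the quadratic part of order `κ²`
times the same integral, so a small `κ` absorbs it; the interaction costs a constant (`spat_lower`).
Hence `∫∫ g_δ''(ρ^N) |∇ρ^N|² ≤ K` with `K` independent of `δ`, for all `N` large depending on `δ`
(`energy_bound`). Since `4 / g_δ'' ≤ 2σ + O(δ)`, the limits `N → ∞` and `δ → 0` show that `Q(π)` is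
finite (`Good.energyQ_lt_top`). So finiteness of `Q` is a consequence of the other conditions, and
no semicontinuity of `Q` is needed when sublevel sets are closed up.

Strong convergence. As `g_δ'' ≥ 1`, the same bound controls `∇ρ^N` in `L²`. A Poincaré inequality
for `P_M` (`eventually_integral_abs_mop_sub_le`) makes `ρ - θ` uniformly `L¹`-close to its
mollification, and mollified densities converge uniformly by equicontinuity. Pointwise weak
convergence in a sublevel set is therefore `L¹` convergence of densities (`Good.tendsto_density`),
and the nonlinear terms with `σ(ρ)` pass to the limit.

Conclusion. By equicontinuity, Skorohod convergence inside a sublevel set implies pointwise weak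
convergence, so sublevel sets are closed. For `ℐ` they are compact, because `F1` is weakly compact
and pointwise limits along ultrafilters are uniform in time for each test function. For `𝒥` the
gradient estimate bounds the functional below by the `L²` norm of `V`, which gives a uniform bound
and a uniform modulus for the currents (`rateJ_bound_modulus`), enough to pass to the limit in the
terms linear in `W`. -/

/-- A measure as an element of the space `Meas`. -/
def Meas.ofSigned (s : SignedMeasure (Cyl n)) : Meas n := s

lemma SignedMeasure.isFiniteMeasure_variation (s : SignedMeasure (Cyl n)) :
    IsFiniteMeasure s.variation := by
  rw [← SignedMeasure.totalVariation_eq_variation]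
  unfold SignedMeasure.totalVariation
  infer_instance

lemma integrable_of_continuous {μ : Measure (Cyl n)} [IsFiniteMeasure μ] {F : Cyl n → ℝ}
    (hF : Continuous F) : Integrable F μ :=
  hF.integrable_of_hasCompactSupport (HasCompactSupport.of_compactSpace F)

lemma Meas.integrable (m : Meas n) {F : Cyl n → ℝ} (hF : Continuous F) :
    VectorMeasure.Integrable m.toSigned F := by
  have := SignedMeasure.isFiniteMeasure_variation m.toSigned
  exact integrable_of_continuous hF

lemma Meas.pair_sub (m : Meas n) {F G : Cyl n → ℝ} (hF : Continuous F) (hG : Continuous G) :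
    m.pair (fun u => F u - G u) = m.pair F - m.pair G :=
  VectorMeasure.integral_fun_sub (m.integrable hF) (m.integrable hG)

lemma Meas.pair_smul (m : Meas n) (c : ℝ) (F : Cyl n → ℝ) :
    m.pair (fun u => c * F u) = c * m.pair F :=
  VectorMeasure.integral_fun_smul m.toSigned _ c F

lemma Meas.pair_zero (m : Meas n) : m.pair (fun _ => 0) = 0 :=
  VectorMeasure.integral_zero ..

/-- Total mass of the variation. -/
def Meas.mass (m : Meas n) : ℝ := m.toSigned.variation.real univ

lemma Meas.mass_nonneg (m : Meas n) : 0 ≤ m.mass := measureReal_nonneg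

lemma Meas.abs_pair_le (m : Meas n) {F : Cyl n → ℝ} {C : ℝ} (h : ∀ u, |F u| ≤ C) :
    |m.pair F| ≤ C * m.mass := by
  have := SignedMeasure.isFiniteMeasure_variation m.toSigned
  have h1 := VectorMeasure.norm_integral_le_of_norm_le_const (μ := m.toSigned) (f := F)
    (B := ContinuousLinearMap.lsmul ℝ ℝ) (C := C) (ae_of_all _ h)
  have h2 : ‖(ContinuousLinearMap.lsmul ℝ ℝ : ℝ →L[ℝ] ℝ →L[ℝ] ℝ)‖ = 1 := by
    simp
  rw [h2, mul_one] at h1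
  exact h1

lemma pair_toSignedMeasure {μ : Measure (Cyl n)} [IsFiniteMeasure μ] (F : Cyl n → ℝ) :
    (Meas.ofSigned μ.toSignedMeasure).pair F = ∫ u, F u ∂μ := by
  rw [← VectorMeasure.integral_toSignedMeasure]
  unfold Meas.pair Meas.toSigned Meas.ofSigned
  congr 1
  ext; simp

lemma Meas.pair_eq_jordan (m : Meas n) {F : Cyl n → ℝ} (hF : Continuous F) :
    m.pair F = (∫ u, F u ∂m.toSigned.toJordanDecomposition.posPart)
      - ∫ u, F u ∂m.toSigned.toJordanDecomposition.negPart := by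
  rw [← pair_toSignedMeasure, ← pair_toSignedMeasure]
  have h := m.toSigned.toSignedMeasure_toJordanDecomposition
  unfold Meas.pair
  conv_lhs => rw [← h]
  exact VectorMeasure.integral_sub_vectorMeasure ((Meas.ofSigned _).integrable hF)
    ((Meas.ofSigned _).integrable hF)

/-- Continuous functions separate signed measures. -/
lemma Meas.ext_of_pair {m m' : Meas n} (h : ∀ F : Cyl n → ℝ, Continuous F → m.pair F = m'.pair F) :
    m = m' := by
  set p := m.toSigned.toJordanDecomposition.posPart with hp
  set q := m.toSigned.toJordanDecomposition.negPart with hq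
  set p' := m'.toSigned.toJordanDecomposition.posPart with hp'
  set q' := m'.toSigned.toJordanDecomposition.negPart with hq'
  -- Exchanging the negative parts leaves positive finite measures on both sides, which bounded
  -- continuous functions determine.
  have key : p + q' = p' + q := by
    apply ext_of_forall_integral_eq_of_IsFiniteMeasure
    intro f
    have hf := f.continuous
    have h1 := h f hf
    rw [m.pair_eq_jordan hf, m'.pair_eq_jordan hf] at h1
    rw [integral_add_measure (integrable_of_continuous hf) (integrable_of_continuous hf),
      integral_add_measure (integrable_of_continuous hf) (integrable_of_continuous hf)]
    linarith
  have e1 : m.toSigned = p.toSignedMeasure - q.toSignedMeasure :=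
    (m.toSigned.toSignedMeasure_toJordanDecomposition).symm
  have e2 : m'.toSigned = p'.toSignedMeasure - q'.toSignedMeasure :=
    (m'.toSigned.toSignedMeasure_toJordanDecomposition).symm
  have e3 : p.toSignedMeasure + q'.toSignedMeasure = p'.toSignedMeasure + q.toSignedMeasure := by
    rw [← Measure.toSignedMeasure_add, ← Measure.toSignedMeasure_add]
    congr 1
  change m.toSigned = m'.toSigned
  rw [e1, e2, sub_eq_sub_iff_add_eq_add, e3]

lemma Meas.tendsto_iff {ι : Type*} {l : Filter ι} {f : ι → Meas n} {m : Meas n} :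
    Tendsto f l (𝓝 m) ↔
      ∀ F : Cyl n → ℝ, Continuous F → Tendsto (fun i => (f i).pair F) l (𝓝 (m.pair F)) := by
  have h1 : (𝓝 m) = comap (fun (m : Meas n) (F : C(Cyl n, ℝ)) => m.pair F)
      (𝓝 (fun F : C(Cyl n, ℝ) => m.pair F)) := by
    rw [← nhds_induced]
  rw [h1, tendsto_comap_iff, tendsto_pi_nhds]
  exact ⟨fun h F hF => h ⟨F, hF⟩, fun h F => h F F.continuous⟩

lemma Meas.continuous_pair {F : Cyl n → ℝ} (hF : Continuous F) :
    Continuous (fun m : Meas n => m.pair F) := by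
  rw [continuous_iff_continuousAt]
  intro m
  exact Meas.tendsto_iff.1 tendsto_id F hF

lemma Meas.uniformContinuous_pair {F : Cyl n → ℝ} (hF : Continuous F) :
    UniformContinuous (fun m : Meas n => m.pair F) := by
  have h : UniformContinuous (fun (m : Meas n) (F : C(Cyl n, ℝ)) => m.pair F) :=
    uniformContinuous_comap
  exact (Pi.uniformContinuous_proj _ (⟨F, hF⟩ : C(Cyl n, ℝ))).comp h

/-- The uniformity is pulled back from a product of real lines, so an entourage constrains only
finitely many pairings. This is what turns uniform-in-time convergence of single pairings into
Skorohod convergence. -/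
lemma Meas.mem_uniformity {V : Set (Meas n × Meas n)} (hV : V ∈ 𝓤 (Meas n)) :
    ∃ (s : Finset C(Cyl n, ℝ)) (ε : ℝ), 0 < ε ∧
      ∀ m m' : Meas n, (∀ F ∈ s, |m.pair F - m'.pair F| < ε) → (m, m') ∈ V := by
  have h1 : 𝓤 (Meas n) = comap (fun p : Meas n × Meas n =>
      ((fun F : C(Cyl n, ℝ) => p.1.pair F), (fun F : C(Cyl n, ℝ) => p.2.pair F)))
      (𝓤 (C(Cyl n, ℝ) → ℝ)) := rfl
  rw [h1, Pi.uniformity, Filter.comap_iInf] at hV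
  rw [Filter.mem_iInf'] at hV
  obtain ⟨I, hI, W, hW, -, rfl, -⟩ := hV
  have h2 : ∀ F ∈ I, ∃ ε > 0, ∀ m m' : Meas n, |m.pair F - m'.pair F| < ε → (m, m') ∈ W F := by
    intro F _
    have h3 := hW F
    rw [comap_comap, mem_comap] at h3
    obtain ⟨U, hU, hUW⟩ := h3
    obtain ⟨ε, hε, h4⟩ := Metric.mem_uniformity_dist.1 hU
    exact ⟨ε, hε, fun m m' h => hUW (h4 (by simpa [Real.dist_eq] using h))⟩
  choose! e he0 he using h2
  obtain ⟨ε, hε0, hε⟩ : ∃ ε > 0, ∀ F ∈ I, ε ≤ e F := by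
    rcases hI.toFinset.eq_empty_or_nonempty with hem | hne
    · exact ⟨1, one_pos, fun F hF => by
        have := hI.mem_toFinset.2 hF; simp [hem] at this⟩
    · refine ⟨hI.toFinset.inf' hne e, ?_, fun F hF => Finset.inf'_le _ (hI.mem_toFinset.2 hF)⟩
      rw [gt_iff_lt, Finset.lt_inf'_iff]
      exact fun F hF => he0 F (hI.mem_toFinset.1 hF)
  refine ⟨hI.toFinset, ε, hε0, fun m m' h => ?_⟩
  simp only [mem_iInter]
  exact fun F hF => he F hF _ _ ((h F (hI.mem_toFinset.2 hF)).trans_le (hε F hF))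

/-! ### Measures with a density in `[0,1]` -/

/-- The density, modified on a null set so as to take values in `[0,1]` everywhere. -/
def Meas.clip (m : Meas n) (u : Cyl n) : ℝ := max 0 (min 1 (m.density u))

lemma Meas.measurable_density (m : Meas n) : Measurable m.density :=
  SignedMeasure.measurable_rnDeriv _ _

lemma Meas.measurable_clip (m : Meas n) : Measurable m.clip :=
  measurable_const.max (measurable_const.min m.measurable_density)

lemma Meas.clip_nonneg (m : Meas n) (u : Cyl n) : 0 ≤ m.clip u := le_max_left _ _

lemma Meas.clip_le_one (m : Meas n) (u : Cyl n) : m.clip u ≤ 1 :=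
  max_le zero_le_one (min_le_left _ _)

lemma integrable_of_bounded {μ : Measure (Cyl n)} [IsFiniteMeasure μ] {F : Cyl n → ℝ}
    (hF : Measurable F) {C : ℝ} (h : ∀ u, |F u| ≤ C) : Integrable F μ :=
  Integrable.of_bound hF.aestronglyMeasurable C (ae_of_all _ h)

lemma density_eq_of_withDensity {m : Meas n} {ρ : Cyl n → ℝ}
    (hρ : Integrable ρ (volume : Measure (Cyl n)))
    (h : m.toSigned = (volume : Measure (Cyl n)).withDensityᵥ ρ) : m.density =ᵐ[volume] ρ := by
  have h1 := SignedMeasure.eq_rnDeriv (s := m.toSigned) (μ := (volume : Measure (Cyl n))) 0 ρ hρ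
    (by simp [VectorMeasure.MutuallySingular.zero_left]) (by rw [h, zero_add])
  exact h1.symm

lemma F1.clip_ae {m : Meas n} (hm : m ∈ F1 n) : m.density =ᵐ[volume] m.clip := by
  obtain ⟨ρ, hρ, hb, h⟩ := hm
  have hi : Integrable ρ (volume : Measure (Cyl n)) :=
    Integrable.of_bound hρ.aestronglyMeasurable 1 (by
      filter_upwards [hb] with u hu
      rw [Real.norm_eq_abs, abs_of_nonneg hu.1]; exact hu.2)
  filter_upwards [density_eq_of_withDensity hi h, hb] with u h1 h2
  rw [Meas.clip, h1, min_eq_right h2.2, max_eq_right h2.1]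

lemma F1.toSigned_eq {m : Meas n} (hm : m ∈ F1 n) :
    m.toSigned = (volume : Measure (Cyl n)).withDensityᵥ m.clip := by
  have h1 := F1.clip_ae hm
  obtain ⟨ρ, hρ, hb, h⟩ := hm
  have hi : Integrable ρ (volume : Measure (Cyl n)) :=
    Integrable.of_bound hρ.aestronglyMeasurable 1 (by
      filter_upwards [hb] with u hu
      rw [Real.norm_eq_abs, abs_of_nonneg hu.1]; exact hu.2)
  rw [h]
  apply WithDensityᵥEq.congr_ae
  filter_upwards [density_eq_of_withDensity hi h, h1] with u h2 h3
  rw [← h2, h3]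

/-- The measure `ρ(u) du`. -/
def measOf (ρ : Cyl n → ℝ) : Meas n := Meas.ofSigned ((volume : Measure (Cyl n)).withDensityᵥ ρ)

lemma pair_measOf {ρ : Cyl n → ℝ} (hρ : Measurable ρ) (h0 : ∀ u, 0 ≤ ρ u) (h1 : ∀ u, ρ u ≤ 1)
    (F : Cyl n → ℝ) : (measOf ρ).pair F = ∫ u, ρ u * F u := by
  have hfin : (∫⁻ u, ENNReal.ofReal (ρ u)) ≠ ⊤ := by
    have : Integrable ρ (volume : Measure (Cyl n)) :=
      integrable_of_bounded hρ (C := 1) (fun u => by rw [abs_of_nonneg (h0 u)]; exact h1 u)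
    exact ((hasFiniteIntegral_iff_ofReal (ae_of_all _ h0)).1 this.2).ne
  have := isFiniteMeasure_withDensity hfin
  have h2 := withDensityᵥ_toReal (μ := (volume : Measure (Cyl n)))
    hρ.ennreal_ofReal.aemeasurable hfin
  have h3 : (fun u => (ENNReal.ofReal (ρ u)).toReal) = ρ := by
    ext u; exact ENNReal.toReal_ofReal (h0 u)
  rw [h3] at h2
  rw [measOf, h2, pair_toSignedMeasure, integral_withDensity_eq_integral_toReal_smul
    hρ.ennreal_ofReal (ae_of_all _ fun u => ENNReal.ofReal_lt_top)]
  simp only [ENNReal.toReal_ofReal (h0 _), smul_eq_mul]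

lemma measOf_mem_F1 {ρ : Cyl n → ℝ} (hρ : Measurable ρ) (h0 : ∀ u, 0 ≤ ρ u) (h1 : ∀ u, ρ u ≤ 1) :
    measOf ρ ∈ F1 n := ⟨ρ, hρ, ae_of_all _ fun u => ⟨h0 u, h1 u⟩, rfl⟩

lemma F1.eq_measOf {m : Meas n} (hm : m ∈ F1 n) : m = measOf m.clip := F1.toSigned_eq hm

lemma F1.pair_eq {m : Meas n} (hm : m ∈ F1 n) (F : Cyl n → ℝ) :
    m.pair F = ∫ u, m.clip u * F u := by
  conv_lhs => rw [F1.eq_measOf hm]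
  exact pair_measOf m.measurable_clip m.clip_nonneg m.clip_le_one F

/-- `F¹` is compact for the weak topology (ultrafilter form). -/
lemma F1.exists_lim {ι : Type*} (l : Ultrafilter ι) {f : ι → Meas n}
    (hf : ∀ᶠ i in (l : Filter ι), f i ∈ F1 n) :
    ∃ m ∈ F1 n, Tendsto f l (𝓝 m) := by
  let μ : Measure (Cyl n) := volume
  have hL2 : ∀ i, MemLp (f i).clip 2 μ := fun i =>
    MemLp.of_bound (f i).measurable_clip.aestronglyMeasurable 1 (ae_of_all _ fun u => by
      rw [Real.norm_eq_abs, abs_of_nonneg ((f i).clip_nonneg u)]; exact (f i).clip_le_one u)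
  let r : ι → Lp ℝ 2 μ := fun i => (hL2 i).toLp
  let e := InnerProductSpace.toDual ℝ (Lp ℝ 2 μ)
  obtain ⟨R, hR⟩ : ∃ R, ∀ i, ‖r i‖ ≤ R := by
    refine ⟨μ.real univ ^ (2 : ENNReal).toReal⁻¹ * 1, fun i => ?_⟩
    refine Lp.norm_le_of_ae_bound zero_le_one ?_
    filter_upwards [(hL2 i).coeFn_toLp] with u hu
    rw [hu, Real.norm_eq_abs, abs_of_nonneg ((f i).clip_nonneg u)]; exact (f i).clip_le_one u
  -- The densities lie in a fixed ball of `L²`; Banach–Alaoglu and the Riesz isomorphism produce a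
  -- weak limit `g` along the ultrafilter.
  have hK : IsCompact (WeakDual.toStrongDual ⁻¹' Metric.closedBall (0 : StrongDual ℝ (Lp ℝ 2 μ)) R) :=
    WeakDual.isCompact_closedBall _ _
  obtain ⟨φ, -, hφ⟩ := hK.ultrafilter_le_nhds
    (l.map (fun i => StrongDual.toWeakDual (e (r i)))) (by
      rw [Ultrafilter.coe_map, le_principal_iff, mem_map]
      refine Filter.univ_mem' fun i => ?_
      simp only [mem_preimage, mem_closedBall_zero_iff]
      change ‖e (r i)‖ ≤ R
      rw [LinearIsometryEquiv.norm_map]; exact hR i)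
  let g : Lp ℝ 2 μ := e.symm (WeakDual.toStrongDual φ)
  have hlim : ∀ x : Lp ℝ 2 μ, Tendsto (fun i => inner ℝ (r i) x) l (𝓝 (inner ℝ g x)) := by
    intro x
    have h1 : Tendsto (fun i => StrongDual.toWeakDual (e (r i)) x) l (𝓝 (φ x)) :=
      ((WeakDual.eval_continuous x).tendsto φ).comp hφ
    have h2 : φ x = inner ℝ g x := by
      rw [← InnerProductSpace.toDual_apply_apply (𝕜 := ℝ)]
      change _ = e g x
      simp only [g, LinearIsometryEquiv.apply_symm_apply]
      rfl
    rw [← h2]; exact h1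
  have hlim2 : ∀ h : Cyl n → ℝ, MemLp h 2 μ →
      Tendsto (fun i => ∫ u, (f i).clip u * h u) l (𝓝 (∫ u, g u * h u)) := by
    intro h hh
    have h1 := hlim hh.toLp
    have h2 : ∀ (k : Lp ℝ 2 μ) (k' : Cyl n → ℝ), k =ᵐ[μ] k' →
        inner ℝ k hh.toLp = ∫ u, k' u * h u := by
      intro k k' hk
      rw [L2.inner_def]
      apply integral_congr_ae
      filter_upwards [hk, hh.coeFn_toLp] with u hu1 hu2
      rw [hu1, hu2]; simp [mul_comm]
    rw [h2 g g ae_eq_rfl] at h1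
    refine h1.congr fun i => h2 _ _ (hL2 i).coeFn_toLp
  have hgi : Integrable g μ := (Lp.memLp g).integrable (by norm_num)
  have hind : ∀ s : Set (Cyl n), MeasurableSet s → MemLp (s.indicator (fun _ => (1 : ℝ))) 2 μ :=
    fun s hs => (memLp_const 1).indicator hs
  have hset : ∀ (k : Cyl n → ℝ) (s : Set (Cyl n)), MeasurableSet s →
      ∫ u, k u * s.indicator (fun _ => (1 : ℝ)) u = ∫ u in s, k u := by
    intro k s hs
    rw [← integral_indicator hs]
    congr 1; ext u
    by_cases hu : u ∈ s <;> simp [hu]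
  -- Indicators belong to `L²`, so the bounds `0` and `1` pass to the weak limit set by set.
  have hg0 : 0 ≤ᵐ[μ] g := by
    refine ae_nonneg_of_forall_setIntegral_nonneg hgi fun s hs _ => ?_
    have h1 := hlim2 _ (hind s hs)
    rw [hset _ s hs] at h1
    refine ge_of_tendsto h1 (Eventually.of_forall fun i => ?_)
    rw [hset _ s hs]
    exact integral_nonneg fun u => (f i).clip_nonneg u
  have hg1 : g ≤ᵐ[μ] fun _ => (1 : ℝ) := by
    refine ae_le_of_forall_setIntegral_le hgi (integrable_const _) fun s hs _ => ?_
    have h1 := hlim2 _ (hind s hs)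
    rw [hset _ s hs] at h1
    refine le_of_tendsto h1 (Eventually.of_forall fun i => ?_)
    rw [hset _ s hs]
    refine integral_mono (integrable_of_bounded (f i).measurable_clip (C := 1) fun u => ?_)
      (integrable_const _) (fun u => (f i).clip_le_one u)
    rw [abs_of_nonneg ((f i).clip_nonneg u)]; exact (f i).clip_le_one u
  obtain ⟨g', hg'm, hg'⟩ : ∃ g' : Cyl n → ℝ, Measurable g' ∧ g =ᵐ[μ] g' :=
    ⟨_, (Lp.aestronglyMeasurable g).stronglyMeasurable_mk.measurable,
      (Lp.aestronglyMeasurable g).ae_eq_mk⟩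
  let k : Cyl n → ℝ := fun u => max 0 (min 1 (g' u))
  have hkm : Measurable k := measurable_const.max (measurable_const.min hg'm)
  have hk0 : ∀ u, 0 ≤ k u := fun u => le_max_left _ _
  have hk1 : ∀ u, k u ≤ 1 := fun u => max_le zero_le_one (min_le_left _ _)
  have hgk : g =ᵐ[μ] k := by
    filter_upwards [hg', hg0, hg1] with u h1 h2 h3
    simp only [k, ← h1, min_eq_right h3]
    exact (max_eq_right h2).symm
  refine ⟨measOf k, measOf_mem_F1 hkm hk0 hk1, Meas.tendsto_iff.2 fun F hF => ?_⟩
  have hFL : MemLp F 2 μ := by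
    obtain ⟨C, hC⟩ := isCompact_univ.exists_bound_of_continuousOn hF.continuousOn
    exact MemLp.of_bound hF.measurable.aestronglyMeasurable C (ae_of_all _ fun u => hC u (mem_univ u))
  rw [pair_measOf hkm hk0 hk1]
  have h1 := hlim2 F hFL
  have h2 : ∫ u, g u * F u = ∫ u, k u * F u := by
    apply integral_congr_ae
    filter_upwards [hgk] with u hu
    rw [hu]
  rw [h2] at h1
  refine h1.congr' ?_
  filter_upwards [hf] with i hi
  exact (F1.pair_eq hi F).symm

/-- `F¹` is closed for the weak topology. -/
lemma F1.mem_of_tendsto {ι : Type*} {l : Filter ι} [l.NeBot] {f : ι → Meas n} {m : Meas n}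
    (hf : ∀ᶠ i in l, f i ∈ F1 n)
    (h : ∀ F : Cyl n → ℝ, Continuous F → Tendsto (fun i => (f i).pair F) l (𝓝 (m.pair F))) :
    m ∈ F1 n := by
  have hle : (Ultrafilter.of l : Filter ι) ≤ l := Ultrafilter.of_le l
  obtain ⟨m', hm', hlim⟩ := F1.exists_lim (Ultrafilter.of l) (hf.filter_mono hle)
  have : m = m' := Meas.ext_of_pair fun F hF =>
    tendsto_nhds_unique ((h F hF).mono_left hle) (Meas.tendsto_iff.1 hlim F hF)
  rwa [this]

end MeasSpace

/-! ### Integrals over compact intervals -/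

lemma integral_Icc_subtype {a c : ℝ} (h : a ≤ c) (g : Icc a c → ℝ) :
    ∫ x, g x = ∫ x in a..c, g (projIcc a c h x) := by
  rw [intervalIntegral.integral_of_le h, ← integral_Icc_eq_integral_Ioc]
  have h1 : ∫ x : Icc a c, g x = ∫ x : Icc a c, (fun y : ℝ => g (projIcc a c h y)) x := by
    congr 1; ext x; simp [projIcc_val]
  rw [h1]
  exact integral_subtype_comap measurableSet_Icc (fun y : ℝ => g (projIcc a c h y))

/-- Differentiation under the integral sign, within a convex set. -/
lemma hasDerivWithinAt_integral_of_bound {Y : Type*} [MeasurableSpace Y] {μ : Measure Y}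
    [IsFiniteMeasure μ] {S : Set ℝ} (hS : Convex ℝ S) {f f' : Y → ℝ → ℝ} {C : ℝ}
    (hd : ∀ y, ∀ s ∈ S, HasDerivWithinAt (f y) (f' y s) S s)
    (hb : ∀ y, ∀ s ∈ S, |f' y s| ≤ C) (hi : ∀ s ∈ S, Integrable (fun y => f y s) μ)
    {s₀ : ℝ} (hs₀ : s₀ ∈ S) :
    HasDerivWithinAt (fun s => ∫ y, f y s ∂μ) (∫ y, f' y s₀ ∂μ) S s₀ := by
  rw [hasDerivWithinAt_iff_tendsto_slope]
  have h1 : ∀ s ∈ S \ {s₀}, ∫ y, slope (f y) s₀ s ∂μ = slope (fun s => ∫ y, f y s ∂μ) s₀ s := by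
    intro s hs
    simp only [slope_def_field]
    rw [integral_div, integral_sub (hi s hs.1) (hi s₀ hs₀)]
  refine Tendsto.congr' (f₁ := fun s => ∫ y, slope (f y) s₀ s ∂μ) ?_ ?_
  · filter_upwards [self_mem_nhdsWithin] with s hs using h1 s hs
  refine tendsto_integral_filter_of_dominated_convergence (fun _ => C) ?_ ?_
    (integrable_const C) (ae_of_all _ fun y => ?_)
  · filter_upwards [self_mem_nhdsWithin] with s hs
    simp only [slope_def_field]
    exact (((hi s hs.1).sub (hi s₀ hs₀)).div_const _).aestronglyMeasurable
  · filter_upwards [self_mem_nhdsWithin] with s hs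
    refine ae_of_all _ fun y => ?_
    -- The mean value inequality on the convex set dominates every slope by the constant `C`.
    have h2 := hS.norm_image_sub_le_of_norm_hasDerivWithin_le (hd y) (hb y) hs₀ hs.1
    rw [slope_def_field, norm_div]
    exact div_le_of_le_mul₀ (norm_nonneg _)
      ((abs_nonneg _).trans (hb y s₀ hs₀)) h2
  · exact (hasDerivWithinAt_iff_tendsto_slope).1 (hd y s₀ hs₀)

/-! ### Calculus along coordinate lines of the cylinder. -/

section Calculus

variable {n : ℕ}

/-- The coordinate line in direction `k` through `u`. -/
def line (k : Fin (n + 1)) (u : Cyl n) (s : ℝ) : Cyl n :=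
  Fin.cases (motive := fun _ => Cyl n) (projIcc (-1) 1 (by norm_num) s, u.2)
    (fun i => (u.1, u.2 + Pi.single i (s : UnitAddCircle))) k

/-- The range of the parameter of `line k u`. -/
def dom (k : Fin (n + 1)) : Set ℝ :=
  Fin.cases (motive := fun _ => Set ℝ) (Icc (-1) 1) (fun _ => univ) k

/-- The parameter of `u` on `line k u`. -/
def base (k : Fin (n + 1)) (u : Cyl n) : ℝ :=
  Fin.cases (motive := fun _ => ℝ) (u.1 : ℝ) (fun _ => 0) k

@[simp] lemma line_zero (u : Cyl n) (s : ℝ) :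
    line 0 u s = (projIcc (-1) 1 (by norm_num) s, u.2) := rfl
@[simp] lemma line_succ (i : Fin n) (u : Cyl n) (s : ℝ) :
    line i.succ u s = (u.1, u.2 + Pi.single i (s : UnitAddCircle)) := rfl
@[simp] lemma dom_succ (i : Fin n) : dom i.succ = univ := rfl
@[simp] lemma base_zero (u : Cyl n) : base 0 u = (u.1 : ℝ) := rfl
@[simp] lemma base_succ (i : Fin n) (u : Cyl n) : base i.succ u = 0 := rfl

@[simp] lemma line_base (k : Fin (n + 1)) (u : Cyl n) : line k u (base k u) = u := by
  cases k using Fin.cases with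
  | zero => simp [projIcc_val]
  | succ i => simp

lemma base_mem (k : Fin (n + 1)) (u : Cyl n) : base k u ∈ dom k := by
  cases k using Fin.cases with
  | zero => exact u.1.2
  | succ i => simp

lemma convex_dom (k : Fin (n + 1)) : Convex ℝ (dom k) := by
  cases k using Fin.cases with
  | zero => exact convex_Icc _ _
  | succ i => exact convex_univ

lemma uniqueDiffWithinAt_dom (k : Fin (n + 1)) (u : Cyl n) :
    UniqueDiffWithinAt ℝ (dom k) (base k u) := by
  cases k using Fin.cases with
  | zero => exact uniqueDiffOn_Icc (by norm_num) _ u.1.2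
  | succ i => exact uniqueDiffWithinAt_univ

lemma continuous_line (k : Fin (n + 1)) : Continuous (fun p : Cyl n × ℝ => line k p.1 p.2) := by
  cases k using Fin.cases with
  | zero =>
    simp only [line_zero]
    exact (continuous_projIcc.comp continuous_snd).prodMk (continuous_snd.comp continuous_fst)
  | succ i =>
    simp only [line_succ]
    refine (continuous_fst.comp continuous_fst).prodMk
      ((continuous_snd.comp continuous_fst).add ?_)
    exact (continuous_single i).comp ((AddCircle.continuous_mk' 1).comp continuous_snd)

/-- `d` is the partial derivative of `F` in direction `k` at `u`. -/
def HasPD (k : Fin (n + 1)) (F : Cyl n → ℝ) (u : Cyl n) (d : ℝ) : Prop :=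
  HasDerivWithinAt (fun s => F (line k u s)) d (dom k) (base k u)

lemma HasPD.hasPartialAt {k : Fin (n + 1)} {F : Cyl n → ℝ} {u : Cyl n} {d : ℝ}
    (h : HasPD k F u d) : HasPartialAt k F u := by
  cases k using Fin.cases with
  | zero => exact HasDerivWithinAt.differentiableWithinAt h
  | succ i => exact (hasDerivWithinAt_univ.1 h).differentiableAt

lemma HasPD.pderiv_eq {k : Fin (n + 1)} {F : Cyl n → ℝ} {u : Cyl n} {d : ℝ}
    (h : HasPD k F u d) : pderiv k F u = d := by
  cases k using Fin.cases with
  | zero => exact HasDerivWithinAt.derivWithin h (uniqueDiffWithinAt_dom 0 u)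
  | succ i => exact (hasDerivWithinAt_univ.1 h).deriv

lemma HasPartialAt.hasPD {k : Fin (n + 1)} {F : Cyl n → ℝ} {u : Cyl n}
    (h : HasPartialAt k F u) : HasPD k F u (pderiv k F u) := by
  cases k using Fin.cases with
  | zero => exact DifferentiableWithinAt.hasDerivWithinAt h
  | succ i => exact hasDerivWithinAt_univ.2 (DifferentiableAt.hasDerivAt h)

lemma HasPD.const (k : Fin (n + 1)) (c : ℝ) (u : Cyl n) : HasPD k (fun _ => c) u 0 :=
  hasDerivWithinAt_const ..

lemma HasPD.add {k : Fin (n + 1)} {F G : Cyl n → ℝ} {u : Cyl n} {d e : ℝ}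
    (h : HasPD k F u d) (h' : HasPD k G u e) : HasPD k (fun u => F u + G u) u (d + e) :=
  HasDerivWithinAt.add h h'

lemma HasPD.sub {k : Fin (n + 1)} {F G : Cyl n → ℝ} {u : Cyl n} {d e : ℝ}
    (h : HasPD k F u d) (h' : HasPD k G u e) : HasPD k (fun u => F u - G u) u (d - e) :=
  HasDerivWithinAt.sub h h'

lemma HasPD.const_mul {k : Fin (n + 1)} {F : Cyl n → ℝ} {u : Cyl n} {d : ℝ} (c : ℝ)
    (h : HasPD k F u d) : HasPD k (fun u => c * F u) u (c * d) :=
  HasDerivWithinAt.const_mul c h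

lemma HasPD.mul {k : Fin (n + 1)} {F G : Cyl n → ℝ} {u : Cyl n} {d e : ℝ}
    (h : HasPD k F u d) (h' : HasPD k G u e) :
    HasPD k (fun u => F u * G u) u (d * G u + F u * e) := by
  have := HasDerivWithinAt.fun_mul h h'
  simpa only [HasPD, line_base] using this

lemma HasPD.comp {k : Fin (n + 1)} {F : Cyl n → ℝ} {u : Cyl n} {d e : ℝ} {g : ℝ → ℝ}
    (hg : HasDerivAt g e (F u)) (h : HasPD k F u d) :
    HasPD k (fun u => g (F u)) u (e * d) := by
  have hg' : HasDerivAt g e ((fun s => F (line k u s)) (base k u)) := by simpa using hg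
  exact HasDerivAt.comp_hasDerivWithinAt (h := fun s => F (KawasakiKac.line k u s)) _ hg' h

/-- The derivative along a coordinate line at an arbitrary parameter. -/
lemma HasPD.line {k : Fin (n + 1)} {F D : Cyl n → ℝ} (h : ∀ u, HasPD k F u (D u)) (u : Cyl n)
    {s : ℝ} (hs : s ∈ dom k) :
    HasDerivWithinAt (fun s => F (line k u s)) (D (line k u s)) (dom k) s := by
  cases k using Fin.cases with
  | zero =>
    have h1 := h (KawasakiKac.line 0 u s)
    have h2 : base 0 (KawasakiKac.line 0 u s) = s := by
      simp [projIcc_of_mem _ (show s ∈ Icc (-1 : ℝ) 1 from hs)]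
    unfold HasPD at h1
    rw [h2] at h1
    exact h1
  | succ i =>
    have h1 := hasDerivWithinAt_univ.1 (h (KawasakiKac.line i.succ u s))
    rw [dom_succ, hasDerivWithinAt_univ]
    -- In a periodic direction the base parameter is always `0`; the derivative at parameter `s` is
    -- the one at the point `line u s`, translated back.
    have h2 : (fun r => F (KawasakiKac.line i.succ u r)) =
        fun r => (fun q => F (KawasakiKac.line i.succ (KawasakiKac.line i.succ u s) q)) (r - s) := by
      ext r
      simp only [line_succ, add_assoc, ← Pi.single_add, ← AddCircle.coe_add, add_sub_cancel]
    rw [h2]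
    have h3 : HasDerivAt (fun q => F (KawasakiKac.line i.succ (KawasakiKac.line i.succ u s) q))
        (D (KawasakiKac.line i.succ u s)) (s - s) := by simpa using h1
    exact h3.comp_sub_const s s

lemma HasPD.integral {Y : Type*} [MeasurableSpace Y] {μ : Measure Y} [IsFiniteMeasure μ]
    {k : Fin (n + 1)} {F D : Y → Cyl n → ℝ} {C : ℝ} (h : ∀ y u, HasPD k (F y) u (D y u))
    (hb : ∀ y u, |D y u| ≤ C) (hi : ∀ u, Integrable (fun y => F y u) μ) (u : Cyl n) :
    HasPD k (fun u => ∫ y, F y u ∂μ) u (∫ y, D y u ∂μ) := by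
  have := hasDerivWithinAt_integral_of_bound (μ := μ) (convex_dom k)
    (f := fun y s => F y (KawasakiKac.line k u s)) (f' := fun y s => D y (KawasakiKac.line k u s))
    (C := C) (fun y s hs => HasPD.line (h y) u hs) (fun y s _ => hb y _) (fun s _ => hi _)
    (base_mem k u)
  simpa only [HasPD, line_base] using this

/-- Continuously differentiable functions on `Λ̄`. -/
structure IsC1 (F : Cyl n → ℝ) : Prop where
  cont : Continuous F
  part : ∀ k u, HasPartialAt k F u
  contD : ∀ k, Continuous (pderiv k F)

lemma IsC1.hasPD {F : Cyl n → ℝ} (h : IsC1 F) (k : Fin (n + 1)) (u : Cyl n) :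
    HasPD k F u (pderiv k F u) := (h.part k u).hasPD

lemma IsC1.of_hasPD {F : Cyl n → ℝ} {D : Fin (n + 1) → Cyl n → ℝ} (hF : Continuous F)
    (h : ∀ k u, HasPD k F u (D k u)) (hD : ∀ k, Continuous (D k)) : IsC1 F := by
  refine ⟨hF, fun k u => (h k u).hasPartialAt, fun k => ?_⟩
  have : pderiv k F = D k := by ext u; exact (h k u).pderiv_eq
  rw [this]; exact hD k

lemma isCSpace_succ {X : Type} [TopologicalSpace X] {m : ℕ} {F : X → Cyl n → ℝ}
    (D : Fin (n + 1) → X → Cyl n → ℝ) (hF : Continuous (Function.uncurry F))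
    (h : ∀ k x u, HasPD k (F x) u (D k x u)) (hD : ∀ k, IsCSpace m (D k)) :
    IsCSpace (m + 1) F := by
  refine ⟨hF, fun k => ⟨fun x u => (h k x u).hasPartialAt, ?_⟩⟩
  have : (fun x u => pderiv k (F x) u) = D k := by ext x u; exact (h k x u).pderiv_eq
  rw [this]; exact hD k

lemma IsCSpace.continuous {X : Type} [TopologicalSpace X] {m : ℕ} {F : X → Cyl n → ℝ}
    (h : IsCSpace m F) : Continuous (Function.uncurry F) := by
  cases m with
  | zero => exact h
  | succ m => exact h.1

lemma IsCSpace.isC1 {X : Type} [TopologicalSpace X] {m : ℕ} {F : X → Cyl n → ℝ}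
    (h : IsCSpace (m + 1) F) (x : X) : IsC1 (F x) :=
  ⟨h.1.comp (Continuous.prodMk_right x), fun k u => (h.2 k).1 x u,
    fun k => (h.2 k).2.continuous.comp (Continuous.prodMk_right x)⟩

lemma IsC1.isCSpace {F : Cyl n → ℝ} (h : IsC1 F) : IsCSpace 1 (fun _ : Unit => F) :=
  ⟨h.cont.comp continuous_snd, fun k => ⟨fun _ u => h.part k u, (h.contD k).comp continuous_snd⟩⟩

lemma IsC1.of_isC₀Space {F : Cyl n → ℝ} (h : IsC₀Space 1 F) : IsC1 F := IsCSpace.isC1 h.1 ()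

lemma IsC1.add {F G : Cyl n → ℝ} (hF : IsC1 F) (hG : IsC1 G) : IsC1 (fun u => F u + G u) :=
  .of_hasPD (hF.cont.add hG.cont) (fun k u => (hF.hasPD k u).add (hG.hasPD k u))
    fun k => (hF.contD k).add (hG.contD k)

lemma IsC1.sub {F G : Cyl n → ℝ} (hF : IsC1 F) (hG : IsC1 G) : IsC1 (fun u => F u - G u) :=
  .of_hasPD (hF.cont.sub hG.cont) (fun k u => (hF.hasPD k u).sub (hG.hasPD k u))
    fun k => (hF.contD k).sub (hG.contD k)

/-! ### Integration by parts -/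

lemma measurePreserving_shift (c : Fin n → UnitAddCircle) :
    MeasurePreserving (fun u : Cyl n => (u.1, u.2 + c)) volume volume :=
  (MeasurePreserving.id _).prod (measurePreserving_add_right volume c)

lemma integral_shift (c : Fin n → UnitAddCircle) (F : Cyl n → ℝ) :
    ∫ u : Cyl n, F (u.1, u.2 + c) = ∫ u, F u := by
  have h : MeasurableEmbedding (fun u : Cyl n => (u.1, u.2 + c)) :=
    ((MeasurableEquiv.refl _).prodCongr (MeasurableEquiv.addRight c)).measurableEmbedding
  exact (measurePreserving_shift c).integral_comp h F

lemma exists_bound {X : Type*} [TopologicalSpace X] [CompactSpace X] {F : X → ℝ}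
    (hF : Continuous F) : ∃ C, 0 ≤ C ∧ ∀ u, |F u| ≤ C := by
  obtain ⟨C, hC⟩ := isCompact_univ.exists_bound_of_continuousOn hF.continuousOn
  exact ⟨max C 0, le_max_right _ _, fun u => (hC u (mem_univ u)).trans (le_max_left _ _)⟩

/-- The boundary term in the divergence theorem for direction `k`. -/
def bdryTerm (k : Fin (n + 1)) (F : Cyl n → ℝ) : ℝ :=
  if k = 0 then surfaceIntegral (fun r => normal1 r * F r.1) else 0

lemma bdryTerm_eq_zero (k : Fin (n + 1)) {F : Cyl n → ℝ} (h : ∀ u ∈ bdry n, F u = 0) :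
    bdryTerm k F = 0 := by
  unfold bdryTerm
  split_ifs with hk
  · simp [surfaceIntegral, h _ (rightPt _).2, h _ (leftPt _).2]
  · rfl

/-- In the axial direction this is the fundamental theorem of calculus on each line, followed by
Fubini. In a periodic direction the integral of a translate of `F` does not depend on the
translation, so differentiating under the integral gives zero. -/
lemma integral_pderiv (k : Fin (n + 1)) {F D : Cyl n → ℝ} (hF : Continuous F)
    (hD : Continuous D) (h : ∀ u, HasPD k F u (D u)) : ∫ u, D u = bdryTerm k F := by
  obtain ⟨C, -, hC⟩ := exists_bound hD
  cases k using Fin.cases with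
  | zero =>
    have h1 : ∫ u : Cyl n, D u = ∫ y, ∫ x, D (x, y) :=
      integral_prod_symm D (integrable_of_continuous hD)
    have h2 : ∀ y : Fin n → UnitAddCircle, ∫ x, D (x, y) =
        F (rightPt y).1 - F (leftPt y).1 := by
      intro y
      have hm : (-1 : ℝ) ≤ 1 := by norm_num
      rw [integral_Icc_subtype hm]
      let u : Cyl n := (⟨0, by norm_num, by norm_num⟩, y)
      have h3 := intervalIntegral.integral_eq_sub_of_hasDerivAt_of_le (a := -1) (b := 1)
        (f := fun s => F (line 0 u s)) (f' := fun s => D (line 0 u s)) hm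
        ((hF.comp ((continuous_line 0).comp (Continuous.prodMk_right u))).continuousOn)
        (fun s hs => (HasPD.line h u (Ioo_subset_Icc_self hs)).hasDerivAt
          (Icc_mem_nhds hs.1 hs.2))
        ((hD.comp ((continuous_line 0).comp (Continuous.prodMk_right u))).intervalIntegrable _ _)
      simp only [line_zero] at h3
      rw [h3, projIcc_right, projIcc_left]; rfl
    have hr : Continuous (fun y : Fin n → UnitAddCircle => F (rightPt y).1) :=
      hF.comp (by unfold rightPt; fun_prop)
    have hl : Continuous (fun y : Fin n → UnitAddCircle => F (leftPt y).1) :=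
      hF.comp (by unfold leftPt; fun_prop)
    rw [h1]
    simp_rw [h2]
    rw [integral_sub (hr.integrable_of_hasCompactSupport (HasCompactSupport.of_compactSpace _))
      (hl.integrable_of_hasCompactSupport (HasCompactSupport.of_compactSpace _))]
    simp [bdryTerm, surfaceIntegral, normal1, rightPt, leftPt, integral_neg, sub_eq_add_neg]
  | succ i =>
    have h1 := HasPD.integral (μ := (volume : Measure (Cyl n))) (k := i.succ)
      (F := fun v u => F (v.1, v.2 + u.2)) (D := fun v u => D (v.1, v.2 + u.2)) (C := C)
      (fun v u => by
        have := h (v.1, v.2 + u.2)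
        unfold HasPD at this ⊢
        simpa only [line_succ, base_succ, add_assoc] using this)
      (fun v u => hC _) (fun u => integrable_of_continuous (by fun_prop))
      (⟨0, by norm_num, by norm_num⟩, 0)
    simp only [add_zero] at h1
    have h2 : ∀ u : Cyl n, ∫ v : Cyl n, F (v.1, v.2 + u.2) = ∫ v, F v := fun u =>
      integral_shift u.2 F
    simp_rw [h2] at h1
    have h3 := h1.pderiv_eq
    rw [(HasPD.const i.succ _ _).pderiv_eq] at h3
    simp [bdryTerm, Fin.succ_ne_zero, ← h3]

/-- Integration by parts. -/
lemma integral_mul_pderiv (k : Fin (n + 1)) {F G DF DG : Cyl n → ℝ} (hF : Continuous F)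
    (hG : Continuous G) (hDF : Continuous DF) (hDG : Continuous DG)
    (h : ∀ u, HasPD k F u (DF u)) (h' : ∀ u, HasPD k G u (DG u)) :
    ∫ u, F u * DG u = bdryTerm k (fun u => F u * G u) - ∫ u, DF u * G u := by
  rw [← integral_pderiv k (F := fun u => F u * G u)
      (D := fun u => DF u * G u + F u * DG u) (hF.mul hG) ((hDF.mul hG).add (hF.mul hDG))
    (fun u => (h u).mul (h' u)), integral_add (f := fun u => DF u * G u) (g := fun u => F u * DG u)
    (integrable_of_continuous (hDF.mul hG)) (integrable_of_continuous (hF.mul hDG))]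
  ring

end Calculus

/-! ### One-dimensional trigonometric mollifiers -/

/-- `(1 + cos (κ z)) ^ N`. -/
def trigPow (κ : ℝ) (N : ℕ) (z : ℝ) : ℝ := (1 + Real.cos (κ * z)) ^ N

lemma continuous_trigPow (κ : ℝ) (N : ℕ) : Continuous (trigPow κ N) := by
  unfold trigPow; fun_prop

lemma trigPow_nonneg (κ : ℝ) (N : ℕ) (z : ℝ) : 0 ≤ trigPow κ N z :=
  pow_nonneg (by linarith [Real.neg_one_le_cos (κ * z)]) N

lemma trigPow_neg (κ : ℝ) (N : ℕ) (z : ℝ) : trigPow κ N (-z) = trigPow κ N z := by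
  simp [trigPow]

lemma trigPow_periodic {κ P : ℝ} (h : κ * P = 2 * Real.pi) (N : ℕ) :
    Function.Periodic (trigPow κ N) P := by
  intro z; simp [trigPow, mul_add, h]

lemma integral_trigPow_pos {κ P : ℝ} (hP : 0 < P) (N : ℕ) :
    0 < ∫ z in (0 : ℝ)..P, trigPow κ N z := by
  refine intervalIntegral.integral_pos hP (continuous_trigPow κ N).continuousOn
    (fun z _ => trigPow_nonneg κ N z) ⟨0, by simp [hP.le], ?_⟩
  simp [trigPow]

/-- Integrate the derivative of `(1 + cos κz)^N sin κz / κ` over one period. After normalization,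
the moment of `1 - cos` equals `1 / (N + 1)`; all concentration properties of the kernels come from
this identity. -/
lemma integral_trigPow_mul {κ P : ℝ} (hκ : κ ≠ 0) (h : κ * P = 2 * Real.pi) (N : ℕ) :
    (N + 1 : ℝ) * ∫ z in (0 : ℝ)..P, trigPow κ N z * (1 - Real.cos (κ * z)) =
      ∫ z in (0 : ℝ)..P, trigPow κ N z := by
  have hc : Continuous (fun z => trigPow κ N z * (1 - Real.cos (κ * z))) := by
    unfold trigPow; fun_prop
  have hd : ∀ z : ℝ, HasDerivAt (fun z => trigPow κ N z * Real.sin (κ * z) / κ)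
      (trigPow κ N z - (N + 1) * (trigPow κ N z * (1 - Real.cos (κ * z)))) z := by
    intro z
    have h1 : HasDerivAt (fun z : ℝ => κ * z) κ z := by
      simpa using (hasDerivAt_id z).const_mul κ
    have h2 := (((h1.cos.const_add 1).pow N).mul h1.sin).div_const κ
    refine h2.congr_deriv ?_
    rw [div_eq_iff hκ]
    simp only [trigPow, Pi.pow_apply]
    have hs : Real.sin (κ * z) * Real.sin (κ * z) =
        (1 - Real.cos (κ * z)) * (1 + Real.cos (κ * z)) := by
      nlinarith [Real.sin_sq_add_cos_sq (κ * z)]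
    rcases N with _ | N
    · simp
    · have : (↑(N + 1) : ℝ) * (1 + Real.cos (κ * z)) ^ N * (-Real.sin (κ * z) * κ) *
          Real.sin (κ * z) = -(↑(N + 1) : ℝ) * (1 + Real.cos (κ * z)) ^ N * κ *
            (Real.sin (κ * z) * Real.sin (κ * z)) := by ring
      simp only [Nat.add_sub_cancel]
      rw [this, hs]; ring
  have h3 := intervalIntegral.integral_eq_sub_of_hasDerivAt (a := 0) (b := P)
    (fun z _ => hd z) (((continuous_trigPow κ N).sub (hc.const_mul _)).intervalIntegrable _ _)
  rw [intervalIntegral.integral_sub ((continuous_trigPow κ N).intervalIntegrable _ _)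
    ((hc.const_mul _).intervalIntegrable _ _), intervalIntegral.integral_const_mul] at h3
  simp [h] at h3
  linarith

/-- The normalized mollifier of period `P`. -/
def moll (κ P : ℝ) (N : ℕ) (z : ℝ) : ℝ := trigPow κ N z / ∫ z in (0 : ℝ)..P, trigPow κ N z

lemma moll_nonneg {κ P : ℝ} (hP : 0 < P) (N : ℕ) (z : ℝ) : 0 ≤ moll κ P N z :=
  div_nonneg (trigPow_nonneg ..) (integral_trigPow_pos hP N).le

lemma contDiff_moll (κ P : ℝ) (N : ℕ) : ContDiff ℝ ∞ (moll κ P N) := by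
  unfold moll trigPow
  exact ContDiff.div_const (((contDiff_const.add
    (Real.contDiff_cos.comp (contDiff_const.mul contDiff_id))).pow N)) _

lemma moll_neg (κ P : ℝ) (N : ℕ) (z : ℝ) : moll κ P N (-z) = moll κ P N z := by
  simp [moll, trigPow_neg]

lemma moll_periodic {κ P : ℝ} (h : κ * P = 2 * Real.pi) (N : ℕ) :
    Function.Periodic (moll κ P N) P := fun z => by
  simp only [moll]; rw [trigPow_periodic h N z]

lemma integral_moll {κ P : ℝ} (hP : 0 < P) (N : ℕ) :
    ∫ z in (0 : ℝ)..P, moll κ P N z = 1 := by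
  unfold moll
  rw [intervalIntegral.integral_div, div_self (integral_trigPow_pos hP N).ne']

lemma integral_moll_mul {κ P : ℝ} (hP : 0 < P) (hκ : κ ≠ 0) (h : κ * P = 2 * Real.pi) (N : ℕ) :
    ∫ z in (0 : ℝ)..P, moll κ P N z * (1 - Real.cos (κ * z)) = 1 / (N + 1) := by
  have h0 := (integral_trigPow_pos (κ := κ) hP N)
  have : ∀ z, moll κ P N z * (1 - Real.cos (κ * z)) =
      (trigPow κ N z * (1 - Real.cos (κ * z))) / ∫ z in (0 : ℝ)..P, trigPow κ N z := by
    intro z; unfold moll; ring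
  simp_rw [this]
  rw [intervalIntegral.integral_div, div_eq_div_iff h0.ne' (by positivity), one_mul,
    ← integral_trigPow_mul hκ h N]
  ring

/-- Derivatives of the mollifier. -/
def mollD (κ P : ℝ) (N j : ℕ) : ℝ → ℝ := iteratedDeriv j (moll κ P N)

lemma mollD_zero (κ P : ℝ) (N : ℕ) : mollD κ P N 0 = moll κ P N := iteratedDeriv_zero

lemma hasDerivAt_mollD (κ P : ℝ) (N j : ℕ) (z : ℝ) :
    HasDerivAt (mollD κ P N j) (mollD κ P N (j + 1) z) z := by
  unfold mollD
  rw [iteratedDeriv_succ]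
  exact ((contDiff_moll κ P N).differentiable_iteratedDeriv j
    (WithTop.coe_lt_coe.2 (ENat.natCast_lt_top j)) z).hasDerivAt

lemma continuous_mollD (κ P : ℝ) (N j : ℕ) : Continuous (mollD κ P N j) :=
  continuous_iff_continuousAt.2 fun z => (hasDerivAt_mollD κ P N j z).continuousAt

lemma mollD_periodic {κ P : ℝ} (h : κ * P = 2 * Real.pi) (N j : ℕ) :
    Function.Periodic (mollD κ P N j) P := by
  induction j with
  | zero => rw [mollD_zero]; exact moll_periodic h N
  | succ j ih =>
    intro z
    have h1 := (hasDerivAt_mollD κ P N j (z + P)).comp_add_const z P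
    have h2 : (fun x => mollD κ P N j (x + P)) = mollD κ P N j := funext ih
    rw [h2] at h1
    exact h1.unique (hasDerivAt_mollD κ P N j z)

lemma mollD_one_neg (κ P : ℝ) (N : ℕ) (z : ℝ) : mollD κ P N 1 (-z) = -mollD κ P N 1 z := by
  have h1 := (hasDerivAt_mollD κ P N 0 (-z)).scomp z (hasDerivAt_neg z)
  have h2 : mollD κ P N 0 ∘ Neg.neg = mollD κ P N 0 := by
    ext x; simp [mollD_zero, moll_neg]
  rw [h2] at h1
  have := h1.unique (hasDerivAt_mollD κ P N 0 z)
  simp at this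
  linarith

/-- The mollifier on `ℝ/4ℤ`. -/
def ax (N j : ℕ) : ℝ → ℝ := mollD (Real.pi / 2) 4 N j

lemma ax_period : (Real.pi / 2) * 4 = 2 * Real.pi := by ring

lemma tor_period : (2 * Real.pi) * 1 = 2 * Real.pi := by ring

/-- The mollifier on `ℝ/ℤ`. -/
def tor (N j : ℕ) : UnitAddCircle → ℝ := (mollD_periodic tor_period N j).lift

lemma tor_coe (N j : ℕ) (x : ℝ) : tor N j (x : UnitAddCircle) = mollD (2 * Real.pi) 1 N j x :=
  (mollD_periodic tor_period N j).lift_coe x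

/-- `1 - cos (2 π z)` on the circle. -/
def tdist : UnitAddCircle → ℝ :=
  Function.Periodic.lift (f := fun z : ℝ => 1 - Real.cos (2 * Real.pi * z)) (c := 1)
    (fun z => by simp [mul_add])

lemma tdist_coe (x : ℝ) : tdist (x : UnitAddCircle) = 1 - Real.cos (2 * Real.pi * x) :=
  Function.Periodic.lift_coe _ _

lemma continuous_circle {f : UnitAddCircle → ℝ} (h : Continuous (fun x : ℝ => f (x : UnitAddCircle))) :
    Continuous f :=
  (QuotientAddGroup.isOpenQuotientMap_mk.isQuotientMap).continuous_iff.2 h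

lemma continuous_tor (N j : ℕ) : Continuous (tor N j) :=
  continuous_circle (by simp only [tor_coe]; exact continuous_mollD ..)

lemma continuous_tdist : Continuous tdist :=
  continuous_circle (by simp only [tdist_coe]; fun_prop)

lemma circle_ind {p : UnitAddCircle → Prop} (h : ∀ x : ℝ, p (x : UnitAddCircle)) (z) : p z :=
  QuotientAddGroup.induction_on z h

lemma tor_nonneg (N : ℕ) (z : UnitAddCircle) : 0 ≤ tor N 0 z := by
  induction z using circle_ind with
  | h x => rw [tor_coe, mollD_zero]; exact moll_nonneg one_pos N x

lemma tor_neg (N : ℕ) (z : UnitAddCircle) : tor N 0 (-z) = tor N 0 z := by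
  induction z using circle_ind with
  | h x => rw [← AddCircle.coe_neg, tor_coe, tor_coe, mollD_zero, moll_neg]

lemma tor_one_neg (N : ℕ) (z : UnitAddCircle) : tor N 1 (-z) = -tor N 1 z := by
  induction z using circle_ind with
  | h x => rw [← AddCircle.coe_neg, tor_coe, tor_coe, mollD_one_neg]

lemma hasDerivAt_tor (N j : ℕ) (z : UnitAddCircle) :
    HasDerivAt (fun s : ℝ => tor N j (z + (s : UnitAddCircle))) (tor N (j + 1) z) 0 := by
  induction z using circle_ind with
  | h x =>
    simp only [← AddCircle.coe_add, tor_coe]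
    have := hasDerivAt_mollD (2 * Real.pi) 1 N j (x + 0)
    rw [add_zero] at this
    exact HasDerivAt.comp_const_add x 0 (by simpa using this)

lemma hasDerivAt_tor_sub (N j : ℕ) (z : UnitAddCircle) :
    HasDerivAt (fun s : ℝ => tor N j (z - (s : UnitAddCircle))) (-tor N (j + 1) z) 0 := by
  have h := HasDerivAt.scomp (h := fun s : ℝ => -s) (h' := -1) (0 : ℝ)
    (g₁ := fun s : ℝ => tor N j (z + (s : UnitAddCircle))) (g₁' := tor N (j + 1) z)
    (by simpa using hasDerivAt_tor N j z) (hasDerivAt_neg 0)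
  simpa [Function.comp_def, sub_eq_add_neg] using h

lemma integral_circle (f : UnitAddCircle → ℝ) :
    ∫ z, f z = ∫ x in (0 : ℝ)..1, f (x : UnitAddCircle) := by
  have := AddCircle.intervalIntegral_preimage 1 0 f
  rw [zero_add] at this
  exact this.symm

lemma integral_tor (N : ℕ) : ∫ z, tor N 0 z = 1 := by
  rw [integral_circle]; simp only [tor_coe, mollD_zero]; exact integral_moll one_pos N

lemma integral_tor_mul (N : ℕ) : ∫ z, tor N 0 z * tdist z = 1 / (N + 1) := by
  rw [integral_circle]; simp only [tor_coe, mollD_zero, tdist_coe]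
  exact integral_moll_mul one_pos (by positivity) tor_period N

/-- For `y` in `[-1,1]` the arguments `x - y` and `x + y - 2` sweep the adjacent intervals `[x-1,
x+1]` and `[x-3, x-1]`, together one period. This is why the axial mollifier has period `4`:
reflecting at both ends unfolds `[-1,1]` onto a circle of that length. -/
lemma integral_reflected {f : ℝ → ℝ} (hf : Continuous f) (hp : Function.Periodic f 4) (x : ℝ) :
    ∫ y : Icc (-1 : ℝ) 1, (f (x - y) + f (x + y - 2)) = ∫ z in (0 : ℝ)..4, f z := by
  have hm : (-1 : ℝ) ≤ 1 := by norm_num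
  rw [integral_Icc_subtype hm]
  have h1 : ∫ y in (-1 : ℝ)..1, (f (x - (projIcc (-1) 1 hm y : ℝ)) +
      f (x + (projIcc (-1) 1 hm y : ℝ) - 2)) =
      ∫ y in (-1 : ℝ)..1, (f (x - y) + f (x + y - 2)) := by
    apply intervalIntegral.integral_congr
    intro y hy
    rw [uIcc_of_le hm] at hy
    simp only [projIcc_of_mem hm hy]
  have i1 : IntervalIntegrable (fun y => f (x - y)) volume (-1) 1 :=
    Continuous.intervalIntegrable (by fun_prop) _ _
  have i2 : IntervalIntegrable (fun y => f (x + y - 2)) volume (-1) 1 :=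
    Continuous.intervalIntegrable (by fun_prop) _ _
  rw [h1, intervalIntegral.integral_add i1 i2,
    intervalIntegral.integral_comp_sub_left (fun y => f y)]
  have h2 : ∫ y in (-1 : ℝ)..1, f (x + y - 2) = ∫ y in (x - 3)..(x - 1), f y := by
    have := intervalIntegral.integral_comp_add_left (a := (-1 : ℝ)) (b := 1) f (x - 2)
    rw [show x - 2 + -1 = x - 3 by ring, show x - 2 + 1 = x - 1 by ring] at this
    rw [← this]; congr 1; ext y; congr 1; ring
  rw [h2, sub_neg_eq_add, add_comm, intervalIntegral.integral_add_adjacent_intervals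
    (hf.intervalIntegrable _ _) (hf.intervalIntegrable _ _)]
  have := hp.intervalIntegral_add_eq (x - 3) 0
  rw [zero_add] at this
  rw [← this]; congr 1; ring

/-! ### The kernels on the cylinder -/

section Kernel

variable {n : ℕ}

/-- Derivative of order `α` in `u` of the mollifying kernel; `ε = -1` gives the kernel with
Dirichlet boundary condition, `ε = 1` the one with Neumann boundary condition. -/
def kern (N : ℕ) (ε : ℝ) (α : Fin (n + 1) → ℕ) (u v : Cyl n) : ℝ :=
  (ax N (α 0) ((u.1 : ℝ) - v.1) + ε * ax N (α 0) ((u.1 : ℝ) + v.1 - 2)) *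
    ∏ i : Fin n, tor N (α i.succ) (u.2 i - v.2 i)

lemma continuous_ax (N j : ℕ) : Continuous (ax N j) := continuous_mollD ..

lemma continuous_kern (N : ℕ) (ε : ℝ) (α : Fin (n + 1) → ℕ) :
    Continuous (fun p : Cyl n × Cyl n => kern N ε α p.1 p.2) := by
  unfold kern
  have h1 : ∀ j, Continuous (ax N j) := continuous_ax N
  have h2 : ∀ j, Continuous (tor N j) := continuous_tor N
  refine Continuous.mul (Continuous.add ((h1 _).comp (by fun_prop))
    (continuous_const.mul ((h1 _).comp (by fun_prop)))) ?_
  exact continuous_finsetProd _ fun i _ => (h2 _).comp (by fun_prop)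

lemma continuous_kern_left (N : ℕ) (ε : ℝ) (α : Fin (n + 1) → ℕ) (v : Cyl n) :
    Continuous (fun u => kern N ε α u v) :=
  (continuous_kern N ε α).comp (Continuous.prodMk_left v)

lemma continuous_kern_right (N : ℕ) (ε : ℝ) (α : Fin (n + 1) → ℕ) (u : Cyl n) :
    Continuous (fun v => kern N ε α u v) :=
  (continuous_kern N ε α).comp (Continuous.prodMk_right u)

/-- The reflection type after one differentiation in direction `k`. -/
def flipSign (k : Fin (n + 1)) (ε : ℝ) : ℝ := if k = 0 then -ε else ε

@[simp] lemma flipSign_zero (ε : ℝ) : flipSign (0 : Fin (n + 1)) ε = -ε := by simp [flipSign]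
@[simp] lemma flipSign_succ (i : Fin n) (ε : ℝ) : flipSign i.succ ε = ε := by
  simp [flipSign, Fin.succ_ne_zero]
@[simp] lemma flipSign_flipSign (k : Fin (n + 1)) (ε : ℝ) : flipSign k (flipSign k ε) = ε := by
  unfold flipSign; split_ifs <;> simp

/-- Only the factor with index `i` moves. The path `g` and the sign `σ` cover both uses: `s` for
derivatives in the first argument of the kernel, `-s` for the second. -/
lemma prod_update_line {q q' : Fin n → UnitAddCircle → ℝ} {i : Fin n} {σ : ℝ}
    {z : Fin n → UnitAddCircle} (g : ℝ → UnitAddCircle)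
    (hd : HasDerivAt (fun s : ℝ => q i (z i + g s)) (σ * q' i (z i)) 0)
    (hq : ∀ j ≠ i, q' j = q j) :
    HasDerivAt (fun s : ℝ => ∏ j, q j (z j + (Pi.single i (g s) : Fin n → UnitAddCircle) j))
      (σ * ∏ j, q' j (z j)) 0 := by
  have h1 : (fun s : ℝ => ∏ j, q j (z j + (Pi.single i (g s) : Fin n → UnitAddCircle) j)) =
      fun s => q i (z i + g s) * ∏ j ∈ Finset.univ.erase i, q j (z j) := by
    ext s
    rw [← Finset.mul_prod_erase _ _ (Finset.mem_univ i), Pi.single_eq_same]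
    congr 1
    refine Finset.prod_congr rfl fun j hj => ?_
    rw [Pi.single_eq_of_ne (Finset.ne_of_mem_erase hj), add_zero]
  have h2 : ∏ j, q' j (z j) = q' i (z i) * ∏ j ∈ Finset.univ.erase i, q j (z j) := by
    rw [← Finset.mul_prod_erase _ _ (Finset.mem_univ i)]
    congr 1
    refine Finset.prod_congr rfl fun j hj => ?_
    rw [hq j (Finset.ne_of_mem_erase hj)]
  rw [h1, h2, ← mul_assoc]
  exact hd.mul_const _

lemma hasPD_kern (N : ℕ) (ε : ℝ) (α : Fin (n + 1) → ℕ) (k : Fin (n + 1)) (v u : Cyl n) :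
    HasPD k (fun u => kern N ε α u v) u (kern N ε (α + Pi.single k 1) u v) := by
  cases k using Fin.cases with
  | zero =>
    have h1 : HasDerivAt (fun s : ℝ => (ax N (α 0) (s - v.1) + ε * ax N (α 0) (s + v.1 - 2)) *
        ∏ i : Fin n, tor N (α i.succ) (u.2 i - v.2 i))
        (kern N ε (α + Pi.single 0 1) u v) (u.1 : ℝ) := by
      have ha : ∀ c : ℝ, HasDerivAt (fun s : ℝ => ax N (α 0) (s + c)) (ax N (α 0 + 1) (u.1 + c))
        (u.1 : ℝ) := fun c => (hasDerivAt_mollD _ _ _ _ _).comp_add_const _ c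
      have h2 := ((ha (-v.1)).add ((ha (v.1 - 2)).const_mul ε)).mul_const
        (∏ i : Fin n, tor N (α i.succ) (u.2 i - v.2 i))
      simpa [kern, sub_eq_add_neg, add_assoc, Pi.single_eq_of_ne (Fin.succ_ne_zero _)] using h2
    refine h1.hasDerivWithinAt.congr_of_mem (fun s hs => ?_) u.1.2
    simp only [line_zero, kern, projIcc_of_mem _ (show s ∈ Icc (-1 : ℝ) 1 from hs)]
  | succ i =>
    refine HasDerivAt.hasDerivWithinAt ?_
    have h1 := prod_update_line (q := fun j => tor N (α j.succ))
      (q' := fun j => tor N ((α + Pi.single i.succ 1 : Fin (n + 1) → ℕ) j.succ)) (i := i) (σ := 1)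
      (z := fun j => u.2 j - v.2 j) (fun s : ℝ => (s : UnitAddCircle))
      (by simpa using hasDerivAt_tor N (α i.succ) (u.2 i - v.2 i))
      (fun j hj => by simp [Pi.single_eq_of_ne ((Fin.succ_injective n).ne hj)])
    have h2 := h1.const_mul (ax N (α 0) ((u.1 : ℝ) - v.1) + ε * ax N (α 0) ((u.1 : ℝ) + v.1 - 2))
    rw [one_mul] at h2
    have h3 : (α + Pi.single i.succ 1 : Fin (n + 1) → ℕ) 0 = α 0 := by
      simp
    simp only [base_succ, line_succ, kern, h3]
    refine h2.congr_of_eventuallyEq (Eventually.of_forall fun s => ?_)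
    simp only [Pi.add_apply]
    congr 1
    refine Finset.prod_congr rfl fun j _ => ?_
    congr 1; abel

/-- The direct term depends on `u₁ - v₁` and the reflected one on `u₁ + v₁`, so a derivative in `v₁`
changes their relative sign: axial differentiation exchanges the Dirichlet and Neumann kernels.
Periodic directions keep the type. -/
lemma hasPD_kern_right (N : ℕ) (ε : ℝ) (α : Fin (n + 1) → ℕ) (k : Fin (n + 1)) (u v : Cyl n) :
    HasPD k (fun v => kern N ε α u v) v
      (-kern N (flipSign k ε) (α + Pi.single k 1) u v) := by
  cases k using Fin.cases with
  | zero =>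
    have h1 : HasDerivAt (fun s : ℝ => (ax N (α 0) (u.1 - s) + ε * ax N (α 0) (u.1 + s - 2)) *
        ∏ i : Fin n, tor N (α i.succ) (u.2 i - v.2 i))
        (-kern N (flipSign (0 : Fin (n + 1)) ε) (α + Pi.single 0 1) u v) (v.1 : ℝ) := by
      have ha : HasDerivAt (fun s : ℝ => ax N (α 0) (u.1 - s)) (-ax N (α 0 + 1) (u.1 - v.1))
        (v.1 : ℝ) := (hasDerivAt_mollD _ _ _ _ _).comp_const_sub _ _
      have hb : HasDerivAt (fun s : ℝ => ax N (α 0) (u.1 + s - 2)) (ax N (α 0 + 1) (u.1 + v.1 - 2))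
        (v.1 : ℝ) := by
        have := (hasDerivAt_mollD (Real.pi / 2) 4 N (α 0) (((u.1 : ℝ) - 2) + v.1)).comp_const_add
          ((u.1 : ℝ) - 2) (v.1 : ℝ)
        rw [show (u.1 : ℝ) + v.1 - 2 = ((u.1 : ℝ) - 2) + v.1 by ring]
        refine this.congr_of_eventuallyEq (Eventually.of_forall fun s => ?_)
        simp only [ax]; congr 1; ring
      have h2 := (ha.add (hb.const_mul ε)).mul_const
        (∏ i : Fin n, tor N (α i.succ) (u.2 i - v.2 i))
      refine h2.congr_deriv ?_
      simp [kern]; ring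
    refine h1.hasDerivWithinAt.congr_of_mem (fun s hs => ?_) v.1.2
    simp only [line_zero, kern, projIcc_of_mem _ (show s ∈ Icc (-1 : ℝ) 1 from hs)]
  | succ i =>
    refine HasDerivAt.hasDerivWithinAt ?_
    have h1 := prod_update_line (q := fun j => tor N (α j.succ))
      (q' := fun j => tor N ((α + Pi.single i.succ 1 : Fin (n + 1) → ℕ) j.succ)) (i := i) (σ := -1)
      (z := fun j => u.2 j - v.2 j) (fun s : ℝ => -(s : UnitAddCircle))
      (by simpa [sub_eq_add_neg] using hasDerivAt_tor_sub N (α i.succ) (u.2 i - v.2 i))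
      (fun j hj => by simp [Pi.single_eq_of_ne ((Fin.succ_injective n).ne hj)])
    have h2 := h1.const_mul (ax N (α 0) ((u.1 : ℝ) - v.1) + ε * ax N (α 0) ((u.1 : ℝ) + v.1 - 2))
    have h3 : (α + Pi.single i.succ 1 : Fin (n + 1) → ℕ) 0 = α 0 := by
      simp
    simp only [base_succ, line_succ, kern, h3, flipSign_succ]
    rw [neg_one_mul, mul_neg] at h2
    refine h2.congr_of_eventuallyEq (Eventually.of_forall fun s => ?_)
    simp only [Pi.add_apply]
    congr 1
    refine Finset.prod_congr rfl fun j _ => ?_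
    congr 1
    by_cases hj : j = i
    · subst hj; simp; abel
    · simp [Pi.single_eq_of_ne hj]

lemma ax_zero_neg (N : ℕ) (z : ℝ) : ax N 0 (-z) = ax N 0 z := by
  unfold ax; rw [mollD_zero, moll_neg]

lemma ax_one_neg (N : ℕ) (z : ℝ) : ax N 1 (-z) = -ax N 1 z := mollD_one_neg ..

lemma ax_nonneg (N : ℕ) (z : ℝ) : 0 ≤ ax N 0 z := by
  unfold ax; rw [mollD_zero]; exact moll_nonneg (by norm_num) N z

lemma kern_symm (N : ℕ) (ε : ℝ) (u v : Cyl n) : kern N ε 0 u v = kern N ε 0 v u := by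
  unfold kern
  simp only [Pi.zero_apply]
  rw [← ax_zero_neg N ((u.1 : ℝ) - v.1), neg_sub, add_comm (u.1 : ℝ)]
  congr 1
  refine Finset.prod_congr rfl fun i _ => ?_
  rw [← tor_neg, neg_sub]

lemma kern_single_symm (N : ℕ) (ε : ℝ) (k : Fin (n + 1)) (u v : Cyl n) :
    kern N (flipSign k ε) (Pi.single k 1) u v = -kern N ε (Pi.single k 1) v u := by
  cases k using Fin.cases with
  | zero =>
    simp only [kern, flipSign_zero, Pi.single_eq_same, ne_eq, Fin.succ_ne_zero,
      not_false_eq_true, Pi.single_eq_of_ne]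
    rw [← neg_mul, neg_add, ← ax_one_neg, neg_sub, add_comm (v.1 : ℝ), neg_mul]
    congr 1
    refine Finset.prod_congr rfl fun i _ => ?_
    rw [← tor_neg, neg_sub]
  | succ i =>
    have h0 : (Pi.single i.succ 1 : Fin (n + 1) → ℕ) 0 = 0 :=
      Pi.single_eq_of_ne (Fin.succ_ne_zero i).symm _
    simp only [kern, flipSign_succ, h0]
    rw [← ax_zero_neg N ((u.1 : ℝ) - v.1), neg_sub, add_comm (u.1 : ℝ), ← mul_neg]
    congr 1
    rw [← Finset.mul_prod_erase _ _ (Finset.mem_univ i),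
      ← Finset.mul_prod_erase _ _ (Finset.mem_univ i), ← neg_mul, Pi.single_eq_same,
      ← tor_one_neg, neg_sub]
    congr 1
    refine Finset.prod_congr rfl fun j hj => ?_
    rw [Pi.single_eq_of_ne ((Fin.succ_injective n).ne (Finset.ne_of_mem_erase hj)),
      ← tor_neg, neg_sub]

lemma ax_periodic (N j : ℕ) : Function.Periodic (ax N j) 4 := mollD_periodic ax_period N j

/-- At `u₁ = 1` the two axial arguments are opposite, at `u₁ = -1` they are opposite up to the
period `4`; the mollifier is even, so the odd reflection cancels. -/
lemma kern_bdry (N : ℕ) {u : Cyl n} (hu : u ∈ bdry n) (v : Cyl n) : kern N (-1) 0 u v = 0 := by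
  have : ax N 0 ((u.1 : ℝ) - v.1) = ax N 0 ((u.1 : ℝ) + v.1 - 2) := by
    rcases hu with h | h
    · rw [h, ← ax_zero_neg, ← ax_periodic N 0 (-1 + (v.1 : ℝ) - 2)]; congr 1; ring
    · rw [h, ← ax_zero_neg]; congr 1; ring
  simp [kern, this]

/-- The difference of the two sides is `2 cos(πx/2) cos(πy/2)`. Monotonicity of `t ↦ (1 + t)^N` then
makes the Dirichlet kernel nonnegative. -/
lemma cos_reflect_le {x y : ℝ} (hx : x ∈ Icc (-1 : ℝ) 1) (hy : y ∈ Icc (-1 : ℝ) 1) :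
    Real.cos (Real.pi / 2 * (x + y - 2)) ≤ Real.cos (Real.pi / 2 * (x - y)) := by
  have h1 : Real.cos (Real.pi / 2 * (x + y - 2)) = -Real.cos (Real.pi / 2 * (x + y)) := by
    rw [show Real.pi / 2 * (x + y - 2) = Real.pi / 2 * (x + y) - Real.pi by ring,
      Real.cos_sub_pi]
  have hc : ∀ z ∈ Icc (-1 : ℝ) 1, 0 ≤ Real.cos (Real.pi / 2 * z) := fun z hz =>
    Real.cos_nonneg_of_neg_pi_div_two_le_of_le (by nlinarith [hz.1, Real.pi_pos])
      (by nlinarith [hz.2, Real.pi_pos])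
  rw [h1, mul_add, mul_sub, Real.cos_add, Real.cos_sub]
  nlinarith [mul_nonneg (hc x hx) (hc y hy)]

lemma ax_reflect_le (N : ℕ) {x y : ℝ} (hx : x ∈ Icc (-1 : ℝ) 1) (hy : y ∈ Icc (-1 : ℝ) 1) :
    ax N 0 (x + y - 2) ≤ ax N 0 (x - y) := by
  unfold ax
  rw [mollD_zero]
  unfold moll
  refine div_le_div_of_nonneg_right ?_ (integral_trigPow_pos (by norm_num) N).le
  exact pow_le_pow_left₀ (by linarith [Real.neg_one_le_cos (Real.pi / 2 * (x + y - 2))])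
    (by linarith [cos_reflect_le hx hy]) N

lemma prod_tor_nonneg (N : ℕ) (z : Fin n → UnitAddCircle) : 0 ≤ ∏ i, tor N 0 (z i) :=
  Finset.prod_nonneg fun _ _ => tor_nonneg N _

lemma kern_dir_nonneg (N : ℕ) (u v : Cyl n) : 0 ≤ kern N (-1) 0 u v :=
  mul_nonneg (by have := ax_reflect_le N u.1.2 v.1.2; simp only [Pi.zero_apply]; linarith)
    (prod_tor_nonneg N fun i => u.2 i - v.2 i)

lemma kern_dir_le (N : ℕ) (u v : Cyl n) : kern N (-1) 0 u v ≤ kern N 1 0 u v :=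
  mul_le_mul_of_nonneg_right
    (by have := ax_nonneg N ((u.1 : ℝ) + v.1 - 2); simp only [Pi.zero_apply]; linarith)
    (prod_tor_nonneg N fun i => u.2 i - v.2 i)

lemma kern_neu_nonneg (N : ℕ) (u v : Cyl n) : 0 ≤ kern N 1 0 u v :=
  (kern_dir_nonneg N u v).trans (kern_dir_le N u v)

lemma integral_cyl_prod (a : Icc (-1 : ℝ) 1 → ℝ) (q : Fin n → UnitAddCircle → ℝ)
    (y : Fin n → UnitAddCircle) :
    ∫ v : Cyl n, a v.1 * ∏ i, q i (y i - v.2 i) = (∫ x, a x) * ∏ i, ∫ z, q i z := by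
  have h1 := integral_prod_mul (μ := (volume : Measure (Icc (-1 : ℝ) 1)))
    (ν := (volume : Measure (Fin n → UnitAddCircle))) a (fun z => ∏ i, q i (y i - z i))
  have h2 := integral_fintype_prod_volume_eq_prod (fun i z => q i (y i - z))
  rw [h2] at h1
  simp_rw [integral_sub_left_eq_self] at h1
  exact h1

lemma integral_ax_reflect (N : ℕ) (x : ℝ) :
    ∫ y : Icc (-1 : ℝ) 1, (ax N 0 (x - y) + 1 * ax N 0 (x + y - 2)) = 1 := by
  simp only [one_mul]
  rw [integral_reflected (continuous_ax N 0) (ax_periodic N 0) x]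
  unfold ax; rw [mollD_zero]; exact integral_moll (by norm_num) N

lemma integral_kern (N : ℕ) (u : Cyl n) : ∫ v, kern N 1 0 u v = 1 := by
  unfold kern
  have := integral_cyl_prod (fun y => ax N 0 ((u.1 : ℝ) - y) + 1 * ax N 0 ((u.1 : ℝ) + y - 2))
    (fun _ => tor N 0) u.2
  simp only [Pi.zero_apply]
  rw [this, integral_ax_reflect]
  simp [integral_tor]

/-- A smooth substitute for the squared distance. -/
def sqd (u v : Cyl n) : ℝ :=
  (1 - Real.cos (Real.pi / 2 * ((u.1 : ℝ) - v.1))) + ∑ i, tdist (u.2 i - v.2 i)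

lemma continuous_sqd : Continuous (fun p : Cyl n × Cyl n => sqd p.1 p.2) := by
  unfold sqd
  refine Continuous.add (by fun_prop) (continuous_finsetSum _ fun i _ => ?_)
  exact continuous_tdist.comp (by fun_prop)

lemma tdist_nonneg (z : UnitAddCircle) : 0 ≤ tdist z := by
  induction z using circle_ind with
  | h x => rw [tdist_coe]; linarith [Real.cos_le_one (2 * Real.pi * x)]

lemma sqd_nonneg (u v : Cyl n) : 0 ≤ sqd u v :=
  add_nonneg (by linarith [Real.cos_le_one (Real.pi / 2 * ((u.1 : ℝ) - v.1))])
    (Finset.sum_nonneg fun i _ => tdist_nonneg _)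

/-- On the reflected term the weight at `x - y` is bounded by the larger weight at `x + y - 2`, by
`cos_reflect_le`; the two terms then unfold to the moment over one period. -/
lemma integral_ax_dist_le (N : ℕ) {x : ℝ} (hx : x ∈ Icc (-1 : ℝ) 1) :
    ∫ y : Icc (-1 : ℝ) 1, (ax N 0 (x - y) + 1 * ax N 0 (x + y - 2)) *
      (1 - Real.cos (Real.pi / 2 * (x - y))) ≤ 1 / (N + 1) := by
  let f : ℝ → ℝ := fun z => ax N 0 z * (1 - Real.cos (Real.pi / 2 * z))
  have hf : Continuous f := (continuous_ax N 0).mul (by fun_prop)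
  have hp : Function.Periodic f 4 := fun z => by
    simp only [f, ax_periodic N 0 z, mul_add, ax_period, Real.cos_add_two_pi]
  have h1 := integral_reflected hf hp x
  have h2 : ∫ z in (0 : ℝ)..4, f z = 1 / (N + 1) := by
    simp only [f, ax, mollD_zero]
    exact integral_moll_mul (by norm_num) (by positivity) ax_period N
  rw [← h2, ← h1]
  have hi : ∀ g : Icc (-1 : ℝ) 1 → ℝ, Continuous g → Integrable g := fun g hg =>
    hg.integrable_of_hasCompactSupport (HasCompactSupport.of_compactSpace g)
  have ha := continuous_ax N 0
  refine integral_mono (hi _ ?_) (hi _ ?_) fun y => ?_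
  · refine Continuous.mul (Continuous.add (ha.comp (by fun_prop))
      (continuous_const.mul (ha.comp (by fun_prop)))) (by fun_prop)
  · exact (hf.comp (by fun_prop)).add (hf.comp (by fun_prop))
  · simp only [f]
    have h3 := cos_reflect_le hx y.2
    have h4 := ax_nonneg N (x + y - 2)
    nlinarith [mul_le_mul_of_nonneg_left h3 h4]

/-- `sqd` is a sum over the `n + 1` coordinates, and each of them contributes at most `1 / (N + 1)`,
the other factors having integral one. -/
lemma integral_kern_mul_sqd_le (N : ℕ) (u : Cyl n) :
    ∫ v, kern N 1 0 u v * sqd u v ≤ (n + 1) / (N + 1) := by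
  have hk := continuous_kern_right N 1 0 u
  let a : Icc (-1 : ℝ) 1 → ℝ := fun y => ax N 0 ((u.1 : ℝ) - y) + 1 * ax N 0 ((u.1 : ℝ) + y - 2)
  have e1 : ∀ v : Cyl n, kern N 1 0 u v * sqd u v =
      (a v.1 * (1 - Real.cos (Real.pi / 2 * ((u.1 : ℝ) - v.1)))) * ∏ i, tor N 0 (u.2 i - v.2 i) +
      ∑ j, a v.1 * ∏ i, (fun i z => tor N 0 z * (if i = j then tdist z else 1)) i
        (u.2 i - v.2 i) := by
    intro v
    simp only [sqd, mul_add, Finset.mul_sum, Finset.prod_mul_distrib]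
    congr 1
    · simp only [kern, a, Pi.zero_apply]; ring
    · refine Finset.sum_congr rfl fun j _ => ?_
      simp only [kern, a, Pi.zero_apply]
      rw [Finset.prod_ite_eq' Finset.univ j]
      simp; ring
  simp_rw [e1]
  have ha : Continuous a := by
    have := continuous_ax N 0
    exact (this.comp (by fun_prop)).add (continuous_const.mul (this.comp (by fun_prop)))
  have ht := continuous_tor N 0
  have hc1 : Continuous fun v : Cyl n => (a v.1 * (1 - Real.cos (Real.pi / 2 * ((u.1 : ℝ) - v.1)))) *
      ∏ i, tor N 0 (u.2 i - v.2 i) :=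
    ((ha.comp continuous_fst).mul (by fun_prop)).mul
      (continuous_finsetProd _ fun i _ => ht.comp (by fun_prop))
  have hc2 : ∀ j, Continuous fun v : Cyl n => a v.1 *
      ∏ i, (fun i z => tor N 0 z * (if i = j then tdist z else 1)) i (u.2 i - v.2 i) := fun j => by
    refine (ha.comp continuous_fst).mul (continuous_finsetProd _ fun i _ => ?_)
    have : Continuous fun z => tor N 0 z * (if i = j then tdist z else 1) := by
      split_ifs
      · exact ht.mul continuous_tdist
      · exact ht.mul continuous_const
    exact this.comp (by fun_prop)
  rw [integral_add (integrable_of_continuous hc1)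
    (integrable_finsetSum _ fun j _ => integrable_of_continuous (hc2 j)),
    integral_finsetSum _ fun j _ => integrable_of_continuous (hc2 j)]
  have e2 := integral_cyl_prod (fun y => a y * (1 - Real.cos (Real.pi / 2 * ((u.1 : ℝ) - y))))
    (fun _ => tor N 0) u.2
  have e3 : ∀ j, ∫ v : Cyl n, a v.1 *
      ∏ i, (fun i z => tor N 0 z * (if i = j then tdist z else 1)) i (u.2 i - v.2 i) =
      1 / (N + 1) := by
    intro j
    rw [integral_cyl_prod a (fun i z => tor N 0 z * (if i = j then tdist z else 1)),
      integral_ax_reflect, one_mul,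
      ← Finset.mul_prod_erase _ _ (Finset.mem_univ j), Finset.prod_eq_one]
    · simp [integral_tor_mul]
    · intro i hi
      simp [Finset.ne_of_mem_erase hi, integral_tor]
  rw [e2]
  simp_rw [e3]
  have := integral_ax_dist_le N u.1.2
  simp only [integral_tor, Finset.prod_const_one, mul_one, Finset.sum_const, Finset.card_univ,
    Fintype.card_fin, nsmul_eq_mul]
  have h4 : ((n : ℝ) + 1) / (N + 1) = 1 / (N + 1) + n * (1 / (N + 1)) := by ring
  rw [h4]
  gcongr

end Kernel

/-! ### Smoothing operators with Dirichlet and Neumann reflection. -/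

section Mollify

variable {n : ℕ}

/-- The integral operator with kernel `kern N ε α`. -/
def mop (N : ℕ) (ε : ℝ) (α : Fin (n + 1) → ℕ) (f : Cyl n → ℝ) (u : Cyl n) : ℝ :=
  ∫ v, kern N ε α u v * f v

lemma kern_bound (N : ℕ) (ε : ℝ) (α : Fin (n + 1) → ℕ) :
    ∃ K, 0 ≤ K ∧ ∀ u v : Cyl n, |kern N ε α u v| ≤ K := by
  obtain ⟨K, hK0, hK⟩ := exists_bound (continuous_kern (n := n) N ε α)
  exact ⟨K, hK0, fun u v => hK (u, v)⟩

lemma measurable_kern_right (N : ℕ) (ε : ℝ) (α : Fin (n + 1) → ℕ) (u : Cyl n) :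
    Measurable (fun v => kern N ε α u v) := (continuous_kern_right N ε α u).measurable

lemma integrable_kern_mul (N : ℕ) (ε : ℝ) (α : Fin (n + 1) → ℕ) {f : Cyl n → ℝ} {C : ℝ}
    (hf : Measurable f) (hb : ∀ u, |f u| ≤ C) (u : Cyl n) :
    Integrable (fun v => kern N ε α u v * f v) := by
  obtain ⟨K, hK0, hK⟩ := kern_bound (n := n) N ε α
  exact integrable_of_bounded ((measurable_kern_right N ε α u).mul hf) (C := K * C) fun v => by
    rw [abs_mul]; exact mul_le_mul (hK _ _) (hb v) (abs_nonneg _) hK0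

lemma continuous_mop_param {X : Type} [TopologicalSpace X] [FirstCountableTopology X] (N : ℕ)
    (ε : ℝ) (α : Fin (n + 1) → ℕ) {A : X → Cyl n → ℝ} {C : ℝ} (hm : ∀ x, Measurable (A x))
    (hb : ∀ x u, |A x u| ≤ C) (hc : ∀ u, Continuous fun x => A x u) :
    Continuous (Function.uncurry fun x u => mop N ε α (A x) u) := by
  obtain ⟨K, hK0, hK⟩ := kern_bound (n := n) N ε α
  refine continuous_of_dominated (bound := fun _ => K * C)
    (fun p => ((measurable_kern_right N ε α p.2).mul (hm p.1)).aestronglyMeasurable)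
    (fun p => ae_of_all _ fun v => ?_) (integrable_const _) (ae_of_all _ fun v => ?_)
  · rw [Real.norm_eq_abs, abs_mul]
    exact mul_le_mul (hK _ _) (hb _ v) (abs_nonneg _) hK0
  · exact ((continuous_kern_left N ε α v).comp continuous_snd).mul ((hc v).comp continuous_fst)

lemma continuous_mop (N : ℕ) (ε : ℝ) (α : Fin (n + 1) → ℕ) {f : Cyl n → ℝ} {C : ℝ}
    (hf : Measurable f) (hb : ∀ u, |f u| ≤ C) : Continuous (mop N ε α f) :=
  (continuous_mop_param N ε α (X := Unit) (A := fun _ => f) (fun _ => hf) (fun _ => hb)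
    fun _ => continuous_const).comp (Continuous.prodMk_right ())

lemma hasPD_mop (N : ℕ) (ε : ℝ) (α : Fin (n + 1) → ℕ) {f : Cyl n → ℝ} {C : ℝ}
    (hf : Measurable f) (hb : ∀ u, |f u| ≤ C) (k : Fin (n + 1)) (u : Cyl n) :
    HasPD k (mop N ε α f) u (mop N ε (α + Pi.single k 1) f u) := by
  obtain ⟨K, hK0, hK⟩ := kern_bound (n := n) N ε (α + Pi.single k 1)
  have h1 : ∀ v u, HasPD k (fun u => kern N ε α u v * f v) u 
      (kern N ε (α + Pi.single k 1) u v * f v) := by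
    intro v u
    have := (hasPD_kern N ε α k v u).const_mul (f v)
    simpa only [mul_comm] using this
  have h2 : ∀ v u, |kern N ε (α + Pi.single k 1) u v * f v| ≤ K * C := by
    intro v u
    rw [abs_mul]; exact mul_le_mul (hK _ _) (hb v) (abs_nonneg _) hK0
  have h3 := HasPD.integral (μ := (volume : Measure (Cyl n))) h1 h2
    (fun u => integrable_kern_mul N ε α hf hb u) u
  exact h3

lemma pderiv_mop (N : ℕ) (ε : ℝ) (α : Fin (n + 1) → ℕ) {f : Cyl n → ℝ} {C : ℝ}
    (hf : Measurable f) (hb : ∀ u, |f u| ≤ C) (k : Fin (n + 1)) :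
    pderiv k (mop N ε α f) = mop N ε (α + Pi.single k 1) f :=
  funext fun u => (hasPD_mop N ε α hf hb k u).pderiv_eq

lemma isC1_mop (N : ℕ) (ε : ℝ) (α : Fin (n + 1) → ℕ) {f : Cyl n → ℝ} {C : ℝ}
    (hf : Measurable f) (hb : ∀ u, |f u| ≤ C) : IsC1 (mop N ε α f) :=
  .of_hasPD (continuous_mop N ε α hf hb) (fun k u => hasPD_mop N ε α hf hb k u)
    fun _ => continuous_mop N ε _ hf hb

lemma isCSpace_mop {X : Type} [TopologicalSpace X] [FirstCountableTopology X] (N : ℕ) (ε : ℝ)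
    {A : X → Cyl n → ℝ} {C : ℝ} (hm : ∀ x, Measurable (A x)) (hb : ∀ x u, |A x u| ≤ C)
    (hc : ∀ u, Continuous fun x => A x u) (m : ℕ) :
    ∀ α : Fin (n + 1) → ℕ, IsCSpace m (fun x u => mop N ε α (A x) u) := by
  induction m with
  | zero => exact fun α => continuous_mop_param N ε α hm hb hc
  | succ m ih =>
    exact fun α => isCSpace_succ (fun k x u => mop N ε (α + Pi.single k 1) (A x) u)
      (continuous_mop_param N ε α hm hb hc) (fun k x u => hasPD_mop N ε α (hm x) (hb x) k u)
      fun k => ih _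

lemma mop_bdry (N : ℕ) (f : Cyl n → ℝ) {u : Cyl n} (hu : u ∈ bdry n) :
    mop N (-1) 0 f u = 0 := by
  simp [mop, kern_bdry N hu]

/-- Derivatives commute with the mollification of functions vanishing on the boundary. -/
lemma mop_by_parts (N : ℕ) (ε : ℝ) (α : Fin (n + 1) → ℕ) {G : Cyl n → ℝ} (hG : IsC1 G)
    (h0 : ∀ u ∈ bdry n, G u = 0) (k : Fin (n + 1)) (u : Cyl n) :
    mop N ε (α + Pi.single k 1) G u = mop N (flipSign k ε) α (pderiv k G) u := by
  have h := integral_mul_pderiv k (F := fun v => kern N (flipSign k ε) α u v) (G := G)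
    (continuous_kern_right N _ α u) hG.cont
    (continuous_kern_right N (flipSign k (flipSign k ε)) (α + Pi.single k 1) u).neg (hG.contD k)
    (fun v => hasPD_kern_right N (flipSign k ε) α k u v) (hG.hasPD k)
  rw [bdryTerm_eq_zero k (fun v hv => by rw [h0 v hv, mul_zero])] at h
  unfold mop
  rw [h]
  simp [integral_neg]

lemma integral_swap_kern {K : Cyl n → Cyl n → ℝ} (hK : Continuous (Function.uncurry K))
    {f g : Cyl n → ℝ} {C D : ℝ} (hf : Measurable f) (hfb : ∀ u, |f u| ≤ C) (hg : Measurable g)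
    (hgb : ∀ u, |g u| ≤ D) :
    ∫ u, f u * ∫ v, K u v * g v = ∫ v, (∫ u, K u v * f u) * g v := by
  obtain ⟨B, hB0, hB⟩ := exists_bound hK
  have hi : Integrable (Function.uncurry fun u v => f u * (K u v * g v))
      ((volume : Measure (Cyl n)).prod volume) := by
    refine Integrable.of_bound (C := C * (B * D)) (Measurable.aestronglyMeasurable ?_)
      (ae_of_all _ fun p => ?_)
    · exact (hf.comp measurable_fst).mul (hK.measurable.mul (hg.comp measurable_snd))
    · simp only [Function.uncurry, Real.norm_eq_abs, abs_mul]
      exact mul_le_mul (hfb _) (mul_le_mul (hB (p.1, p.2)) (hgb _) (abs_nonneg _) hB0)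
        (by positivity) ((abs_nonneg _).trans (hfb p.1))
  have := integral_integral_swap hi
  simp_rw [← integral_const_mul, ← integral_mul_const]
  rw [this]
  congr 1; ext v; congr 1; ext u; ring

lemma mop_symm (N : ℕ) (ε : ℝ) {f g : Cyl n → ℝ} {C D : ℝ} (hf : Measurable f)
    (hfb : ∀ u, |f u| ≤ C) (hg : Measurable g) (hgb : ∀ u, |g u| ≤ D) :
    ∫ u, f u * mop N ε 0 g u = ∫ u, mop N ε 0 f u * g u := by
  unfold mop
  rw [integral_swap_kern (continuous_kern N ε 0) hf hfb hg hgb]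
  congr 1; ext v; congr 1; congr 1; ext u
  rw [kern_symm]

lemma mop_symm_single (N : ℕ) (ε : ℝ) (k : Fin (n + 1)) {f g : Cyl n → ℝ} {C D : ℝ}
    (hf : Measurable f) (hfb : ∀ u, |f u| ≤ C) (hg : Measurable g) (hgb : ∀ u, |g u| ≤ D) :
    ∫ u, f u * mop N (flipSign k ε) (Pi.single k 1) g u =
      -∫ u, mop N ε (Pi.single k 1) f u * g u := by
  unfold mop
  rw [integral_swap_kern (continuous_kern N _ _) hf hfb hg hgb, ← integral_neg]
  congr 1; ext v
  rw [← neg_mul, ← integral_neg]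
  congr 2; ext u
  rw [kern_single_symm]; ring

/-- Admissible signs. -/
lemma flipSign_sign (k : Fin (n + 1)) {ε : ℝ} (h : ε = 1 ∨ ε = -1) :
    flipSign k ε = 1 ∨ flipSign k ε = -1 := by
  unfold flipSign
  split_ifs
  · rcases h with rfl | rfl <;> simp
  · exact h

lemma kern_sign_nonneg (N : ℕ) {ε : ℝ} (h : ε = 1 ∨ ε = -1) (u v : Cyl n) :
    0 ≤ kern N ε 0 u v := by
  rcases h with rfl | rfl
  · exact kern_neu_nonneg N u v
  · exact kern_dir_nonneg N u v

lemma kern_sign_le (N : ℕ) {ε : ℝ} (h : ε = 1 ∨ ε = -1) (u v : Cyl n) :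
    kern N ε 0 u v ≤ kern N 1 0 u v := by
  rcases h with rfl | rfl
  · exact le_rfl
  · exact kern_dir_le N u v

lemma integrable_kern (N : ℕ) (ε : ℝ) (α : Fin (n + 1) → ℕ) (u : Cyl n) :
    Integrable (fun v => kern N ε α u v) := integrable_of_continuous (continuous_kern_right N ε α u)

lemma integral_kern_sign_le (N : ℕ) {ε : ℝ} (h : ε = 1 ∨ ε = -1) (u : Cyl n) :
    ∫ v, kern N ε 0 u v ≤ 1 := by
  refine le_of_le_of_eq ?_ (integral_kern N u)
  exact integral_mono (integrable_kern ..) (integrable_kern ..) fun v => kern_sign_le N h u v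

lemma mop_mono (N : ℕ) {ε : ℝ} (h : ε = 1 ∨ ε = -1) {f g : Cyl n → ℝ} {C D : ℝ}
    (hf : Measurable f) (hfb : ∀ u, |f u| ≤ C) (hg : Measurable g) (hgb : ∀ u, |g u| ≤ D)
    (hfg : ∀ u, f u ≤ g u) (u : Cyl n) : mop N ε 0 f u ≤ mop N ε 0 g u :=
  integral_mono (integrable_kern_mul N ε 0 hf hfb u) (integrable_kern_mul N ε 0 hg hgb u)
    fun v => mul_le_mul_of_nonneg_left (hfg v) (kern_sign_nonneg N h u v)

lemma mop_nonneg (N : ℕ) {ε : ℝ} (h : ε = 1 ∨ ε = -1) {f : Cyl n → ℝ} (hf : ∀ u, 0 ≤ f u)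
    (u : Cyl n) : 0 ≤ mop N ε 0 f u :=
  integral_nonneg fun v => mul_nonneg (kern_sign_nonneg N h u v) (hf v)

lemma mop_sub (N : ℕ) (ε : ℝ) (α : Fin (n + 1) → ℕ) {f g : Cyl n → ℝ} {C D : ℝ}
    (hf : Measurable f) (hfb : ∀ u, |f u| ≤ C) (hg : Measurable g) (hgb : ∀ u, |g u| ≤ D)
    (u : Cyl n) : mop N ε α (fun v => f v - g v) u = mop N ε α f u - mop N ε α g u := by
  unfold mop
  simp_rw [mul_sub]
  exact integral_sub (integrable_kern_mul N ε α hf hfb u) (integrable_kern_mul N ε α hg hgb u)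

lemma mop_const_mul (N : ℕ) (ε : ℝ) (α : Fin (n + 1) → ℕ) (c : ℝ) (f : Cyl n → ℝ) (u : Cyl n) :
    mop N ε α (fun v => c * f v) u = c * mop N ε α f u := by
  unfold mop
  rw [← integral_const_mul]
  congr 1; ext v; ring

lemma mop_const (N : ℕ) (c : ℝ) (u : Cyl n) : mop N 1 0 (fun _ => c) u = c := by
  unfold mop
  rw [integral_mul_const, integral_kern, one_mul]

lemma abs_mop_le_mop_abs (N : ℕ) {ε : ℝ} (h : ε = 1 ∨ ε = -1) {f : Cyl n → ℝ} {C : ℝ}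
    (hf : Measurable f) (hfb : ∀ u, |f u| ≤ C) (u : Cyl n) :
    |mop N ε 0 f u| ≤ mop N 1 0 (fun v => |f v|) u := by
  refine (abs_integral_le_integral_abs).trans ?_
  refine integral_mono (integrable_kern_mul N ε 0 hf hfb u).abs
    (integrable_kern_mul N 1 0 (measurable_abs.comp hf) (C := C) (fun v => by simpa using hfb v) u)
    fun v => ?_
  simp only [abs_mul, abs_of_nonneg (kern_sign_nonneg N h u v)]
  exact mul_le_mul_of_nonneg_right (kern_sign_le N h u v) (abs_nonneg _)

lemma abs_mop_le (N : ℕ) {ε : ℝ} (h : ε = 1 ∨ ε = -1) {f : Cyl n → ℝ} {C : ℝ}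
    (hf : Measurable f) (hfb : ∀ u, |f u| ≤ C) (u : Cyl n) : |mop N ε 0 f u| ≤ C := by
  refine (abs_mop_le_mop_abs N h hf hfb u).trans ?_
  rw [← mop_const N C u]
  exact mop_mono N (.inl rfl) (measurable_abs.comp hf) (C := C) (fun v => by simpa using hfb v)
    measurable_const (D := |C|) (fun _ => le_rfl) hfb u

/-- Jensen's inequality for the mollifiers. -/
lemma sq_mop_le (N : ℕ) {ε : ℝ} (h : ε = 1 ∨ ε = -1) {f : Cyl n → ℝ} {C : ℝ}
    (hf : Measurable f) (hfb : ∀ u, |f u| ≤ C) (u : Cyl n) :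
    mop N ε 0 f u ^ 2 ≤ mop N 1 0 (fun v => f v ^ 2) u := by
  have hf2b : ∀ v, |f v ^ 2| ≤ C ^ 2 := fun v => by
    rw [abs_pow]; exact pow_le_pow_left₀ (abs_nonneg _) (hfb v) 2
  have h1 : mop N ε 0 (fun v => f v ^ 2) u ≤ mop N 1 0 (fun v => f v ^ 2) u :=
    integral_mono (integrable_kern_mul N ε 0 (hf.pow_const 2) hf2b u)
      (integrable_kern_mul N 1 0 (hf.pow_const 2) hf2b u)
      fun v => mul_le_mul_of_nonneg_right (kern_sign_le N h u v) (sq_nonneg _)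
  refine le_trans ?_ h1
  set c := mop N ε 0 f u with hc
  -- Expand the variance about `c`. Total mass at most `1` is enough, since the last term enters as
  -- `c²` times the mass; so the Dirichlet kernel is allowed.
  have h2 : 0 ≤ ∫ v, kern N ε 0 u v * (f v - c) ^ 2 :=
    integral_nonneg fun v => mul_nonneg (kern_sign_nonneg N h u v) (sq_nonneg _)
  have h3 : ∫ v, kern N ε 0 u v * (f v - c) ^ 2 =
      mop N ε 0 (fun v => f v ^ 2) u - 2 * c * mop N ε 0 f u + c ^ 2 * ∫ v, kern N ε 0 u v := by
    have i1 := integrable_kern_mul N ε 0 (hf.pow_const 2) hf2b u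
    have i2 := (integrable_kern_mul N ε 0 hf hfb u).const_mul (2 * c)
    have i3 := (integrable_kern N ε 0 u).const_mul (c ^ 2)
    have i4 := integral_add (i1.sub i2) i3
    simp only [Pi.sub_apply] at i4
    rw [integral_sub i1 i2, integral_const_mul, integral_const_mul] at i4
    unfold mop
    rw [← i4]
    congr 1; ext v; ring
  rw [h3, ← hc] at h2
  nlinarith [mul_le_mul_of_nonneg_left (integral_kern_sign_le N h u) (sq_nonneg c)]

/-- The Neumann operator is symmetric and fixes constants. -/
lemma integral_mop_neu (N : ℕ) {f : Cyl n → ℝ} {C : ℝ} (hf : Measurable f)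
    (hfb : ∀ u, |f u| ≤ C) : ∫ u, mop N 1 0 f u = ∫ u, f u := by
  have := mop_symm N 1 (f := fun _ : Cyl n => (1 : ℝ)) (g := f) measurable_const (C := 1)
    (fun _ => by simp) hf hfb
  simpa [mop_const] using this

/-- The mollifiers are contractions of `L¹`. -/
lemma integral_abs_mop_le (N : ℕ) {ε : ℝ} (h : ε = 1 ∨ ε = -1) {f : Cyl n → ℝ} {C : ℝ}
    (hf : Measurable f) (hfb : ∀ u, |f u| ≤ C) : ∫ u, |mop N ε 0 f u| ≤ ∫ u, |f u| := by
  rw [← integral_mop_neu N (f := fun u => |f u|) (measurable_abs.comp hf) (C := C)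
    (fun v => by simpa using hfb v)]
  exact integral_mono (integrable_of_continuous (continuous_mop N ε 0 hf hfb).abs)
    (integrable_of_continuous (continuous_mop N 1 0 (measurable_abs.comp hf) (C := C)
      (fun v => by simpa using hfb v))) fun u => abs_mop_le_mop_abs N h hf hfb u

/-! ### Approximation -/

/-- Axial coordinates differ by at most `2`, half the period `4`, so the axial cosine equals one
only at difference zero. -/
lemma eq_of_sqd_eq_zero {u v : Cyl n} (h : sqd u v = 0) : u = v := by
  have h1 := Real.cos_le_one (Real.pi / 2 * ((u.1 : ℝ) - v.1))
  have h2 : 0 ≤ ∑ i, tdist (u.2 i - v.2 i) := Finset.sum_nonneg fun i _ => tdist_nonneg _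
  have h3 : Real.cos (Real.pi / 2 * ((u.1 : ℝ) - v.1)) = 1 := by unfold sqd at h; linarith
  have h4 : ∑ i, tdist (u.2 i - v.2 i) = 0 := by unfold sqd at h; linarith
  refine Prod.ext (Subtype.ext ?_) (funext fun i => ?_)
  · have h5 := (Real.cos_eq_one_iff_of_lt_of_lt
      (x := Real.pi / 2 * ((u.1 : ℝ) - v.1))
      (by nlinarith [u.1.2.1, v.1.2.2, Real.pi_pos])
      (by nlinarith [u.1.2.2, v.1.2.1, Real.pi_pos])).1 h3
    rcases mul_eq_zero.1 h5 with h6 | h6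
    · exact absurd h6 (by positivity)
    · linarith
  · have h5 := (Finset.sum_eq_zero_iff_of_nonneg fun i _ => tdist_nonneg _).1 h4 i
      (Finset.mem_univ i)
    have h6 : ∀ z : UnitAddCircle, tdist z = 0 → z = 0 := by
      intro z
      induction z using circle_ind with
      | h x =>
        intro h
        rw [tdist_coe] at h
        obtain ⟨k, hk⟩ := (Real.cos_eq_one_iff _).1 (show Real.cos (2 * Real.pi * x) = 1 by linarith)
        rw [AddCircle.coe_eq_zero_iff]
        refine ⟨k, ?_⟩
        have : (2 * Real.pi) * (k - x) = 0 := by linarith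
        rcases mul_eq_zero.1 this with h | h
        · exact absurd h (by positivity)
        · simp; linarith
    exact sub_eq_zero.1 (h6 _ h5)

/-- Modulus of continuity in terms of `sqd`. -/
lemma exists_modulus {f : Cyl n → ℝ} (hf : Continuous f) {ε : ℝ} (hε : 0 < ε) :
    ∃ C, 0 ≤ C ∧ ∀ u v, |f v - f u| ≤ ε + C * sqd u v := by
  obtain ⟨B, hB0, hB⟩ := exists_bound hf
  -- The pairs across which `f` oscillates by at least `ε` form a compact set off the diagonal,
  -- where `sqd` has a positive minimum; there the crude bound `2B` is divided by this minimum.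
  let S : Set (Cyl n × Cyl n) := {p | ε ≤ |f p.2 - f p.1|}
  have hS : IsCompact S := (isClosed_le continuous_const (by fun_prop)).isCompact
  rcases S.eq_empty_or_nonempty with he | hne
  · refine ⟨0, le_rfl, fun u v => ?_⟩
    have : (u, v) ∉ S := by simp [he]
    simp only [S, mem_ofPred_eq, not_le] at this
    simpa using this.le
  · obtain ⟨p, hp, hmin⟩ := hS.exists_isMinOn hne continuous_sqd.continuousOn
    have hpos : 0 < sqd p.1 p.2 := by
      rcases (sqd_nonneg p.1 p.2).lt_or_eq with h | h
      · exact h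
      · have := eq_of_sqd_eq_zero h.symm
        simp only [S, mem_ofPred_eq, this, sub_self, abs_zero] at hp
        linarith
    refine ⟨2 * B / sqd p.1 p.2, by positivity, fun u v => ?_⟩
    by_cases huv : (u, v) ∈ S
    · have h1 : sqd p.1 p.2 ≤ sqd u v := isMinOn_iff.1 hmin (u, v) huv
      have h2 : |f v - f u| ≤ 2 * B := by
        have := abs_sub (f v) (f u); linarith [hB u, hB v]
      have h3 : 2 * B ≤ 2 * B / sqd p.1 p.2 * sqd u v := by
        rw [div_mul_eq_mul_div, le_div_iff₀ hpos]
        exact mul_le_mul_of_nonneg_left h1 (by positivity)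
      linarith
    · simp only [S, mem_ofPred_eq, not_le] at huv
      have : 0 ≤ 2 * B / sqd p.1 p.2 * sqd u v := by have := sqd_nonneg u v; positivity
      linarith

lemma continuous_sqd_right (u : Cyl n) : Continuous (fun v => sqd u v) := by
  unfold sqd
  refine Continuous.add (by fun_prop) (continuous_finsetSum _ fun i _ => ?_)
  exact continuous_tdist.comp (by fun_prop)

/-- Uniform concentration of the kernels, tested on a continuous function. -/
lemma eventually_integral_kern_mul_osc {f : Cyl n → ℝ} (hf : Continuous f) {ε : ℝ} (hε : 0 < ε) :
    ∀ᶠ N : ℕ in atTop, ∀ u, ∫ v, kern N 1 0 u v * |f v - f u| ≤ ε := by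
  obtain ⟨C, hC0, hC⟩ := exists_modulus hf (half_pos hε)
  have hlim : Tendsto (fun N : ℕ => C * ((n + 1 : ℝ) / (N + 1))) atTop (𝓝 0) := by
    have h1 := (tendsto_one_div_add_atTop_nhds_zero_nat (𝕜 := ℝ)).const_mul (C * (n + 1))
    rw [mul_zero] at h1
    refine h1.congr fun N => by ring
  filter_upwards [hlim.eventually (gt_mem_nhds (half_pos hε))] with N hN u
  have hk := continuous_kern_right N 1 0 u
  have hs : Continuous (fun v => sqd u v) := continuous_sqd_right u
  have i1 : Integrable fun v => kern N 1 0 u v * (ε / 2) := (integrable_kern N 1 0 u).mul_const _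
  have i2 : Integrable fun v => C * (kern N 1 0 u v * sqd u v) :=
    integrable_of_continuous (continuous_const.mul (hk.mul hs))
  have i3 : Integrable fun v => kern N 1 0 u v * |f v - f u| :=
    integrable_of_continuous (hk.mul (hf.sub continuous_const).abs)
  have h1 : ∫ v, kern N 1 0 u v * |f v - f u| ≤
      ∫ v, (kern N 1 0 u v * (ε / 2) + C * (kern N 1 0 u v * sqd u v)) := by
    refine integral_mono i3 (i1.add i2) fun v => ?_
    have := mul_le_mul_of_nonneg_left (hC u v) (kern_neu_nonneg N u v)
    dsimp only
    linarith
  rw [integral_add i1 i2, integral_mul_const, integral_const_mul, integral_kern, one_mul] at h1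
  have h2 := mul_le_mul_of_nonneg_left (integral_kern_mul_sqd_le N u) hC0
  linarith

lemma abs_mop_neu_sub_le (N : ℕ) {f : Cyl n → ℝ} (hf : Continuous f) (u : Cyl n) :
    |mop N 1 0 f u - f u| ≤ ∫ v, kern N 1 0 u v * |f v - f u| := by
  obtain ⟨B, -, hB⟩ := exists_bound hf
  have h1 : mop N 1 0 f u - f u = ∫ v, kern N 1 0 u v * (f v - f u) := by
    conv_lhs => rw [← mop_const N (f u) u]
    rw [← mop_sub N 1 0 hf.measurable hB measurable_const (D := |f u|) (fun _ => le_rfl)]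
    rfl
  rw [h1]
  refine abs_integral_le_integral_abs.trans (le_of_eq ?_)
  congr 1; ext v
  rw [abs_mul, abs_of_nonneg (kern_neu_nonneg N u v)]

/-- The mass lost at the boundary by the Dirichlet mollifier. -/
def loss (N : ℕ) (u : Cyl n) : ℝ := 1 - mop N (-1) 0 (fun _ => 1) u

lemma continuous_loss (N : ℕ) : Continuous (loss N : Cyl n → ℝ) :=
  continuous_const.sub (continuous_mop N _ _ measurable_const (C := 1) fun _ => by simp)

lemma loss_eq (N : ℕ) (u : Cyl n) : loss N u = ∫ v, (kern N 1 0 u v - kern N (-1) 0 u v) := by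
  rw [integral_sub (integrable_kern ..) (integrable_kern ..), integral_kern]
  simp [loss, mop]

lemma loss_nonneg (N : ℕ) (u : Cyl n) : 0 ≤ loss N u := by
  rw [loss_eq]
  exact integral_nonneg fun v => sub_nonneg.2 (kern_dir_le N u v)

lemma loss_le_one (N : ℕ) (u : Cyl n) : loss N u ≤ 1 := by
  have := mop_nonneg (n := n) N (.inr rfl) (f := fun _ => 1) (fun _ => zero_le_one) u
  unfold loss; linarith

lemma abs_mop_neu_sub_dir_le (N : ℕ) {f : Cyl n → ℝ} {C : ℝ} (hf : Measurable f)
    (hfb : ∀ u, |f u| ≤ C) (u : Cyl n) :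
    |mop N 1 0 f u - mop N (-1) 0 f u| ≤ C * loss N u := by
  unfold mop
  rw [← integral_sub (integrable_kern_mul N 1 0 hf hfb u) (integrable_kern_mul N (-1) 0 hf hfb u),
    loss_eq, ← integral_const_mul]
  refine abs_integral_le_integral_abs.trans (integral_mono ?_ ?_ fun v => ?_)
  · exact ((integrable_kern_mul N 1 0 hf hfb u).sub (integrable_kern_mul N (-1) 0 hf hfb u)).abs
  · exact ((integrable_kern ..).sub (integrable_kern ..)).const_mul _
  · simp only [← sub_mul, abs_mul, abs_of_nonneg (sub_nonneg.2 (kern_dir_le N u v))]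
    rw [mul_comm]
    exact mul_le_mul_of_nonneg_right (hfb v) (sub_nonneg.2 (kern_dir_le N u v))

/-- The loss is twice the mass of the reflected term. For an interior point, `u₁ + y - 2` stays away
from the multiples of `4` uniformly in `y`, so `1 - cos` is at least some `c > 0` there and the
moment `1 / (N + 1)` controls that mass. -/
lemma tendsto_loss {u : Cyl n} (hu : u ∉ bdry n) : Tendsto (fun N => loss N u) atTop (𝓝 0) := by
  have hu1 : |(u.1 : ℝ)| < 1 := by
    rw [abs_lt]
    simp only [bdry, mem_ofPred_eq, not_or] at hu
    exact ⟨lt_of_le_of_ne u.1.2.1 (Ne.symm hu.1), lt_of_le_of_ne u.1.2.2 hu.2⟩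
  rw [abs_lt] at hu1
  have hmono : ∀ y : Icc (-1 : ℝ) 1, 0 < 1 - Real.cos (Real.pi / 2 * ((u.1 : ℝ) + y - 2)) := by
    intro y
    have h1 : Real.cos (Real.pi / 2 * ((u.1 : ℝ) + y - 2)) =
        -Real.cos (Real.pi / 2 * ((u.1 : ℝ) + y)) := by
      rw [show Real.pi / 2 * ((u.1 : ℝ) + y - 2) = Real.pi / 2 * ((u.1 : ℝ) + y) - Real.pi by ring,
        Real.cos_sub_pi]
    rw [h1, sub_neg_eq_add]
    have h2 : Real.cos (Real.pi / 2 * ((u.1 : ℝ) + y)) =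
        2 * Real.cos (Real.pi / 4 * ((u.1 : ℝ) + y)) ^ 2 - 1 := by
      rw [← Real.cos_two_mul]; congr 1; ring
    have h3 : 0 < Real.cos (Real.pi / 4 * ((u.1 : ℝ) + y)) :=
      Real.cos_pos_of_mem_Ioo ⟨by nlinarith [hu1.1, y.2.1, Real.pi_pos],
        by nlinarith [hu1.2, y.2.2, Real.pi_pos]⟩
    rw [h2]; nlinarith
  obtain ⟨y₀, -, hmin⟩ := isCompact_univ.exists_isMinOn
    (⟨⟨0, by norm_num, by norm_num⟩, mem_univ _⟩ : (univ : Set (Icc (-1 : ℝ) 1)).Nonempty)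
    (f := fun y : Icc (-1 : ℝ) 1 => 1 - Real.cos (Real.pi / 2 * ((u.1 : ℝ) + y - 2)))
    (Continuous.continuousOn (by fun_prop))
  set c := 1 - Real.cos (Real.pi / 2 * ((u.1 : ℝ) + y₀ - 2)) with hc
  have hc0 : 0 < c := hmono y₀
  have hi : ∀ g : Icc (-1 : ℝ) 1 → ℝ, Continuous g → Integrable g := fun g hg =>
    hg.integrable_of_hasCompactSupport (HasCompactSupport.of_compactSpace g)
  have key : ∀ N : ℕ, loss N u ≤ 2 / c * (1 / (N + 1)) := by
    intro N
    have ha := continuous_ax N 0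
    let f : ℝ → ℝ := fun z => ax N 0 z * (1 - Real.cos (Real.pi / 2 * z))
    have hf : Continuous f := ha.mul (by fun_prop)
    have hp : Function.Periodic f 4 := fun z => by
      simp only [f, ax_periodic N 0 z, mul_add, ax_period, Real.cos_add_two_pi]
    have h2 : ∫ z in (0 : ℝ)..4, f z = 1 / (N + 1) := by
      simp only [f, ax, mollD_zero]
      exact integral_moll_mul (by norm_num) (by positivity) ax_period N
    have hf0 : ∀ z, 0 ≤ f z := fun z => mul_nonneg (ax_nonneg N z)
      (by linarith [Real.cos_le_one (Real.pi / 2 * z)])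
    have h1 : loss N u = ∫ y : Icc (-1 : ℝ) 1, 2 * ax N 0 ((u.1 : ℝ) + y - 2) := by
      rw [loss_eq]
      have := integral_cyl_prod (fun y : Icc (-1 : ℝ) 1 => 2 * ax N 0 ((u.1 : ℝ) + y - 2))
        (fun _ => tor N 0) u.2
      simp only [integral_tor, Finset.prod_const_one, mul_one] at this
      rw [← this]
      congr 1; ext v
      simp only [kern, Pi.zero_apply]; ring
    rw [h1, ← h2, ← integral_reflected hf hp u.1, ← integral_const_mul]
    refine integral_mono (hi _ (continuous_const.mul (ha.comp (by fun_prop))))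
      ((hi _ ((hf.comp (by fun_prop)).add (hf.comp (by fun_prop)))).const_mul _) fun y => ?_
    have h3 : c ≤ 1 - Real.cos (Real.pi / 2 * ((u.1 : ℝ) + y - 2)) := hmin (mem_univ y)
    have h4 := mul_le_mul_of_nonneg_left h3 (ax_nonneg N ((u.1 : ℝ) + y - 2))
    simp only
    rw [div_mul_eq_mul_div, le_div_iff₀ hc0]
    have h5 := hf0 ((u.1 : ℝ) - y)
    have h6 : f ((u.1 : ℝ) + y - 2) = ax N 0 ((u.1 : ℝ) + y - 2) *
      (1 - Real.cos (Real.pi / 2 * ((u.1 : ℝ) + y - 2))) := rfl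
    rw [← h6] at h4
    nlinarith
  refine squeeze_zero (fun N => loss_nonneg N u) key ?_
  have := (tendsto_one_div_add_atTop_nhds_zero_nat (𝕜 := ℝ)).const_mul (2 / c)
  rwa [mul_zero] at this

lemma volume_bdry : (volume : Measure (Cyl n)) (bdry n) = 0 := by
  have h : bdry n = ({⟨-1, by norm_num, by norm_num⟩, ⟨1, by norm_num, by norm_num⟩} :
      Set (Icc (-1 : ℝ) 1)) ×ˢ univ := by
    ext u; simp [bdry, Subtype.ext_iff]
  have h0 : ∀ x : Icc (-1 : ℝ) 1, (volume : Measure (Icc (-1 : ℝ) 1)) {x} = 0 := fun x => by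
    change Measure.comap Subtype.val volume {x} = 0
    rw [comap_subtype_coe_apply measurableSet_Icc, image_singleton, Real.volume_singleton]
  rw [h, Measure.volume_eq_prod, Measure.prod_prod]
  have : (volume : Measure (Icc (-1 : ℝ) 1)) {⟨-1, by norm_num, by norm_num⟩,
      ⟨1, by norm_num, by norm_num⟩} = 0 := by
    rw [insert_eq]
    exact measure_union_null (h0 _) (h0 _)
  rw [this, zero_mul]

lemma tendsto_integral_loss : Tendsto (fun N => ∫ u : Cyl n, loss N u) atTop (𝓝 0) := by
  have := tendsto_integral_of_dominated_convergence (μ := (volume : Measure (Cyl n)))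
    (F := fun N u => loss N u) (f := fun _ => 0) (fun _ => 1)
    (fun N => (continuous_loss N).aestronglyMeasurable) (integrable_const _)
    (fun N => ae_of_all _ fun u => by
      rw [Real.norm_eq_abs, abs_of_nonneg (loss_nonneg N u)]; exact loss_le_one N u)
    (by
      have : ∀ᵐ u : Cyl n, u ∉ bdry n := measure_eq_zero_iff_ae_notMem.1 volume_bdry
      filter_upwards [this] with u hu using tendsto_loss hu)
  simpa using this

/-- Continuous functions are dense in `L¹` and the operator contracts `L¹`, so it suffices to treat
a continuous function, for which concentration of the kernel gives uniform convergence. -/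
lemma tendsto_integral_abs_mop_neu_sub {f : Cyl n → ℝ} {C : ℝ} (hf : Measurable f)
    (hfb : ∀ u, |f u| ≤ C) :
    Tendsto (fun N => ∫ u, |mop N 1 0 f u - f u|) atTop (𝓝 0) := by
  rw [Metric.tendsto_atTop']
  intro ε hε
  obtain ⟨g, hg1, -⟩ := (integrable_of_bounded (μ := (volume : Measure (Cyl n))) hf
    hfb).exists_boundedContinuous_integral_sub_le (show 0 < ε / 4 by positivity)
  have hg : Continuous g := g.continuous
  obtain ⟨B, -, hB⟩ := exists_bound hg
  have hV : 0 ≤ (volume : Measure (Cyl n)).real univ := measureReal_nonneg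
  have hev := eventually_integral_kern_mul_osc hg
    (show 0 < ε / (4 * ((volume : Measure (Cyl n)).real univ + 1)) by positivity)
  obtain ⟨N₀, hN₀⟩ := eventually_atTop.1 hev
  refine ⟨N₀, fun N hN => ?_⟩
  have hfg : ∀ u, |f u - g u| ≤ C + B := fun u => by
    have := abs_sub (f u) (g u); linarith [hfb u, hB u]
  have hm : Measurable fun u => f u - g u := hf.sub hg.measurable
  have h1 : ∀ u, |mop N 1 0 f u - f u| ≤
      |mop N 1 0 (fun v => f v - g v) u| + |mop N 1 0 g u - g u| + |f u - g u| := by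
    intro u
    rw [mop_sub N 1 0 hf hfb hg.measurable hB]
    have : mop N 1 0 f u - f u = (mop N 1 0 f u - mop N 1 0 g u) + (mop N 1 0 g u - g u)
      - (f u - g u) := by ring
    rw [this]
    exact (abs_sub _ _).trans (add_le_add_left (abs_add_le _ _) _)
  have i1 : Integrable fun u => |mop N 1 0 (fun v => f v - g v) u| :=
    integrable_of_continuous (continuous_mop N 1 0 hm hfg).abs
  have i2 : Integrable fun u => |mop N 1 0 g u - g u| :=
    integrable_of_continuous ((continuous_mop N 1 0 hg.measurable hB).sub hg).abs
  have i3 : Integrable fun u => |f u - g u| := (integrable_of_bounded hm hfg).abs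
  have h2 : ∫ u, |mop N 1 0 f u - f u| ≤ ∫ u, (|mop N 1 0 (fun v => f v - g v) u| +
      |mop N 1 0 g u - g u| + |f u - g u|) := by
    refine integral_mono ?_ ((i1.add i2).add i3) h1
    exact ((integrable_of_continuous (continuous_mop N 1 0 hf hfb)).sub
      (integrable_of_bounded hf hfb)).abs
  have h2' := integral_add (i1.add i2) i3
  simp only [Pi.add_apply] at h2'
  rw [h2', integral_add i1 i2] at h2
  have h3 := integral_abs_mop_le N (.inl rfl) hm hfg
  simp only [Real.norm_eq_abs] at hg1
  have h4 : ∫ u, |mop N 1 0 g u - g u| ≤ ε / 4 := by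
    calc ∫ u, |mop N 1 0 g u - g u|
        ≤ ∫ _ : Cyl n, ε / (4 * ((volume : Measure (Cyl n)).real univ + 1)) :=
          integral_mono i2 (integrable_const _) fun u =>
            (abs_mop_neu_sub_le N hg u).trans (hN₀ N hN.le u)
      _ = (volume : Measure (Cyl n)).real univ *
          (ε / (4 * ((volume : Measure (Cyl n)).real univ + 1))) := by
          rw [integral_const, smul_eq_mul]
      _ ≤ ε / 4 := by
          rw [← mul_div_assoc, div_le_div_iff₀ (by positivity) (by positivity)]
          nlinarith
  have h5 : 0 ≤ ∫ u, |mop N 1 0 f u - f u| := integral_nonneg fun u => abs_nonneg _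
  rw [Real.dist_eq, sub_zero, abs_of_nonneg h5]
  linarith

/-- Approximation in `L¹` by mollification. -/
lemma tendsto_integral_abs_mop_sub {ε : ℝ} (h : ε = 1 ∨ ε = -1) {f : Cyl n → ℝ} {C : ℝ}
    (hf : Measurable f) (hfb : ∀ u, |f u| ≤ C) :
    Tendsto (fun N => ∫ u, |mop N ε 0 f u - f u|) atTop (𝓝 0) := by
  rcases h with rfl | rfl
  · exact tendsto_integral_abs_mop_neu_sub hf hfb
  · have h1 := (tendsto_integral_abs_mop_neu_sub hf hfb).add
      ((tendsto_integral_loss (n := n)).const_mul C)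
    rw [mul_zero, add_zero] at h1
    refine squeeze_zero (fun N => integral_nonneg fun u => abs_nonneg _) (fun N => ?_) h1
    have i1 : Integrable fun u => |mop N 1 0 f u - f u| :=
      ((integrable_of_continuous (continuous_mop N 1 0 hf hfb)).sub
        (integrable_of_bounded hf hfb)).abs
    have i2 : Integrable fun u => |mop N (-1) 0 f u - f u| :=
      ((integrable_of_continuous (continuous_mop N (-1) 0 hf hfb)).sub
        (integrable_of_bounded hf hfb)).abs
    have i3 : Integrable fun u : Cyl n => C * loss N u :=
      (integrable_of_continuous (continuous_loss N)).const_mul _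
    rw [← integral_const_mul, ← integral_add i1 i3]
    refine integral_mono i2 (i1.add i3) fun u => ?_
    have h2 := abs_mop_neu_sub_dir_le N hf hfb u
    have h3 : mop N (-1) 0 f u - f u =
      (mop N 1 0 f u - f u) - (mop N 1 0 f u - mop N (-1) 0 f u) := by ring
    simp only
    rw [h3]
    exact (abs_sub _ _).trans (by linarith)

end Mollify

/-! ### Functions given through the covering map -/

section Cover

variable {n : ℕ}

/-- The `k`-th unit vector of `ℝ × ℝ^{d-1}`. -/
def dir (k : Fin (n + 1)) : ℝ × (Fin n → ℝ) :=
  Fin.cases (motive := fun _ => ℝ × (Fin n → ℝ)) (1, 0) (fun i => (0, Pi.single i 1)) k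

lemma cover_add (x y : ℝ × (Fin n → ℝ)) : cover (x + y) = cover x + cover y := by
  ext <;> simp [cover]

lemma cover_smul_dir_zero (s : ℝ) : cover (s • dir (0 : Fin (n + 1))) = (s, 0) := by
  ext <;> simp [cover, dir]

lemma cover_smul_dir_succ (s : ℝ) (i : Fin n) :
    cover (s • dir i.succ) = (0, Pi.single i (s : UnitAddCircle)) := by
  refine Prod.ext (by simp [cover, dir]) (funext fun j => ?_)
  by_cases h : j = i
  · subst h; simp [cover, dir]
  · simp [cover, dir, h]

lemma isOpenQuotientMap_torus :
    IsOpenQuotientMap (fun (y : Fin n → ℝ) (i : Fin n) => (y i : UnitAddCircle)) :=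
  IsOpenQuotientMap.piMap (f := fun (_ : Fin n) (x : ℝ) => (QuotientAddGroup.mk x : UnitAddCircle))
    fun _ => QuotientAddGroup.isOpenQuotientMap_mk

lemma isOpenQuotientMap_cover : IsOpenQuotientMap (cover : ℝ × (Fin n → ℝ) → InfCyl n) :=
  IsOpenQuotientMap.id.prodMap isOpenQuotientMap_torus

lemma continuous_emb : Continuous (Cyl.emb : Cyl n → InfCyl n) :=
  (continuous_subtype_val.comp continuous_fst).prodMk continuous_snd

lemma emb_line (k : Fin (n + 1)) (u : Cyl n) {s : ℝ} (hs : s ∈ dom k) :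
    (line k u s).emb = u.emb + cover ((s - base k u) • dir k) := by
  cases k using Fin.cases with
  | zero => 
    rw [cover_smul_dir_zero]
    refine Prod.ext ?_ ?_
    · simp only [line_zero, Cyl.emb, base_zero, Prod.fst_add]
      rw [projIcc_of_mem _ hs]; ring
    · simp [Cyl.emb]
  | succ i =>
    rw [cover_smul_dir_succ]
    refine Prod.ext ?_ ?_ <;> simp [Cyl.emb]

/-- The derivatives of a function on an open subset of the infinite cylinder whose composite with
the covering map is `C¹`. -/
lemma exists_deriv_of_cover {V : Set (InfCyl n)} {g : InfCyl n → ℝ} (hV : IsOpen V)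
    (hg : ContDiffOn ℝ 1 (fun x => g (cover x)) (cover ⁻¹' V)) :
    ∃ D : Fin (n + 1) → InfCyl n → ℝ, ∀ k, ContinuousOn (D k) V ∧ ∀ z ∈ V,
      HasDerivAt (fun s : ℝ => g (z + cover (s • dir k))) (D k z) 0 := by
  have hO : IsOpen (cover ⁻¹' V : Set (ℝ × (Fin n → ℝ))) :=
    hV.preimage isOpenQuotientMap_cover.continuous
  have key : ∀ (k : Fin (n + 1)) (x : ℝ × (Fin n → ℝ)), cover x ∈ V →
      HasDerivAt (fun s : ℝ => g (cover x + cover (s • dir k)))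
        (fderiv ℝ (fun x => g (cover x)) x (dir k)) 0 := by
    intro k x hx
    have h1 : HasFDerivAt (fun x => g (cover x)) (fderiv ℝ (fun x => g (cover x)) x)
        (x + (0 : ℝ) • dir k) := by
      rw [zero_smul, add_zero]
      exact ((hg.differentiableOn one_ne_zero).differentiableAt (hO.mem_nhds hx)).hasFDerivAt
    have h2 : HasDerivAt (fun s : ℝ => x + s • dir k) (dir k) 0 := by
      simpa using ((hasDerivAt_id (0 : ℝ)).smul_const (dir k)).const_add x
    have h3 := h1.comp_hasDerivAt (0 : ℝ) h2
    refine h3.congr_of_eventuallyEq (Eventually.of_forall fun s => ?_)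
    simp [cover_add]
  refine ⟨fun k z => deriv (fun s : ℝ => g (z + cover (s • dir k))) 0, fun k => ⟨?_, ?_⟩⟩
  · intro z hz
    obtain ⟨x, rfl⟩ := isOpenQuotientMap_cover.surjective z
    refine ContinuousAt.continuousWithinAt ?_
    rw [← isOpenQuotientMap_cover.continuousAt_comp_iff]
    have h1 : ContinuousAt (fun y => fderiv ℝ (fun x => g (cover x)) y (dir k)) x :=
      ((hg.continuousOn_fderiv_of_isOpen hO le_rfl).continuousAt (hO.mem_nhds hz)).clm_apply
        continuousAt_const
    refine h1.congr ?_
    filter_upwards [hO.mem_nhds hz] with y hy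
    exact ((key k y hy).deriv).symm
  · intro z hz
    obtain ⟨x, rfl⟩ := isOpenQuotientMap_cover.surjective z
    exact (key k x hz).differentiableAt.hasDerivAt

/-- The factor `σ` is `1` when `g` is evaluated at the moving point itself, and `-1` for the kernel
`J(0, w - u)`, in which `u` enters with a minus sign. -/
lemma hasDerivWithinAt_cover {g : InfCyl n → ℝ} {z : InfCyl n} {k : Fin (n + 1)} {d : ℝ}
    (h : HasDerivAt (fun s : ℝ => g (z + cover (s • dir k))) d 0) (σ b : ℝ) (S : Set ℝ) :
    HasDerivWithinAt (fun s => g (z + cover ((σ * (s - b)) • dir k))) (σ * d) S b := by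
  have h2 : HasDerivAt (fun s : ℝ => σ * (s - b)) σ b := by
    simpa using ((hasDerivAt_id b).sub_const b).const_mul σ
  have h1 : HasDerivAt (fun s : ℝ => g (z + cover (s • dir k))) d (σ * (b - b)) := by simpa using h
  have h3 := (h1.comp b h2).hasDerivWithinAt (s := S)
  rw [mul_comm] at h3
  exact h3

lemma AdmissibleBoundary.exists_isC1 {b : bdry n → ℝ} (hb : AdmissibleBoundary b) :
    ∃ (θ : Cyl n → ℝ) (c C : ℝ), IsC1 θ ∧ 0 < c ∧ C < 1 ∧ (∀ u, c ≤ θ u ∧ θ u ≤ C) ∧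
      ∀ r : bdry n, θ r.1 = b r := by
  obtain ⟨V, θ, c, C, hV, hu, hc, hC, hθ, hd, hr⟩ := hb
  obtain ⟨D, hD⟩ := exists_deriv_of_cover hV (hd.of_le (by norm_num))
  refine ⟨fun u => θ u.emb, c, C, ?_, hc, hC, fun u => hθ _ (hu u), hr⟩
  have hcont : ContinuousOn θ V := by
    intro z hz
    obtain ⟨x, rfl⟩ := isOpenQuotientMap_cover.surjective z
    refine ContinuousAt.continuousWithinAt ?_
    rw [← isOpenQuotientMap_cover.continuousAt_comp_iff]
    exact hd.continuousOn.continuousAt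
      ((hV.preimage isOpenQuotientMap_cover.continuous).mem_nhds hz)
  refine IsC1.of_hasPD (D := fun k u => D k u.emb) (hcont.comp_continuous continuous_emb hu)
    (fun k u => ?_) (fun k => (hD k).1.comp_continuous continuous_emb hu)
  have h1 := hasDerivWithinAt_cover ((hD k).2 u.emb (hu u)) 1 (base k u) (dom k)
  rw [one_mul] at h1
  refine h1.congr (fun s hs => ?_) ?_
  · change θ (line k u s).emb = _
    rw [emb_line k u hs, one_mul]
  · change θ (line k u (base k u)).emb = _
    have e : (cover (0 : ℝ × (Fin n → ℝ)) : InfCyl n) = 0 := by ext <;> simp [cover]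
    simp [e]

/-! ### The interaction -/

namespace KacKernel

variable (J : KacKernel n)

lemma exists_grad : ∃ D : Fin (n + 1) → InfCyl n → ℝ, ∀ k, Continuous (D k) ∧
    ∀ (w : InfCyl n) (u : Cyl n), HasPD k (fun u => J.toFun u.emb w) u (D k (w - u.emb)) := by
  obtain ⟨D, hD⟩ := exists_deriv_of_cover (V := univ) (g := J.toFun 0) isOpen_univ
    J.contDiff.contDiffOn
  refine ⟨fun k z => -D k z, fun k => ⟨(continuousOn_univ.1 (hD k).1).neg, fun w u => ?_⟩⟩
  have h1 := hasDerivWithinAt_cover ((hD k).2 (w - u.emb) (mem_univ _)) (-1) (base k u) (dom k)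
  rw [neg_one_mul] at h1
  have h0 : ∀ s ∈ dom k, J.toFun (line k u s).emb w =
      J.toFun 0 (w - u.emb + cover ((-1 * (s - base k u)) • dir k)) := by
    intro s hs
    rw [J.transl, emb_line k u hs]
    congr 1
    have : cover ((-1 * (s - base k u)) • dir k) = -cover ((s - base k u) • dir k) := by
      rw [neg_one_mul, neg_smul]
      ext <;> simp [cover]
    rw [this]; abel
  exact h1.congr h0 (h0 _ (base_mem k u))

lemma continuous_zero : Continuous (J.toFun 0) := by
  rw [← isOpenQuotientMap_cover.continuous_comp_iff]
  exact J.contDiff.continuous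

lemma continuous_toFun {X : Type*} [TopologicalSpace X] {f g : X → InfCyl n} (hf : Continuous f)
    (hg : Continuous g) : Continuous (fun x => J.toFun (f x) (g x)) := by
  have : (fun x => J.toFun (f x) (g x)) = fun x => J.toFun 0 (g x - f x) := by
    ext x; exact J.transl _ _
  rw [this]
  exact J.continuous_zero.comp (hg.sub hf)

lemma continuous_neum : Continuous (fun p : Cyl n × Cyl n => J.neum p.1 p.2) := by
  have h1 : Continuous (fun p : Cyl n × Cyl n => p.1.emb) := continuous_emb.comp continuous_fst
  have h2 : Continuous (fun p : Cyl n × Cyl n => p.2.emb) := continuous_emb.comp continuous_snd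
  have h3 : Continuous (fun p : Cyl n × Cyl n => (p.2.1 : ℝ)) := by fun_prop
  have h4 : Continuous (fun p : Cyl n × Cyl n =>
      p.2.emb + ((2 * (1 - (p.2.1 : ℝ)), 0) : InfCyl n)) :=
    h2.add (((continuous_const.sub h3).const_mul 2).prodMk continuous_const)
  have h5 : Continuous (fun p : Cyl n × Cyl n =>
      p.2.emb - ((2 * (1 + (p.2.1 : ℝ)), 0) : InfCyl n)) :=
    h2.sub (((continuous_const.add h3).const_mul 2).prodMk continuous_const)
  exact ((J.continuous_toFun h1 h2).add (J.continuous_toFun h1 h4)).add (J.continuous_toFun h1 h5)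

/-- The derivative of `J^neum(u,v)` in the variable `u`. -/
def gradNeum (k : Fin (n + 1)) (u v : Cyl n) : ℝ := pderiv k (fun u => J.neum u v) u

/-- The image points depend on `v` only, so each of the three terms is differentiated in `u` with
its second argument fixed. -/
lemma exists_grad_neum (k : Fin (n + 1)) : ∃ D : Cyl n × Cyl n → ℝ, Continuous D ∧
    ∀ u v, HasPD k (fun u => J.neum u v) u (D (u, v)) := by
  obtain ⟨D, hD⟩ := J.exists_grad
  refine ⟨fun p => D k (p.2.emb - p.1.emb)
    + D k (p.2.emb + (2 * (1 - (p.2.1 : ℝ)), 0) - p.1.emb)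
    + D k (p.2.emb - (2 * (1 + (p.2.1 : ℝ)), 0) - p.1.emb), ?_, fun u v =>
    (((hD k).2 _ u).add ((hD k).2 _ u)).add ((hD k).2 _ u)⟩
  have h1 : Continuous (fun p : Cyl n × Cyl n => p.1.emb) := continuous_emb.comp continuous_fst
  have h2 : Continuous (fun p : Cyl n × Cyl n => p.2.emb) := continuous_emb.comp continuous_snd
  have h3 : Continuous (fun p : Cyl n × Cyl n => (p.2.1 : ℝ)) := by fun_prop
  have h4 : Continuous (fun p : Cyl n × Cyl n =>
      p.2.emb + ((2 * (1 - (p.2.1 : ℝ)), 0) : InfCyl n)) :=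
    h2.add (((continuous_const.sub h3).const_mul 2).prodMk continuous_const)
  have h5 : Continuous (fun p : Cyl n × Cyl n =>
      p.2.emb - ((2 * (1 + (p.2.1 : ℝ)), 0) : InfCyl n)) :=
    h2.sub (((continuous_const.add h3).const_mul 2).prodMk continuous_const)
  exact (((hD k).1.comp (h2.sub h1)).add ((hD k).1.comp (h4.sub h1))).add
    ((hD k).1.comp (h5.sub h1))

lemma hasPD_neum (k : Fin (n + 1)) (u v : Cyl n) :
    HasPD k (fun u => J.neum u v) u (J.gradNeum k u v) := by
  obtain ⟨D, -, hD⟩ := J.exists_grad_neum k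
  rw [gradNeum, (hD u v).pderiv_eq]
  exact hD u v

lemma continuous_gradNeum (k : Fin (n + 1)) :
    Continuous (fun p : Cyl n × Cyl n => J.gradNeum k p.1 p.2) := by
  obtain ⟨D, hc, hD⟩ := J.exists_grad_neum k
  have : (fun p : Cyl n × Cyl n => J.gradNeum k p.1 p.2) = D := by
    ext p; exact (hD p.1 p.2).pderiv_eq
  rwa [this]

lemma exists_gradNeum_bound : ∃ K, 0 ≤ K ∧ ∀ k u v, |J.gradNeum k u v| ≤ K := by
  choose K h0 hK using fun k => exists_bound (J.continuous_gradNeum k)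
  exact ⟨∑ k, K k, Finset.sum_nonneg fun k _ => h0 k, fun k u v => (hK k (u, v)).trans
    (Finset.single_le_sum (f := K) (fun k _ => h0 k) (Finset.mem_univ k))⟩

lemma hasPD_star {m : Cyl n → ℝ} {C : ℝ} (hm : Measurable m) (hb : ∀ u, |m u| ≤ C)
    (k : Fin (n + 1)) (u : Cyl n) :
    HasPD k (J.star m) u (∫ v, J.gradNeum k u v * m v) := by
  obtain ⟨K, h0, hK⟩ := J.exists_gradNeum_bound
  have hC : 0 ≤ C := (abs_nonneg _).trans (hb u)
  refine HasPD.integral (F := fun v u => J.neum u v * m v)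
    (D := fun v u => J.gradNeum k u v * m v) (C := K * C) (fun v u => ?_) (fun v u => ?_)
    (fun u => ?_) u
  · have := (J.hasPD_neum k u v).const_mul (m v)
    simpa only [mul_comm (m v)] using this
  · rw [abs_mul]; exact mul_le_mul (hK k u v) (hb v) (abs_nonneg _) h0
  · have hc : Continuous (fun v => J.neum u v) :=
      J.continuous_neum.comp (Continuous.prodMk_right u)
    obtain ⟨B, hB0, hB⟩ := exists_bound hc
    refine integrable_of_bounded (hc.measurable.mul hm) (C := B * C) fun v => ?_
    simp only [abs_mul]
    exact mul_le_mul (hB v) (hb v) (abs_nonneg _) hB0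

lemma pderiv_star {m : Cyl n → ℝ} {C : ℝ} (hm : Measurable m) (hb : ∀ u, |m u| ≤ C)
    (k : Fin (n + 1)) (u : Cyl n) :
    pderiv k (J.star m) u = ∫ v, J.gradNeum k u v * m v := (J.hasPD_star hm hb k u).pderiv_eq

lemma star_congr {m m' : Cyl n → ℝ} (h : m =ᵐ[volume] m') : J.star m = J.star m' := by
  ext u
  refine integral_congr_ae ?_
  filter_upwards [h] with v hv
  rw [hv]

end KacKernel

/-! ### Smooth test functions -/

/-- Smoothness is prescribed on the covering space, one-sidedly at the ends of the intervals. The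
partial derivative is the derivative within the strip `S` in the direction `dir k`, and its
continuity descends through the open quotient map `q`. -/
lemma IsSmoothCompact.exists_deriv {T : ℝ} [hT : Fact (0 < T)] {H : TimeI T → Cyl n → ℝ}
    (h : IsSmoothCompact H) (k : Fin (n + 1)) :
    Continuous (fun p : TimeI T × Cyl n => pderiv k (H p.1) p.2) ∧
      ∀ t u, HasPD k (H t) u (pderiv k (H t) u) := by
  set Φ : ℝ × ℝ × (Fin n → ℝ) → ℝ := fun p => H (projIcc 0 T hT.out.le p.1)
    (projIcc (-1) 1 (by norm_num) p.2.1, fun i => (p.2.2 i : UnitAddCircle)) with hΦ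
  set S : Set (ℝ × ℝ × (Fin n → ℝ)) := Icc 0 T ×ˢ Icc (-1) 1 ×ˢ univ with hS
  have hU : UniqueDiffOn ℝ S := (uniqueDiffOn_Icc hT.out).prod
    ((uniqueDiffOn_Icc (by norm_num)).prod uniqueDiffOn_univ)
  have hC : ContDiffOn ℝ ∞ Φ S := h.1
  set q : TimeI T × Icc (-1 : ℝ) 1 × (Fin n → ℝ) → TimeI T × Cyl n :=
    Prod.map id (Prod.map id fun y i => (y i : UnitAddCircle)) with hq
  have hqo : IsOpenQuotientMap q :=
    IsOpenQuotientMap.id.prodMap (IsOpenQuotientMap.id.prodMap isOpenQuotientMap_torus)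
  set ι : TimeI T × Icc (-1 : ℝ) 1 × (Fin n → ℝ) → ℝ × ℝ × (Fin n → ℝ) :=
    fun p => (p.1, p.2.1, p.2.2) with hι
  have hιc : Continuous ι := by fun_prop
  have hιS : ∀ p, ι p ∈ S := fun p => ⟨p.1.2, p.2.1.2, mem_univ _⟩
  have key : ∀ p, HasPD k (H (q p).1) (q p).2 (fderivWithin ℝ Φ S (ι p) (0, dir k)) := by
    intro p
    have h1 : HasFDerivWithinAt Φ (fderivWithin ℝ Φ S (ι p)) S
        (ι p + (base k (q p).2 - base k (q p).2) • (0, dir k)) := by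
      rw [sub_self, zero_smul, add_zero]
      exact (hC.differentiableOn (by simp) _ (hιS p)).hasFDerivWithinAt
    have h2 : HasDerivWithinAt (fun s : ℝ => ι p + (s - base k (q p).2) • ((0 : ℝ), dir k))
        (0, dir k) (dom k) (base k (q p).2) := by
      simpa using ((((hasDerivAt_id (base k (q p).2)).sub_const _).smul_const
        ((0 : ℝ), dir k)).const_add (ι p)).hasDerivWithinAt
    have h0 : ∀ s ∈ dom k, ι p + (s - base k (q p).2) • ((0 : ℝ), dir k) ∈ S ∧
        H (q p).1 (line k (q p).2 s) = Φ (ι p + (s - base k (q p).2) • ((0 : ℝ), dir k)) := by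
      intro s hs
      cases k using Fin.cases with
      | zero =>
        have e : ι p + (s - base 0 (q p).2) • ((0 : ℝ), dir 0) = ((p.1 : ℝ), s, p.2.2) := by
          ext <;> simp [hι, hq, dir]
        rw [e]
        refine ⟨⟨p.1.2, hs, mem_univ _⟩, ?_⟩
        simp [hΦ, hq, projIcc_val]
      | succ i =>
        have e : ι p + (s - base i.succ (q p).2) • ((0 : ℝ), dir i.succ) =
            ((p.1 : ℝ), (p.2.1 : ℝ), p.2.2 + s • (Pi.single i 1 : Fin n → ℝ)) := by
          ext <;> simp [hι, dir]
        rw [e]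
        refine ⟨⟨p.1.2, p.2.1.2, mem_univ _⟩, ?_⟩
        simp only [hΦ, hq, projIcc_val, line_succ, Prod.map_fst, Prod.map_snd, id]
        congr 2
        funext j
        by_cases hj : j = i
        · subst hj; simp
        · simp [hj]
    have h3 := h1.comp_hasDerivWithinAt (base k (q p).2) h2 fun s hs => (h0 s hs).1
    exact h3.congr (fun s hs => (h0 s hs).2) ((h0 _ (base_mem k _)).2)
  constructor
  · rw [← hqo.continuous_comp_iff]
    have e : (fun p : TimeI T × Cyl n => pderiv k (H p.1) p.2) ∘ q =
        fun p => fderivWithin ℝ Φ S (ι p) (0, dir k) := by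
      ext p; exact (key p).pderiv_eq
    rw [e]
    exact ((hC.continuousOn_fderivWithin hU (by simp)).comp_continuous hιc hιS).clm_apply
      continuous_const
  · intro t u
    obtain ⟨p, hp⟩ := hqo.surjective (t, u)
    have := key p
    rw [hp] at this
    exact this.pderiv_eq.symm ▸ this

lemma IsSmoothCompact.continuous {T : ℝ} [hT : Fact (0 < T)] {H : TimeI T → Cyl n → ℝ}
    (h : IsSmoothCompact H) : Continuous (fun p : TimeI T × Cyl n => H p.1 p.2) := by
  have hqo : IsOpenQuotientMap (Prod.map id (Prod.map id fun y i => (y i : UnitAddCircle)) :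
      TimeI T × Icc (-1 : ℝ) 1 × (Fin n → ℝ) → TimeI T × Cyl n) :=
    IsOpenQuotientMap.id.prodMap (IsOpenQuotientMap.id.prodMap isOpenQuotientMap_torus)
  rw [← hqo.continuous_comp_iff]
  have h1 := h.1.continuousOn.comp_continuous
    (f := fun p : TimeI T × Icc (-1 : ℝ) 1 × (Fin n → ℝ) =>
      ((p.1, p.2.1, p.2.2) : ℝ × ℝ × (Fin n → ℝ))) (by fun_prop)
    fun p => ⟨p.1.2, p.2.1.2, mem_univ _⟩
  refine h1.congr fun p => ?_
  simp only [Function.comp_apply, projIcc_val]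
  rfl

lemma IsSmoothCompact.eq_zero {T : ℝ} [hT : Fact (0 < T)] {H : TimeI T → Cyl n → ℝ}
    (h : IsSmoothCompact H) (t : TimeI T) {u : Cyl n} (hu : u ∈ bdry n) : H t u = 0 := by
  by_contra h0
  exact h.2 (subset_tsupport (Function.uncurry H) (a := (t, u)) h0) hu

end Cover

/-! ### Bounded measurable functions -/

section Bounded

variable {Y : Type*} [MeasurableSpace Y]

/-- Bounded measurable real functions. -/
def BM (f : Y → ℝ) : Prop := Measurable f ∧ ∃ C, ∀ y, |f y| ≤ C

lemma BM.of_bound {f : Y → ℝ} (hf : Measurable f) (C : ℝ) (h : ∀ y, |f y| ≤ C) : BM f := ⟨hf, C, h⟩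

lemma BM.const (c : ℝ) : BM (fun _ : Y => c) := ⟨measurable_const, |c|, fun _ => le_rfl⟩

lemma BM.add {f g : Y → ℝ} (hf : BM f) (hg : BM g) : BM (fun y => f y + g y) := by
  obtain ⟨hf, C, hC⟩ := hf
  obtain ⟨hg, D, hD⟩ := hg
  exact ⟨hf.add hg, C + D, fun y => (abs_add_le _ _).trans (add_le_add (hC y) (hD y))⟩

lemma BM.neg {f : Y → ℝ} (hf : BM f) : BM (fun y => -f y) := by
  obtain ⟨hf, C, hC⟩ := hf
  exact ⟨hf.neg, C, fun y => by rw [abs_neg]; exact hC y⟩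

lemma BM.sub {f g : Y → ℝ} (hf : BM f) (hg : BM g) : BM (fun y => f y - g y) := by
  simpa only [sub_eq_add_neg] using hf.add hg.neg

lemma BM.mul {f g : Y → ℝ} (hf : BM f) (hg : BM g) : BM (fun y => f y * g y) := by
  obtain ⟨hf, C, hC⟩ := hf
  obtain ⟨hg, D, hD⟩ := hg
  refine ⟨hf.mul hg, C * D, fun y => ?_⟩
  rw [abs_mul]
  exact mul_le_mul (hC y) (hD y) (abs_nonneg _) ((abs_nonneg _).trans (hC y))

lemma BM.const_mul {f : Y → ℝ} (c : ℝ) (hf : BM f) : BM (fun y => c * f y) := (BM.const c).mul hf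

lemma BM.pow {f : Y → ℝ} (hf : BM f) (k : ℕ) : BM (fun y => f y ^ k) := by
  obtain ⟨hf, C, hC⟩ := hf
  exact ⟨hf.pow_const k, C ^ k, fun y => by
    rw [abs_pow]; exact pow_le_pow_left₀ (abs_nonneg _) (hC y) k⟩

lemma BM.abs {f : Y → ℝ} (hf : BM f) : BM (fun y => |f y|) := by
  obtain ⟨hf, C, hC⟩ := hf
  exact ⟨hf.abs, C, fun y => by rw [abs_abs]; exact hC y⟩

lemma BM.sum {ι : Type*} {s : Finset ι} {f : ι → Y → ℝ} (hf : ∀ i ∈ s, BM (f i)) :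
    BM (fun y => ∑ i ∈ s, f i y) := by
  classical
  induction s using Finset.induction_on with
  | empty => simpa using BM.const (Y := Y) 0
  | insert i s hi ih =>
    simp only [Finset.sum_insert hi]
    exact (hf i (Finset.mem_insert_self ..)).add (ih fun j hj => hf j (Finset.mem_insert_of_mem hj))

lemma BM.comp {Z : Type*} [MeasurableSpace Z] {f : Y → ℝ} (hf : BM f) {g : Z → Y}
    (hg : Measurable g) : BM (fun z => f (g z)) :=
  ⟨hf.1.comp hg, hf.2.imp fun _ h z => h (g z)⟩

lemma BM.integrable {f : Y → ℝ} (hf : BM f) (μ : Measure Y) [IsFiniteMeasure μ] :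
    Integrable f μ :=
  Integrable.of_bound hf.1.aestronglyMeasurable hf.2.choose (ae_of_all _ hf.2.choose_spec)

lemma BM.mobility {f : Y → ℝ} (hf : BM f) : BM (fun y => mobility (f y)) :=
  (hf.mul ((BM.const 1).sub hf)).const_mul 2

lemma BM.of_unit {f : Y → ℝ} (hf : Measurable f) (h0 : ∀ y, 0 ≤ f y) (h1 : ∀ y, f y ≤ 1) : BM f :=
  ⟨hf, 1, fun y => by rw [abs_of_nonneg (h0 y)]; exact h1 y⟩

lemma BM.of_continuous [TopologicalSpace Y] [CompactSpace Y] [OpensMeasurableSpace Y] {f : Y → ℝ}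
    (hf : Continuous f) : BM f :=
  ⟨hf.measurable, (exists_bound hf).imp fun _ h => h.2⟩

end Bounded

lemma mobility_nonneg {m : ℝ} (h0 : 0 ≤ m) (h1 : m ≤ 1) : 0 ≤ mobility m := by
  have := mul_nonneg h0 (sub_nonneg.2 h1)
  unfold mobility; linarith

lemma mobility_le (m : ℝ) : mobility m ≤ 1 / 2 := by
  unfold mobility; nlinarith [sq_nonneg (2 * m - 1)]

/-! ### The functional at a fixed time. -/

section Spatial

variable {n : ℕ}

lemma BM.mop {f : Cyl n → ℝ} (hf : BM f) (N : ℕ) (ε : ℝ) (α : Fin (n + 1) → ℕ) :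
    BM (mop N ε α f) :=
  BM.of_continuous (continuous_mop N ε α hf.1 hf.2.choose_spec)

lemma IsC1.bm {f : Cyl n → ℝ} (hf : IsC1 f) : BM f := BM.of_continuous hf.cont

lemma IsC1.bm_pderiv {f : Cyl n → ℝ} (hf : IsC1 f) (k : Fin (n + 1)) : BM (pderiv k f) :=
  BM.of_continuous (hf.contD k)

lemma IsC1.const_mul {f : Cyl n → ℝ} (hf : IsC1 f) (c : ℝ) : IsC1 (fun u => c * f u) :=
  IsC1.of_hasPD (D := fun k u => c * pderiv k f u) (continuous_const.mul hf.cont)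
    (fun k u => (hf.hasPD k u).const_mul c) fun k => continuous_const.mul (hf.contD k)

lemma BM.isC1_mop {f : Cyl n → ℝ} (hf : BM f) (N : ℕ) (ε : ℝ) (α : Fin (n + 1) → ℕ) :
    IsC1 (KawasakiKac.mop N ε α f) := KawasakiKac.isC1_mop N ε α hf.1 hf.2.choose_spec

lemma BM.pderiv_mop {f : Cyl n → ℝ} (hf : BM f) (N : ℕ) (ε : ℝ) (α : Fin (n + 1) → ℕ)
    (k : Fin (n + 1)) :
    pderiv k (KawasakiKac.mop N ε α f) = KawasakiKac.mop N ε (α + Pi.single k 1) f :=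
  KawasakiKac.pderiv_mop N ε α hf.1 hf.2.choose_spec k

/-- The part of the functionals which is local in time, evaluated at the vector field `V` and the
density `ρ`. -/
def spat (β : ℝ) (J : KacKernel n) (b : bdry n → ℝ) (ρ : Cyl n → ℝ)
    (V : Fin (n + 1) → Cyl n → ℝ) : ℝ :=
  -(∫ u, ρ u * ∑ k, pderiv k (V k) u) + surfaceIntegral (fun r => b r * normal1 r * V 0 r.1)
    - β * (∫ u, mobility (ρ u) * ∑ k, V k u * pderiv k (J.star ρ) u)
    - 1 / 2 * ∫ u, mobility (ρ u) * ∑ k, V k u * V k u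

/-- The gradient of the mollification of `A`. -/
def gradMop (N : ℕ) (A : Cyl n → ℝ) (k : Fin (n + 1)) : Cyl n → ℝ := mop N (-1) (Pi.single k 1) A

lemma gradMop_eq (N : ℕ) {A : Cyl n → ℝ} (hA : IsC1 A) (hA0 : ∀ u ∈ bdry n, A u = 0)
    (k : Fin (n + 1)) : gradMop N A k = mop N (flipSign k (-1)) 0 (pderiv k A) := by
  ext u
  have := mop_by_parts N (-1) 0 hA hA0 k u
  rwa [zero_add] at this

lemma sum_bdryTerm (F : Fin (n + 1) → Cyl n → ℝ) :
    ∑ k, bdryTerm k (F k) = surfaceIntegral (fun r => normal1 r * F 0 r.1) := by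
  rw [Fin.sum_univ_succ]
  simp [bdryTerm, Fin.succ_ne_zero]

/-- Write `ρ = (ρ - θ) + θ`. The smoothing operators move from the test field onto `ρ - θ` by
symmetry, without any boundary term; `θ` is integrated by parts, and its boundary term cancels the
surface integral because `θ = b` on `Γ`. Thus the weak boundary condition is encoded with no
regularity of `ρ`. -/
lemma linear_part {b : bdry n → ℝ} {θ : Cyl n → ℝ} (hθ : IsC1 θ) (hb : ∀ r : bdry n, θ r.1 = b r)
    {ρ : Cyl n → ℝ} (hρ : BM ρ) (N : ℕ) {A : Cyl n → ℝ} (hA : IsC1 A)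
    (hA0 : ∀ u ∈ bdry n, A u = 0) :
    -(∫ u, ρ u * ∑ k, pderiv k (gradMop N A k) u)
      + surfaceIntegral (fun r => b r * normal1 r * gradMop N A 0 r.1) =
    ∑ k, ∫ u, (mop N (-1) (Pi.single k 1) (fun v => ρ v - θ v) u
      + mop N (flipSign k (-1)) 0 (pderiv k θ) u) * pderiv k A u := by
  have hw : BM (fun v => ρ v - θ v) := hρ.sub hθ.bm
  have hV : ∀ k, IsC1 (gradMop N A k) := fun k => hA.bm.isC1_mop N (-1) _
  have h1 : ∀ k, pderiv k (gradMop N A k) =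
      mop N (flipSign k (-1)) (Pi.single k 1) (pderiv k A) := by
    intro k
    ext u
    rw [gradMop, hA.bm.pderiv_mop]
    exact mop_by_parts N (-1) _ hA hA0 k u
  have h2 : ∀ k, ∫ u, ρ u * pderiv k (gradMop N A k) u = bdryTerm k (fun u => θ u * gradMop N A k u)
      - ∫ u, (mop N (-1) (Pi.single k 1) (fun v => ρ v - θ v) u
      + mop N (flipSign k (-1)) 0 (pderiv k θ) u) * pderiv k A u := by
    intro k
    have e1 : ∫ u, ρ u * pderiv k (gradMop N A k) u =
        (∫ u, (ρ u - θ u) * pderiv k (gradMop N A k) u)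
          + ∫ u, θ u * pderiv k (gradMop N A k) u := by
      rw [← integral_add ((hw.mul ((hV k).bm_pderiv k)).integrable _)
        ((hθ.bm.mul ((hV k).bm_pderiv k)).integrable _)]
      congr 1; ext u; ring
    have e2 : ∫ u, (ρ u - θ u) * pderiv k (gradMop N A k) u =
        -∫ u, mop N (-1) (Pi.single k 1) (fun v => ρ v - θ v) u * pderiv k A u := by
      rw [h1]
      exact mop_symm_single N (-1) k hw.1 hw.2.choose_spec (hA.bm_pderiv k).1
        (hA.bm_pderiv k).2.choose_spec
    have e3 := integral_mul_pderiv k hθ.cont (hV k).cont (hθ.contD k) ((hV k).contD k)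
      (hθ.hasPD k) ((hV k).hasPD k)
    have e4 : ∫ u, pderiv k θ u * gradMop N A k u =
        ∫ u, mop N (flipSign k (-1)) 0 (pderiv k θ) u * pderiv k A u := by
      rw [gradMop_eq N hA hA0 k]
      exact mop_symm N _ (hθ.bm_pderiv k).1 (hθ.bm_pderiv k).2.choose_spec (hA.bm_pderiv k).1
        (hA.bm_pderiv k).2.choose_spec
    have e5 := integral_add (((hw.mop N (-1) (Pi.single k 1)).mul (hA.bm_pderiv k)).integrable
      volume) ((((hθ.bm_pderiv k).mop N (flipSign k (-1)) 0).mul (hA.bm_pderiv k)).integrable volume)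
    simp only [← add_mul] at e5
    rw [e1, e2, e3, e4, e5]; ring
  have h3 : ∫ u, ρ u * ∑ k, pderiv k (gradMop N A k) u =
      ∑ k, ∫ u, ρ u * pderiv k (gradMop N A k) u := by
    simp only [Finset.mul_sum]
    exact integral_finsetSum _ fun k _ => (hρ.mul ((hV k).bm_pderiv k)).integrable _
  rw [h3]
  simp only [h2, Finset.sum_sub_distrib]
  rw [sum_bdryTerm (fun k u => θ u * gradMop N A k u)]
  have h4 : (fun r : bdry n => b r * normal1 r * gradMop N A 0 r.1) =
      fun r => normal1 r * (θ r.1 * gradMop N A 0 r.1) := by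
    ext r; rw [hb]; ring
  rw [h4]; ring

/-! ### The regularized entropy -/

/-- The derivative of the regularized entropy. -/
def logit (δ r : ℝ) : ℝ := Real.log (r + δ) - Real.log (1 - r + δ)

/-- The second derivative of the regularized entropy. -/
def dlogit (δ r : ℝ) : ℝ := (r + δ)⁻¹ + (1 - r + δ)⁻¹

lemma hasDerivAt_logit {δ r : ℝ} (h0 : 0 < r + δ) (h1 : 0 < 1 - r + δ) :
    HasDerivAt (logit δ) (dlogit δ r) r := by
  have e1 : HasDerivAt (fun r => r + δ) 1 r := (hasDerivAt_id r).add_const δ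
  have e2 : HasDerivAt (fun r => 1 - r + δ) (-1) r := by
    simpa using ((hasDerivAt_id r).const_sub 1).add_const δ
  have := (e1.log h0.ne').sub (e2.log h1.ne')
  refine this.congr_deriv ?_
  simp [dlogit, neg_div]

/-- The two arguments are positive with sum `1 + 2δ ≤ 3`, so their inverses add up to at least
`4/3`. -/
lemma one_le_dlogit {δ r : ℝ} (h0 : 0 < r + δ) (h1 : 0 < 1 - r + δ) (hδ : δ ≤ 1) :
    1 ≤ dlogit δ r := by
  by_contra! h
  have e1 : (r + δ) * (r + δ)⁻¹ = 1 := mul_inv_cancel₀ h0.ne'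
  have e2 : (1 - r + δ) * (1 - r + δ)⁻¹ = 1 := mul_inv_cancel₀ h1.ne'
  have p1 : 0 < (r + δ)⁻¹ := inv_pos.2 h0
  have p2 : 0 < (1 - r + δ)⁻¹ := inv_pos.2 h1
  unfold dlogit at h
  set x := (r + δ)⁻¹
  set y := (1 - r + δ)⁻¹
  have h3 : x * y * (1 + 2 * δ) = x + y := by linear_combination y * e1 + x * e2
  nlinarith [sq_nonneg (x - y), mul_pos p1 p2]

end Spatial

/-! ### Pointwise bounds for the entropy test function. -/

section Spatial

variable {n : ℕ}

/-- The mollified density, with boundary values `θ`. -/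
def rhoN (N : ℕ) (θ ρ : Cyl n → ℝ) (u : Cyl n) : ℝ :=
  mop N (-1) 0 (fun v => ρ v - θ v) u + θ u

/-- The test function of the entropy estimate. -/
def tst (δ : ℝ) (N : ℕ) (θ ρ : Cyl n → ℝ) (u : Cyl n) : ℝ :=
  logit δ (rhoN N θ ρ u) - logit δ (θ u)

/-- The weighted Dirichlet form of the mollified density. -/
def wform (δ : ℝ) (N : ℕ) (θ ρ : Cyl n → ℝ) : ℝ :=
  ∫ u, dlogit δ (rhoN N θ ρ u) * ∑ k, (pderiv k (rhoN N θ ρ) u) ^ 2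

lemma isC1_rhoN (N : ℕ) {θ ρ : Cyl n → ℝ} (hθ : IsC1 θ) (hρ : BM ρ) : IsC1 (rhoN N θ ρ) :=
  ((hρ.sub hθ.bm).isC1_mop N (-1) 0).add hθ

lemma pderiv_rhoN (N : ℕ) {θ ρ : Cyl n → ℝ} (hθ : IsC1 θ) (hρ : BM ρ) (k : Fin (n + 1))
    (u : Cyl n) : pderiv k (rhoN N θ ρ) u =
      mop N (-1) (Pi.single k 1) (fun v => ρ v - θ v) u + pderiv k θ u := by
  have h1 := ((hρ.sub hθ.bm).isC1_mop N (-1) 0).hasPD k u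
  rw [(hρ.sub hθ.bm).pderiv_mop, zero_add] at h1
  exact (h1.add (hθ.hasPD k u)).pderiv_eq

lemma rhoN_bdry (N : ℕ) (θ ρ : Cyl n → ℝ) {u : Cyl n} (hu : u ∈ bdry n) :
    rhoN N θ ρ u = θ u := by
  rw [rhoN, mop_bdry N _ hu, zero_add]

/-- The mass lost at the boundary by the Dirichlet operator is refilled with `θ ≥ c`, up to the
oscillation `e` of `θ` at the scale of the kernel; and since `f ≤ 1`, the Dirichlet and Neumann
averages of `f` differ by at most that lost mass. The comparison with the Neumann average is what
later lets `σ` cancel the poles of the entropy. -/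
lemma le_rhoN (N : ℕ) {θ f : Cyl n → ℝ} {c e : ℝ} (hθ : IsC1 θ) (hc0 : 0 ≤ c) (hc1 : c ≤ 1)
    (hc : ∀ u, c ≤ θ u) (hf : Measurable f) (hf0 : ∀ u, 0 ≤ f u) (hf1 : ∀ u, f u ≤ 1)
    (he : ∀ u, ∫ v, kern N 1 0 u v * |θ v - θ u| ≤ e) (u : Cyl n) :
    c * mop N 1 0 f u - e ≤ rhoN N θ f u := by
  have hfb := BM.of_unit hf hf0 hf1
  have hfa : ∀ u, |f u| ≤ 1 := fun u => by rw [abs_of_nonneg (hf0 u)]; exact hf1 u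
  have h1 := abs_le.1 (abs_mop_neu_sub_dir_le N hf hfa u)
  have h2 := mop_nonneg N (ε := -1) (Or.inr rfl) hf0 u
  have h3 : mop N (-1) 0 (fun v => f v - θ v) u = mop N (-1) 0 f u - mop N (-1) 0 θ u :=
    mop_sub N (-1) 0 hf hfa hθ.bm.1 hθ.bm.2.choose_spec u
  have h4 : mop N (-1) 0 (fun v => θ v - θ u) u =
      mop N (-1) 0 θ u - mop N (-1) 0 (fun _ => θ u) u :=
    mop_sub N (-1) 0 hθ.bm.1 hθ.bm.2.choose_spec (BM.const (θ u)).1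
      (BM.const (Y := Cyl n) (θ u)).2.choose_spec u
  have h5 : mop N (-1) 0 (fun _ : Cyl n => θ u) u = θ u * (1 - loss N u) := by
    have := mop_const_mul N (-1) 0 (θ u) (fun _ : Cyl n => (1 : ℝ)) u
    simp only [mul_one] at this
    rw [this, loss]; ring
  have hd : BM (fun v => θ v - θ u) := hθ.bm.sub (BM.const _)
  have h6 := (abs_le.1 ((abs_mop_le_mop_abs N (ε := -1) (Or.inr rfl) hd.1
    hd.2.choose_spec u).trans (he u))).2
  have h7 := mul_le_mul_of_nonneg_right (hc u) (loss_nonneg N u)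
  rw [rhoN, h3]
  have h8 := mul_le_mul_of_nonneg_left h1.2 hc0
  have h9 := mul_le_mul_of_nonneg_right hc1 h2
  nlinarith

/-- Particle–hole symmetry: upper bounds on the mollified density are lower bounds for `1 - ρ` and
`1 - θ`. -/
lemma one_sub_rhoN (N : ℕ) {θ ρ : Cyl n → ℝ} (u : Cyl n) :
    1 - rhoN N θ ρ u = rhoN N (fun u => 1 - θ u) (fun u => 1 - ρ u) u := by
  have : (fun v => 1 - ρ v - (1 - θ v)) = fun v => (-1) * (ρ v - θ v) := by ext v; ring
  rw [rhoN, rhoN, this, mop_const_mul]; ring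

/-- Here `p` and `s` stand for the second derivative of the entropy at `ρ^N` and at `θ`, `q` and `t`
for the derivatives of `ρ^N` and `θ`, and `e` for the commutator of mollification and
differentiation. Young's inequality keeps half of `p q²`. -/
lemma linear_pointwise {p q s t e P L : ℝ} (hp : 1 ≤ p) (hP : p ≤ P) (hs : 0 ≤ s) (hL : s ≤ L) :
    p * q ^ 2 / 2 - L ^ 2 * t ^ 2 - P * e ^ 2 - L * |e * t| ≤ (q + e) * (p * q - s * t) := by
  have h1 : s ^ 2 * t ^ 2 ≤ L ^ 2 * t ^ 2 :=
    mul_le_mul_of_nonneg_right (pow_le_pow_left₀ hs hL 2) (sq_nonneg _)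
  have h2 : p * e ^ 2 ≤ P * e ^ 2 := mul_le_mul_of_nonneg_right hP (sq_nonneg _)
  have h3 : s * (e * t) ≤ L * |e * t| :=
    (mul_le_mul_of_nonneg_left (le_abs_self _) hs).trans
      (mul_le_mul_of_nonneg_right hL (abs_nonneg _))
  have h4 : 0 ≤ (p - 1) * q ^ 2 := mul_nonneg (by linarith) (sq_nonneg _)
  have h5 : 0 ≤ p * (q / 2 + e) ^ 2 := mul_nonneg (by linarith) (sq_nonneg _)
  nlinarith [sq_nonneg (q / 2 - s * t)]

/-- Same letters as in `linear_pointwise`, with `m` the mobility. One factor `p` is spent on `m p ≤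
K`, so that the square is compared with `p q²` and not with `p² q²`. -/
lemma quadratic_pointwise {m p q s t K L : ℝ} (hm : 0 ≤ m) (hm' : m ≤ 1 / 2) (hp : 0 ≤ p)
    (hK : m * p ≤ K) (hs : 0 ≤ s) (hL : s ≤ L) :
    m * (p * q - s * t) ^ 2 ≤ 2 * K * (p * q ^ 2) + L ^ 2 * t ^ 2 := by
  have h1 : s ^ 2 * t ^ 2 ≤ L ^ 2 * t ^ 2 :=
    mul_le_mul_of_nonneg_right (pow_le_pow_left₀ hs hL 2) (sq_nonneg _)
  have h2 : m * p * (p * q ^ 2) ≤ K * (p * q ^ 2) :=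
    mul_le_mul_of_nonneg_right hK (mul_nonneg hp (sq_nonneg _))
  have h3 : 0 ≤ m * (p * q + s * t) ^ 2 := mul_nonneg hm (sq_nonneg _)
  have h4 : m * (s ^ 2 * t ^ 2) ≤ 1 / 2 * (s ^ 2 * t ^ 2) :=
    mul_le_mul_of_nonneg_right hm' (by positivity)
  nlinarith

/-- The mobility vanishes where the entropy is singular: the factor `m` cancels the pole at `0`
because `r + δ ≥ c m`, and `1 - m` cancels the pole at `1`. The bound does not depend on `δ`. -/
lemma mobility_mul_dlogit_le {m r c c' δ : ℝ} (hm0 : 0 ≤ m) (hm1 : m ≤ 1) (hc : 0 < c)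
    (hc' : 0 < c') (hδ : 0 < δ) (h1 : c * m - δ / 2 ≤ r) (h2 : c' * (1 - m) - δ / 2 ≤ 1 - r) :
    mobility m * dlogit δ r ≤ 2 / c + 2 / c' := by
  have k1 : m * (r + δ)⁻¹ ≤ 1 / c := by
    rw [← div_eq_mul_inv, div_le_div_iff₀ (by nlinarith) hc]; nlinarith
  have k2 : (1 - m) * (1 - r + δ)⁻¹ ≤ 1 / c' := by
    rw [← div_eq_mul_inv, div_le_div_iff₀ (by nlinarith) hc']; nlinarith
  have k3 : 0 ≤ m * (r + δ)⁻¹ := mul_nonneg hm0 (inv_nonneg.2 (by nlinarith))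
  have k4 : 0 ≤ (1 - m) * (1 - r + δ)⁻¹ := mul_nonneg (by linarith) (inv_nonneg.2 (by nlinarith))
  have e : mobility m * dlogit δ r =
      2 * ((1 - m) * (m * (r + δ)⁻¹) + m * ((1 - m) * (1 - r + δ)⁻¹)) := by
    unfold mobility dlogit; ring
  have k5 : (1 - m) * (m * (r + δ)⁻¹) ≤ 1 * (1 / c) :=
    mul_le_mul (by linarith) k1 k3 zero_le_one
  have k6 : m * ((1 - m) * (1 - r + δ)⁻¹) ≤ 1 * (1 / c') :=
    mul_le_mul hm1 k2 k4 zero_le_one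
  rw [e]
  have : 2 / c + 2 / c' = 2 * (1 * (1 / c) + 1 * (1 / c')) := by ring
  rw [this]; linarith

lemma dlogit_le {δ r : ℝ} (hδ : 0 < δ) (h0 : -(δ / 2) ≤ r) (h1 : r ≤ 1 + δ / 2) :
    dlogit δ r ≤ 4 / δ := by
  have k1 : (r + δ)⁻¹ ≤ (δ / 2)⁻¹ := inv_anti₀ (by linarith) (by linarith)
  have k2 : (1 - r + δ)⁻¹ ≤ (δ / 2)⁻¹ := inv_anti₀ (by linarith) (by linarith)
  have e : 4 / δ = (δ / 2)⁻¹ + (δ / 2)⁻¹ := by field_simp; norm_num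
  rw [e]; exact add_le_add k1 k2

lemma continuous_logit_comp {X : Type*} [TopologicalSpace X] {δ : ℝ} {R : X → ℝ}
    (hR : Continuous R) (h0 : ∀ x, 0 < R x + δ) (h1 : ∀ x, 0 < 1 - R x + δ) :
    Continuous (fun x => logit δ (R x)) :=
  ((hR.add continuous_const).log fun x => (h0 x).ne').sub
    (((continuous_const.sub hR).add continuous_const).log fun x => (h1 x).ne')

lemma continuous_dlogit_comp {X : Type*} [TopologicalSpace X] {δ : ℝ} {R : X → ℝ}
    (hR : Continuous R) (h0 : ∀ x, 0 < R x + δ) (h1 : ∀ x, 0 < 1 - R x + δ) :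
    Continuous (fun x => dlogit δ (R x)) :=
  ((hR.add continuous_const).inv₀ fun x => (h0 x).ne').add
    (((continuous_const.sub hR).add continuous_const).inv₀ fun x => (h1 x).ne')

/-- Chain rule for the regularized entropy. -/
lemma isC1_logit_comp {δ : ℝ} {R : Cyl n → ℝ} (hR : IsC1 R) (h0 : ∀ x, 0 < R x + δ)
    (h1 : ∀ x, 0 < 1 - R x + δ) : IsC1 (fun u => logit δ (R u)) ∧
      ∀ k u, pderiv k (fun u => logit δ (R u)) u = dlogit δ (R u) * pderiv k R u := by
  have h : ∀ k u, HasPD k (fun u => logit δ (R u)) u (dlogit δ (R u) * pderiv k R u) :=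
    fun k u => HasPD.comp (hasDerivAt_logit (h0 u) (h1 u)) (hR.hasPD k u)
  exact ⟨IsC1.of_hasPD (continuous_logit_comp hR.cont h0 h1) h
    fun k => (continuous_dlogit_comp hR.cont h0 h1).mul (hR.contD k), fun k u => (h k u).pderiv_eq⟩

/-- Jensen twice. Convexity of the square brings the average outside the square of the gradient,
symmetry transfers it to `σ(ρ)`, and concavity of `σ` moves it inside. The intermediate kernel is
bounded by the Neumann one in every direction, whatever the flipped sign. -/
lemma quadratic_part {ρ : Cyl n → ℝ} (hρ : Measurable ρ) (h0 : ∀ u, 0 ≤ ρ u) (h1 : ∀ u, ρ u ≤ 1)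
    (N : ℕ) {A : Cyl n → ℝ} (hA : IsC1 A) (hA0 : ∀ u ∈ bdry n, A u = 0) (k : Fin (n + 1)) :
    ∫ u, mobility (ρ u) * gradMop N A k u ^ 2 ≤
      ∫ u, mobility (mop N 1 0 ρ u) * pderiv k A u ^ 2 := by
  have hb := BM.of_unit hρ h0 h1
  have hD := hA.bm_pderiv k
  have hD2 := hD.pow 2
  have e1 : ∫ u, mobility (ρ u) * gradMop N A k u ^ 2 ≤
      ∫ u, mobility (ρ u) * mop N 1 0 (fun v => pderiv k A v ^ 2) u := by
    refine integral_mono ((hb.mobility.mul ((hA.bm.mop N _ _).pow 2)).integrable _)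
      ((hb.mobility.mul (hD2.mop N _ _)).integrable _) fun u => ?_
    refine mul_le_mul_of_nonneg_left ?_ (mobility_nonneg (h0 u) (h1 u))
    rw [gradMop_eq N hA hA0]
    exact sq_mop_le N (flipSign_sign k (Or.inr rfl)) hD.1 hD.2.choose_spec u
  have e2 : ∫ u, mobility (ρ u) * mop N 1 0 (fun v => pderiv k A v ^ 2) u =
      ∫ u, mop N 1 0 (fun v => mobility (ρ v)) u * pderiv k A u ^ 2 :=
    mop_symm N 1 hb.mobility.1 hb.mobility.2.choose_spec hD2.1 hD2.2.choose_spec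
  rw [e2] at e1
  refine e1.trans (integral_mono (((hb.mobility.mop N 1 0).mul hD2).integrable _)
    (((hb.mop N 1 0).mobility.mul hD2).integrable _) fun u => ?_)
  refine mul_le_mul_of_nonneg_right ?_ (sq_nonneg _)
  have e3 : mop N 1 0 (fun v => mobility (ρ v)) u =
      2 * (mop N 1 0 ρ u - mop N 1 0 (fun v => ρ v ^ 2) u) := by
    have : (fun v => mobility (ρ v)) = fun v => 2 * (ρ v - ρ v ^ 2) := by
      ext v; unfold mobility; ring
    rw [this, mop_const_mul, mop_sub N 1 0 hb.1 hb.2.choose_spec (hb.pow 2).1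
      (hb.pow 2).2.choose_spec]
  have e4 := sq_mop_le N (ε := 1) (Or.inl rfl) hb.1 hb.2.choose_spec u
  rw [e3]; unfold mobility
  nlinarith

lemma pderiv_star_bound (J : KacKernel n) : ∃ D, 0 ≤ D ∧ ∀ ρ : Cyl n → ℝ, Measurable ρ →
    (∀ u, 0 ≤ ρ u) → (∀ u, ρ u ≤ 1) → ∀ k, BM (pderiv k (J.star ρ)) ∧
      ∀ u, |pderiv k (J.star ρ) u| ≤ D := by
  obtain ⟨K, hK0, hK⟩ := J.exists_gradNeum_bound
  refine ⟨K * volume.real (univ : Set (Cyl n)), by positivity, fun ρ hρ h0 h1 k => ?_⟩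
  have ha : ∀ u, |ρ u| ≤ 1 := fun u => by rw [abs_of_nonneg (h0 u)]; exact h1 u
  have hb : ∀ u, |pderiv k (J.star ρ) u| ≤ K * volume.real (univ : Set (Cyl n)) := by
    intro u
    rw [J.pderiv_star hρ ha, ← Real.norm_eq_abs]
    refine norm_integral_le_of_norm_le_const (ae_of_all _ fun v => ?_)
    rw [Real.norm_eq_abs, abs_mul]
    have := mul_le_mul (hK k u v) (ha v) (abs_nonneg _) hK0
    linarith
  refine ⟨⟨?_, _, hb⟩, hb⟩
  have hc : Continuous (pderiv k (J.star ρ)) := by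
    have : pderiv k (J.star ρ) = fun u => ∫ v, J.gradNeum k u v * ρ v := by
      ext u; exact J.pderiv_star hρ ha k u
    rw [this]
    refine continuous_of_dominated (bound := fun _ => K) (fun u => ?_) (fun u => ae_of_all _ fun v => ?_)
      (integrable_const _) (ae_of_all _ fun v => ?_)
    · exact (((J.continuous_gradNeum k).comp (Continuous.prodMk_right u)).measurable.mul
        hρ).aestronglyMeasurable
    · rw [Real.norm_eq_abs, abs_mul]
      have := mul_le_mul (hK k u v) (ha v) (abs_nonneg _) hK0
      linarith
    · exact ((J.continuous_gradNeum k).comp (Continuous.prodMk_left v)).mul continuous_const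
  exact hc.measurable

end Spatial

/-! ### Coercivity of the spatial functional. -/

section SpatialBound

variable {n : ℕ}

lemma wform_eq_sum {δ : ℝ} {N : ℕ} {θ ρ : Cyl n → ℝ} (hp : BM fun u => dlogit δ (rhoN N θ ρ u))
    (hR : IsC1 (rhoN N θ ρ)) :
    wform δ N θ ρ = ∑ k, ∫ u, dlogit δ (rhoN N θ ρ u) * pderiv k (rhoN N θ ρ) u ^ 2 := by
  unfold wform
  simp only [Finset.mul_sum]
  exact integral_finsetSum _ fun k _ => (hp.mul ((hR.bm_pderiv k).pow 2)).integrable _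

lemma exists_pderiv_bound {θ : Cyl n → ℝ} (hθ : IsC1 θ) :
    ∃ B, 0 ≤ B ∧ ∀ k u, |pderiv k θ u| ≤ B := by
  choose B h0 hB using fun k => exists_bound (hθ.contD k)
  exact ⟨∑ k, B k, Finset.sum_nonneg fun k _ => h0 k, fun k u => (hB k u).trans
    (Finset.single_le_sum (f := B) (fun k _ => h0 k) (Finset.mem_univ k))⟩

/-- Young's inequality with weight `σ(ρ) ≤ 1/2`: the drift doubles the quadratic cost of `V` and
otherwise contributes a constant. -/
lemma interaction_part {β D : ℝ} {J : KacKernel n} {ρ : Cyl n → ℝ}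
    (hρ : Measurable ρ) (h0 : ∀ u, 0 ≤ ρ u) (h1 : ∀ u, ρ u ≤ 1)
    (hD : ∀ k, BM (pderiv k (J.star ρ)) ∧ ∀ u, |pderiv k (J.star ρ) u| ≤ D)
    {V : Fin (n + 1) → Cyl n → ℝ} (hV : ∀ k, BM (V k)) :
    β * (∫ u, mobility (ρ u) * ∑ k, V k u * pderiv k (J.star ρ) u) ≤
      1 / 2 * (∫ u, mobility (ρ u) * ∑ k, V k u * V k u)
        + (n + 1) * (β ^ 2 * D ^ 2 / 4) * volume.real (univ : Set (Cyl n)) := by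
  have hm := (BM.of_unit hρ h0 h1).mobility
  have i1 := (hm.mul (BM.sum (s := Finset.univ) fun k _ => (hV k).mul (hD k).1)).const_mul β
  have i2 := (hm.mul (BM.sum (s := Finset.univ) fun k _ => (hV k).mul (hV k))).const_mul (1 / 2)
  have i3 : ∫ _ : Cyl n, (n + 1) * (β ^ 2 * D ^ 2 / 4) =
      (n + 1) * (β ^ 2 * D ^ 2 / 4) * volume.real (univ : Set (Cyl n)) := by
    rw [integral_const, smul_eq_mul, mul_comm]
  rw [← i3, ← integral_const_mul, ← integral_const_mul, ← integral_add (i2.integrable _)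
    ((BM.const _).integrable _)]
  refine integral_mono (i1.integrable _) ((i2.add (BM.const _)).integrable _) fun u => ?_
  have key : ∀ k, mobility (ρ u) * (β * (V k u * pderiv k (J.star ρ) u)) ≤
      mobility (ρ u) * (V k u * V k u) / 2 + β ^ 2 * D ^ 2 / 4 := by
    intro k
    have hm0 := mobility_nonneg (h0 u) (h1 u)
    have hm1 := mobility_le (ρ u)
    have e1 : (pderiv k (J.star ρ) u) ^ 2 ≤ D ^ 2 := sq_le_sq' (abs_le.1 ((hD k).2 u)).1
      (abs_le.1 ((hD k).2 u)).2
    have e2 : mobility (ρ u) * (β ^ 2 * (pderiv k (J.star ρ) u) ^ 2) ≤ 1 / 2 * (β ^ 2 * D ^ 2) :=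
      mul_le_mul hm1 (mul_le_mul_of_nonneg_left e1 (sq_nonneg _)) (by positivity) (by norm_num)
    nlinarith [mul_nonneg hm0 (sq_nonneg (V k u - β * pderiv k (J.star ρ) u))]
  have := Finset.sum_le_sum fun k (_ : k ∈ Finset.univ) => key k
  rw [Finset.sum_add_distrib, ← Finset.mul_sum, ← Finset.sum_div, ← Finset.mul_sum,
    ← Finset.mul_sum, Finset.sum_const, Finset.card_univ, Fintype.card_fin, nsmul_eq_mul] at this
  push_cast at this
  calc _ = mobility (ρ u) * (β * ∑ k, V k u * pderiv k (J.star ρ) u) := by ring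
    _ ≤ _ := this
    _ = _ := by ring

lemma eventually_integral_abs_le {θ : Cyl n → ℝ} (hθ : IsC1 θ) {δ : ℝ} (hδ : 0 < δ) :
    ∀ᶠ N : ℕ in atTop, ∀ k : Fin (n + 1),
      ∫ u, |mop N (flipSign k (-1)) 0 (pderiv k θ) u - pderiv k θ u| ≤ δ :=
  eventually_all.2 fun k => (tendsto_integral_abs_mop_sub (flipSign_sign k (Or.inr rfl))
    (hθ.bm_pderiv k).1 (hθ.bm_pderiv k).2.choose_spec).eventually_le_const hδ

/-- The basic coercivity estimate, for the test function `κ g'(ρ^N)`. -/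
lemma spat_lower (β : ℝ) (J : KacKernel n) {b : bdry n → ℝ} {θ : Cyl n → ℝ} {c C : ℝ}
    (hθ : IsC1 θ) (hc : 0 < c) (hC : C < 1) (hcC : ∀ u, c ≤ θ u ∧ θ u ≤ C)
    (hb : ∀ r : bdry n, θ r.1 = b r) :
    ∃ κ c₀ C₁ : ℝ, 0 < κ ∧ 0 < c₀ ∧ ∀ δ : ℝ, 0 < δ → δ ≤ 1 → ∀ᶠ N : ℕ in atTop,
      ∀ ρ : Cyl n → ℝ, Measurable ρ → (∀ u, 0 ≤ ρ u) → (∀ u, ρ u ≤ 1) →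
        (∀ u, -(δ / 2) ≤ rhoN N θ ρ u ∧ rhoN N θ ρ u ≤ 1 + δ / 2) ∧
        c₀ * wform δ N θ ρ ≤ spat β J b ρ (gradMop N fun u => κ * tst δ N θ ρ u) + C₁ := by
  obtain ⟨B, hB0, hB⟩ := exists_pderiv_bound hθ
  obtain ⟨D, hD0, hD⟩ := pderiv_star_bound J
  have hc' : 0 < 1 - C := by linarith
  set L : ℝ := 1 / c + 1 / (1 - C) with hL
  set K : ℝ := 2 / c + 2 / (1 - C) with hK
  set m0 : ℝ := volume.real (univ : Set (Cyl n)) with hm0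
  have hL0 : 0 < L := by positivity
  have hK0 : 0 < K := by positivity
  -- The linear part yields `κ/2` times the weighted form. The quadratic cost, counted with the
  -- share taken by the interaction, is at most `2Kκ² = κ/4` times it. The difference is the
  -- constant `κ/4` of the conclusion.
  set κ : ℝ := 1 / (8 * K) with hκ
  have hκ0 : 0 < κ := by positivity
  have hκK : κ * K = 1 / 8 := by rw [hκ]; field_simp
  -- The errors must not depend on `δ`. The summand `8B` is `(8B/δ) · δ`: the bound `4/δ` on the
  -- second derivative of the entropy is paid for by a commutator of `L¹` norm at most `δ`.
  set E1 : ℝ := L ^ 2 * B ^ 2 * m0 + 8 * B + L * B with hE1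
  set E2 : ℝ := L ^ 2 * B ^ 2 * m0 with hE2
  set E3 : ℝ := (n + 1) * (β ^ 2 * D ^ 2 / 4) * m0 with hE3
  refine ⟨κ, κ / 4, κ * ((n + 1) * E1) + κ ^ 2 * ((n + 1) * E2) + E3, hκ0, by positivity,
    fun δ hδ hδ1 => ?_⟩
  -- The threshold for `N` involves `θ` and `δ` only, so the estimate is uniform over all densities.
  filter_upwards [eventually_integral_kern_mul_osc hθ.cont (half_pos hδ),
    eventually_integral_abs_le hθ hδ] with N hN hNe ρ hρ h0 h1
  have hρb : BM ρ := BM.of_unit hρ h0 h1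
  have hθ' : IsC1 (fun u => 1 - θ u) :=
    IsC1.of_hasPD (D := fun k u => 0 - pderiv k θ u) (continuous_const.sub hθ.cont)
      (fun k u => (HasPD.const k 1 u).sub (hθ.hasPD k u)) fun k => continuous_const.sub (hθ.contD k)
  have hlow : ∀ u, c * mop N 1 0 ρ u - δ / 2 ≤ rhoN N θ ρ u := fun u =>
    le_rhoN N hθ hc.le (by linarith [hcC u]) (fun u => (hcC u).1) hρ h0 h1 hN u
  have hup : ∀ u, (1 - C) * (1 - mop N 1 0 ρ u) - δ / 2 ≤ 1 - rhoN N θ ρ u := by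
    intro u
    have e : mop N 1 0 (fun v => 1 - ρ v) u = 1 - mop N 1 0 ρ u := by
      rw [mop_sub N 1 0 (BM.const 1).1 (BM.const (Y := Cyl n) 1).2.choose_spec hρb.1
        hρb.2.choose_spec, mop_const]
    rw [one_sub_rhoN, ← e]
    refine le_rhoN N (f := fun u => 1 - ρ u) hθ' hc'.le (by linarith [hcC u]) (fun u => by linarith [hcC u])
      (measurable_const.sub hρ) (fun u => by linarith [h1 u]) (fun u => by linarith [h0 u])
      (fun u => ?_) u
    refine le_of_eq_of_le ?_ (hN u)
    congr 1; ext v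
    rw [show 1 - θ v - (1 - θ u) = -(θ v - θ u) by ring, abs_neg]
  have hM0 : ∀ u, 0 ≤ mop N 1 0 ρ u := mop_nonneg N (Or.inl rfl) h0
  have hM1 : ∀ u, mop N 1 0 ρ u ≤ 1 := fun u =>
    (le_abs_self _).trans (abs_mop_le N (Or.inl rfl) hρ
      (fun u => by rw [abs_of_nonneg (h0 u)]; exact h1 u) u)
  have hR : ∀ u, -(δ / 2) ≤ rhoN N θ ρ u ∧ rhoN N θ ρ u ≤ 1 + δ / 2 := fun u =>
    ⟨by linarith [hlow u, mul_nonneg hc.le (hM0 u)],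
      by linarith [hup u, mul_nonneg hc'.le (sub_nonneg.2 (hM1 u))]⟩
  refine ⟨hR, ?_⟩
  have hR1 := isC1_rhoN N hθ hρb
  have hRp : ∀ u, 0 < rhoN N θ ρ u + δ := fun u => by linarith [(hR u).1]
  have hRm : ∀ u, 0 < 1 - rhoN N θ ρ u + δ := fun u => by linarith [(hR u).2]
  have hθp : ∀ u, 0 < θ u + δ := fun u => by linarith [(hcC u).1]
  have hθm : ∀ u, 0 < 1 - θ u + δ := fun u => by linarith [(hcC u).2]
  obtain ⟨hg1, hg1'⟩ := isC1_logit_comp hR1 hRp hRm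
  obtain ⟨hg2, hg2'⟩ := isC1_logit_comp hθ hθp hθm
  have hG : IsC1 (tst δ N θ ρ) := hg1.sub hg2
  set A : Cyl n → ℝ := fun u => κ * tst δ N θ ρ u with hA
  have hA1 : IsC1 A := hG.const_mul κ
  have hA0 : ∀ u ∈ bdry n, A u = 0 := fun u hu => by
    simp only [hA, tst, rhoN_bdry N θ ρ hu, sub_self, mul_zero]
  have hAd : ∀ k u, pderiv k A u = κ * (dlogit δ (rhoN N θ ρ u) * pderiv k (rhoN N θ ρ) u
      - dlogit δ (θ u) * pderiv k θ u) := fun k u => by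
    have := ((hg1.hasPD k u).sub (hg2.hasPD k u)).const_mul κ
    rw [hg1', hg2'] at this
    exact this.pderiv_eq
  have hp1 : ∀ u, 1 ≤ dlogit δ (rhoN N θ ρ u) := fun u => one_le_dlogit (hRp u) (hRm u) hδ1
  have hpP : ∀ u, dlogit δ (rhoN N θ ρ u) ≤ 4 / δ := fun u => dlogit_le hδ (hR u).1 (hR u).2
  have hs0 : ∀ u, 0 ≤ dlogit δ (θ u) := fun u =>
    add_nonneg (inv_nonneg.2 (hθp u).le) (inv_nonneg.2 (hθm u).le)
  have hsL : ∀ u, dlogit δ (θ u) ≤ L := fun u => by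
    rw [hL, one_div, one_div]
    exact add_le_add (inv_anti₀ hc (by linarith [(hcC u).1]))
      (inv_anti₀ hc' (by linarith [(hcC u).2]))
  have hpb : BM (fun u => dlogit δ (rhoN N θ ρ u)) :=
    BM.of_continuous (continuous_dlogit_comp hR1.cont hRp hRm)
  set p := fun u => dlogit δ (rhoN N θ ρ u) with hp
  set q := fun k u => pderiv k (rhoN N θ ρ) u with hq
  set e := fun k u => mop N (flipSign k (-1)) 0 (pderiv k θ) u - pderiv k θ u with he
  have hqb : ∀ k, BM (q k) := hR1.bm_pderiv
  have htb : ∀ k, BM (pderiv k θ) := hθ.bm_pderiv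
  have heb : ∀ k, BM (e k) := fun k => ((htb k).mop N _ 0).sub (htb k)
  have hpq : ∀ k, BM (fun u => p u * q k u ^ 2) := fun k => hpb.mul ((hqb k).pow 2)
  have heB : ∀ k u, |e k u| ≤ 2 * B := fun k u => by
    have := abs_mop_le N (flipSign_sign k (Or.inr rfl)) (htb k).1 (hB k) u
    have h2 := hB k u
    rw [abs_le] at *
    constructor <;> simp only [he] <;> linarith [this.1, this.2, h2.1, h2.2]
  have hlin : ∀ k, κ * (1 / 2 * (∫ u, p u * q k u ^ 2) - E1) ≤
      ∫ u, (mop N (-1) (Pi.single k 1) (fun v => ρ v - θ v) u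
        + mop N (flipSign k (-1)) 0 (pderiv k θ) u) * pderiv k A u := by
    intro k
    have i1 : BM (fun u => κ * (1 / 2 * (p u * q k u ^ 2) - L ^ 2 * B ^ 2
        - (8 * B / δ + L * B) * |e k u|)) :=
      ((((hpq k).const_mul (1 / 2)).sub (BM.const _)).sub ((heb k).abs.const_mul _)).const_mul κ
    have i2 : ∫ u, κ * (1 / 2 * (p u * q k u ^ 2) - L ^ 2 * B ^ 2
        - (8 * B / δ + L * B) * |e k u|) = κ * (1 / 2 * (∫ u, p u * q k u ^ 2)
          - L ^ 2 * B ^ 2 * m0 - (8 * B / δ + L * B) * ∫ u, |e k u|) := by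
      have j1 := ((hpq k).const_mul (1 / 2)).integrable volume
      have j2 := (BM.const (Y := Cyl n) (L ^ 2 * B ^ 2)).integrable volume
      have j3 := ((heb k).abs.const_mul (8 * B / δ + L * B)).integrable volume
      have j4 := integral_sub (j1.sub j2) j3
      simp only [Pi.sub_apply] at j4
      rw [integral_const_mul, j4, integral_sub j1 j2, integral_const_mul (1 / 2),
        integral_const_mul (8 * B / δ + L * B), integral_const, smul_eq_mul, ← hm0]
      ring
    have i3 : κ * (1 / 2 * (∫ u, p u * q k u ^ 2) - E1) ≤ κ * (1 / 2 * (∫ u, p u * q k u ^ 2)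
          - L ^ 2 * B ^ 2 * m0 - (8 * B / δ + L * B) * ∫ u, |e k u|) := by
      refine mul_le_mul_of_nonneg_left ?_ hκ0.le
      have j1 : (8 * B / δ + L * B) * ∫ u, |e k u| ≤ (8 * B / δ + L * B) * δ :=
        mul_le_mul_of_nonneg_left (hNe k) (by positivity)
      have j2 : (8 * B / δ + L * B) * δ = 8 * B + L * B * δ := by field_simp
      have j3 : L * B * δ ≤ L * B * 1 := mul_le_mul_of_nonneg_left hδ1 (by positivity)
      rw [hE1]; linarith
    refine i3.trans (i2 ▸ integral_mono (i1.integrable _)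
      (((((hρb.sub hθ.bm).mop N _ _).add ((htb k).mop N _ _)).mul (hA1.bm_pderiv k)).integrable _)
      fun u => ?_)
    have j1 : mop N (-1) (Pi.single k 1) (fun v => ρ v - θ v) u
        + mop N (flipSign k (-1)) 0 (pderiv k θ) u = q k u + e k u := by
      simp only [hq, he]; rw [pderiv_rhoN N hθ hρb]; ring
    have j2 := linear_pointwise (q := q k u) (t := pderiv k θ u) (e := e k u) (hp1 u) (hpP u)
      (hs0 u) (hsL u)
    have j3 : pderiv k θ u ^ 2 ≤ B ^ 2 := sq_le_sq' (abs_le.1 (hB k u)).1 (abs_le.1 (hB k u)).2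
    -- One factor of the commutator is bounded pointwise by `2B`; the other is kept for its small
    -- `L¹` norm.
    have j4 : 4 / δ * e k u ^ 2 ≤ 8 * B / δ * |e k u| := by
      rw [← sq_abs, pow_two, ← mul_assoc]
      refine mul_le_mul_of_nonneg_right ?_ (abs_nonneg _)
      calc 4 / δ * |e k u| ≤ 4 / δ * (2 * B) := mul_le_mul_of_nonneg_left (heB k u) (by positivity)
        _ = _ := by ring
    have j5 : L * |e k u * pderiv k θ u| ≤ L * B * |e k u| := by
      rw [abs_mul, mul_assoc, mul_comm B]
      exact mul_le_mul_of_nonneg_left (mul_le_mul_of_nonneg_left (hB k u) (abs_nonneg _)) hL0.le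
    have j6 := mul_le_mul_of_nonneg_left j3 (sq_nonneg L)
    simp only [j1, hAd]
    have j7 : 1 / 2 * (p u * q k u ^ 2) - L ^ 2 * B ^ 2 - (8 * B / δ + L * B) * |e k u| ≤
        (q k u + e k u) * (p u * q k u - dlogit δ (θ u) * pderiv k θ u) := by
      rw [add_mul]; simp only [hp] at *; linarith
    calc _ ≤ κ * ((q k u + e k u) * (p u * q k u - dlogit δ (θ u) * pderiv k θ u)) :=
          mul_le_mul_of_nonneg_left j7 hκ0.le
      _ = _ := by simp only [hp, hq]; ring
  have hquad : ∀ k, ∫ u, mobility (ρ u) * gradMop N A k u ^ 2 ≤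
      κ ^ 2 * (2 * K * (∫ u, p u * q k u ^ 2) + E2) := by
    intro k
    refine (quadratic_part hρ h0 h1 N hA1 hA0 k).trans ?_
    have i1 : BM (fun u => κ ^ 2 * (2 * K * (p u * q k u ^ 2) + L ^ 2 * B ^ 2)) :=
      (((hpq k).const_mul _).add (BM.const _)).const_mul _
    have i2 : ∫ u, κ ^ 2 * (2 * K * (p u * q k u ^ 2) + L ^ 2 * B ^ 2) =
        κ ^ 2 * (2 * K * (∫ u, p u * q k u ^ 2) + E2) := by
      rw [integral_const_mul, integral_add (((hpq k).const_mul _).integrable _)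
        ((BM.const _).integrable _), integral_const_mul, integral_const, smul_eq_mul, hE2]
      ring
    rw [← i2]
    refine integral_mono (((hρb.mop N 1 0).mobility.mul ((hA1.bm_pderiv k).pow 2)).integrable _)
      (i1.integrable _) fun u => ?_
    have j1 := quadratic_pointwise (q := q k u) (t := pderiv k θ u)
      (mobility_nonneg (hM0 u) (hM1 u)) (mobility_le _) (zero_le_one.trans (hp1 u))
      (mobility_mul_dlogit_le (hM0 u) (hM1 u) hc hc' hδ (hlow u) (hup u)) (hs0 u) (hsL u)
    have j3 : pderiv k θ u ^ 2 ≤ B ^ 2 := sq_le_sq' (abs_le.1 (hB k u)).1 (abs_le.1 (hB k u)).2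
    have j6 := mul_le_mul_of_nonneg_left j3 (sq_nonneg L)
    simp only [hAd]
    calc _ = κ ^ 2 * (mobility (mop N 1 0 ρ u) *
          (dlogit δ (rhoN N θ ρ u) * q k u - dlogit δ (θ u) * pderiv k θ u) ^ 2) := by
          simp only [hq]; ring
      _ ≤ _ := mul_le_mul_of_nonneg_left (by simp only [hp]; linarith) (sq_nonneg _)
  have hVb : ∀ k, BM (gradMop N A k) := fun k => hA1.bm.mop N _ _
  have hmb := hρb.mobility
  have hE : ∫ u, mobility (ρ u) * ∑ k, gradMop N A k u * gradMop N A k u =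
      ∑ k, ∫ u, mobility (ρ u) * gradMop N A k u ^ 2 := by
    simp only [Finset.mul_sum, ← pow_two]
    exact integral_finsetSum _ fun k _ => (hmb.mul ((hVb k).pow 2)).integrable _
  have hint := interaction_part (β := β) hρ h0 h1 (hD ρ hρ h0 h1) hVb
  have hX : wform δ N θ ρ = ∑ k, ∫ u, p u * q k u ^ 2 := wform_eq_sum hpb hR1
  have s1 := Finset.sum_le_sum fun k (_ : k ∈ Finset.univ) => hlin k
  have s2 := Finset.sum_le_sum fun k (_ : k ∈ Finset.univ) => hquad k
  rw [← linear_part hθ hb hρb N hA1 hA0, ← Finset.mul_sum, Finset.sum_sub_distrib,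
    ← Finset.mul_sum, ← hX, Finset.sum_const, Finset.card_univ, Fintype.card_fin, nsmul_eq_mul]
    at s1
  rw [← hE, ← Finset.mul_sum, Finset.sum_add_distrib, ← Finset.mul_sum, ← hX, Finset.sum_const,
    Finset.card_univ, Fintype.card_fin, nsmul_eq_mul] at s2
  push_cast at s1 s2
  have hfin : κ ^ 2 * (2 * K * wform δ N θ ρ) = κ / 4 * wform δ N θ ρ := by
    rw [pow_two, show κ * κ * (2 * K * wform δ N θ ρ) = 2 * (κ * K) * κ * wform δ N θ ρ by ring,
      hκK]; ring
  unfold spat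
  rw [← hE3] at hint
  nlinarith
end SpatialBound

section Time

set_option linter.unusedSectionVars false

variable {n : ℕ} {T : ℝ} [hT : Fact (0 < T)]

/-! ### Time derivatives -/

/-- `d` is the time derivative of `F` at `(t,u)`. -/
def HasTD (F : TimeI T → Cyl n → ℝ) (t : TimeI T) (u : Cyl n) (d : ℝ) : Prop :=
  HasDerivWithinAt (fun s : ℝ => F (projIcc 0 T hT.out.le s) u) d (Icc 0 T) (t : ℝ)

lemma HasTD.tderiv_eq {F : TimeI T → Cyl n → ℝ} {t : TimeI T} {u : Cyl n} {d : ℝ}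
    (h : HasTD F t u d) : tderiv F t u = d :=
  HasDerivWithinAt.derivWithin h (uniqueDiffOn_Icc hT.out _ t.2)

lemma IsCTime.hasTD {F : TimeI T → Cyl n → ℝ} (h : IsCTime 1 F) (t : TimeI T) (u : Cyl n) :
    HasTD F t u (tderiv F t u) := (h.2.1 t u).hasDerivWithinAt

lemma IsCTime.continuous {F : TimeI T → Cyl n → ℝ} (h : IsCTime 1 F) :
    Continuous (Function.uncurry F) := h.1

lemma IsCTime.continuous_tderiv {F : TimeI T → Cyl n → ℝ} (h : IsCTime 1 F) :
    Continuous (Function.uncurry (tderiv F)) := h.2.2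

lemma isCTime_of_hasTD {F D : TimeI T → Cyl n → ℝ} (hF : Continuous (Function.uncurry F))
    (hD : Continuous (Function.uncurry D)) (h : ∀ t u, HasTD F t u (D t u)) :
    IsCTime 1 F ∧ tderiv F = D := by
  have e : tderiv F = D := by ext t u; exact (h t u).tderiv_eq
  refine ⟨⟨hF, fun t u => (h t u).differentiableWithinAt, ?_⟩, e⟩
  rw [e]; exact hD

lemma hasTD_mop (N : ℕ) (ε : ℝ) (α : Fin (n + 1) → ℕ) {A : TimeI T → Cyl n → ℝ}
    (hA : IsCTime 1 A) (t : TimeI T) (u : Cyl n) :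
    HasTD (fun t => mop N ε α (A t)) t u (mop N ε α (tderiv A t) u) := by
  obtain ⟨K, hK0, hK⟩ := kern_bound (n := n) N ε α
  obtain ⟨B, hB0, hB⟩ := exists_bound hA.continuous_tderiv
  have key := hasDerivWithinAt_integral_of_bound (μ := (volume : Measure (Cyl n)))
    (convex_Icc 0 T) (f := fun v s => kern N ε α u v * A (projIcc 0 T hT.out.le s) v)
    (f' := fun v s => kern N ε α u v * tderiv A (projIcc 0 T hT.out.le s) v) (C := K * B)
    (fun v s hs => ?_) (fun v s hs => ?_) (fun s hs => ?_) t.2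
  · simp only [projIcc_val] at key
    exact key
  · have := (hA.hasTD ⟨s, hs⟩ v).const_mul (kern N ε α u v)
    simpa only [projIcc_of_mem _ hs] using this
  · rw [abs_mul]; exact mul_le_mul (hK u v) (hB (_, v)) (abs_nonneg _) hK0
  · exact integrable_of_continuous ((continuous_kern_right N ε α u).mul
      (hA.continuous.comp (Continuous.prodMk_right _)))

lemma continuous_mop_time (N : ℕ) (ε : ℝ) (α : Fin (n + 1) → ℕ) {A : TimeI T → Cyl n → ℝ}
    (hA : Continuous (Function.uncurry A)) :
    Continuous (Function.uncurry fun t => mop N ε α (A t)) := by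
  obtain ⟨B, hB0, hB⟩ := exists_bound hA
  exact continuous_mop_param N ε α (fun t => (hA.comp (Continuous.prodMk_right t)).measurable)
    (fun t u => hB (t, u)) fun u => hA.comp (Continuous.prodMk_left u)

lemma isCTime_mop (N : ℕ) (ε : ℝ) (α : Fin (n + 1) → ℕ) {A : TimeI T → Cyl n → ℝ}
    (hA : IsCTime 1 A) : IsCTime 1 (fun t => mop N ε α (A t)) ∧
      tderiv (fun t => mop N ε α (A t)) = fun t => mop N ε α (tderiv A t) :=
  isCTime_of_hasTD (continuous_mop_time N ε α hA.continuous)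
    (continuous_mop_time N ε α hA.continuous_tderiv) (hasTD_mop N ε α hA)

lemma isCSpace_mop_time (N : ℕ) (ε : ℝ) (α : Fin (n + 1) → ℕ) {A : TimeI T → Cyl n → ℝ}
    (hA : Continuous (Function.uncurry A)) (m : ℕ) : IsCSpace m (fun t => mop N ε α (A t)) := by
  obtain ⟨B, hB0, hB⟩ := exists_bound hA
  exact isCSpace_mop N ε (fun t => (hA.comp (Continuous.prodMk_right t)).measurable)
    (fun t u => hB (t, u)) (fun u => hA.comp (Continuous.prodMk_left u)) m α

lemma continuous_slice {A : TimeI T → Cyl n → ℝ} (hA : Continuous (Function.uncurry A))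
    (t : TimeI T) : Continuous (A t) := hA.comp (Continuous.prodMk_right t)

lemma isC₀_mop (N : ℕ) {A : TimeI T → Cyl n → ℝ} (hA : IsCTime 1 A) :
    IsC₀ 1 2 (fun t => mop N (-1) 0 (A t)) :=
  ⟨⟨(isCTime_mop N (-1) 0 hA).1, isCSpace_mop_time N (-1) 0 hA.continuous 2⟩,
    fun t _ hu => mop_bdry N (A t) hu⟩

/-- The fundamental theorem of calculus in time. -/
lemma integral_tderiv {F : TimeI T → Cyl n → ℝ} (hF : IsCTime 1 F) (u : Cyl n) :
    ∫ t, tderiv F t u = F (t1 T) u - F (t0 T) u := by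
  rw [integral_Icc_subtype hT.out.le]
  have h := intervalIntegral.integral_eq_sub_of_hasDeriv_right_of_le hT.out.le
    (f := fun s => F (projIcc 0 T hT.out.le s) u)
    (f' := fun s => tderiv F (projIcc 0 T hT.out.le s) u) ?_ ?_ ?_
  · rw [h, projIcc_right, projIcc_left]; rfl
  · exact ((hF.continuous.comp (Continuous.prodMk_left u)).comp
      (continuous_projIcc (h := hT.out.le))).continuousOn
  · intro s hs
    have h1 := hF.hasTD ⟨s, Ioo_subset_Icc_self hs⟩ u
    rw [projIcc_of_mem _ (Ioo_subset_Icc_self hs)]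
    exact (HasDerivWithinAt.hasDerivAt h1 (Icc_mem_nhds hs.1 hs.2)).hasDerivWithinAt
  · exact ((hF.continuous_tderiv.comp (Continuous.prodMk_left u)).comp
      (continuous_projIcc (h := hT.out.le))).intervalIntegrable _ _

/-! ### Jointly measurable densities -/

/-- Sample `f` at the next point of the grid of mesh `1/(k+1)` to the right of `t`, truncated at
`T`. These functions factor through the integers, hence are measurable, and right continuity makes
them converge pointwise. -/
lemma measurable_of_rightCont {f : TimeI T → ℝ} (h : ∀ t, ContinuousWithinAt f (Ici t) t) :
    Measurable f := by
  set d : ℕ → TimeI T → TimeI T := fun k t =>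
    projIcc 0 T hT.out.le ((⌊((k : ℝ) + 1) * t⌋ + 1 : ℝ) / (k + 1)) with hd
  have hle : ∀ k t, t ≤ d k t ∧ (d k t : ℝ) - t ≤ 1 / ((k : ℝ) + 1) := by
    intro k t
    have hk : (0 : ℝ) < k + 1 := by positivity
    have h1 : (t : ℝ) ≤ (⌊((k : ℝ) + 1) * t⌋ + 1 : ℝ) / (k + 1) := by
      rw [le_div_iff₀ hk]; linarith [Int.lt_floor_add_one (((k : ℝ) + 1) * t)]
    have h2 : (⌊((k : ℝ) + 1) * t⌋ + 1 : ℝ) / (k + 1) ≤ t + 1 / ((k : ℝ) + 1) := by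
      rw [div_le_iff₀ hk, add_mul (t : ℝ), one_div, inv_mul_cancel₀ hk.ne']
      linarith [Int.floor_le (((k : ℝ) + 1) * t)]
    have h3 : (d k t : ℝ) = max 0 (min T ((⌊((k : ℝ) + 1) * t⌋ + 1 : ℝ) / (k + 1))) := rfl
    constructor
    · change (t : ℝ) ≤ d k t
      rw [h3]; exact le_max_of_le_right (le_min t.2.2 h1)
    · rw [h3, sub_le_iff_le_add, max_le_iff]
      have : (0 : ℝ) < 1 / ((k : ℝ) + 1) := by positivity
      exact ⟨by linarith [t.2.1], (min_le_right _ _).trans (by linarith)⟩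
  refine measurable_of_tendsto_metrizable (f := fun k t => f (d k t)) (fun k => ?_) ?_
  · have h1 : Measurable (fun t : TimeI T => ⌊((k : ℝ) + 1) * t⌋) :=
      Int.measurable_floor.comp (measurable_subtype_coe.const_mul _)
    exact (measurable_of_countable
      (fun z : ℤ => f (projIcc 0 T hT.out.le ((z + 1 : ℝ) / (k + 1))))).comp h1
  · rw [tendsto_pi_nhds]
    intro t
    refine (h t).tendsto.comp (tendsto_nhdsWithin_iff.2 ⟨?_, Eventually.of_forall fun k =>
      (hle k t).1⟩)
    rw [tendsto_subtype_rng]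
    refine tendsto_of_tendsto_of_tendsto_of_le_of_le tendsto_const_nhds
      (h := fun k : ℕ => (t : ℝ) + 1 / ((k : ℝ) + 1)) ?_ (fun k => (hle k t).1) fun k => ?_
    · simpa using tendsto_one_div_add_atTop_nhds_zero_nat.const_add (t : ℝ)
    · have := (hle k t).2
      linarith

/-- `ρ` is a jointly measurable version of the densities of the trajectory `π`. -/
structure IsDensity (π : TimeI T → Meas n) (ρ : TimeI T → Cyl n → ℝ) : Prop where
  meas : Measurable (Function.uncurry ρ)
  nonneg : ∀ t u, 0 ≤ ρ t u
  le_one : ∀ t u, ρ t u ≤ 1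
  mem : ∀ t, π t ∈ F1 n
  ae : ∀ t, (π t).density =ᵐ[volume] ρ t

lemma IsDensity.meas_slice {π : TimeI T → Meas n} {ρ : TimeI T → Cyl n → ℝ}
    (h : IsDensity π ρ) (t : TimeI T) : Measurable (ρ t) :=
  h.meas.comp measurable_prodMk_left

lemma IsDensity.bm {π : TimeI T → Meas n} {ρ : TimeI T → Cyl n → ℝ}
    (h : IsDensity π ρ) : BM (Function.uncurry ρ) :=
  BM.of_unit h.meas (fun p => h.nonneg p.1 p.2) fun p => h.le_one p.1 p.2

lemma IsDensity.bm_slice {π : TimeI T → Meas n} {ρ : TimeI T → Cyl n → ℝ}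
    (h : IsDensity π ρ) (t : TimeI T) : BM (ρ t) :=
  BM.of_unit (h.meas_slice t) (h.nonneg t) (h.le_one t)

lemma IsDensity.abs_le {π : TimeI T → Meas n} {ρ : TimeI T → Cyl n → ℝ}
    (h : IsDensity π ρ) (t : TimeI T) (u : Cyl n) : |ρ t u| ≤ 1 := by
  rw [abs_of_nonneg (h.nonneg t u)]; exact h.le_one t u

lemma IsDensity.pair_eq {π : TimeI T → Meas n} {ρ : TimeI T → Cyl n → ℝ}
    (h : IsDensity π ρ) (t : TimeI T) (F : Cyl n → ℝ) : (π t).pair F = ∫ u, ρ t u * F u := by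
  rw [F1.pair_eq (h.mem t)]
  refine integral_congr_ae ?_
  filter_upwards [F1.clip_ae (h.mem t), h.ae t] with u h1 h2
  rw [← h1, h2]

/-- Densities chosen separately for each time need not be jointly measurable. Pairings with bounded
measurable functions are limits of pairings with mollified ones, so `t ↦ ρ_t du` is a measurable
kernel; its kernel Radon–Nikodym derivative with respect to the constant kernel `volume` is jointly
measurable. -/
lemma exists_isDensity {π : TimeI T → Meas n} (hπ : ∀ t, π t ∈ F1 n)
    (hm : ∀ F : Cyl n → ℝ, Continuous F → Measurable fun t => (π t).pair F) :
    ∃ ρ, IsDensity π ρ := by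
  have hcb : ∀ t, BM (π t).clip := fun t =>
    BM.of_unit (π t).measurable_clip (π t).clip_nonneg (π t).clip_le_one
  have h1 : ∀ f : Cyl n → ℝ, BM f → Measurable fun t => ∫ u, (π t).clip u * f u := by
    intro f hf
    refine measurable_of_tendsto_metrizable
      (f := fun N t => ∫ u, (π t).clip u * mop N 1 0 f u) (fun N => ?_) ?_
    · have := hm (mop N 1 0 f) (continuous_mop N 1 0 hf.1 hf.2.choose_spec)
      simpa only [F1.pair_eq (hπ _)] using this
    · rw [tendsto_pi_nhds]
      intro t
      rw [tendsto_iff_dist_tendsto_zero]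
      refine squeeze_zero (fun _ => dist_nonneg) (fun N => ?_)
        (tendsto_integral_abs_mop_sub (Or.inl rfl) hf.1 hf.2.choose_spec)
      rw [Real.dist_eq, ← integral_sub (((hcb t).mul (hf.mop N 1 0)).integrable _)
        (((hcb t).mul hf).integrable _)]
      refine (abs_integral_le_integral_abs).trans (integral_mono
        ((((hcb t).mul (hf.mop N 1 0)).sub ((hcb t).mul hf)).abs.integrable _)
        (((hf.mop N 1 0).sub hf).abs.integrable _) fun u => ?_)
      simp only [← mul_sub, abs_mul]
      rw [abs_of_nonneg ((π t).clip_nonneg u)]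
      exact mul_le_of_le_one_left (abs_nonneg _) ((π t).clip_le_one u)
  set κ : ProbabilityTheory.Kernel (TimeI T) (Cyl n) :=
    ⟨fun t => volume.withDensity fun u => ENNReal.ofReal ((π t).clip u), by
      refine Measure.measurable_of_measurable_coe _ fun s hs => ?_
      have e : ∀ t, (volume.withDensity fun u => ENNReal.ofReal ((π t).clip u)) s =
          ENNReal.ofReal (∫ u, (π t).clip u * s.indicator (fun _ => (1 : ℝ)) u) := by
        intro t
        rw [withDensity_apply _ hs, ← ofReal_integral_eq_lintegral_ofReal
          ((hcb t).integrable _) (ae_of_all _ (π t).clip_nonneg), ← integral_indicator hs]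
        congr 2; ext u
        by_cases hu : u ∈ s <;> simp [hu]
      simp only [e]
      refine ENNReal.measurable_ofReal.comp (h1 _ (BM.of_unit (measurable_const.indicator hs)
        (fun u => ?_) fun u => ?_))
      · exact indicator_nonneg (fun _ _ => zero_le_one) u
      · exact indicator_le' (fun _ _ => le_rfl) (fun _ _ => zero_le_one) u⟩ with hκ
  have hκt : ∀ t, κ t = volume.withDensity fun u => ENNReal.ofReal ((π t).clip u) := fun t => rfl
  have : ProbabilityTheory.IsFiniteKernel κ := by
    refine ⟨⟨volume (univ : Set (Cyl n)), measure_lt_top _ _, fun t => ?_⟩⟩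
    rw [hκt, withDensity_apply _ MeasurableSet.univ]
    refine (lintegral_mono (g := fun _ => 1) fun u => ?_).trans (by simp)
    exact ENNReal.ofReal_le_one.2 ((π t).clip_le_one u)
  set η : ProbabilityTheory.Kernel (TimeI T) (Cyl n) :=
    ProbabilityTheory.Kernel.const _ volume with hη
  refine ⟨fun t u => max 0 (min 1 (κ.rnDeriv η t u).toReal), ?_, fun t u => le_max_left _ _,
    fun t u => max_le zero_le_one (min_le_left _ _), hπ, fun t => ?_⟩
  · exact measurable_const.max (measurable_const.min
      (ProbabilityTheory.Kernel.measurable_rnDeriv κ η).ennreal_toReal)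
  · have e1 := ProbabilityTheory.Kernel.rnDeriv_eq_rnDeriv_measure (κ := κ) (η := η) (a := t)
    have e2 := Measure.rnDeriv_withDensity (volume : Measure (Cyl n))
      (f := fun u => ENNReal.ofReal ((π t).clip u))
      (ENNReal.measurable_ofReal.comp (π t).measurable_clip)
    rw [hκt] at e1
    filter_upwards [e1, e2, F1.clip_ae (hπ t)] with u h1 h2 h3
    have h4 : κ.rnDeriv η t u = ENNReal.ofReal ((π t).clip u) := h1.trans h2
    rw [h4, ENNReal.toReal_ofReal ((π t).clip_nonneg u), h3,
      min_eq_right ((π t).clip_le_one u), max_eq_right ((π t).clip_nonneg u)]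

end Time

lemma BM.integral_right {X Y : Type*} [MeasurableSpace X] [MeasurableSpace Y] {μ : Measure Y}
    [IsFiniteMeasure μ] {f : X → Y → ℝ} (hf : BM (Function.uncurry f)) :
    BM (fun x => ∫ y, f x y ∂μ) := by
  obtain ⟨hm, C, hC⟩ := hf
  refine ⟨(hm.stronglyMeasurable.integral_prod_right (ν := μ)).measurable, C * μ.real univ,
    fun x => ?_⟩
  rw [← Real.norm_eq_abs]
  exact norm_integral_le_of_norm_le_const (ae_of_all _ fun y => hC (x, y))

/-! ### The rate functionals in terms of densities. -/

section Functional

set_option linter.unusedSectionVars false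

variable {n : ℕ} {T : ℝ} [hT : Fact (0 < T)]

lemma IsDensity.star_eq {π : TimeI T → Meas n} {ρ : TimeI T → Cyl n → ℝ} (h : IsDensity π ρ)
    (J : KacKernel n) (t : TimeI T) : J.star (π t).density = J.star (ρ t) := J.star_congr (h.ae t)

lemma bm_pderiv_star {ρ : TimeI T → Cyl n → ℝ} (hρ : BM (Function.uncurry ρ)) (J : KacKernel n)
    (k : Fin (n + 1)) : BM (fun p : TimeI T × Cyl n => pderiv k (J.star (ρ p.1)) p.2) := by
  obtain ⟨C, hC⟩ := hρ.2
  have e : (fun p : TimeI T × Cyl n => pderiv k (J.star (ρ p.1)) p.2) =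
      fun p => ∫ v, J.gradNeum k p.2 v * ρ p.1 v := by
    ext p
    exact J.pderiv_star (hρ.1.comp measurable_prodMk_left) (fun u => hC (p.1, u)) k p.2
  rw [e]
  refine BM.integral_right (X := TimeI T × Cyl n)
    (f := fun (p : TimeI T × Cyl n) (v : Cyl n) => J.gradNeum k p.2 v * ρ p.1 v) ?_
  have h1 : Continuous (fun q : (TimeI T × Cyl n) × Cyl n => J.gradNeum k q.1.2 q.2) :=
    (J.continuous_gradNeum k).comp ((continuous_snd.comp continuous_fst).prodMk continuous_snd)
  have h2 : BM (fun q : (TimeI T × Cyl n) × Cyl n => ρ q.1.1 q.2) :=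
    hρ.comp (g := fun q : (TimeI T × Cyl n) × Cyl n => (q.1.1, q.2)) (by fun_prop)
  exact (BM.of_continuous h1).mul h2

lemma continuous_surface {θ : Cyl n → ℝ} (hθ : Continuous θ) {V : TimeI T → Cyl n → ℝ}
    (hV : Continuous (Function.uncurry V)) {b : bdry n → ℝ} (hb : ∀ r : bdry n, θ r.1 = b r) :
    BM (fun t => surfaceIntegral (fun r => b r * normal1 r * V t r.1)) := by
  have hr : Continuous (fun y : Fin n → UnitAddCircle => (rightPt y).1) :=
    continuous_const.prodMk continuous_id
  have hl : Continuous (fun y : Fin n → UnitAddCircle => (leftPt y).1) :=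
    continuous_const.prodMk continuous_id
  have key : ∀ (q : (Fin n → UnitAddCircle) → bdry n) (c : ℝ), (Continuous fun y => (q y).1) →
      (∀ y, normal1 (q y) = c) →
      BM (fun t : TimeI T => ∫ y, b (q y) * normal1 (q y) * V t (q y).1) := by
    intro q c hq hc
    refine BM.integral_right (f := fun (t : TimeI T) y => b (q y) * normal1 (q y) * V t (q y).1) ?_
    simp only [hc, ← hb]
    refine BM.of_continuous (Y := TimeI T × (Fin n → UnitAddCircle)) ?_
    exact (((hθ.comp hq).comp continuous_snd).mul continuous_const).mul
      (hV.comp (continuous_fst.prodMk (hq.comp continuous_snd)))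
  unfold surfaceIntegral
  exact (key rightPt 1 hr fun y => rfl).add (key leftPt (-1) hl fun y => rfl)

variable {β : ℝ} {J : KacKernel n} {b : bdry n → ℝ}

/-- Gathers the terms that are local in time into `spat`. Both functionals differ from this integral
only by terms linear in the trajectory, the one of `ℐ` with `V = ∇F`. -/
lemma IsDensity.integral_spat {π : TimeI T → Meas n} {ρ : TimeI T → Cyl n → ℝ}
    (h : IsDensity π ρ) {θ : Cyl n → ℝ} (hθ : Continuous θ) (hb : ∀ r : bdry n, θ r.1 = b r)
    {V : Fin (n + 1) → TimeI T → Cyl n → ℝ} (hV : ∀ k, IsCSpace 1 (V k)) :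
    BM (fun t => spat β J b (ρ t) fun k => V k t) ∧
    ∫ t, spat β J b (ρ t) (fun k => V k t) =
      -(∫ t, (π t).pair (fun u => ∑ k, pderiv k (V k t) u))
      + (∫ t, surfaceIntegral (fun r => b r * normal1 r * V 0 t r.1))
      - β * (∫ t, ∫ u, mobility ((π t).density u)
        * ∑ k, V k t u * pderiv k (J.star (π t).density) u)
      - 1 / 2 * ∫ t, ∫ u, mobility ((π t).density u) * ∑ k, V k t u * V k t u := by
  have hVb : ∀ k, BM (Function.uncurry (V k)) := fun k => BM.of_continuous (hV k).continuous
  have hm : BM (fun p : TimeI T × Cyl n => mobility (ρ p.1 p.2)) := h.bm.mobility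
  have b1 : BM (fun t => ∫ u, ρ t u * ∑ k, pderiv k (V k t) u) :=
    BM.integral_right (f := fun t u => ρ t u * ∑ k, pderiv k (V k t) u)
      (h.bm.mul (BM.sum (s := Finset.univ)
        (f := fun k (p : TimeI T × Cyl n) => pderiv k (V k p.1) p.2)
        fun k _ => BM.of_continuous ((hV k).2 k).2))
  have b2 := continuous_surface hθ (hV 0).continuous hb
  have b3 : BM (fun t => ∫ u, mobility (ρ t u) * ∑ k, V k t u * pderiv k (J.star (ρ t)) u) :=
    BM.integral_right (f := fun t u => mobility (ρ t u) *
        ∑ k, V k t u * pderiv k (J.star (ρ t)) u)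
      (hm.mul (BM.sum (s := Finset.univ)
        (f := fun k (p : TimeI T × Cyl n) => V k p.1 p.2 * pderiv k (J.star (ρ p.1)) p.2)
        fun k _ => (hVb k).mul (bm_pderiv_star h.bm J k)))
  have b4 : BM (fun t => ∫ u, mobility (ρ t u) * ∑ k, V k t u * V k t u) :=
    BM.integral_right (f := fun t u => mobility (ρ t u) * ∑ k, V k t u * V k t u)
      (hm.mul (BM.sum (s := Finset.univ)
        (f := fun k (p : TimeI T × Cyl n) => V k p.1 p.2 * V k p.1 p.2)
        fun k _ => (hVb k).mul (hVb k)))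
  refine ⟨((b1.neg.add b2).sub (b3.const_mul β)).sub (b4.const_mul _), ?_⟩
  have e1 : ∀ t, (π t).pair (fun u => ∑ k, pderiv k (V k t) u) =
      ∫ u, ρ t u * ∑ k, pderiv k (V k t) u := fun t => h.pair_eq t _
  have e3 : ∀ t, ∫ u, mobility ((π t).density u)
        * ∑ k, V k t u * pderiv k (J.star (π t).density) u =
      ∫ u, mobility (ρ t u) * ∑ k, V k t u * pderiv k (J.star (ρ t)) u := fun t => by
    rw [h.star_eq J t]
    refine integral_congr_ae ?_
    filter_upwards [h.ae t] with u hu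
    rw [hu]
  have e4 : ∀ t, ∫ u, mobility ((π t).density u) * ∑ k, V k t u * V k t u =
      ∫ u, mobility (ρ t u) * ∑ k, V k t u * V k t u := fun t => by
    refine integral_congr_ae ?_
    filter_upwards [h.ae t] with u hu
    rw [hu]
  simp only [e1, e3, e4]
  have i1 := b1.neg.integrable volume
  have i2 := b2.integrable volume
  have i3 := (b3.const_mul β).integrable volume
  have i4 := (b4.const_mul (1 / 2)).integrable volume
  have j1 := integral_sub ((i1.add i2).sub i3) i4
  have j2 := integral_sub (i1.add i2) i3
  have j3 := integral_add i1 i2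
  simp only [Pi.sub_apply, Pi.add_apply] at j1 j2 j3
  unfold spat
  rw [j1, j2, j3, integral_neg, integral_const_mul, integral_const_mul]

lemma IsDensity.hatI_eq {π : TimeI T → Meas n} {ρ : TimeI T → Cyl n → ℝ}
    (h : IsDensity π ρ) {θ : Cyl n → ℝ} (hθ : Continuous θ) (hb : ∀ r : bdry n, θ r.1 = b r)
    (γ : Meas n) {F : TimeI T → Cyl n → ℝ} (hF : IsCSpace 2 F) :
    hatI β J b γ F π = (π (t1 T)).pair (F (t1 T)) - γ.pair (F (t0 T))
      - (∫ t, (π t).pair (tderiv F t)) + ∫ t, spat β J b (ρ t) fun k => pderiv k (F t) := by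
  rw [(h.integral_spat hθ hb (V := fun k t => pderiv k (F t)) fun k => (hF.2 k).2).2]
  unfold hatI ell laplacian
  ring

lemma IsDensity.hatJ_eq {π : TimeI T → Meas n} {ρ : TimeI T → Cyl n → ℝ}
    (h : IsDensity π ρ) {θ : Cyl n → ℝ} (hθ : Continuous θ) (hb : ∀ r : bdry n, θ r.1 = b r)
    (W : TimeI T → Fin (n + 1) → Meas n) {V : Fin (n + 1) → TimeI T → Cyl n → ℝ}
    (hV : ∀ k, IsCSpace 1 (V k)) :
    hatJ β J b V W π = (∑ k, (W (t1 T) k).pair (V k (t1 T)))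
      - (∫ t, ∑ k, (W t k).pair (tderiv (V k) t)) + ∫ t, spat β J b (ρ t) fun k => V k t := by
  rw [(h.integral_spat hθ hb hV).2]
  unfold hatJ linearL
  ring

/-- The weak form of the inequality `ℐ ≤ a`, tested against mollified functions only. -/
def Sub (β : ℝ) (J : KacKernel n) (b : bdry n → ℝ) (γ : Meas n) (a : ℝ)
    (π : TimeI T → Meas n) : Prop :=
  ∀ (N : ℕ) (A : TimeI T → Cyl n → ℝ), IsCTime 1 A →
    hatI β J b γ (fun t => mop N (-1) 0 (A t)) π ≤ a

lemma pderiv_mop_slice (N : ℕ) {A : TimeI T → Cyl n → ℝ} (hA : Continuous (Function.uncurry A))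
    (k : Fin (n + 1)) (t : TimeI T) : pderiv k (mop N (-1) 0 (A t)) = gradMop N (A t) k := by
  rw [(BM.of_continuous (continuous_slice hA t)).pderiv_mop, zero_add, gradMop]

lemma IsDensity.hatI_mop {π : TimeI T → Meas n} {ρ : TimeI T → Cyl n → ℝ}
    (h : IsDensity π ρ) {θ : Cyl n → ℝ} (hθ : Continuous θ) (hb : ∀ r : bdry n, θ r.1 = b r)
    (γ : Meas n) (N : ℕ) {A : TimeI T → Cyl n → ℝ} (hA : IsCTime 1 A) :
    hatI β J b γ (fun t => mop N (-1) 0 (A t)) π =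
      (π (t1 T)).pair (mop N (-1) 0 (A (t1 T))) - γ.pair (mop N (-1) 0 (A (t0 T)))
      - (∫ t, (π t).pair (mop N (-1) 0 (tderiv A t)))
      + ∫ t, spat β J b (ρ t) (gradMop N (A t)) := by
  rw [h.hatI_eq hθ hb γ (isCSpace_mop_time N (-1) 0 hA.continuous 2), (isCTime_mop N (-1) 0 hA).2]
  simp only [pderiv_mop_slice N hA.continuous]

lemma Sub.of_rateI {γ : Meas n} {a : ℝ} {x : Path T (Meas n)} (h : rateI β J b γ x ≤ a) :
    (∀ t, x t ∈ F1 n) ∧ Sub β J b γ a x.toFun := by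
  unfold rateI at h
  split_ifs at h with h1
  · refine ⟨h1.1, fun N A hA => ?_⟩
    have := (le_iSup (fun F : {F : TimeI T → Cyl n → ℝ // IsC₀ 1 2 F} =>
      (hatI β J b γ F.1 x.toFun : EReal)) ⟨_, isC₀_mop N hA⟩).trans h
    exact_mod_cast this
  · exact absurd h (by simp)

lemma isC_gradMop (N : ℕ) {A : TimeI T → Cyl n → ℝ} (hA : IsCTime 1 A) (k : Fin (n + 1)) :
    IsC 1 1 (fun t => gradMop N (A t) k) :=
  ⟨(isCTime_mop N (-1) _ hA).1, isCSpace_mop_time N (-1) _ hA.continuous 1⟩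

/-- For a gradient field the continuity equation, applied to the mollifications of `A` and of its
time derivative, replaces `W` by `π - γ`. The time integral of the `γ` part is evaluated by the
fundamental theorem of calculus and leaves the initial term of the functional of `ℐ`. -/
lemma hatJ_eq_hatI {π : TimeI T → Meas n} {ρ : TimeI T → Cyl n → ℝ}
    (h : IsDensity π ρ) {θ : Cyl n → ℝ} (hθ : Continuous θ) (hb : ∀ r : bdry n, θ r.1 = b r)
    {γ : Meas n} (hγ : γ ∈ F1 n) {W : TimeI T → Fin (n + 1) → Meas n} (hW : ContinuityEq γ W π)
    (N : ℕ) {A : TimeI T → Cyl n → ℝ} (hA : IsCTime 1 A) :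
    hatJ β J b (fun k t => gradMop N (A t) k) W π =
      hatI β J b γ (fun t => mop N (-1) 0 (A t)) π := by
  rw [h.hatJ_eq hθ hb W fun k => (isC_gradMop N hA k).2, h.hatI_mop hθ hb γ N hA]
  have e1 : ∀ t (f : Cyl n → ℝ), Continuous f → ∑ k, (W t k).pair (gradMop N f k) =
      (π t).pair (mop N (-1) 0 f) - γ.pair (mop N (-1) 0 f) := by
    intro t f hf
    have hf' := BM.of_continuous hf
    rw [hW t _ ⟨(hf'.isC1_mop N (-1) 0).isCSpace, fun u hu => mop_bdry N f hu⟩]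
    simp only [hf'.pderiv_mop, zero_add, gradMop]
  have e2 : ∀ k, tderiv (fun t => gradMop N (A t) k) = fun t => gradMop N (tderiv A t) k :=
    fun k => (isCTime_mop N (-1) (Pi.single k 1) hA).2
  simp only [e2, e1 _ _ (continuous_slice hA.continuous _),
    e1 _ _ (continuous_slice hA.continuous_tderiv _)]
  have hF := isCTime_mop N (-1) 0 hA
  have b0 : BM (Function.uncurry fun t => mop N (-1) 0 (tderiv A t)) :=
    BM.of_continuous (continuous_mop_time N (-1) 0 hA.continuous_tderiv)
  have b1 : BM (fun t => (π t).pair (mop N (-1) 0 (tderiv A t))) := by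
    simp only [h.pair_eq]
    exact BM.integral_right (f := fun t u => ρ t u * mop N (-1) 0 (tderiv A t) u) (h.bm.mul b0)
  have hcb : BM γ.clip := BM.of_unit γ.measurable_clip γ.clip_nonneg γ.clip_le_one
  have b2' : BM (Function.uncurry fun (t : TimeI T) u =>
      γ.clip u * mop N (-1) 0 (tderiv A t) u) := (hcb.comp measurable_snd).mul b0
  have b2 : BM (fun t => γ.pair (mop N (-1) 0 (tderiv A t))) := by
    simp only [F1.pair_eq hγ]
    exact BM.integral_right b2'
  rw [integral_sub (b1.integrable _) (b2.integrable _)]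
  have e3 : ∫ t, γ.pair (mop N (-1) 0 (tderiv A t)) =
      γ.pair (mop N (-1) 0 (A (t1 T))) - γ.pair (mop N (-1) 0 (A (t0 T))) := by
    simp only [F1.pair_eq hγ]
    rw [integral_integral_swap (b2'.integrable _), ← integral_sub
      ((hcb.mul ((BM.of_continuous (continuous_slice hA.continuous _)).mop N _ _)).integrable _)
      ((hcb.mul ((BM.of_continuous (continuous_slice hA.continuous _)).mop N _ _)).integrable _)]
    congr 1; ext u
    have e4 := integral_tderiv hF.1 u
    rw [hF.2] at e4
    rw [integral_const_mul, e4]; ring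
  rw [e3]; ring

lemma measurable_pair_path {x : Path T (Meas n)} {F : Cyl n → ℝ} (hF : Continuous F) :
    Measurable fun t => (x t).pair F :=
  measurable_of_rightCont fun t =>
    (Meas.continuous_pair hF).continuousAt.comp_continuousWithinAt (x.right_cont t)

lemma measurable_pair_path_snd {x : Path T (MeasVec n)} {F : Cyl n → ℝ} (hF : Continuous F) :
    Measurable fun t => (x t).2.pair F :=
  measurable_of_rightCont fun t =>
    ((Meas.continuous_pair hF).comp continuous_snd).continuousAt.comp_continuousWithinAt
      (x.right_cont t)

lemma energy_lt_top {γ : Meas n} {W : TimeI T → Fin (n + 1) → Meas n} {π : TimeI T → Meas n} :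
    energy γ W π < ⊤ ↔ ContinuityEq γ W π ∧ (∀ t, π t ∈ F1 n) ∧ energyQ π < ⊤ := by
  unfold energy
  split_ifs with h
  · tauto
  · simp only [lt_self_iff_false, false_iff]; tauto

lemma Sub.of_rateJ {θ : Cyl n → ℝ} (hθ : Continuous θ) (hb : ∀ r : bdry n, θ r.1 = b r)
    {γ : Meas n} (hγ : γ ∈ F1 n) {a : ℝ} {x : Path T (MeasVec n)} (h : rateJ β J b γ x ≤ a) :
    ContinuityEq γ (fun t => (x t).1) (fun t => (x t).2) ∧ (∀ t, (x t).2 ∈ F1 n) ∧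
      Sub β J b γ a (fun t => (x t).2) := by
  unfold rateJ at h
  split_ifs at h with h1
  · obtain ⟨hc, hF, -⟩ := energy_lt_top.1 h1
    obtain ⟨ρ, hρ⟩ := exists_isDensity hF fun F hF => measurable_pair_path_snd hF
    refine ⟨hc, hF, fun N A hA => ?_⟩
    have := (le_iSup (fun V : {V : Fin (n + 1) → TimeI T → Cyl n → ℝ // ∀ k, IsC 1 1 (V k)} =>
      (hatJ β J b V.1 (fun t => (x t).1) (fun t => (x t).2) : EReal))
      ⟨_, isC_gradMop N hA⟩).trans h
    rw [hatJ_eq_hatI hρ hθ hb hγ hc N hA] at this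
    exact_mod_cast this
  · exact absurd h (by simp)

end Functional

/-! ### A one-dimensional modulus of continuity -/

section Holder

/-- A smooth ramp of width `h` starting at `s`. -/
def ramp (h s r : ℝ) : ℝ := Real.smoothTransition ((r - s) / h)

/-- The derivative of `ramp`. -/
def dramp (h s r : ℝ) : ℝ := deriv Real.smoothTransition ((r - s) / h) / h

lemma hasDerivAt_ramp (h s r : ℝ) : HasDerivAt (ramp h s) (dramp h s r) r := by
  have h1 : HasDerivAt (fun r => (r - s) / h) (1 / h) r := ((hasDerivAt_id r).sub_const s).div_const h
  have h2 := (Real.smoothTransition.contDiff (n := 1)).differentiable one_ne_zero ((r - s) / h)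
  have := h2.hasDerivAt.comp r h1
  rwa [mul_one_div] at this

lemma continuous_dramp (h s : ℝ) : Continuous (dramp h s) :=
  (((Real.smoothTransition.contDiff (n := 1)).continuous_deriv le_rfl).comp (by fun_prop)).div_const h

lemma dramp_nonneg {h : ℝ} (hh : 0 < h) (s r : ℝ) : 0 ≤ dramp h s r :=
  div_nonneg (Real.smoothTransition.monotone.deriv_nonneg) hh.le

lemma ramp_of_le {h s r : ℝ} (hh : 0 < h) (hr : r ≤ s) : ramp h s r = 0 :=
  Real.smoothTransition.zero_of_nonpos (div_nonpos_of_nonpos_of_nonneg (by linarith) hh.le)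

lemma ramp_of_ge {h s r : ℝ} (hh : 0 < h) (hr : s + h ≤ r) : ramp h s r = 1 :=
  Real.smoothTransition.one_of_one_le ((one_le_div hh).2 (by linarith))

lemma dramp_eq_zero {h s r : ℝ} (hh : 0 < h) (hr : r < s ∨ s + h < r) : dramp h s r = 0 := by
  rcases hr with hr | hr
  · refine (hasDerivAt_ramp h s r).unique ((hasDerivAt_const r (0 : ℝ)).congr_of_eventuallyEq ?_)
    filter_upwards [gt_mem_nhds hr] with x hx using ramp_of_le hh hx.le
  · refine (hasDerivAt_ramp h s r).unique ((hasDerivAt_const r (1 : ℝ)).congr_of_eventuallyEq ?_)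
    filter_upwards [lt_mem_nhds hr] with x hx using ramp_of_ge hh hx.le

variable {f : ℝ → ℝ} {T B : ℝ}

/-- `dramp h s` is a probability density carried by `[s, s + h]`, so right continuity at `s`
suffices. Integrating up to `T + h` catches its whole mass even for `s = T`. -/
lemma tendsto_integral_dramp (hfm : Measurable f) (hfb : ∀ r, |f r| ≤ B) {s : ℝ}
    (hs : 0 ≤ s) (hsT : s ≤ T) (hrc : ContinuousWithinAt f (Ici s) s) :
    Tendsto (fun h => ∫ r in (0 : ℝ)..(T + h), dramp h s r * f r) (𝓝[>] 0) (𝓝 (f s)) := by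
  rw [Metric.tendsto_nhds]
  intro ε hε
  obtain ⟨δ, hδ, hd⟩ := Metric.continuousWithinAt_iff.1 hrc (ε / 2) (half_pos hε)
  filter_upwards [Ioo_mem_nhdsGT hδ] with h hh
  have hh0 : 0 < h := hh.1
  have hTh : 0 ≤ T + h := by linarith
  have i0 : ∀ a b, IntervalIntegrable (dramp h s) volume a b := fun a b =>
    (continuous_dramp h s).intervalIntegrable a b
  have i1 : IntervalIntegrable (fun r => dramp h s r * f r) volume 0 (T + h) := by
    rw [intervalIntegrable_iff_integrableOn_Ioc_of_le hTh]
    exact Integrable.mul_bdd (c := B) ((i0 0 (T + h)).1) hfm.aestronglyMeasurable (ae_of_all _ hfb)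
  have e1 : ∫ r in (0 : ℝ)..(T + h), dramp h s r = 1 := by
    rw [intervalIntegral.integral_eq_sub_of_hasDerivAt (fun r _ => hasDerivAt_ramp h s r) (i0 _ _),
      ramp_of_ge hh0 (by linarith), ramp_of_le hh0 hs, sub_zero]
  have e2 : (∫ r in (0 : ℝ)..(T + h), dramp h s r * f r) - f s =
      ∫ r in (0 : ℝ)..(T + h), dramp h s r * (f r - f s) := by
    simp only [mul_sub]
    rw [intervalIntegral.integral_sub i1 ((i0 _ _).mul_const _),
      intervalIntegral.integral_mul_const, e1, one_mul]
  rw [Real.dist_eq, e2]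
  have h3 : |∫ r in (0 : ℝ)..(T + h), dramp h s r * (f r - f s)| ≤
      ∫ r in (0 : ℝ)..(T + h), dramp h s r * (ε / 2) := by
    rw [← Real.norm_eq_abs]
    refine intervalIntegral.norm_integral_le_of_norm_le hTh (ae_of_all _ fun r _ => ?_)
      ((i0 _ _).mul_const _)
    rw [norm_mul, Real.norm_eq_abs, abs_of_nonneg (dramp_nonneg hh0 s r)]
    by_cases hr : r < s ∨ s + h < r
    · rw [dramp_eq_zero hh0 hr, zero_mul, zero_mul]
    · push Not at hr
      refine mul_le_mul_of_nonneg_left ?_ (dramp_nonneg hh0 s r)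
      have := hd hr.1 (by rw [Real.dist_eq, abs_of_nonneg (by linarith)]; linarith [hh.2])
      exact (Real.dist_eq _ _ ▸ this).le
  rw [intervalIntegral.integral_mul_const, e1, one_mul] at h3
  linarith

/-- With `f` frozen after `T` and `φ` zero at `T + h`, the terminal value is itself an integral over
`[T, T + h]`. This treats jumps near `T` like interior ones. -/
lemma boundary_shift (hfm : Measurable f) (hfb : ∀ r, |f r| ≤ B) (hconst : ∀ r, T ≤ r → f r = f T)
    {h : ℝ} (hh : 0 < h) {φ ψ : ℝ → ℝ} (hφ : ∀ r, HasDerivAt φ (ψ r) r) (hψ : Continuous ψ)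
    (h0 : φ (T + h) = 0) :
    φ T * f T - ∫ r in (0 : ℝ)..T, ψ r * f r = -∫ r in (0 : ℝ)..(T + h), ψ r * f r := by
  have i0 : ∀ a b, IntervalIntegrable (fun r => ψ r * f r) volume a b := by
    intro a b
    have : ∀ a b, a ≤ b → IntervalIntegrable (fun r => ψ r * f r) volume a b := by
      intro a b hab
      rw [intervalIntegrable_iff_integrableOn_Ioc_of_le hab]
      exact Integrable.mul_bdd (c := B) ((hψ.intervalIntegrable a b).1) hfm.aestronglyMeasurable
        (ae_of_all _ hfb)
    rcases le_total a b with hab | hab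
    · exact this a b hab
    · exact (this b a hab).symm
  rw [← intervalIntegral.integral_add_adjacent_intervals (i0 0 T) (i0 T (T + h))]
  have e1 : ∫ r in T..(T + h), ψ r * f r = ∫ r in T..(T + h), ψ r * f T := by
    refine intervalIntegral.integral_congr fun r hr => ?_
    rw [uIcc_of_le (by linarith)] at hr
    simp only [hconst r hr.1]
  rw [e1, intervalIntegral.integral_mul_const,
    intervalIntegral.integral_eq_sub_of_hasDerivAt (fun r _ => hφ r) (hψ.intervalIntegrable _ _), h0]
  ring

variable {a c C : ℝ}

/-- Take for `φ` the factor `l` times a smoothed indicator of `[s,t]` and let its ramps become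
steep. The real parameter `l` stays free: dividing by a large `|l|` makes the constant `a` harmless,
which gives a modulus of continuity although the bound is not small. -/
lemma increment_le_of_test (hT : 0 < T) (hC : 0 ≤ C) (hfm : Measurable f) (hfb : ∀ r, |f r| ≤ B)
    (hrc : ∀ s, 0 ≤ s → ContinuousWithinAt f (Ici s) s) (hconst : ∀ r, T ≤ r → f r = f T)
    (H : ∀ φ ψ : ℝ → ℝ, (∀ r, HasDerivAt φ (ψ r) r) → Continuous ψ →
      φ T * f T - φ 0 * c - (∫ r in (0 : ℝ)..T, ψ r * f r) ≤
        a + C * (∫ r in (0 : ℝ)..T, |φ r|) + C * ∫ r in (0 : ℝ)..T, φ r ^ 2)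
    {s t : ℝ} (hs : 0 ≤ s) (hst : s ≤ t) (ht : t ≤ T) (l : ℝ) :
    l * (f t - f s) ≤ a + C * (|l| * (t - s)) + C * (l ^ 2 * (t - s)) := by
  have hl := ((tendsto_integral_dramp (T := T) hfm hfb (hs.trans hst) ht
    (hrc t (hs.trans hst))).sub (tendsto_integral_dramp (T := T) hfm hfb hs (hst.trans ht)
    (hrc s hs))).const_mul l
  have hr : Tendsto (fun h => a + C * (|l| * (t + h - s)) + C * (l ^ 2 * (t + h - s)))
      (𝓝[>] 0) (𝓝 (a + C * (|l| * (t - s)) + C * (l ^ 2 * (t - s)))) := by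
    have : Continuous fun h => a + C * (|l| * (t + h - s)) + C * (l ^ 2 * (t + h - s)) := by fun_prop
    have h2 := this.tendsto 0
    rw [add_zero] at h2
    exact h2.mono_left nhdsWithin_le_nhds
  refine le_of_tendsto_of_tendsto hl hr ?_
  filter_upwards [self_mem_nhdsWithin] with h hh
  have hh0 : 0 < h := hh
  set φ : ℝ → ℝ := fun r => l * (ramp h s r - ramp h t r) with hφ
  set ψ : ℝ → ℝ := fun r => l * (dramp h s r - dramp h t r) with hψ
  have h1 : ∀ r, HasDerivAt φ (ψ r) r := fun r =>
    ((hasDerivAt_ramp h s r).sub (hasDerivAt_ramp h t r)).const_mul l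
  have h2 : Continuous ψ := ((continuous_dramp h s).sub (continuous_dramp h t)).const_mul l
  have h3 : φ (T + h) = 0 := by
    simp only [hφ]
    rw [ramp_of_ge hh0 (by linarith), ramp_of_ge hh0 (by linarith)]; ring
  have h4 : φ 0 = 0 := by
    simp only [hφ]
    rw [ramp_of_le hh0 hs, ramp_of_le hh0 (hs.trans hst)]; ring
  have h5 := H φ ψ h1 h2
  have h6 := boundary_shift hfm hfb hconst hh0 h1 h2 h3
  have i0 : ∀ s, IntervalIntegrable (fun r => dramp h s r * f r) volume 0 (T + h) := by
    intro s
    rw [intervalIntegrable_iff_integrableOn_Ioc_of_le (by linarith)]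
    exact Integrable.mul_bdd (c := B) (((continuous_dramp h s).intervalIntegrable _ _).1)
      hfm.aestronglyMeasurable (ae_of_all _ hfb)
  have h7 : ∫ r in (0 : ℝ)..(T + h), ψ r * f r =
      l * ((∫ r in (0 : ℝ)..(T + h), dramp h s r * f r)
        - ∫ r in (0 : ℝ)..(T + h), dramp h t r * f r) := by
    rw [← intervalIntegral.integral_sub (i0 s) (i0 t), ← intervalIntegral.integral_const_mul]
    congr 1; ext r; simp only [hψ]; ring
  have hφc : Continuous φ := continuous_iff_continuousAt.2 fun r => (h1 r).continuousAt
  have h8 : ∀ r, |φ r| ≤ (Icc s (t + h)).indicator (fun _ => |l|) r := by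
    intro r
    simp only [hφ, abs_mul]
    by_cases hr : r ∈ Icc s (t + h)
    · rw [indicator_of_mem hr]
      refine mul_le_of_le_one_right (abs_nonneg _) (abs_le.2 ?_)
      have a1 := Real.smoothTransition.nonneg ((r - s) / h)
      have a2 := Real.smoothTransition.le_one ((r - s) / h)
      have a3 := Real.smoothTransition.nonneg ((r - t) / h)
      have a4 := Real.smoothTransition.le_one ((r - t) / h)
      unfold ramp
      constructor <;> linarith
    · rw [indicator_of_notMem hr]
      rw [mem_Icc, not_and_or, not_le, not_le] at hr
      rcases hr with hr | hr
      · rw [ramp_of_le hh0 hr.le, ramp_of_le hh0 (by linarith)]; simp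
      · rw [ramp_of_ge hh0 (by linarith), ramp_of_ge hh0 hr.le]; simp
  have h9 : ∫ r in (0 : ℝ)..T, |φ r| ≤ |l| * (t + h - s) := by
    rw [intervalIntegral.integral_of_le hT.le]
    have hi : Integrable ((Icc s (t + h)).indicator fun _ : ℝ => |l|) volume :=
      (integrable_indicator_iff measurableSet_Icc).2 (integrableOn_const (by simp) (by simp))
    calc ∫ r in Ioc 0 T, |φ r| ≤ ∫ r in Ioc 0 T, (Icc s (t + h)).indicator (fun _ => |l|) r :=
          integral_mono (hφc.abs.integrableOn_Ioc) hi.integrableOn h8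
      _ ≤ ∫ r, (Icc s (t + h)).indicator (fun _ => |l|) r :=
          setIntegral_le_integral hi (ae_of_all _ fun r => indicator_nonneg (fun _ _ => abs_nonneg l) r)
      _ = |l| * (t + h - s) := by
          rw [integral_indicator measurableSet_Icc, setIntegral_const, smul_eq_mul,
            Real.volume_real_Icc_of_le (by linarith), mul_comm]
  have h10 : ∫ r in (0 : ℝ)..T, φ r ^ 2 ≤ l ^ 2 * (t + h - s) := by
    have : ∫ r in (0 : ℝ)..T, φ r ^ 2 ≤ ∫ r in (0 : ℝ)..T, |l| * |φ r| := by
      refine intervalIntegral.integral_mono_on hT.le ((hφc.pow 2).intervalIntegrable _ _)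
        ((continuous_const.mul hφc.abs).intervalIntegrable _ _) fun r _ => ?_
      rw [← sq_abs, pow_two]
      exact mul_le_mul_of_nonneg_right ((h8 r).trans
        (indicator_le_self' (fun _ _ => abs_nonneg l) r)) (abs_nonneg _)
    rw [intervalIntegral.integral_const_mul] at this
    refine this.trans ((mul_le_mul_of_nonneg_left h9 (abs_nonneg _)).trans_eq ?_)
    rw [← mul_assoc, abs_mul_abs_self, pow_two]
  have h11 := mul_le_mul_of_nonneg_left h9 hC
  have h12 := mul_le_mul_of_nonneg_left h10 hC
  rw [h4, zero_mul, sub_zero] at h5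
  rw [h6, h7] at h5
  linarith

/-- Take for `φ` the value `l` at time `0`, decaying to zero before time `h`. The cost vanishes with
`h`, so `l (f 0 - c) ≤ a` for every real `l`. -/
lemma initial_eq_of_test (hT : 0 < T) (hC : 0 ≤ C) (hfm : Measurable f) (hfb : ∀ r, |f r| ≤ B)
    (hrc : ∀ s, 0 ≤ s → ContinuousWithinAt f (Ici s) s) (hconst : ∀ r, T ≤ r → f r = f T)
    (H : ∀ φ ψ : ℝ → ℝ, (∀ r, HasDerivAt φ (ψ r) r) → Continuous ψ →
      φ T * f T - φ 0 * c - (∫ r in (0 : ℝ)..T, ψ r * f r) ≤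
        a + C * (∫ r in (0 : ℝ)..T, |φ r|) + C * ∫ r in (0 : ℝ)..T, φ r ^ 2) : f 0 = c := by
  have key : ∀ l : ℝ, l * (f 0 - c) ≤ a := by
    intro l
    have hl := ((tendsto_integral_dramp (T := T) hfm hfb le_rfl hT.le
      (hrc 0 le_rfl)).sub_const c).const_mul l
    have hr : Tendsto (fun h => a + C * (|l| * h) + C * (l ^ 2 * h)) (𝓝[>] 0) (𝓝 a) := by
      have : Continuous fun h => a + C * (|l| * h) + C * (l ^ 2 * h) := by fun_prop
      have h2 := this.tendsto 0
      simp only [mul_zero, add_zero] at h2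
      exact h2.mono_left nhdsWithin_le_nhds
    refine le_of_tendsto_of_tendsto hl hr ?_
    filter_upwards [self_mem_nhdsWithin] with h hh
    have hh0 : 0 < h := hh
    set φ : ℝ → ℝ := fun r => l * (1 - ramp h 0 r) with hφ
    set ψ : ℝ → ℝ := fun r => l * (-dramp h 0 r) with hψ
    have h1 : ∀ r, HasDerivAt φ (ψ r) r := fun r =>
      ((hasDerivAt_ramp h 0 r).const_sub 1).const_mul l
    have h2 : Continuous ψ := (continuous_dramp h 0).neg.const_mul l
    have h3 : φ (T + h) = 0 := by
      simp only [hφ]; rw [ramp_of_ge hh0 (by linarith)]; ring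
    have h4 : φ 0 = l := by simp only [hφ]; rw [ramp_of_le hh0 le_rfl]; ring
    have h5 := H φ ψ h1 h2
    have h6 := boundary_shift hfm hfb hconst hh0 h1 h2 h3
    have h7 : ∫ r in (0 : ℝ)..(T + h), ψ r * f r =
        -(l * ∫ r in (0 : ℝ)..(T + h), dramp h 0 r * f r) := by
      rw [← intervalIntegral.integral_const_mul, ← intervalIntegral.integral_neg]
      congr 1; ext r; simp only [hψ]; ring
    have hφc : Continuous φ := continuous_iff_continuousAt.2 fun r => (h1 r).continuousAt
    have h8 : ∀ r, 0 ≤ r → |φ r| ≤ (Icc 0 h).indicator (fun _ => |l|) r := by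
      intro r hr0
      simp only [hφ, abs_mul]
      by_cases hr : r ∈ Icc 0 h
      · rw [indicator_of_mem hr]
        refine mul_le_of_le_one_right (abs_nonneg _) (abs_le.2 ?_)
        have a1 := Real.smoothTransition.nonneg ((r - 0) / h)
        have a2 := Real.smoothTransition.le_one ((r - 0) / h)
        unfold ramp
        constructor <;> linarith
      · rw [indicator_of_notMem hr]
        rw [mem_Icc, not_and_or, not_le, not_le] at hr
        rcases hr with hr | hr
        · linarith
        · rw [ramp_of_ge hh0 (by linarith)]; simp
    have h9 : ∫ r in (0 : ℝ)..T, |φ r| ≤ |l| * h := by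
      rw [intervalIntegral.integral_of_le hT.le]
      have hi : Integrable ((Icc 0 h).indicator fun _ : ℝ => |l|) volume :=
        (integrable_indicator_iff measurableSet_Icc).2 (integrableOn_const (by simp) (by simp))
      calc ∫ r in Ioc 0 T, |φ r| ≤ ∫ r in Ioc 0 T, (Icc 0 h).indicator (fun _ => |l|) r :=
            setIntegral_mono_on (hφc.abs.integrableOn_Ioc) hi.integrableOn measurableSet_Ioc
              fun r hr => h8 r hr.1.le
        _ ≤ ∫ r, (Icc 0 h).indicator (fun _ => |l|) r :=
            setIntegral_le_integral hi
              (ae_of_all _ fun r => indicator_nonneg (fun _ _ => abs_nonneg l) r)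
        _ = |l| * h := by
            rw [integral_indicator measurableSet_Icc, setIntegral_const, smul_eq_mul,
              Real.volume_real_Icc_of_le hh0.le, mul_comm, sub_zero]
    have h10 : ∫ r in (0 : ℝ)..T, φ r ^ 2 ≤ l ^ 2 * h := by
      have : ∫ r in (0 : ℝ)..T, φ r ^ 2 ≤ ∫ r in (0 : ℝ)..T, |l| * |φ r| := by
        refine intervalIntegral.integral_mono_on hT.le ((hφc.pow 2).intervalIntegrable _ _)
          ((continuous_const.mul hφc.abs).intervalIntegrable _ _) fun r hr => ?_
        rw [← sq_abs, pow_two]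
        exact mul_le_mul_of_nonneg_right ((h8 r hr.1).trans
          (indicator_le_self' (fun _ _ => abs_nonneg l) r)) (abs_nonneg _)
      rw [intervalIntegral.integral_const_mul] at this
      refine this.trans ((mul_le_mul_of_nonneg_left h9 (abs_nonneg _)).trans_eq ?_)
      rw [← mul_assoc, abs_mul_abs_self, pow_two]
    have h11 := mul_le_mul_of_nonneg_left h9 hC
    have h12 := mul_le_mul_of_nonneg_left h10 hC
    rw [h4] at h5
    have h13 : φ T * f T - l * c - (∫ r in (0 : ℝ)..T, ψ r * f r) =
      φ T * f T - (∫ r in (0 : ℝ)..T, ψ r * f r) - l * c := by ring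
    rw [h13, h6, h7] at h5
    linarith
  by_contra hne
  have h0 : f 0 - c ≠ 0 := sub_ne_zero.2 hne
  have := key ((a + 1) / (f 0 - c))
  rw [div_mul_cancel₀ _ h0] at this
  linarith

end Holder

/-! ### Initial condition and weak equicontinuity in time. -/

section Modulus

set_option linter.unusedSectionVars false

variable {n : ℕ} {T : ℝ} [hT : Fact (0 < T)] {β : ℝ} {J : KacKernel n} {b : bdry n → ℝ}

lemma spat_const_mul {V : Fin (n + 1) → Cyl n → ℝ} (hV : ∀ k, IsC1 (V k)) (ρ : Cyl n → ℝ) (c : ℝ) :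
    spat β J b ρ (fun k u => c * V k u) =
      c * (-(∫ u, ρ u * ∑ k, pderiv k (V k) u)
        + surfaceIntegral (fun r => b r * normal1 r * V 0 r.1)
        - β * ∫ u, mobility (ρ u) * ∑ k, V k u * pderiv k (J.star ρ) u)
      - c ^ 2 * (1 / 2 * ∫ u, mobility (ρ u) * ∑ k, V k u * V k u) := by
  have e0 : ∀ k u, pderiv k (fun u => c * V k u) u = c * pderiv k (V k) u := fun k u =>
    (((hV k).hasPD k u).const_mul c).pderiv_eq
  have e1 : ∫ u, ρ u * ∑ k, pderiv k (fun u => c * V k u) u =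
      c * ∫ u, ρ u * ∑ k, pderiv k (V k) u := by
    rw [← integral_const_mul]
    congr 1; ext u
    simp only [e0, ← Finset.mul_sum]; ring
  have e2 : surfaceIntegral (fun r : bdry n => b r * normal1 r * (c * V 0 r.1)) =
      c * surfaceIntegral (fun r => b r * normal1 r * V 0 r.1) := by
    unfold surfaceIntegral
    rw [mul_add, ← integral_const_mul, ← integral_const_mul]
    congr 2 <;> (ext y; ring)
  have e3 : ∫ u, mobility (ρ u) * ∑ k, (c * V k u) * pderiv k (J.star ρ) u =
      c * ∫ u, mobility (ρ u) * ∑ k, V k u * pderiv k (J.star ρ) u := by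
    rw [← integral_const_mul]
    congr 1; ext u
    simp only [mul_assoc, ← Finset.mul_sum]; ring
  have e4 : ∫ u, mobility (ρ u) * ∑ k, (c * V k u) * (c * V k u) =
      c ^ 2 * ∫ u, mobility (ρ u) * ∑ k, V k u * V k u := by
    rw [← integral_const_mul]
    congr 1; ext u
    have : ∀ k, (c * V k u) * (c * V k u) = c ^ 2 * (V k u * V k u) := fun k => by ring
    simp only [this, ← Finset.mul_sum]; ring
  unfold spat
  rw [e1, e2, e3, e4]; ring

lemma abs_integral_le_const {f : Cyl n → ℝ} {C : ℝ} (h : ∀ u, |f u| ≤ C) :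
    |∫ u, f u| ≤ C * volume.real (univ : Set (Cyl n)) := by
  rw [← Real.norm_eq_abs]
  exact norm_integral_le_of_norm_le_const (ae_of_all _ h)

lemma abs_sum_le_card {f : Fin (n + 1) → ℝ} {C : ℝ} (h : ∀ k, |f k| ≤ C) :
    |∑ k, f k| ≤ (n + 1) * C := by
  refine (Finset.abs_sum_le_sum_abs _ _).trans ((Finset.sum_le_sum fun k _ => h k).trans_eq ?_)
  simp

lemma spat_bound (β : ℝ) (J : KacKernel n) (b : bdry n → ℝ) {V : Fin (n + 1) → Cyl n → ℝ}
    (hV : ∀ k, IsC1 (V k)) : ∃ C, 0 ≤ C ∧ ∀ ρ : Cyl n → ℝ, Measurable ρ →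
      (∀ u, 0 ≤ ρ u) → (∀ u, ρ u ≤ 1) → ∀ c : ℝ,
        |spat β J b ρ (fun k u => c * V k u)| ≤ C * |c| + C * c ^ 2 := by
  obtain ⟨D, hD0, hD⟩ := pderiv_star_bound J
  choose B1 hB10 hB1 using fun k => exists_bound (hV k).cont
  choose B2 hB20 hB2 using fun k => exists_bound ((hV k).contD k)
  set B : ℝ := ∑ k, (B1 k + B2 k) with hB
  have hB0 : 0 ≤ B := Finset.sum_nonneg fun k _ => add_nonneg (hB10 k) (hB20 k)
  have hle : ∀ k, B1 k + B2 k ≤ B := fun k =>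
    Finset.single_le_sum (f := fun k => B1 k + B2 k)
      (fun k _ => add_nonneg (hB10 k) (hB20 k)) (Finset.mem_univ k)
  have hV1 : ∀ k u, |V k u| ≤ B := fun k u => (hB1 k u).trans (by linarith [hle k, hB20 k])
  have hV2 : ∀ k u, |pderiv k (V k) u| ≤ B := fun k u => (hB2 k u).trans (by linarith [hle k, hB10 k])
  set m0 : ℝ := volume.real (univ : Set (Cyl n)) with hm0
  set S : ℝ := |surfaceIntegral (fun r : bdry n => b r * normal1 r * V 0 r.1)| with hS
  set C1 : ℝ := ((n + 1) * B) * m0 + S + |β| * (((n + 1) * (B * D)) * m0) with hC1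
  set C2 : ℝ := 1 / 2 * (((n + 1) * (B * B)) * m0) with hC2
  have hm : 0 ≤ m0 := measureReal_nonneg
  refine ⟨C1 + C2, by positivity, fun ρ hρ h0 h1 c => ?_⟩
  have hσ : ∀ u x C, 0 ≤ C → |x| ≤ C → |mobility (ρ u) * x| ≤ C := fun u x C hC hx => by
    rw [abs_mul, abs_of_nonneg (mobility_nonneg (h0 u) (h1 u))]
    have := mobility_le (ρ u)
    exact (mul_le_mul (by linarith) hx (abs_nonneg _) zero_le_one).trans_eq (one_mul C)
  have b1 : |∫ u, ρ u * ∑ k, pderiv k (V k) u| ≤ ((n + 1) * B) * m0 := by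
    refine abs_integral_le_const fun u => ?_
    rw [abs_mul, abs_of_nonneg (h0 u)]
    exact (mul_le_mul (h1 u) (abs_sum_le_card fun k => hV2 k u) (abs_nonneg _)
      zero_le_one).trans_eq (one_mul _)
  have b2 : |∫ u, mobility (ρ u) * ∑ k, V k u * pderiv k (J.star ρ) u| ≤
      ((n + 1) * (B * D)) * m0 := by
    refine abs_integral_le_const fun u => hσ u _ _ (by positivity) (abs_sum_le_card fun k => ?_)
    rw [abs_mul]
    exact mul_le_mul (hV1 k u) ((hD ρ hρ h0 h1 k).2 u) (abs_nonneg _) hB0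
  have b3 : |∫ u, mobility (ρ u) * ∑ k, V k u * V k u| ≤ ((n + 1) * (B * B)) * m0 := by
    refine abs_integral_le_const fun u => hσ u _ _ (by positivity) (abs_sum_le_card fun k => ?_)
    rw [abs_mul]
    exact mul_le_mul (hV1 k u) (hV1 k u) (abs_nonneg _) hB0
  rw [spat_const_mul hV]
  set X1 := ∫ u, ρ u * ∑ k, pderiv k (V k) u
  set X2 := ∫ u, mobility (ρ u) * ∑ k, V k u * pderiv k (J.star ρ) u
  set X3 := ∫ u, mobility (ρ u) * ∑ k, V k u * V k u
  set Y := surfaceIntegral (fun r : bdry n => b r * normal1 r * V 0 r.1)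
  have c1 : |-X1 + Y - β * X2| ≤ C1 := by
    have d1 : |β * X2| ≤ |β| * (((n + 1) * (B * D)) * m0) := by
      rw [abs_mul]; exact mul_le_mul_of_nonneg_left b2 (abs_nonneg _)
    have d2 := abs_add_le (-X1 + Y) (-(β * X2))
    have d3 := abs_add_le (-X1) Y
    rw [abs_neg] at d2 d3
    rw [sub_eq_add_neg]
    linarith
  have c2 : |1 / 2 * X3| ≤ C2 := by
    rw [abs_mul, abs_of_pos (by norm_num : (0 : ℝ) < 1 / 2)]
    exact mul_le_mul_of_nonneg_left b3 (by norm_num)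
  have c3 := abs_sub (c * (-X1 + Y - β * X2)) (c ^ 2 * (1 / 2 * X3))
  rw [abs_mul, abs_mul, abs_of_nonneg (sq_nonneg c)] at c3
  have c4 := mul_le_mul_of_nonneg_left c1 (abs_nonneg c)
  have c5 := mul_le_mul_of_nonneg_left c2 (sq_nonneg c)
  have hC10 : 0 ≤ C1 := (abs_nonneg _).trans c1
  have hC20 : 0 ≤ C2 := (abs_nonneg _).trans c2
  have c6 := mul_nonneg hC20 (abs_nonneg c)
  have c7 := mul_nonneg hC10 (sq_nonneg c)
  nlinarith

/-- Trajectories in `F¹`, weakly right continuous, satisfying the weak inequality `Sub`. -/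
structure Good (β : ℝ) (J : KacKernel n) (b : bdry n → ℝ) (γ : Meas n) (a : ℝ)
    (π : TimeI T → Meas n) : Prop where
  mem : ∀ t, π t ∈ F1 n
  sub : Sub β J b γ a π
  right_cont : ∀ F : Cyl n → ℝ, Continuous F →
    ∀ t, ContinuousWithinAt (fun t => (π t).pair F) (Ici t) t

lemma Good.of_rateI {γ : Meas n} {a : ℝ} {x : Path T (Meas n)} (h : rateI β J b γ x ≤ a) :
    Good β J b γ a x.toFun :=
  ⟨(Sub.of_rateI h).1, (Sub.of_rateI h).2, fun _ hF t =>
    (Meas.continuous_pair hF).continuousAt.comp_continuousWithinAt (x.right_cont t)⟩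

lemma Good.of_rateJ {θ : Cyl n → ℝ} (hθ : Continuous θ) (hb : ∀ r : bdry n, θ r.1 = b r)
    {γ : Meas n} (hγ : γ ∈ F1 n) {a : ℝ} {x : Path T (MeasVec n)} (h : rateJ β J b γ x ≤ a) :
    Good β J b γ a (fun t => (x t).2) :=
  ⟨(Sub.of_rateJ hθ hb hγ h).2.1, (Sub.of_rateJ hθ hb hγ h).2.2, fun _ hF t =>
    ((Meas.continuous_pair hF).comp continuous_snd).continuousAt.comp_continuousWithinAt
      (x.right_cont t)⟩

lemma Good.measurable_pair {γ : Meas n} {a : ℝ} {π : TimeI T → Meas n} (h : Good β J b γ a π)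
    {F : Cyl n → ℝ} (hF : Continuous F) : Measurable fun t => (π t).pair F :=
  measurable_of_rightCont (h.right_cont F hF)

lemma Good.exists_isDensity {γ : Meas n} {a : ℝ} {π : TimeI T → Meas n}
    (h : Good β J b γ a π) : ∃ ρ, IsDensity π ρ :=
  KawasakiKac.exists_isDensity h.mem fun _ hF => h.measurable_pair hF

lemma F1.abs_pair_le {m : Meas n} (hm : m ∈ F1 n) {F : Cyl n → ℝ} (hF : BM F) :
    |m.pair F| ≤ ∫ u, |F u| := by
  rw [F1.pair_eq hm]
  have hc : BM m.clip := BM.of_unit m.measurable_clip m.clip_nonneg m.clip_le_one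
  refine abs_integral_le_integral_abs.trans (integral_mono ((hc.mul hF).abs.integrable _)
    (hF.abs.integrable _) fun u => ?_)
  simp only [abs_mul]
  rw [abs_of_nonneg (m.clip_nonneg u)]
  exact mul_le_of_le_one_left (abs_nonneg _) (m.clip_le_one u)

lemma isCTime_const_mul {φ ψ : ℝ → ℝ} (hφ : ∀ r, HasDerivAt φ (ψ r) r) (hψ : Continuous ψ)
    {g : Cyl n → ℝ} (hg : Continuous g) :
    IsCTime 1 (fun (t : TimeI T) u => φ t * g u) ∧
      tderiv (fun (t : TimeI T) u => φ t * g u) = fun (t : TimeI T) u => ψ t * g u := by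
  have hφc : Continuous φ := continuous_iff_continuousAt.2 fun r => (hφ r).continuousAt
  refine isCTime_of_hasTD ?_ ?_ fun t u => ?_
  · exact ((hφc.comp continuous_subtype_val).comp continuous_fst).mul (hg.comp continuous_snd)
  · exact ((hψ.comp continuous_subtype_val).comp continuous_fst).mul (hg.comp continuous_snd)
  · have h1 : HasDerivWithinAt (fun s => φ s * g u) (ψ t * g u) (Icc 0 T) t :=
      ((hφ t).mul_const (g u)).hasDerivWithinAt
    refine h1.congr (fun s hs => ?_) ?_
    · rw [projIcc_of_mem hT.out.le hs]
    · rw [projIcc_val]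

/-- Product tests `φ(t) g(u)`. The spatial functional is linear plus quadratic in the scalar `φ(t)`,
so it is bounded by `C(|φ| + φ²)`; since `C` is found before `γ`, `a` and `π`, the resulting modulus
is uniform over trajectories. -/
lemma Good.test {θ : Cyl n → ℝ} (hθ : Continuous θ) (hb : ∀ r : bdry n, θ r.1 = b r) (N : ℕ)
    {g : Cyl n → ℝ} (hg : Continuous g) : ∃ C, 0 ≤ C ∧ ∀ (γ : Meas n) (a : ℝ)
      (π : TimeI T → Meas n), Good β J b γ a π → ∀ φ ψ : ℝ → ℝ, (∀ r, HasDerivAt φ (ψ r) r) →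
      Continuous ψ → φ T * (π (t1 T)).pair (mop N (-1) 0 g) - φ 0 * γ.pair (mop N (-1) 0 g)
        - (∫ r in (0 : ℝ)..T, ψ r * (π (projIcc 0 T hT.out.le r)).pair (mop N (-1) 0 g)) ≤
        a + C * (∫ r in (0 : ℝ)..T, |φ r|) + C * ∫ r in (0 : ℝ)..T, φ r ^ 2 := by
  have hg' := BM.of_continuous hg
  obtain ⟨C, hC0, hC⟩ := spat_bound β J b (V := gradMop N g) fun k => hg'.isC1_mop N _ _
  refine ⟨C, hC0, fun γ a π h φ ψ hφ hψ => ?_⟩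
  obtain ⟨ρ, hρ⟩ := h.exists_isDensity
  have hA := isCTime_const_mul (T := T) hφ hψ hg
  have h1 := h.sub N _ hA.1
  rw [hρ.hatI_mop hθ hb γ N hA.1, hA.2] at h1
  have e1 : ∀ c : ℝ, mop N (-1) 0 (fun u => c * g u) = fun u => c * mop N (-1) 0 g u := fun c => by
    ext u; exact mop_const_mul N (-1) 0 c g u
  have e2 : ∀ c : ℝ, gradMop N (fun u => c * g u) = fun k u => c * gradMop N g k u := fun c => by
    ext k u; exact mop_const_mul N (-1) _ c g u
  simp only [e1, e2, Meas.pair_smul] at h1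
  have e3 : ∀ F : ℝ → ℝ, ∫ t : TimeI T, F t = ∫ r in (0 : ℝ)..T, F r := fun F => by
    rw [integral_Icc_subtype hT.out.le]
    refine intervalIntegral.integral_congr fun r hr => ?_
    rw [uIcc_of_le hT.out.le] at hr
    simp only [projIcc_of_mem hT.out.le hr]
  have e4 : ∫ t : TimeI T, ψ t * (π t).pair (mop N (-1) 0 g) =
      ∫ r in (0 : ℝ)..T, ψ r * (π (projIcc 0 T hT.out.le r)).pair (mop N (-1) 0 g) := by
    rw [integral_Icc_subtype hT.out.le]
    refine intervalIntegral.integral_congr fun r hr => ?_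
    rw [uIcc_of_le hT.out.le] at hr
    simp only [projIcc_of_mem hT.out.le hr]
  have hφc : Continuous φ := continuous_iff_continuousAt.2 fun r => (hφ r).continuousAt
  have i1 : BM (fun t : TimeI T => C * |φ t| + C * φ t ^ 2) :=
    BM.of_continuous (by fun_prop)
  have h2 : -(∫ t : TimeI T, (C * |φ t| + C * φ t ^ 2)) ≤
      ∫ t : TimeI T, spat β J b (ρ t) fun k u => φ t * gradMop N g k u := by
    have hV := (hρ.integral_spat (β := β) (J := J) hθ hb fun k => (isC_gradMop N hA.1 k).2).1
    simp only [e2] at hV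
    rw [← integral_neg]
    refine integral_mono (i1.neg.integrable _) (hV.integrable _) fun t => ?_
    exact (abs_le.1 (hC (ρ t) (hρ.meas_slice t) (hρ.nonneg t) (hρ.le_one t) (φ t))).1
  have h3 : ∫ t : TimeI T, (C * |φ t| + C * φ t ^ 2) =
      C * (∫ r in (0 : ℝ)..T, |φ r|) + C * ∫ r in (0 : ℝ)..T, φ r ^ 2 := by
    have j1 : Continuous fun r => C * |φ r| := continuous_const.mul hφc.abs
    have j2 : Continuous fun r => C * φ r ^ 2 := continuous_const.mul (hφc.pow 2)
    rw [e3 (fun r => C * |φ r| + C * φ r ^ 2), intervalIntegral.integral_add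
      (j1.intervalIntegrable _ _) (j2.intervalIntegrable _ _),
      intervalIntegral.integral_const_mul, intervalIntegral.integral_const_mul]
  rw [e4] at h1
  rw [h3] at h2
  have h4 : ((t1 T : TimeI T) : ℝ) = T := rfl
  have h5 : ((t0 T : TimeI T) : ℝ) = 0 := rfl
  rw [h4, h5] at h1
  linarith

lemma Good.increment {θ : Cyl n → ℝ} (hθ : Continuous θ) (hb : ∀ r : bdry n, θ r.1 = b r) (N : ℕ)
    {g : Cyl n → ℝ} (hg : Continuous g) : ∃ C, 0 ≤ C ∧ ∀ (γ : Meas n) (a : ℝ)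
      (π : TimeI T → Meas n), Good β J b γ a π →
      (π (t0 T)).pair (mop N (-1) 0 g) = γ.pair (mop N (-1) 0 g) ∧
      ∀ s t : TimeI T, s ≤ t → ∀ l : ℝ,
        l * ((π t).pair (mop N (-1) 0 g) - (π s).pair (mop N (-1) 0 g)) ≤
          a + C * (|l| * (t - s)) + C * (l ^ 2 * (t - s)) := by
  obtain ⟨C, hC0, hC⟩ := Good.test (T := T) (β := β) (J := J) hθ hb N hg
  refine ⟨C, hC0, fun γ a π h => ?_⟩
  have hc : Continuous (mop N (-1) 0 g) :=
    continuous_mop N (-1) 0 hg.measurable (BM.of_continuous hg).2.choose_spec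
  set f : ℝ → ℝ := fun r => (π (projIcc 0 T hT.out.le r)).pair (mop N (-1) 0 g) with hf
  have f1 : Measurable f := (h.measurable_pair hc).comp continuous_projIcc.measurable
  have f2 : ∀ r, |f r| ≤ ∫ u, |mop N (-1) 0 g u| := fun r =>
    F1.abs_pair_le (h.mem _) (BM.of_continuous hc)
  have f3 : ∀ s, 0 ≤ s → ContinuousWithinAt f (Ici s) s := fun s _ =>
    (h.right_cont _ hc (projIcc 0 T hT.out.le s)).comp
      continuous_projIcc.continuousWithinAt fun r hr => monotone_projIcc hT.out.le hr
  have f4 : f T = (π (t1 T)).pair (mop N (-1) 0 g) := by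
    simp only [hf, projIcc_right]; rfl
  have f5 : ∀ r, T ≤ r → f r = f T := fun r hr => by
    simp only [hf, projIcc_right, projIcc_of_right_le hT.out.le hr]
  have f6 : f 0 = (π (t0 T)).pair (mop N (-1) 0 g) := by
    simp only [hf, projIcc_left]; rfl
  have H : ∀ φ ψ : ℝ → ℝ, (∀ r, HasDerivAt φ (ψ r) r) → Continuous ψ →
      φ T * f T - φ 0 * γ.pair (mop N (-1) 0 g) - (∫ r in (0 : ℝ)..T, ψ r * f r) ≤
        a + C * (∫ r in (0 : ℝ)..T, |φ r|) + C * ∫ r in (0 : ℝ)..T, φ r ^ 2 := by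
    rw [f4]; exact hC γ a π h
  refine ⟨?_, fun s t hst l => ?_⟩
  · rw [← f6]; exact initial_eq_of_test hT.out hC0 f1 f2 f3 f5 H
  · have := increment_le_of_test hT.out hC0 f1 f2 f3 f5 H s.2.1 hst t.2.2 l
    simpa only [hf, projIcc_val] using this

lemma abs_pair_mop_sub_le {m : Meas n} (hm : m ∈ F1 n) (N : ℕ) {F : Cyl n → ℝ}
    (hF : Continuous F) :
    |m.pair (mop N (-1) 0 F) - m.pair F| ≤ ∫ u, |mop N (-1) 0 F u - F u| := by
  have hF' := BM.of_continuous hF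
  rw [← m.pair_sub (hF'.isC1_mop N (-1) 0).cont hF]
  exact F1.abs_pair_le hm ((hF'.mop N (-1) 0).sub hF')

/-- The tests vanish on `Γ`, but both measures have bounded densities, so `L¹` convergence of
Dirichlet mollifications reaches every continuous function. -/
lemma Good.initial {θ : Cyl n → ℝ} (hθ : Continuous θ) (hb : ∀ r : bdry n, θ r.1 = b r)
    {γ : Meas n} (hγ : γ ∈ F1 n) {a : ℝ} {π : TimeI T → Meas n} (h : Good β J b γ a π) :
    π (t0 T) = γ := by
  refine Meas.ext_of_pair fun F hF => ?_
  have hF' := BM.of_continuous hF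
  have key : ∀ {m : Meas n}, m ∈ F1 n →
      Tendsto (fun N => m.pair (mop N (-1) 0 F)) atTop (𝓝 (m.pair F)) := by
    intro m hm
    rw [tendsto_iff_dist_tendsto_zero]
    exact squeeze_zero (fun _ => dist_nonneg) (fun N => abs_pair_mop_sub_le hm N hF)
      (tendsto_integral_abs_mop_sub (Or.inr rfl) hF'.1 hF'.2.choose_spec)
  refine tendsto_nhds_unique (key (h.mem _)) ((key hγ).congr fun N => ?_)
  obtain ⟨C, -, hC⟩ := Good.increment (T := T) (β := β) (J := J) hθ hb N hF
  exact (hC γ a π h).1.symm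

/-- Uniform weak equicontinuity in time. -/
lemma Good.modulus {θ : Cyl n → ℝ} (hθ : Continuous θ) (hb : ∀ r : bdry n, θ r.1 = b r)
    (γ : Meas n) (a : ℝ) {F : Cyl n → ℝ} (hF : Continuous F) {ε : ℝ} (hε : 0 < ε) :
    ∃ δ > 0, ∀ π : TimeI T → Meas n, Good β J b γ a π → ∀ s t : TimeI T, |(s : ℝ) - t| < δ →
      |(π s).pair F - (π t).pair F| < ε := by
  have hF' := BM.of_continuous hF
  obtain ⟨N, hN⟩ := ((tendsto_integral_abs_mop_sub (ε := -1) (Or.inr rfl) hF'.1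
    hF'.2.choose_spec).eventually_lt_const (show (0 : ℝ) < ε / 4 by linarith)).exists
  obtain ⟨C, hC0, hC⟩ := Good.increment (T := T) (β := β) (J := J) hθ hb N hF
  -- The choice `l = ±L` brings the contribution of `a` to the increment below `ε/8`; the remaining
  -- terms, at most `K(t - s)`, are then made small through `δ`.
  set L : ℝ := 8 * (|a| + 1) / ε with hL
  have hL0 : 0 < L := by positivity
  have hLε : L * (ε / 8) = |a| + 1 := by rw [hL]; field_simp
  set K : ℝ := C * (L + L ^ 2) + 1 with hK
  have hK0 : 0 < K := by positivity
  refine ⟨L * (ε / 8) / K, by positivity, fun π h s t hst => ?_⟩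
  have key : ∀ s t : TimeI T, s ≤ t → (t : ℝ) - s < L * (ε / 8) / K →
      |(π t).pair (mop N (-1) 0 F) - (π s).pair (mop N (-1) 0 F)| < ε / 2 := by
    intro s t hst hd
    have hst' : (0 : ℝ) ≤ t - s := sub_nonneg.2 hst
    have h1 := (hC γ a π h).2 s t hst L
    have h2 := (hC γ a π h).2 s t hst (-L)
    rw [abs_neg, neg_sq] at h2
    rw [abs_of_pos hL0] at h1 h2
    have h3 : K * (t - s) < L * (ε / 8) := by
      rw [lt_div_iff₀ hK0] at hd; linarith
    have h4 : C * (L * (t - s)) + C * (L ^ 2 * (t - s)) ≤ K * (t - s) := by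
      rw [hK]; nlinarith
    have h5 := le_abs_self a
    have h6 : L * |(π t).pair (mop N (-1) 0 F) - (π s).pair (mop N (-1) 0 F)| <
        L * (ε / 2) := by
      rcases abs_cases ((π t).pair (mop N (-1) 0 F) - (π s).pair (mop N (-1) 0 F)) with hc | hc <;>
        rw [hc.1] <;> nlinarith
    exact lt_of_mul_lt_mul_left h6 hL0.le
  have h1 := abs_pair_mop_sub_le (h.mem s) N hF
  have h2 := abs_pair_mop_sub_le (h.mem t) N hF
  have h3 : |(π s).pair (mop N (-1) 0 F) - (π t).pair (mop N (-1) 0 F)| < ε / 2 := by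
    rcases le_total s t with hle | hle
    · rw [abs_sub_comm]; exact key s t hle (by linarith [(abs_lt.1 hst).1])
    · exact key t s hle (by linarith [(abs_lt.1 hst).2])
  have h4 := abs_sub_abs_le_abs_sub ((π s).pair F) ((π t).pair F)
  rw [abs_lt] at *
  have e1 := abs_le.1 h1
  have e2 := abs_le.1 h2
  constructor <;> linarith [e1.1, e1.2, e2.1, e2.2, h3.1, h3.2]

lemma Good.continuous_pair {θ : Cyl n → ℝ} (hθ : Continuous θ) (hb : ∀ r : bdry n, θ r.1 = b r)
    {γ : Meas n} {a : ℝ} {π : TimeI T → Meas n} (h : Good β J b γ a π) {F : Cyl n → ℝ}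
    (hF : Continuous F) : Continuous fun t => (π t).pair F := by
  rw [Metric.continuous_iff]
  intro t ε hε
  obtain ⟨δ, hδ, hd⟩ := Good.modulus (T := T) (β := β) (J := J) hθ hb γ a hF hε
  exact ⟨δ, hδ, fun s hs => hd π h s t hs⟩

end Modulus

/-! ### Regularity in time of the mollified density -/

section TimeRegularity

set_option linter.unusedSectionVars false

variable {n : ℕ} {T : ℝ} [hT : Fact (0 < T)] {β : ℝ} {J : KacKernel n} {b : bdry n → ℝ}

/-- Weak continuity handles the time variable for a fixed kernel; the change of kernel costs its
`L¹` distance, uniformly in time because densities are at most one. -/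
lemma continuous_pair_kernel {π : TimeI T → Meas n} (hm : ∀ t, π t ∈ F1 n)
    (hc : ∀ F : Cyl n → ℝ, Continuous F → Continuous fun t => (π t).pair F)
    {K : Cyl n → Cyl n → ℝ} (hK : Continuous (Function.uncurry K)) :
    Continuous (Function.uncurry fun (t : TimeI T) u => (π t).pair (K u)) := by
  have hKu : ∀ u, Continuous (K u) := fun u => hK.comp (Continuous.prodMk_right u)
  rw [continuous_iff_continuousAt]
  rintro ⟨t₀, u₀⟩
  have h1 : Continuous fun u => ∫ v, |K u v - K u₀ v| := by
    refine continuous_parametric_integral_of_continuous (s := univ) ?_ isCompact_univ |>.congr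
      fun u => by rw [Measure.restrict_univ]
    exact (hK.sub ((hKu u₀).comp continuous_snd)).abs
  have h2 : Continuous fun t => (π t).pair (K u₀) := hc _ (hKu u₀)
  have h3 : Tendsto (fun p : TimeI T × Cyl n => (∫ v, |K p.2 v - K u₀ v|)
      + |(π p.1).pair (K u₀) - (π t₀).pair (K u₀)|) (𝓝 (t₀, u₀)) (𝓝 0) := by
    have : Continuous fun p : TimeI T × Cyl n => (∫ v, |K p.2 v - K u₀ v|)
      + |(π p.1).pair (K u₀) - (π t₀).pair (K u₀)| :=
      (h1.comp continuous_snd).add (((h2.comp continuous_fst).sub continuous_const).abs)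
    have h4 := this.tendsto (t₀, u₀)
    simpa using h4
  rw [ContinuousAt, tendsto_iff_dist_tendsto_zero]
  refine squeeze_zero (fun _ => dist_nonneg) (fun p => ?_) h3
  rw [Real.dist_eq]
  have e : (π p.1).pair (K p.2) - (π t₀).pair (K u₀) =
      (π p.1).pair (fun v => K p.2 v - K u₀ v)
        + ((π p.1).pair (K u₀) - (π t₀).pair (K u₀)) := by
    rw [(π p.1).pair_sub (hKu _) (hKu _)]; ring
  change |(π p.1).pair (K p.2) - (π t₀).pair (K u₀)| ≤ _
  rw [e]
  exact (abs_add_le _ _).trans (add_le_add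
    (F1.abs_pair_le (hm _) ((BM.of_continuous (hKu _)).sub (BM.of_continuous (hKu _)))) le_rfl)

lemma IsDensity.mop_eq_pair {π : TimeI T → Meas n} {ρ : TimeI T → Cyl n → ℝ} (h : IsDensity π ρ)
    (N : ℕ) (ε : ℝ) (α : Fin (n + 1) → ℕ) (t : TimeI T) (u : Cyl n) :
    mop N ε α (ρ t) u = (π t).pair (fun v => kern N ε α u v) := by
  rw [h.pair_eq]
  unfold mop
  congr 1; ext v; ring

lemma IsDensity.continuous_mop_sub {π : TimeI T → Meas n} {ρ : TimeI T → Cyl n → ℝ}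
    (h : IsDensity π ρ) (hc : ∀ F : Cyl n → ℝ, Continuous F → Continuous fun t => (π t).pair F)
    {θ : Cyl n → ℝ} (hθ : BM θ) (N : ℕ) (ε : ℝ) (α : Fin (n + 1) → ℕ) :
    Continuous fun p : TimeI T × Cyl n => mop N ε α (fun v => ρ p.1 v - θ v) p.2 := by
  have e : (fun p : TimeI T × Cyl n => mop N ε α (fun v => ρ p.1 v - θ v) p.2) =
      fun p => (π p.1).pair (fun v => kern N ε α p.2 v) - mop N ε α θ p.2 := by
    ext p
    rw [mop_sub N ε α (h.meas_slice _) (h.abs_le _) hθ.1 hθ.2.choose_spec, h.mop_eq_pair]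
  rw [e]
  exact (continuous_pair_kernel h.mem hc (K := fun u v => kern N ε α u v)
    (continuous_kern N ε α)).sub
    ((hθ.isC1_mop N ε α).cont.comp continuous_snd)

lemma IsDensity.continuous_rhoN {π : TimeI T → Meas n} {ρ : TimeI T → Cyl n → ℝ}
    (h : IsDensity π ρ) (hc : ∀ F : Cyl n → ℝ, Continuous F → Continuous fun t => (π t).pair F)
    {θ : Cyl n → ℝ} (hθ : IsC1 θ) (N : ℕ) :
    Continuous fun p : TimeI T × Cyl n => rhoN N θ (ρ p.1) p.2 :=
  (h.continuous_mop_sub hc hθ.bm N (-1) 0).add (hθ.cont.comp continuous_snd)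

lemma IsDensity.continuous_pderiv_rhoN {π : TimeI T → Meas n} {ρ : TimeI T → Cyl n → ℝ}
    (h : IsDensity π ρ) (hc : ∀ F : Cyl n → ℝ, Continuous F → Continuous fun t => (π t).pair F)
    {θ : Cyl n → ℝ} (hθ : IsC1 θ) (N : ℕ) (k : Fin (n + 1)) :
    Continuous fun p : TimeI T × Cyl n => pderiv k (rhoN N θ (ρ p.1)) p.2 := by
  simp only [pderiv_rhoN N hθ (h.bm_slice _)]
  exact (h.continuous_mop_sub hc hθ.bm N (-1) _).add ((hθ.contD k).comp continuous_snd)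

end TimeRegularity

/-! ### Steklov averages -/

section Steklov

/-- A chain rule without derivatives. Summation by parts, with `r` frozen outside `[0,T]`, turns the
right side into `τ⁻¹ ∫ (r_t - r_{t-τ}) y_t` over `[0, T + τ]`. Convexity, in the form of `h`, bounds
the integrand below by increments of `Φ`, which telescope to the values at the two ends. -/
lemma steklov_ineq {r y Φ : ℝ → ℝ} {T τ : ℝ} (hτ : 0 < τ) (hr : Continuous r)
    (hy : Continuous y) (hΦ : Continuous Φ) (hr0 : ∀ s ≤ 0, r s = r 0) (hrT : ∀ s, T ≤ s → r s = r T)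
    (hΦ0 : ∀ s ≤ 0, Φ s = Φ 0) (hΦT : ∀ s, T ≤ s → Φ s = Φ T) (hT : 0 < T)
    (h : ∀ s s', Φ s - Φ s' ≤ (r s - r s') * y s) :
    Φ T - Φ 0 ≤ r T * (τ⁻¹ * ∫ s in T..(T + τ), y s) - r 0 * (τ⁻¹ * ∫ s in (0 : ℝ)..(0 + τ), y s)
      - ∫ t in (0 : ℝ)..T, r t * (τ⁻¹ * (y (t + τ) - y t)) := by
  have i : ∀ {f : ℝ → ℝ}, Continuous f → ∀ a b, IntervalIntegrable f volume a b :=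
    fun hf a b => hf.intervalIntegrable a b
  have cs : Continuous fun t => r (t - τ) := hr.comp (continuous_id.sub continuous_const)
  have cΦ : Continuous fun t => Φ (t - τ) := hΦ.comp (continuous_id.sub continuous_const)
  have ca : Continuous fun t => y (t + τ) := hy.comp (continuous_id.add continuous_const)
  have cry : Continuous fun t => r t * y t := hr.mul hy
  have cra : Continuous fun t => r t * y (t + τ) := hr.mul ca
  have csy : Continuous fun t => r (t - τ) * y t := cs.mul hy
  have e1 : r T * ∫ s in T..(T + τ), y s = ∫ s in T..(T + τ), r s * y s := by
    rw [← intervalIntegral.integral_const_mul]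
    refine intervalIntegral.integral_congr fun s hs => ?_
    rw [uIcc_of_le (by linarith)] at hs
    simp only [hrT s hs.1]
  have e2 : r 0 * ∫ s in (0 : ℝ)..(0 + τ), y s = ∫ s in (0 : ℝ)..τ, r (s - τ) * y s := by
    rw [zero_add, ← intervalIntegral.integral_const_mul]
    refine intervalIntegral.integral_congr fun s hs => ?_
    rw [uIcc_of_le hτ.le] at hs
    simp only [hr0 (s - τ) (by linarith [hs.2])]
  have e3 : ∫ t in (0 : ℝ)..T, r t * y (t + τ) = ∫ t in τ..(T + τ), r (t - τ) * y t := by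
    have := intervalIntegral.integral_comp_add_right (a := 0) (b := T)
      (fun t => r (t - τ) * y t) τ
    simpa using this
  have e4 : ∫ t in (0 : ℝ)..T, r t * (τ⁻¹ * (y (t + τ) - y t)) =
      τ⁻¹ * ((∫ t in (0 : ℝ)..T, r t * y (t + τ)) - ∫ t in (0 : ℝ)..T, r t * y t) := by
    rw [← intervalIntegral.integral_sub (i cra _ _) (i cry _ _),
      ← intervalIntegral.integral_const_mul]
    congr 1; ext t; ring
  have e5 := intervalIntegral.integral_add_adjacent_intervals (i cry 0 T)
    (i cry T (T + τ))
  have e6 := intervalIntegral.integral_add_adjacent_intervals (i csy 0 τ)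
    (i csy τ (T + τ))
  have e7 : ∫ t in (0 : ℝ)..(T + τ), (Φ t - Φ (t - τ)) ≤
      ∫ t in (0 : ℝ)..(T + τ), (r t * y t - r (t - τ) * y t) :=
    intervalIntegral.integral_mono_on (by linarith) (i (hΦ.sub cΦ) _ _)
      (i (cry.sub csy) _ _) fun t _ => by
        have := h t (t - τ); rw [sub_mul] at this; exact this
  rw [intervalIntegral.integral_sub (i hΦ _ _) (i cΦ _ _),
    intervalIntegral.integral_sub (i cry _ _) (i csy _ _),
    intervalIntegral.integral_comp_sub_right Φ τ] at e7
  have e8 := intervalIntegral.integral_add_adjacent_intervals (i hΦ 0 T) (i hΦ T (T + τ))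
  have e9 := intervalIntegral.integral_add_adjacent_intervals (i hΦ (0 - τ) 0) (i hΦ 0 T)
  have e10 : ∫ t in T..(T + τ), Φ t = τ * Φ T := by
    rw [intervalIntegral.integral_congr (g := fun _ => Φ T) fun t ht => ?_]
    · simp
    · rw [uIcc_of_le (by linarith)] at ht; exact hΦT t ht.1
  have e11 : ∫ t in (0 - τ)..0, Φ t = τ * Φ 0 := by
    rw [intervalIntegral.integral_congr (g := fun _ => Φ 0) fun t ht => ?_]
    · simp
    · rw [uIcc_of_le (by linarith)] at ht; exact hΦ0 t ht.2
  have e12 : T + τ - τ = T := by ring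
  rw [e12] at e7
  have e13 : Φ T - Φ 0 = τ⁻¹ * (τ * Φ T - τ * Φ 0) := by field_simp
  rw [e13, e4]
  have e14 : r T * (τ⁻¹ * ∫ s in T..(T + τ), y s) - r 0 * (τ⁻¹ * ∫ s in (0 : ℝ)..(0 + τ), y s)
      - τ⁻¹ * ((∫ t in (0 : ℝ)..T, r t * y (t + τ)) - ∫ t in (0 : ℝ)..T, r t * y t) =
      τ⁻¹ * (r T * (∫ s in T..(T + τ), y s) - r 0 * (∫ s in (0 : ℝ)..(0 + τ), y s)
        - ((∫ t in (0 : ℝ)..T, r t * y (t + τ)) - ∫ t in (0 : ℝ)..T, r t * y t)) := by ring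
  rw [e14]
  refine mul_le_mul_of_nonneg_left ?_ (inv_nonneg.2 hτ.le)
  rw [e1, e2, e3]
  linarith

/-- The regularized entropy. -/
def ent (δ r : ℝ) : ℝ := (r + δ) * Real.log (r + δ) + (1 - r + δ) * Real.log (1 - r + δ)

lemma mul_log_tangent {x x' : ℝ} (hx : 0 < x) (hx' : 0 < x') :
    x * Real.log x - x' * Real.log x' ≤ (Real.log x + 1) * (x - x') := by
  have h1 := Real.log_le_sub_one_of_pos (div_pos hx hx')
  rw [Real.log_div hx.ne' hx'.ne'] at h1
  have h2 := mul_le_mul_of_nonneg_left h1 hx'.le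
  have h3 : x' * (x / x' - 1) = x - x' := by field_simp
  rw [h3] at h2
  nlinarith

lemma ent_tangent {δ r r' : ℝ} (h0 : 0 < r + δ) (h1 : 0 < 1 - r + δ) (h0' : 0 < r' + δ)
    (h1' : 0 < 1 - r' + δ) : ent δ r - ent δ r' ≤ (r - r') * logit δ r := by
  have e1 := mul_log_tangent h0 h0'
  have e2 := mul_log_tangent h1 h1'
  unfold ent logit
  nlinarith

/-- The range up to `5/2` covers `r + δ` and `1 - r + δ` when `r` lies in `[-δ/2, 1 + δ/2]` and `δ ≤
1`. -/
lemma mul_log_bounds {x : ℝ} (hx : 0 < x) (hx' : x ≤ 5 / 2) :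
    -1 ≤ x * Real.log x ∧ x * Real.log x ≤ 4 := by
  constructor
  · have := Real.one_sub_inv_le_log_of_pos hx
    have h2 := mul_le_mul_of_nonneg_left this hx.le
    rw [mul_sub, mul_inv_cancel₀ hx.ne'] at h2
    linarith
  · have := Real.log_le_sub_one_of_pos hx
    nlinarith

lemma abs_log_le {c x : ℝ} (hc : 0 < c) (hcx : c ≤ x) (hx : x ≤ 2) :
    |Real.log x| ≤ 1 + 1 / c := by
  have hx0 : 0 < x := hc.trans_le hcx
  have h1 := Real.log_le_sub_one_of_pos hx0
  have h2 := Real.one_sub_inv_le_log_of_pos hx0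
  have h3 : x⁻¹ ≤ 1 / c := by rw [one_div]; exact inv_anti₀ hc hcx
  have h4 : 0 < 1 / c := by positivity
  rw [abs_le]
  constructor <;> linarith

lemma abs_logit_le {δ c c' x : ℝ} (hc : 0 < c) (hc' : 0 < c') (hcx : c ≤ x) (hx' : c' ≤ 1 - x)
    (hδ : 0 < δ) (hδ1 : δ ≤ 1) : |logit δ x| ≤ 2 + 1 / c + 1 / c' := by
  have h1 := abs_log_le (x := x + δ) hc (by linarith) (by linarith)
  have h2 := abs_log_le (x := 1 - x + δ) hc' (by linarith) (by linarith)
  have := abs_sub (Real.log (x + δ)) (Real.log (1 - x + δ))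
  unfold logit
  linarith

/-- Each of the four terms `x log x` lies between `-1` and `4`, which accounts for `10 = 2 · 1 + 2 ·
4`; the linear part uses `|r - r'| ≤ 2`. -/
lemma entropy_diff_lower {δ r r' l L : ℝ} (hδ : 0 < δ) (hδ1 : δ ≤ 1) (hl : |l| ≤ L)
    (h0 : -(δ / 2) ≤ r) (h1 : r ≤ 1 + δ / 2) (h0' : -(δ / 2) ≤ r') (h1' : r' ≤ 1 + δ / 2) :
    -(10 + 2 * L) ≤ (ent δ r - l * r) - (ent δ r' - l * r') := by
  have e1 := mul_log_bounds (x := r + δ) (by linarith) (by linarith)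
  have e2 := mul_log_bounds (x := 1 - r + δ) (by linarith) (by linarith)
  have e3 := mul_log_bounds (x := r' + δ) (by linarith) (by linarith)
  have e4 := mul_log_bounds (x := 1 - r' + δ) (by linarith) (by linarith)
  have e5 : l * (r - r') ≤ L * 2 := by
    refine (le_abs_self _).trans ?_
    rw [abs_mul]
    exact mul_le_mul hl (abs_le.2 ⟨by linarith, by linarith⟩) (abs_nonneg _)
      ((abs_nonneg _).trans hl)
  unfold ent
  linarith [e1.1, e2.1, e3.2, e4.2]

end Steklov

/-! ### Dependence of the spatial functional on the test field. -/

section SpatLimit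

variable {n : ℕ}

lemma spat_bound_of (β : ℝ) (J : KacKernel n) (B : ℝ) : ∃ C, 0 ≤ C ∧ ∀ (b : bdry n → ℝ)
      (V : Fin (n + 1) → Cyl n → ℝ) (ρ : Cyl n → ℝ), (∀ r, |b r| ≤ 1) → (∀ k u, |V k u| ≤ B) →
      (∀ k u, |pderiv k (V k) u| ≤ B) → Measurable ρ → (∀ u, 0 ≤ ρ u) → (∀ u, ρ u ≤ 1) →
        |spat β J b ρ V| ≤ C := by
  obtain ⟨D, hD0, hD⟩ := pderiv_star_bound J
  set m0 : ℝ := volume.real (univ : Set (Cyl n)) with hm0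
  have hm : 0 ≤ m0 := measureReal_nonneg
  set m1 : ℝ := volume.real (univ : Set (Fin n → UnitAddCircle)) with hm1
  have hm1' : 0 ≤ m1 := measureReal_nonneg
  refine ⟨((n + 1) * |B|) * m0 + (|B| * m1 + |B| * m1) + |β| * (((n + 1) * (|B| * D)) * m0)
    + 1 / 2 * (((n + 1) * (|B| * |B|)) * m0), by positivity, fun b V ρ hb hV hV' hρ h0 h1 => ?_⟩
  have hV1 : ∀ k u, |V k u| ≤ |B| := fun k u => (hV k u).trans (le_abs_self B)
  have hV2 : ∀ k u, |pderiv k (V k) u| ≤ |B| := fun k u => (hV' k u).trans (le_abs_self B)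
  have hσ : ∀ u x C, 0 ≤ C → |x| ≤ C → |mobility (ρ u) * x| ≤ C := fun u x C hC hx => by
    rw [abs_mul, abs_of_nonneg (mobility_nonneg (h0 u) (h1 u))]
    have := mobility_le (ρ u)
    exact (mul_le_mul (by linarith) hx (abs_nonneg _) zero_le_one).trans_eq (one_mul C)
  have b1 : |∫ u, ρ u * ∑ k, pderiv k (V k) u| ≤ ((n + 1) * |B|) * m0 := by
    refine abs_integral_le_const fun u => ?_
    rw [abs_mul, abs_of_nonneg (h0 u)]
    exact (mul_le_mul (h1 u) (abs_sum_le_card fun k => hV2 k u) (abs_nonneg _)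
      zero_le_one).trans_eq (one_mul _)
  have b2 : |∫ u, mobility (ρ u) * ∑ k, V k u * pderiv k (J.star ρ) u| ≤
      ((n + 1) * (|B| * D)) * m0 := by
    refine abs_integral_le_const fun u => hσ u _ _ (by positivity) (abs_sum_le_card fun k => ?_)
    rw [abs_mul]
    exact mul_le_mul (hV1 k u) ((hD ρ hρ h0 h1 k).2 u) (abs_nonneg _) (abs_nonneg _)
  have b3 : |∫ u, mobility (ρ u) * ∑ k, V k u * V k u| ≤ ((n + 1) * (|B| * |B|)) * m0 := by
    refine abs_integral_le_const fun u => hσ u _ _ (by positivity) (abs_sum_le_card fun k => ?_)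
    rw [abs_mul]
    exact mul_le_mul (hV1 k u) (hV1 k u) (abs_nonneg _) (abs_nonneg _)
  have b4 : |surfaceIntegral (fun r : bdry n => b r * normal1 r * V 0 r.1)| ≤
      |B| * m1 + |B| * m1 := by
    have hp : ∀ r : bdry n, |normal1 r| ≤ 1 → |b r * normal1 r * V 0 r.1| ≤ |B| := by
      intro r hr
      rw [abs_mul, abs_mul]
      have h2 := mul_le_mul (hb r) hr (abs_nonneg _) zero_le_one
      exact (mul_le_mul h2 (hV1 0 r.1) (abs_nonneg _) (by norm_num)).trans_eq (by ring)
    refine (abs_add_le _ _).trans (add_le_add ?_ ?_) <;> rw [← Real.norm_eq_abs] <;>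
      refine norm_integral_le_of_norm_le_const (ae_of_all _ fun y => hp _ ?_)
    · simp [normal1, rightPt]
    · simp [normal1, leftPt]
  unfold spat
  set X1 := ∫ u, ρ u * ∑ k, pderiv k (V k) u
  set X2 := ∫ u, mobility (ρ u) * ∑ k, V k u * pderiv k (J.star ρ) u
  set X3 := ∫ u, mobility (ρ u) * ∑ k, V k u * V k u
  set Y := surfaceIntegral (fun r : bdry n => b r * normal1 r * V 0 r.1)
  have d1 : |β * X2| ≤ |β| * (((n + 1) * (|B| * D)) * m0) := by
    rw [abs_mul]; exact mul_le_mul_of_nonneg_left b2 (abs_nonneg _)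
  have d2 : |1 / 2 * X3| ≤ 1 / 2 * (((n + 1) * (|B| * |B|)) * m0) := by
    rw [abs_mul, abs_of_pos (by norm_num : (0 : ℝ) < 1 / 2)]
    exact mul_le_mul_of_nonneg_left b3 (by norm_num)
  have d3 := abs_sub (-X1 + Y - β * X2) (1 / 2 * X3)
  have d4 := abs_sub (-X1 + Y) (β * X2)
  have d5 := abs_add_le (-X1) Y
  rw [abs_neg] at d5
  linarith

lemma tendsto_integral_of_bound {Y : Type*} [MeasurableSpace Y] {μ : Measure Y} [IsFiniteMeasure μ]
    {f : ℕ → Y → ℝ} {g : Y → ℝ} {C : ℝ} (hf : ∀ j, AEStronglyMeasurable (f j) μ)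
    (hb : ∀ j y, |f j y| ≤ C) (h : ∀ y, Tendsto (fun j => f j y) atTop (𝓝 (g y))) :
    Tendsto (fun j => ∫ y, f j y ∂μ) atTop (𝓝 (∫ y, g y ∂μ)) :=
  tendsto_integral_of_dominated_convergence (fun _ => C) hf (integrable_const C)
    (fun j => ae_of_all _ (hb j)) (ae_of_all _ h)

lemma spat_tendsto {β : ℝ} {J : KacKernel n} {b : bdry n → ℝ} {θ : Cyl n → ℝ} (hθ : Continuous θ)
    (hb : ∀ r : bdry n, θ r.1 = b r) {ρ : Cyl n → ℝ} (hρ : BM ρ)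
    (hJ : ∀ k, BM (pderiv k (J.star ρ)))
    {V : ℕ → Fin (n + 1) → Cyl n → ℝ} {V' : Fin (n + 1) → Cyl n → ℝ} {B : ℝ}
    (hV : ∀ j k, IsC1 (V j k)) (hB : ∀ j k u, |V j k u| ≤ B)
    (hB' : ∀ j k u, |pderiv k (V j k) u| ≤ B)
    (hl : ∀ k u, Tendsto (fun j => V j k u) atTop (𝓝 (V' k u)))
    (hl' : ∀ k u, Tendsto (fun j => pderiv k (V j k) u) atTop (𝓝 (pderiv k (V' k) u))) :
    Tendsto (fun j => spat β J b ρ (V j)) atTop (𝓝 (spat β J b ρ V')) := by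
  obtain ⟨C, hC⟩ := hρ.2
  have hσ := hρ.mobility
  obtain ⟨S, hS⟩ := hσ.2
  choose D hD using fun k => (hJ k).2
  have h1 : Tendsto (fun j => ∫ u, ρ u * ∑ k, pderiv k (V j k) u) atTop
      (𝓝 (∫ u, ρ u * ∑ k, pderiv k (V' k) u)) := by
    refine tendsto_integral_of_bound (C := C * ((n + 1) * B)) (fun j => ?_) (fun j u => ?_)
      fun u => (tendsto_finsetSum _ fun k _ => hl' k u).const_mul _
    · exact (hρ.mul (BM.sum fun k _ => (hV j k).bm_pderiv k)).1.aestronglyMeasurable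
    · rw [abs_mul]
      exact mul_le_mul (hC u) (abs_sum_le_card fun k => hB' j k u) (abs_nonneg _)
        ((abs_nonneg _).trans (hC u))
  have h2 : Tendsto (fun j => surfaceIntegral (fun r : bdry n => b r * normal1 r * V j 0 r.1)) atTop
      (𝓝 (surfaceIntegral (fun r : bdry n => b r * normal1 r * V' 0 r.1))) := by
    have key : ∀ (q : (Fin n → UnitAddCircle) → bdry n) (c : ℝ), (Continuous fun y => (q y).1) →
        (∀ y, normal1 (q y) = c) →
        Tendsto (fun j => ∫ y, b (q y) * normal1 (q y) * V j 0 (q y).1) atTop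
          (𝓝 (∫ y, b (q y) * normal1 (q y) * V' 0 (q y).1)) := by
      intro q c hq hc
      have hbm : BM fun y => θ (q y).1 * c := BM.of_continuous ((hθ.comp hq).mul continuous_const)
      obtain ⟨E, hE⟩ := hbm.2
      simp only [hc, ← hb]
      refine tendsto_integral_of_bound (C := E * B) (fun j => ?_) (fun j y => ?_) fun y =>
        (hl 0 _).const_mul _
      · exact (((hθ.comp hq).mul continuous_const).mul
          ((hV j 0).cont.comp hq)).aestronglyMeasurable
      · rw [abs_mul]
        exact mul_le_mul (hE y) (hB j 0 _) (abs_nonneg _) ((abs_nonneg _).trans (hE y))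
    unfold surfaceIntegral
    exact (key rightPt 1 (continuous_const.prodMk continuous_id) fun _ => rfl).add
      (key leftPt (-1) (continuous_const.prodMk continuous_id) fun _ => rfl)
  have h3 : Tendsto (fun j => ∫ u, mobility (ρ u) * ∑ k, V j k u * pderiv k (J.star ρ) u) atTop
      (𝓝 (∫ u, mobility (ρ u) * ∑ k, V' k u * pderiv k (J.star ρ) u)) := by
    refine tendsto_integral_of_bound (C := S * ((n + 1) * (B * ∑ k, |D k|))) (fun j => ?_)
      (fun j u => ?_)
      fun u => (tendsto_finsetSum _ fun k _ => (hl k u).mul_const _).const_mul _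
    · exact (hσ.mul (BM.sum fun k _ => (hV j k).bm.mul (hJ k))).1.aestronglyMeasurable
    · rw [abs_mul]
      refine mul_le_mul (hS u) (abs_sum_le_card fun k => ?_) (abs_nonneg _)
        ((abs_nonneg _).trans (hS u))
      rw [abs_mul]
      exact mul_le_mul (hB j k u) (((hD k u).trans (le_abs_self _)).trans
        (Finset.single_le_sum (f := fun k => |D k|) (fun k _ => abs_nonneg _) (Finset.mem_univ k)))
        (abs_nonneg _) ((abs_nonneg _).trans (hB j k u))
  have h4 : Tendsto (fun j => ∫ u, mobility (ρ u) * ∑ k, V j k u * V j k u) atTop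
      (𝓝 (∫ u, mobility (ρ u) * ∑ k, V' k u * V' k u)) := by
    refine tendsto_integral_of_bound (C := S * ((n + 1) * (B * B))) (fun j => ?_)
      (fun j u => ?_)
      fun u => (tendsto_finsetSum _ fun k _ => (hl k u).mul (hl k u)).const_mul _
    · exact (hσ.mul (BM.sum fun k _ => (hV j k).bm.mul (hV j k).bm)).1.aestronglyMeasurable
    · rw [abs_mul]
      refine mul_le_mul (hS u) (abs_sum_le_card fun k => ?_) (abs_nonneg _)
        ((abs_nonneg _).trans (hS u))
      rw [abs_mul]
      exact mul_le_mul (hB j k u) (hB j k u) (abs_nonneg _) ((abs_nonneg _).trans (hB j k u))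
  unfold spat
  exact ((h1.neg.add h2).sub (h3.const_mul β)).sub (h4.const_mul _)

end SpatLimit

/-! ### The uniform energy estimate. -/

section Energy

set_option linter.unusedSectionVars false

variable {n : ℕ} {T : ℝ} [hT : Fact (0 < T)] {β : ℝ} {J : KacKernel n} {b : bdry n → ℝ}

/-- The forward Steklov average of a function on `[0,T]`, extended by its final value. -/
def stek (τ : ℝ) (Y : TimeI T → Cyl n → ℝ) (t : TimeI T) (u : Cyl n) : ℝ :=
  τ⁻¹ * ∫ s in (t : ℝ)..(t + τ), Y (projIcc 0 T hT.out.le s) u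

lemma continuous_ext {Y : TimeI T → Cyl n → ℝ} (hY : Continuous (Function.uncurry Y)) (u : Cyl n) :
    Continuous fun s : ℝ => Y (projIcc 0 T hT.out.le s) u :=
  (hY.comp (Continuous.prodMk_left u)).comp (continuous_projIcc (h := hT.out.le))

lemma isCTime_stek (τ : ℝ) {Y : TimeI T → Cyl n → ℝ} (hY : Continuous (Function.uncurry Y)) :
    IsCTime 1 (stek τ Y) ∧ tderiv (stek τ Y) =
      fun (t : TimeI T) u => τ⁻¹ * (Y (projIcc 0 T hT.out.le ((t : ℝ) + τ)) u - Y t u) := by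
  have hi : ∀ u a b, IntervalIntegrable (fun s : ℝ => Y (projIcc 0 T hT.out.le s) u) volume a b :=
    fun u a b => (continuous_ext hY u).intervalIntegrable a b
  have e : ∀ (t : ℝ) u, ∫ s in t..(t + τ), Y (projIcc 0 T hT.out.le s) u =
      (∫ s in (0 : ℝ)..(t + τ), Y (projIcc 0 T hT.out.le s) u)
        - ∫ s in (0 : ℝ)..t, Y (projIcc 0 T hT.out.le s) u := fun t u =>
    (intervalIntegral.integral_interval_sub_left (hi u _ _) (hi u _ _)).symm
  refine isCTime_of_hasTD ?_ ?_ fun t u => ?_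
  · have h1 : Continuous (Function.uncurry fun (p : TimeI T × Cyl n) (s : ℝ) =>
        Y (projIcc 0 T hT.out.le s) p.2) :=
      hY.comp (((continuous_projIcc (h := hT.out.le)).comp continuous_snd).prodMk
        (continuous_snd.comp continuous_fst))
    have h2 := intervalIntegral.continuous_parametric_intervalIntegral_of_continuous
      (μ := (volume : Measure ℝ)) (a₀ := 0) h1
      (s := fun p : TimeI T × Cyl n => (p.1 : ℝ) + τ) (by fun_prop)
    have h3 := intervalIntegral.continuous_parametric_intervalIntegral_of_continuous
      (μ := (volume : Measure ℝ)) (a₀ := 0) h1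
      (s := fun p : TimeI T × Cyl n => (p.1 : ℝ)) (by fun_prop)
    have h4 : Continuous fun p : TimeI T × Cyl n => τ⁻¹ *
        ((∫ s in (0 : ℝ)..((p.1 : ℝ) + τ), Y (projIcc 0 T hT.out.le s) p.2)
          - ∫ s in (0 : ℝ)..(p.1 : ℝ), Y (projIcc 0 T hT.out.le s) p.2) :=
      continuous_const.mul (h2.sub h3)
    refine h4.congr fun p => ?_
    simp only [Function.uncurry, stek, e]
  · have h1 : Continuous fun p : TimeI T × Cyl n =>
        (projIcc 0 T hT.out.le ((p.1 : ℝ) + τ), p.2) :=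
      ((continuous_projIcc (h := hT.out.le)).comp (by fun_prop)).prodMk continuous_snd
    exact continuous_const.mul ((hY.comp h1).sub hY)
  · have h1 : HasDerivAt (fun s : ℝ => τ⁻¹ *
        ((∫ r in (0 : ℝ)..(s + τ), Y (projIcc 0 T hT.out.le r) u)
          - ∫ r in (0 : ℝ)..s, Y (projIcc 0 T hT.out.le r) u))
        (τ⁻¹ * (Y (projIcc 0 T hT.out.le ((t : ℝ) + τ)) u
          - Y (projIcc 0 T hT.out.le (t : ℝ)) u)) (t : ℝ) := by
      have h2 := ((continuous_ext hY u).integral_hasStrictDerivAt 0 ((t : ℝ) + τ)).hasDerivAt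
      have h3 := ((continuous_ext hY u).integral_hasStrictDerivAt 0 (t : ℝ)).hasDerivAt
      have h4 := h2.comp_add_const (t : ℝ) τ
      exact (h4.sub h3).const_mul _
    rw [projIcc_val] at h1
    refine h1.hasDerivWithinAt.congr (fun s hs => ?_) ?_
    · simp only [stek, e, projIcc_of_mem hT.out.le hs]
    · simp only [stek, e, projIcc_val]

lemma abs_stek_le {τ : ℝ} (hτ : 0 < τ) {Y : TimeI T → Cyl n → ℝ} {B : ℝ} (hB : ∀ t u, |Y t u| ≤ B)
    (t : TimeI T) (u : Cyl n) : |stek τ Y t u| ≤ B := by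
  unfold stek
  rw [abs_mul, abs_of_pos (inv_pos.2 hτ)]
  have h1 : |∫ s in (t : ℝ)..(t + τ), Y (projIcc 0 T hT.out.le s) u| ≤ B * |(t : ℝ) + τ - t| := by
    rw [← Real.norm_eq_abs]
    exact intervalIntegral.norm_integral_le_of_norm_le_const fun s _ => hB _ u
  rw [add_sub_cancel_left, abs_of_pos hτ] at h1
  calc _ ≤ τ⁻¹ * (B * τ) := mul_le_mul_of_nonneg_left h1 (inv_nonneg.2 hτ.le)
    _ = B := by field_simp

lemma tendsto_stek {Y : TimeI T → Cyl n → ℝ} (hY : Continuous (Function.uncurry Y)) (t : TimeI T)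
    (u : Cyl n) : Tendsto (fun j : ℕ => stek (1 / ((j : ℝ) + 1)) Y t u) atTop (𝓝 (Y t u)) := by
  have h3 := ((continuous_ext hY u).integral_hasStrictDerivAt (t : ℝ) (t : ℝ)).hasDerivAt
  rw [hasDerivAt_iff_tendsto_slope_zero, projIcc_val] at h3
  have h4 : Tendsto (fun j : ℕ => 1 / ((j : ℝ) + 1)) atTop (𝓝[≠] 0) :=
    tendsto_nhdsWithin_iff.2 ⟨tendsto_one_div_add_atTop_nhds_zero_nat,
      Eventually.of_forall fun j => (by positivity : (1 : ℝ) / (j + 1) ≠ 0)⟩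
  refine (h3.comp h4).congr fun j => ?_
  simp [stek]

lemma mop_tendsto (N : ℕ) (ε : ℝ) (α : Fin (n + 1) → ℕ) {A : ℕ → Cyl n → ℝ} {A' : Cyl n → ℝ}
    {B : ℝ} (hA : ∀ j, Continuous (A j)) (hB : ∀ j u, |A j u| ≤ B)
    (h : ∀ u, Tendsto (fun j => A j u) atTop (𝓝 (A' u))) (u : Cyl n) :
    Tendsto (fun j => mop N ε α (A j) u) atTop (𝓝 (mop N ε α A' u)) := by
  obtain ⟨K, hK0, hK⟩ := kern_bound (n := n) N ε α
  refine tendsto_integral_of_bound (C := K * B) (fun j => ?_) (fun j v => ?_) fun v =>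
    (h v).const_mul _
  · exact ((continuous_kern_right N ε α u).mul (hA j)).aestronglyMeasurable
  · rw [abs_mul]; exact mul_le_mul (hK u v) (hB j v) (abs_nonneg _) hK0

lemma mop_abs_bound (N : ℕ) (ε : ℝ) (α : Fin (n + 1) → ℕ) (B : ℝ) : ∃ B', ∀ A : Cyl n → ℝ,
    (∀ u, |A u| ≤ B) → ∀ u, |mop N ε α A u| ≤ B' := by
  obtain ⟨K, hK0, hK⟩ := kern_bound (n := n) N ε α
  refine ⟨K * B * volume.real (univ : Set (Cyl n)), fun A hA u => abs_integral_le_const fun v => ?_⟩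
  rw [abs_mul]; exact mul_le_mul (hK u v) (hA v) (abs_nonneg _) hK0

lemma gradMop_bounds (N : ℕ) (B : ℝ) : ∃ B', ∀ A : Cyl n → ℝ, BM A → (∀ u, |A u| ≤ B) →
    (∀ k u, |gradMop N A k u| ≤ B') ∧ ∀ k u, |pderiv k (gradMop N A k) u| ≤ B' := by
  choose B1 hB1 using fun k : Fin (n + 1) => mop_abs_bound (n := n) N (-1) (Pi.single k 1) B
  choose B2 hB2 using fun k : Fin (n + 1) =>
    mop_abs_bound (n := n) N (-1) (Pi.single k 1 + Pi.single k 1) B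
  have hle : ∀ k, |B1 k| + |B2 k| ≤ ∑ k, (|B1 k| + |B2 k|) := fun k =>
    Finset.single_le_sum (f := fun k => |B1 k| + |B2 k|) (fun k _ => by positivity)
      (Finset.mem_univ k)
  refine ⟨∑ k, (|B1 k| + |B2 k|), fun A hA hB => ⟨fun k u => ?_, fun k u => ?_⟩⟩
  · exact ((hB1 k A hB u).trans (le_abs_self _)).trans (by linarith [hle k, abs_nonneg (B2 k)])
  · rw [gradMop, hA.pderiv_mop]
    exact ((hB2 k A hB u).trans (le_abs_self _)).trans (by linarith [hle k, abs_nonneg (B1 k)])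

/-- Convergence of the local functional along Steklov averages. -/
lemma tendsto_integral_spat_stek {π : TimeI T → Meas n} {ρ : TimeI T → Cyl n → ℝ}
    (h : IsDensity π ρ) {θ : Cyl n → ℝ} (hθ : Continuous θ) (hb : ∀ r : bdry n, θ r.1 = b r)
    (hb1 : ∀ r, |b r| ≤ 1) (N : ℕ) {Y : TimeI T → Cyl n → ℝ}
    (hY : Continuous (Function.uncurry Y)) :
    Tendsto (fun j : ℕ => ∫ t, spat β J b (ρ t) (gradMop N (stek (1 / ((j : ℝ) + 1)) Y t))) atTop
      (𝓝 (∫ t, spat β J b (ρ t) (gradMop N (Y t)))) := by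
  obtain ⟨B, hB0, hB⟩ := exists_bound hY
  obtain ⟨B', hB'⟩ := gradMop_bounds (n := n) N B
  obtain ⟨C, hC0, hC⟩ := spat_bound_of (n := n) β J B'
  obtain ⟨D, hD0, hD⟩ := pderiv_star_bound J
  have hτ : ∀ j : ℕ, (0 : ℝ) < 1 / (j + 1) := fun j => by positivity
  have hsc : ∀ j : ℕ, ∀ t, Continuous (stek (1 / ((j : ℝ) + 1)) Y t) := fun j t =>
    continuous_slice (isCTime_stek _ hY).1.continuous t
  have hsb : ∀ j : ℕ, ∀ t u, |stek (1 / ((j : ℝ) + 1)) Y t u| ≤ B := fun j t u =>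
    abs_stek_le (hτ j) (fun t u => hB (t, u)) t u
  refine tendsto_integral_of_bound (C := C) (fun j => ?_) (fun j t => ?_) fun t => ?_
  · exact (h.integral_spat (β := β) (J := J) hθ hb
      fun k => (isC_gradMop N (isCTime_stek (1 / ((j : ℝ) + 1)) hY).1 k).2).1.1.aestronglyMeasurable
  · have := hB' _ (BM.of_continuous (hsc j t)) (hsb j t)
    exact hC b _ (ρ t) hb1 this.1 this.2 (h.meas_slice t) (h.nonneg t) (h.le_one t)
  · refine spat_tendsto hθ hb (h.bm_slice t) (fun k => (hD (ρ t) (h.meas_slice t) (h.nonneg t)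
      (h.le_one t) k).1) (B := B') (fun j k => (BM.of_continuous (hsc j t)).isC1_mop N _ _)
      (fun j => (hB' _ (BM.of_continuous (hsc j t)) (hsb j t)).1)
      (fun j => (hB' _ (BM.of_continuous (hsc j t)) (hsb j t)).2) (fun k u => ?_) fun k u => ?_
    · exact mop_tendsto N _ _ (fun j => hsc j t) (fun j => hsb j t) (fun u => tendsto_stek hY t u) u
    · have e : ∀ {A : Cyl n → ℝ}, Continuous A → pderiv k (gradMop N A k) =
          mop N (-1) (Pi.single k 1 + Pi.single k 1) A := fun hA => by
        rw [gradMop, (BM.of_continuous hA).pderiv_mop]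
      simp only [e (hsc _ t), e (continuous_slice hY t)]
      exact mop_tendsto N _ _ (fun j => hsc j t) (fun j => hsb j t) (fun u => tendsto_stek hY t u) u

lemma pair_mop_eq {π : TimeI T → Meas n} {ρ : TimeI T → Cyl n → ℝ} (h : IsDensity π ρ)
    {θ : Cyl n → ℝ} (hθ : IsC1 θ) (N : ℕ) (t : TimeI T) {f : Cyl n → ℝ} (hf : BM f) :
    (π t).pair (mop N (-1) 0 f) =
      (∫ u, rhoN N θ (ρ t) u * f u) + ∫ u, (mop N (-1) 0 θ u - θ u) * f u := by
  have hρ := h.bm_slice t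
  rw [h.pair_eq, mop_symm N (-1) hρ.1 hρ.2.choose_spec hf.1 hf.2.choose_spec,
    ← integral_add (((isC1_rhoN N hθ hρ).bm.mul hf).integrable _)
      ((((hθ.bm.mop N _ _).sub hθ.bm).mul hf).integrable _)]
  congr 1; ext u
  rw [rhoN, mop_sub N (-1) 0 hρ.1 hρ.2.choose_spec hθ.bm.1 hθ.bm.2.choose_spec]
  ring

/-- Symmetry moves the mollifier onto `ρ`, whose Dirichlet mollification is `ρ^N` plus a function of
`u` alone. A time-independent factor contributes nothing, by the fundamental theorem of calculus, so
`ρ^N` with its correct boundary values may be used instead. -/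
lemma time_part {π : TimeI T → Meas n} {ρ : TimeI T → Cyl n → ℝ} (h : IsDensity π ρ)
    {θ : Cyl n → ℝ} (hθ : IsC1 θ) (N : ℕ)
    (hR : Continuous fun p : TimeI T × Cyl n => rhoN N θ (ρ p.1) p.2)
    {A : TimeI T → Cyl n → ℝ} (hA : IsCTime 1 A) :
    (π (t1 T)).pair (mop N (-1) 0 (A (t1 T))) - (π (t0 T)).pair (mop N (-1) 0 (A (t0 T)))
      - (∫ t, (π t).pair (mop N (-1) 0 (tderiv A t))) =
    ∫ u, (rhoN N θ (ρ (t1 T)) u * A (t1 T) u - rhoN N θ (ρ (t0 T)) u * A (t0 T) u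
      - ∫ t, rhoN N θ (ρ t) u * tderiv A t u) := by
  have bA : ∀ t, BM (A t) := fun t => BM.of_continuous (continuous_slice hA.continuous t)
  have bD : ∀ t, BM (tderiv A t) := fun t => BM.of_continuous (continuous_slice hA.continuous_tderiv t)
  have bψ : BM fun u => mop N (-1) 0 θ u - θ u := (hθ.bm.mop N _ _).sub hθ.bm
  have bR : ∀ t, BM (rhoN N θ (ρ t)) := fun t => (isC1_rhoN N hθ (h.bm_slice t)).bm
  have bD2 : BM (Function.uncurry (tderiv A)) := BM.of_continuous hA.continuous_tderiv
  have bRD : BM (Function.uncurry fun t u => rhoN N θ (ρ t) u * tderiv A t u) :=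
    (BM.of_continuous hR).mul bD2
  have bψD : BM (Function.uncurry fun (t : TimeI T) u =>
      (mop N (-1) 0 θ u - θ u) * tderiv A t u) := (bψ.comp measurable_snd).mul bD2
  simp only [pair_mop_eq h hθ N _ (bA _), pair_mop_eq h hθ N _ (bD _)]
  rw [integral_add ((BM.integral_right bRD).integrable _) ((BM.integral_right bψD).integrable _),
    integral_integral_swap (bRD.integrable _), integral_integral_swap (bψD.integrable _)]
  have e1 : ∀ u, ∫ t, (mop N (-1) 0 θ u - θ u) * tderiv A t u =
      (mop N (-1) 0 θ u - θ u) * A (t1 T) u - (mop N (-1) 0 θ u - θ u) * A (t0 T) u := fun u => by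
    rw [integral_const_mul, integral_tderiv hA]; ring
  simp only [e1]
  have bRD' : BM (Function.uncurry fun u (t : TimeI T) => rhoN N θ (ρ t) u * tderiv A t u) :=
    bRD.comp (g := fun p : Cyl n × TimeI T => (p.2, p.1)) (by fun_prop)
  have i1 := ((bR (t1 T)).mul (bA (t1 T))).integrable volume
  have i2 := ((bR (t0 T)).mul (bA (t0 T))).integrable volume
  have i3 := (BM.integral_right (μ := (volume : Measure (TimeI T))) bRD').integrable volume
  have j1 := integral_sub (i1.sub i2) i3
  have j2 := integral_sub i1 i2
  simp only [Pi.sub_apply] at j1 j2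
  rw [j1, j2, integral_sub ((bψ.mul (bA _)).integrable _) ((bψ.mul (bA _)).integrable _)]
  ring

/-- Lower bound for the time part of the functional. -/
lemma time_part_lower {π : TimeI T → Meas n} {ρ : TimeI T → Cyl n → ℝ} (h : IsDensity π ρ)
    {θ : Cyl n → ℝ} {c C : ℝ} (hθ : IsC1 θ) (hc : 0 < c) (hC : C < 1)
    (hcC : ∀ u, c ≤ θ u ∧ θ u ≤ C) (N : ℕ)
    (hRc : Continuous fun p : TimeI T × Cyl n => rhoN N θ (ρ p.1) p.2)
    {δ κ τ : ℝ} (hδ : 0 < δ) (hδ1 : δ ≤ 1) (hκ : 0 < κ) (hτ : 0 < τ)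
    (hR : ∀ t u, -(δ / 2) ≤ rhoN N θ (ρ t) u ∧ rhoN N θ (ρ t) u ≤ 1 + δ / 2)
    (hY : Continuous (Function.uncurry fun (t : TimeI T) u => κ * tst δ N θ (ρ t) u)) :
    -(κ * (10 + 2 * (2 + 1 / c + 1 / (1 - C))) * volume.real (univ : Set (Cyl n))) ≤
    (π (t1 T)).pair (mop N (-1) 0 (stek τ (fun t u => κ * tst δ N θ (ρ t) u) (t1 T)))
      - (π (t0 T)).pair (mop N (-1) 0 (stek τ (fun t u => κ * tst δ N θ (ρ t) u) (t0 T)))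
      - (∫ t, (π t).pair (mop N (-1) 0
        (tderiv (stek τ (fun t u => κ * tst δ N θ (ρ t) u)) t))) := by
  set Y : TimeI T → Cyl n → ℝ := fun t u => κ * tst δ N θ (ρ t) u with hYdef
  obtain ⟨hA, hAd⟩ := isCTime_stek τ hY
  rw [time_part h hθ N hRc hA]
  have e0 : -(κ * (10 + 2 * (2 + 1 / c + 1 / (1 - C))) * volume.real (univ : Set (Cyl n))) =
      ∫ _ : Cyl n, -(κ * (10 + 2 * (2 + 1 / c + 1 / (1 - C)))) := by
    rw [integral_const, smul_eq_mul]; ring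
  rw [e0]
  have bA : ∀ t, BM (stek τ Y t) := fun t => BM.of_continuous (continuous_slice hA.continuous t)
  have bR : ∀ t, BM (rhoN N θ (ρ t)) := fun t => (isC1_rhoN N hθ (h.bm_slice t)).bm
  have bRD : BM (Function.uncurry fun u (t : TimeI T) => rhoN N θ (ρ t) u * tderiv (stek τ Y) t u) :=
    BM.comp (g := fun p : Cyl n × TimeI T => (p.2, p.1)) (f := fun p : TimeI T × Cyl n =>
      rhoN N θ (ρ p.1) p.2 * tderiv (stek τ Y) p.1 p.2) ((BM.of_continuous hRc).mul
        (BM.of_continuous hA.continuous_tderiv)) (by fun_prop)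
  refine integral_mono ((BM.const _).integrable _)
    (((((bR _).mul (bA _)).sub ((bR _).mul (bA _))).sub
      (BM.integral_right (μ := (volume : Measure (TimeI T))) bRD)).integrable _) fun u => ?_
  have hTle := hT.out.le
  set r : ℝ → ℝ := fun s => rhoN N θ (ρ (projIcc 0 T hTle s)) u with hr
  set y : ℝ → ℝ := fun s => Y (projIcc 0 T hTle s) u with hy
  -- As a function of `r` this is convex with slope equal to the test function `y`, which is what
  -- `steklov_ineq` asks for.
  set Φ : ℝ → ℝ := fun s => κ * (ent δ (r s) - logit δ (θ u) * r s) with hΦ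
  have hrc : Continuous r := (hRc.comp (Continuous.prodMk_left u)).comp (continuous_projIcc (h := hTle))
  have hyc : Continuous y := continuous_ext hY u
  have hrp : ∀ s, 0 < r s + δ := fun s => by linarith [(hR (projIcc 0 T hTle s) u).1]
  have hrm : ∀ s, 0 < 1 - r s + δ := fun s => by linarith [(hR (projIcc 0 T hTle s) u).2]
  have hΦc : Continuous Φ := by
    have h1 : Continuous fun s => ent δ (r s) :=
      ((hrc.add continuous_const).mul ((hrc.add continuous_const).log fun s => (hrp s).ne')).add
        (((continuous_const.sub hrc).add continuous_const).mul
          (((continuous_const.sub hrc).add continuous_const).log fun s => (hrm s).ne'))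
    exact continuous_const.mul (h1.sub (continuous_const.mul hrc))
  have hp0 : ∀ s ≤ (0 : ℝ), projIcc 0 T hTle s = projIcc 0 T hTle 0 := fun s hs => by
    rw [projIcc_of_le_left hTle hs, projIcc_left]
  have hpT : ∀ s, T ≤ s → projIcc 0 T hTle s = projIcc 0 T hTle T := fun s hs => by
    rw [projIcc_of_right_le hTle hs, projIcc_right]
  have key := steklov_ineq (r := r) (y := y) (Φ := Φ) (T := T) hτ hrc hyc hΦc
    (fun s hs => by simp only [hr, hp0 s hs]) (fun s hs => by simp only [hr, hpT s hs])
    (fun s hs => by simp only [hΦ, hr, hp0 s hs]) (fun s hs => by simp only [hΦ, hr, hpT s hs])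
    hT.out fun s s' => by
      have h1 := ent_tangent (hrp s) (hrm s) (hrp s') (hrm s')
      have h2 : (r s - r s') * y s = κ * ((r s - r s') * logit δ (r s)
          - logit δ (θ u) * (r s - r s')) := by
        simp only [hy, hYdef, tst, hr]; ring
      rw [h2]
      have h3 := mul_le_mul_of_nonneg_left h1 hκ.le
      simp only [hΦ]
      nlinarith
  have hlow := entropy_diff_lower (δ := δ) (r := r T) (r' := r 0) (l := logit δ (θ u)) hδ hδ1
    (abs_logit_le hc (c' := 1 - C) (by linarith) (hcC u).1 (by linarith [(hcC u).2]) hδ hδ1)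
    (hR _ u).1 (hR _ u).2 (hR _ u).1 (hR _ u).2
  have hlow' := mul_le_mul_of_nonneg_left hlow hκ.le
  have eT : projIcc 0 T hTle T = t1 T := by rw [projIcc_right]; rfl
  have e0' : projIcc 0 T hTle 0 = t0 T := by rw [projIcc_left]; rfl
  have e1 : ∫ t, rhoN N θ (ρ t) u * tderiv (stek τ Y) t u =
      ∫ t in (0 : ℝ)..T, r t * (τ⁻¹ * (y (t + τ) - y t)) := by
    rw [integral_Icc_subtype hTle, hAd]
    refine intervalIntegral.integral_congr fun s hs => ?_
    rw [uIcc_of_le hTle] at hs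
    simp only [hr, hy, projIcc_of_mem hTle hs]
  rw [e1]
  have e2 : rhoN N θ (ρ (t1 T)) u * stek τ Y (t1 T) u =
      r T * (τ⁻¹ * ∫ s in T..(T + τ), y s) := by simp only [hr, eT]; rfl
  have e3 : rhoN N θ (ρ (t0 T)) u * stek τ Y (t0 T) u =
      r 0 * (τ⁻¹ * ∫ s in (0 : ℝ)..(0 + τ), y s) := by simp only [hr, e0']; rfl
  rw [e2, e3]
  refine le_trans ?_ key
  simp only [hΦ]
  linarith

lemma abs_b_le {θ : Cyl n → ℝ} {c C : ℝ} (hc : 0 < c) (hC : C < 1)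
    (hcC : ∀ u, c ≤ θ u ∧ θ u ≤ C) (hb : ∀ r : bdry n, θ r.1 = b r) (r : bdry n) : |b r| ≤ 1 := by
  rw [← hb, abs_le]
  constructor <;> linarith [hcC r.1]

/-- The uniform energy estimate. -/
lemma energy_bound (β : ℝ) (J : KacKernel n) {θ : Cyl n → ℝ} {c C : ℝ} (hθ : IsC1 θ) (hc : 0 < c)
    (hC : C < 1) (hcC : ∀ u, c ≤ θ u ∧ θ u ≤ C) (hb : ∀ r : bdry n, θ r.1 = b r) (a : ℝ) :
    ∃ K : ℝ, 0 ≤ K ∧ ∀ δ : ℝ, 0 < δ → δ ≤ 1 → ∀ᶠ N : ℕ in atTop, ∀ γ ∈ F1 n,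
      ∀ (π : TimeI T → Meas n) (ρ : TimeI T → Cyl n → ℝ), Good β J b γ a π → IsDensity π ρ →
        (∀ t u, -(δ / 2) ≤ rhoN N θ (ρ t) u ∧ rhoN N θ (ρ t) u ≤ 1 + δ / 2) ∧
        ∫ t, wform δ N θ (ρ t) ≤ K := by
  obtain ⟨κ, c₀, C₁, hκ, hc₀, H⟩ := spat_lower β J hθ hc hC hcC hb
  set m0 : ℝ := volume.real (univ : Set (Cyl n)) with hm0
  set mT : ℝ := volume.real (univ : Set (TimeI T)) with hmT
  set P : ℝ := κ * (10 + 2 * (2 + 1 / c + 1 / (1 - C))) * m0 with hP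
  refine ⟨|(a + P + C₁ * mT) / c₀|, abs_nonneg _, fun δ hδ hδ1 => ?_⟩
  filter_upwards [H δ hδ hδ1] with N hN γ hγ π ρ hπ hρ
  have hR : ∀ t u, -(δ / 2) ≤ rhoN N θ (ρ t) u ∧ rhoN N θ (ρ t) u ≤ 1 + δ / 2 := fun t =>
    (hN (ρ t) (hρ.meas_slice t) (hρ.nonneg t) (hρ.le_one t)).1
  refine ⟨hR, ?_⟩
  have hpc : ∀ F : Cyl n → ℝ, Continuous F → Continuous fun t => (π t).pair F := fun F hF =>
    hπ.continuous_pair hθ.cont hb hF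
  have hRc := hρ.continuous_rhoN hpc hθ N
  have hRp : ∀ p : TimeI T × Cyl n, 0 < rhoN N θ (ρ p.1) p.2 + δ := fun p => by
    linarith [(hR p.1 p.2).1]
  have hRm : ∀ p : TimeI T × Cyl n, 0 < 1 - rhoN N θ (ρ p.1) p.2 + δ := fun p => by
    linarith [(hR p.1 p.2).2]
  set Y : TimeI T → Cyl n → ℝ := fun t u => κ * tst δ N θ (ρ t) u with hYdef
  have hY : Continuous (Function.uncurry Y) :=
    continuous_const.mul ((continuous_logit_comp hRc hRp hRm).sub
      ((continuous_logit_comp hθ.cont (fun u => by linarith [(hcC u).1])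
        (fun u => by linarith [(hcC u).2])).comp continuous_snd))
  -- The entropy test is only continuous in time, so its Steklov averages are used. The lower bound
  -- on the time part does not depend on `τ`; only the spatial part has to be followed as `τ → 0`.
  have hstep : ∀ τ : ℝ, 0 < τ → ∫ t, spat β J b (ρ t) (gradMop N (stek τ Y t)) ≤ a + P := by
    intro τ hτ
    have hA := (isCTime_stek τ hY).1
    have h1 := hπ.sub N _ hA
    rw [hρ.hatI_mop hθ.cont hb γ N hA, ← hπ.initial hθ.cont hb hγ] at h1
    have h2 := time_part_lower hρ hθ hc hC hcC N hRc hδ hδ1 hκ hτ hR hY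
    linarith
  have hlim := tendsto_integral_spat_stek (β := β) (J := J) hρ hθ.cont hb
    (abs_b_le hc hC hcC hb) N hY
  have h3 : ∫ t, spat β J b (ρ t) (gradMop N (Y t)) ≤ a + P :=
    le_of_tendsto' hlim fun j => hstep _ (by positivity)
  have hpb : BM fun p : TimeI T × Cyl n => dlogit δ (rhoN N θ (ρ p.1) p.2) *
      ∑ k, pderiv k (rhoN N θ (ρ p.1)) p.2 ^ 2 :=
    (BM.of_continuous (continuous_dlogit_comp hRc hRp hRm)).mul
      (BM.sum (s := Finset.univ) (f := fun k (p : TimeI T × Cyl n) =>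
        pderiv k (rhoN N θ (ρ p.1)) p.2 ^ 2) fun k _ =>
        (BM.of_continuous (hρ.continuous_pderiv_rhoN hpc hθ N k)).pow 2)
  have hwb : BM fun t => wform δ N θ (ρ t) :=
    BM.integral_right (f := fun t u => dlogit δ (rhoN N θ (ρ t) u) *
      ∑ k, pderiv k (rhoN N θ (ρ t)) u ^ 2) hpb
  have hsb : BM fun t => spat β J b (ρ t) (gradMop N (Y t)) :=
    (hρ.integral_spat hθ.cont hb (V := fun k t => gradMop N (Y t) k)
      fun k => isCSpace_mop_time N (-1) _ hY 1).1
  have h4 : c₀ * ∫ t, wform δ N θ (ρ t) ≤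
      (∫ t, spat β J b (ρ t) (gradMop N (Y t))) + C₁ * mT := by
    have e : C₁ * mT = ∫ _ : TimeI T, C₁ := by rw [integral_const, smul_eq_mul, mul_comm]
    rw [e, ← integral_const_mul, ← integral_add (hsb.integrable _) ((BM.const _).integrable _)]
    exact integral_mono ((hwb.const_mul _).integrable _) ((hsb.add (BM.const _)).integrable _)
      fun t => (hN (ρ t) (hρ.meas_slice t) (hρ.nonneg t) (hρ.le_one t)).2
  refine le_trans ?_ (le_abs_self _)
  rw [le_div_iff₀ hc₀]
  linarith

end Energy

/-! ### Finiteness of the energy -/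

section EnergyFinite

set_option linter.unusedSectionVars false

variable {n : ℕ} {T : ℝ} [hT : Fact (0 < T)] {β : ℝ} {J : KacKernel n} {b : bdry n → ℝ}

lemma BM.integral_integral {f : TimeI T → Cyl n → ℝ} (hf : BM (Function.uncurry f)) :
    ∫ t, ∫ u, f t u = ∫ p : TimeI T × Cyl n, f p.1 p.2 :=
  (integral_prod (Function.uncurry f) (hf.integrable _)).symm

lemma integral2_mono {f g : TimeI T → Cyl n → ℝ} (hf : BM (Function.uncurry f))
    (hg : BM (Function.uncurry g)) (h : ∀ t u, f t u ≤ g t u) :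
    ∫ t, ∫ u, f t u ≤ ∫ t, ∫ u, g t u := by
  rw [hf.integral_integral, hg.integral_integral]
  exact integral_mono (hf.integrable _) (hg.integrable _) fun p => h p.1 p.2

lemma integral2_add {f g : TimeI T → Cyl n → ℝ} (hf : BM (Function.uncurry f))
    (hg : BM (Function.uncurry g)) :
    ∫ t, ∫ u, (f t u + g t u) = (∫ t, ∫ u, f t u) + ∫ t, ∫ u, g t u := by
  rw [BM.integral_integral (f := fun t u => f t u + g t u) (hf.add hg), hf.integral_integral,
    hg.integral_integral]
  exact integral_add (hf.integrable _) (hg.integrable _)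

lemma integral2_const_mul (c : ℝ) (f : TimeI T → Cyl n → ℝ) :
    ∫ t, ∫ u, c * f t u = c * ∫ t, ∫ u, f t u := by
  simp only [integral_const_mul]

lemma integral2_sub {f g : TimeI T → Cyl n → ℝ} (hf : BM (Function.uncurry f))
    (hg : BM (Function.uncurry g)) :
    ∫ t, ∫ u, (f t u - g t u) = (∫ t, ∫ u, f t u) - ∫ t, ∫ u, g t u := by
  rw [BM.integral_integral (f := fun t u => f t u - g t u) (hf.sub hg), hf.integral_integral,
    hg.integral_integral]
  exact integral_sub (hf.integrable _) (hg.integrable _)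

lemma abs_integral2_le {f : TimeI T → Cyl n → ℝ} (hf : BM (Function.uncurry f)) :
    |∫ t, ∫ u, f t u| ≤ ∫ t, ∫ u, |f t u| := by
  rw [hf.integral_integral, BM.integral_integral (f := fun t u => |f t u|) hf.abs]
  exact abs_integral_le_integral_abs

lemma bm_mop_param {X : Type*} [MeasurableSpace X] (N : ℕ) (ε : ℝ) (α : Fin (n + 1) → ℕ)
    {f : X → Cyl n → ℝ} (hf : BM (Function.uncurry f)) :
    BM (fun p : X × Cyl n => mop N ε α (f p.1) p.2) := by
  refine BM.integral_right (f := fun (p : X × Cyl n) v => kern N ε α p.2 v * f p.1 v) ?_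
  obtain ⟨K, -, hK⟩ := kern_bound (n := n) N ε α
  have h1 : BM fun q : (X × Cyl n) × Cyl n => kern N ε α q.1.2 q.2 :=
    .of_bound ((continuous_kern N ε α).measurable.comp
      ((measurable_snd.comp measurable_fst).prodMk measurable_snd)) K fun q => hK _ _
  exact h1.mul (hf.comp (g := fun q : (X × Cyl n) × Cyl n => (q.1.1, q.2))
    ((measurable_fst.comp measurable_fst).prodMk measurable_snd))

lemma bm_slice {X Z : Type*} [MeasurableSpace X] [MeasurableSpace Z] {f : X → Z → ℝ}
    (hf : BM (Function.uncurry f)) (x : X) : BM (f x) :=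
  hf.comp (g := fun z => (x, z)) measurable_prodMk_left

/-- Mollification converges in `L¹([0,T] × Λ)`. -/
lemma tendsto_integral2_mop {ε : ℝ} (hε : ε = 1 ∨ ε = -1) {f : TimeI T → Cyl n → ℝ}
    (hf : BM (Function.uncurry f)) :
    Tendsto (fun N : ℕ => ∫ t, ∫ u, |mop N ε 0 (f t) u - f t u|) atTop (𝓝 0) := by
  obtain ⟨C, hC⟩ := hf.2
  have hC' : ∀ t u, |f t u| ≤ C := fun t u => hC (t, u)
  have h0 : 𝓝 (0 : ℝ) = 𝓝 (∫ _ : TimeI T, (0 : ℝ)) := by simp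
  simp only [h0]
  refine tendsto_integral_of_bound (C := 2 * C * volume.real (univ : Set (Cyl n))) (fun N => ?_)
    (fun N t => ?_) fun t => ?_
  · exact ((BM.integral_right (f := fun t u => |mop N ε 0 (f t) u - f t u|)
      ((bm_mop_param N ε 0 hf).sub hf).abs).1).aestronglyMeasurable
  · refine abs_integral_le_const fun u => ?_
    rw [abs_abs]
    refine (abs_sub _ _).trans ?_
    have := abs_mop_le N hε (bm_slice hf t).1 (hC' t) u
    linarith [hC' t u]
  · exact tendsto_integral_abs_mop_sub hε (bm_slice hf t).1 (hC' t)

lemma IsDensity.bm_sub {π : TimeI T → Meas n} {ρ : TimeI T → Cyl n → ℝ} (h : IsDensity π ρ)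
    {θ : Cyl n → ℝ} (hθ : BM θ) : BM (Function.uncurry fun t u => ρ t u - θ u) :=
  h.bm.sub (hθ.comp measurable_snd)

lemma IsDensity.bm_rhoN {π : TimeI T → Meas n} {ρ : TimeI T → Cyl n → ℝ} (h : IsDensity π ρ)
    {θ : Cyl n → ℝ} (hθ : BM θ) (N : ℕ) :
    BM (Function.uncurry fun t u => rhoN N θ (ρ t) u) :=
  (bm_mop_param N (-1) 0 (h.bm_sub hθ)).add (hθ.comp measurable_snd)

lemma IsDensity.bm_pderiv_rhoN {π : TimeI T → Meas n} {ρ : TimeI T → Cyl n → ℝ}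
    (h : IsDensity π ρ) {θ : Cyl n → ℝ} (hθ : IsC1 θ) (N : ℕ) (k : Fin (n + 1)) :
    BM (Function.uncurry fun t u => pderiv k (rhoN N θ (ρ t)) u) := by
  have h1 : (Function.uncurry fun t u => pderiv k (rhoN N θ (ρ t)) u) = fun p : TimeI T × Cyl n =>
      mop N (-1) (Pi.single k 1) (fun v => ρ p.1 v - θ v) p.2 + pderiv k θ p.2 := by
    funext p
    exact pderiv_rhoN N hθ (h.bm_slice p.1) k p.2
  rw [h1]
  exact (bm_mop_param N (-1) (Pi.single k 1) (h.bm_sub hθ.bm)).add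
    ((hθ.bm_pderiv k).comp measurable_snd)

lemma IsDensity.tendsto_rhoN {π : TimeI T → Meas n} {ρ : TimeI T → Cyl n → ℝ}
    (h : IsDensity π ρ) {θ : Cyl n → ℝ} (hθ : BM θ) :
    Tendsto (fun N : ℕ => ∫ t, ∫ u, |rhoN N θ (ρ t) u - ρ t u|) atTop (𝓝 0) := by
  refine (tendsto_integral2_mop (Or.inr rfl) (h.bm_sub hθ)).congr fun N => ?_
  refine integral_congr_ae (ae_of_all _ fun t => integral_congr_ae (ae_of_all _ fun u => ?_))
  simp only [rhoN]
  congr 1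
  ring

/-- Convergence of integrals against a bounded function, under `L¹` convergence. -/
lemma tendsto_integral2_mul {ι : Type*} {l : Filter ι} {f : ι → TimeI T → Cyl n → ℝ}
    {f₀ H : TimeI T → Cyl n → ℝ} (hf : ∀ i, BM (Function.uncurry (f i)))
    (hf₀ : BM (Function.uncurry f₀)) (hH : BM (Function.uncurry H))
    (h : Tendsto (fun i => ∫ t, ∫ u, |f i t u - f₀ t u|) l (𝓝 0)) :
    Tendsto (fun i => ∫ t, ∫ u, f i t u * H t u) l (𝓝 (∫ t, ∫ u, f₀ t u * H t u)) := by
  obtain ⟨C, hC⟩ := hH.2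
  rw [tendsto_iff_dist_tendsto_zero]
  have h2 : Tendsto (fun i => C * ∫ t, ∫ u, |f i t u - f₀ t u|) l (𝓝 0) := by
    simpa using h.const_mul C
  refine squeeze_zero (fun _ => dist_nonneg) (fun i => ?_) h2
  rw [Real.dist_eq, ← integral2_sub (f := fun t u => f i t u * H t u)
    (g := fun t u => f₀ t u * H t u) ((hf i).mul hH) (hf₀.mul hH), ← integral2_const_mul]
  refine (abs_integral2_le (f := fun t u => f i t u * H t u - f₀ t u * H t u)
    (((hf i).mul hH).sub (hf₀.mul hH))).trans
    (integral2_mono (((hf i).mul hH).sub (hf₀.mul hH)).abs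
      (((hf i).sub hf₀).abs.const_mul C) fun t u => ?_)
  rw [← sub_mul, abs_mul, mul_comm]
  exact mul_le_mul_of_nonneg_right (hC (t, u)) (abs_nonneg _)

lemma abs_mobility_sub_le {r s B : ℝ} (hr : |r| ≤ B) (hs : |s| ≤ B) :
    |mobility r - mobility s| ≤ (2 + 4 * B) * |r - s| := by
  have e : mobility r - mobility s = (2 * (1 - r - s)) * (r - s) := by
    simp only [mobility]; ring
  rw [e, abs_mul]
  refine mul_le_mul_of_nonneg_right ?_ (abs_nonneg _)
  rw [abs_le] at *
  constructor <;> linarith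

lemma tendsto_integral2_mobility {ι : Type*} {l : Filter ι} {f : ι → TimeI T → Cyl n → ℝ}
    {f₀ : TimeI T → Cyl n → ℝ} {B : ℝ} (hf : ∀ i, BM (Function.uncurry (f i)))
    (hf₀ : BM (Function.uncurry f₀)) (hB : ∀ i t u, |f i t u| ≤ B) (hB₀ : ∀ t u, |f₀ t u| ≤ B)
    (h : Tendsto (fun i => ∫ t, ∫ u, |f i t u - f₀ t u|) l (𝓝 0)) :
    Tendsto (fun i => ∫ t, ∫ u, |mobility (f i t u) - mobility (f₀ t u)|) l (𝓝 0) := by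
  have h2 : Tendsto (fun i => (2 + 4 * B) * ∫ t, ∫ u, |f i t u - f₀ t u|) l (𝓝 0) := by
    simpa using h.const_mul (2 + 4 * B)
  refine squeeze_zero (fun i => integral_nonneg fun t => integral_nonneg fun u => abs_nonneg _)
    (fun i => ?_) h2
  rw [← integral2_const_mul]
  exact integral2_mono ((hf i).mobility.sub hf₀.mobility).abs
    (((hf i).sub hf₀).abs.const_mul _) fun t u => abs_mobility_sub_le (hB i t u) (hB₀ t u)

/-- Young's inequality weighted by the second derivative of the entropy leaves `4 (dlogit δ r)⁻¹
h²`, and `4 (r+δ)(1-r+δ)/(1+2δ)` is at most `2σ(r) + 8δ`. This matches the factor `2` in the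
definition of `Q`. -/
lemma energy_pointwise {δ r q h : ℝ} (hδ : 0 < δ) (hδ1 : δ ≤ 1) (h0 : -(δ / 2) ≤ r)
    (h1 : r ≤ 1 + δ / 2) :
    -(q * h) ≤ 1 / 16 * (dlogit δ r * q ^ 2) + 2 * (mobility r * h ^ 2) + 8 * δ * h ^ 2 := by
  have hx : 0 < r + δ := by linarith
  have hy : 0 < 1 - r + δ := by linarith
  have hp : dlogit δ r = (1 + 2 * δ) / ((r + δ) * (1 - r + δ)) := by
    simp only [dlogit]; field_simp; ring
  have hpp : 0 < dlogit δ r := by rw [hp]; positivity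
  have hinv : 4 * (dlogit δ r)⁻¹ ≤ 2 * mobility r + 8 * δ := by
    rw [hp, inv_div, mul_div_assoc', div_le_iff₀ (by linarith)]
    simp only [mobility]
    nlinarith [mul_pos hδ hδ, mul_nonneg hδ.le (sq_nonneg (2 * r - 1)),
      mul_nonneg hδ.le (sub_nonneg.2 h1), mul_nonneg hδ.le (by linarith : 0 ≤ r + δ / 2),
      mul_nonneg (mul_pos hδ hδ).le (sub_nonneg.2 h1)]
  have hy2 : -(q * h) ≤ 1 / 16 * (dlogit δ r * q ^ 2) + 4 * (dlogit δ r)⁻¹ * h ^ 2 := by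
    have e : 1 / 16 * (dlogit δ r * q ^ 2) + 4 * (dlogit δ r)⁻¹ * h ^ 2 + q * h =
        dlogit δ r * (q / 4 + 2 * (dlogit δ r)⁻¹ * h) ^ 2 := by
      field_simp
      ring
    nlinarith [mul_nonneg hpp.le (sq_nonneg (q / 4 + 2 * (dlogit δ r)⁻¹ * h))]
  nlinarith [mul_le_mul_of_nonneg_right hinv (sq_nonneg h)]

lemma IsDensity.bm_wform {π : TimeI T → Meas n} {ρ : TimeI T → Cyl n → ℝ}
    (h : IsDensity π ρ) {θ : Cyl n → ℝ} (hθ : IsC1 θ) {δ : ℝ} (hδ : 0 < δ) {N : ℕ}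
    (hR : ∀ t u, -(δ / 2) ≤ rhoN N θ (ρ t) u ∧ rhoN N θ (ρ t) u ≤ 1 + δ / 2) :
    BM (Function.uncurry fun t u => dlogit δ (rhoN N θ (ρ t) u)) := by
  have hm := (h.bm_rhoN hθ.bm N).1
  refine .of_bound ?_ (4 / δ) fun p => ?_
  · exact (((hm.add_const δ).inv).add (((measurable_const.sub hm).add_const δ).inv) :)
  · have h1 := hR p.1 p.2
    have h2 : 0 < rhoN N θ (ρ p.1) p.2 + δ := by linarith [h1.1]
    have h3 : 0 < 1 - rhoN N θ (ρ p.1) p.2 + δ := by linarith [h1.2]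
    have h4 : 0 ≤ dlogit δ (rhoN N θ (ρ p.1) p.2) := by simp only [dlogit]; positivity
    simp only [Function.uncurry]
    rw [abs_of_nonneg h4]
    exact dlogit_le hδ h1.1 h1.2

/-- A uniform bound for the energy. -/
lemma Good.energy_term_le {θ : Cyl n → ℝ} {c C : ℝ} (hθ : IsC1 θ) (hc : 0 < c)
    (hC : C < 1) (hcC : ∀ u, c ≤ θ u ∧ θ u ≤ C) (hb : ∀ r : bdry n, θ r.1 = b r) (a : ℝ) :
    ∃ K : ℝ, ∀ γ ∈ F1 n, ∀ (π : TimeI T → Meas n), Good β J b γ a π → ∀ k : Fin (n + 1),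
      ∀ H : TimeI T → Cyl n → ℝ, IsSmoothCompact H →
      (∫ t, ∫ u, (π t).density u * pderiv k (H t) u)
        - 2 * (∫ t, ∫ u, mobility ((π t).density u) * (H t u) ^ 2) ≤ K := by
  obtain ⟨K, hK0, hK⟩ := energy_bound (T := T) β J hθ hc hC hcC hb a
  refine ⟨K / 16, fun γ hγ π hπ k H hH => ?_⟩
  obtain ⟨ρ, hρ⟩ := hπ.exists_isDensity
  have e1 : ∫ t, ∫ u, (π t).density u * pderiv k (H t) u = ∫ t, ∫ u, ρ t u * pderiv k (H t) u :=
    integral_congr_ae (ae_of_all _ fun t => integral_congr_ae (by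
      filter_upwards [hρ.ae t] with u hu; rw [hu]))
  have e2 : ∫ t, ∫ u, mobility ((π t).density u) * (H t u) ^ 2 =
      ∫ t, ∫ u, mobility (ρ t u) * (H t u) ^ 2 :=
    integral_congr_ae (ae_of_all _ fun t => integral_congr_ae (by
      filter_upwards [hρ.ae t] with u hu; rw [hu]))
  rw [e1, e2]
  have hHb : BM (Function.uncurry H) := BM.of_continuous hH.continuous
  have hDb : BM (Function.uncurry fun t u => pderiv k (H t) u) :=
    BM.of_continuous (hH.exists_deriv k).1
  have hH2 : BM (Function.uncurry fun t u => (H t u) ^ 2) := hHb.pow 2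
  set S := ∫ t, ∫ u, (H t u) ^ 2 with hS
  have hR := fun N => hρ.bm_rhoN hθ.bm N
  have hQ := fun N => hρ.bm_pderiv_rhoN hθ N k
  have hlim := hρ.tendsto_rhoN hθ.bm
  have hB : ∀ N t u, |rhoN N θ (ρ t) u| ≤ 2 := fun N t u => by
    have h1 : |θ u| ≤ 1 := by
      rw [abs_le]; constructor <;> linarith [(hcC u).1, (hcC u).2]
    have h2 : |mop N (-1) 0 (fun v => ρ t v - θ v) u| ≤ 1 := by
      refine abs_mop_le N (Or.inr rfl) ((hρ.bm_slice t).sub hθ.bm).1 (fun v => ?_) u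
      rw [abs_le]
      constructor <;> linarith [(hcC v).1, (hcC v).2, hρ.nonneg t v, hρ.le_one t v]
    exact (abs_add_le _ _).trans (by linarith)
  have l1 := tendsto_integral2_mul hR hρ.bm hDb hlim
  have l2 := tendsto_integral2_mul (fun N => (hR N).mobility) hρ.bm.mobility hH2
    (tendsto_integral2_mobility hR hρ.bm hB (fun t u => (hρ.abs_le t u).trans (by norm_num)) hlim)
  -- The limit `N → ∞` is taken at fixed `δ`, because the energy bound holds only for `N` large
  -- depending on `δ`. The error `8δS` disappears afterwards.
  have key : ∀ δ : ℝ, 0 < δ → δ ≤ 1 → (∫ t, ∫ u, ρ t u * pderiv k (H t) u)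
      - 2 * (∫ t, ∫ u, mobility (ρ t u) * (H t u) ^ 2) ≤ K / 16 + 8 * δ * S := by
    intro δ hδ hδ1
    refine le_of_tendsto (l1.sub (l2.const_mul 2)) ?_
    filter_upwards [hK δ hδ hδ1] with N hN
    obtain ⟨hr, hw⟩ := hN γ hγ π ρ hπ hρ
    have hp := hρ.bm_wform hθ hδ hr
    -- No boundary term appears because `H` vanishes on `Γ`.
    have h1 : ∫ t, ∫ u, rhoN N θ (ρ t) u * pderiv k (H t) u =
        ∫ t, ∫ u, -(pderiv k (rhoN N θ (ρ t)) u * H t u) := by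
      refine integral_congr_ae (ae_of_all _ fun t => ?_)
      have hC1 := isC1_rhoN N hθ (hρ.bm_slice t)
      have := integral_mul_pderiv k hC1.cont (hH.continuous.comp (Continuous.prodMk_right t))
        (hC1.contD k) ((hH.exists_deriv k).1.comp (Continuous.prodMk_right t))
        (hC1.hasPD k) ((hH.exists_deriv k).2 t)
      simp only [Function.comp_def] at this
      rw [bdryTerm_eq_zero k fun u hu => by simp only [hH.eq_zero t hu, mul_zero]] at this
      simp only [this, integral_neg, zero_sub]
    rw [h1]
    have h2 : ∫ t, ∫ u, -(pderiv k (rhoN N θ (ρ t)) u * H t u) ≤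
        ∫ t, ∫ u, (1 / 16 * (dlogit δ (rhoN N θ (ρ t) u) * pderiv k (rhoN N θ (ρ t)) u ^ 2)
          + 2 * (mobility (rhoN N θ (ρ t) u) * (H t u) ^ 2) + 8 * δ * (H t u) ^ 2) :=
      integral2_mono ((hQ N).mul hHb).neg
        (((((hp.mul ((hQ N).pow 2)).const_mul _).add
          (((hR N).mobility.mul hH2).const_mul 2))).add (hH2.const_mul _))
        fun t u => energy_pointwise hδ hδ1 (hr t u).1 (hr t u).2
    have h3 : ∫ t, ∫ u, (1 / 16 * (dlogit δ (rhoN N θ (ρ t) u) * pderiv k (rhoN N θ (ρ t)) u ^ 2)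
          + 2 * (mobility (rhoN N θ (ρ t) u) * (H t u) ^ 2) + 8 * δ * (H t u) ^ 2) =
        1 / 16 * (∫ t, ∫ u, dlogit δ (rhoN N θ (ρ t) u) * pderiv k (rhoN N θ (ρ t)) u ^ 2)
        + 2 * (∫ t, ∫ u, mobility (rhoN N θ (ρ t) u) * (H t u) ^ 2) + 8 * δ * S := by
      rw [integral2_add (f := fun t u =>
          1 / 16 * (dlogit δ (rhoN N θ (ρ t) u) * pderiv k (rhoN N θ (ρ t)) u ^ 2)
          + 2 * (mobility (rhoN N θ (ρ t) u) * (H t u) ^ 2)) (g := fun t u => 8 * δ * (H t u) ^ 2)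
          (((hp.mul ((hQ N).pow 2)).const_mul _).add
          (((hR N).mobility.mul hH2).const_mul 2)) (hH2.const_mul _),
        integral2_add (f := fun t u =>
          1 / 16 * (dlogit δ (rhoN N θ (ρ t) u) * pderiv k (rhoN N θ (ρ t)) u ^ 2))
          (g := fun t u => 2 * (mobility (rhoN N θ (ρ t) u) * (H t u) ^ 2))
          ((hp.mul ((hQ N).pow 2)).const_mul _) (((hR N).mobility.mul hH2).const_mul 2),
        integral2_const_mul, integral2_const_mul, integral2_const_mul]
    have h4 : ∫ t, ∫ u, dlogit δ (rhoN N θ (ρ t) u) * pderiv k (rhoN N θ (ρ t)) u ^ 2 ≤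
        ∫ t, wform δ N θ (ρ t) := by
      refine integral2_mono (g := fun t u => dlogit δ (rhoN N θ (ρ t) u) *
        ∑ j, pderiv j (rhoN N θ (ρ t)) u ^ 2) (hp.mul ((hQ N).pow 2))
        (hp.mul (BM.sum (s := Finset.univ) (f := fun j (p : TimeI T × Cyl n) =>
          pderiv j (rhoN N θ (ρ p.1)) p.2 ^ 2) fun j _ => (hρ.bm_pderiv_rhoN hθ N j).pow 2))
        fun t u => ?_
      refine mul_le_mul_of_nonneg_left (Finset.single_le_sum
        (f := fun j => pderiv j (rhoN N θ (ρ t)) u ^ 2) (fun j _ => sq_nonneg _)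
        (Finset.mem_univ k)) ?_
      have h5 := one_le_dlogit (δ := δ) (r := rhoN N θ (ρ t) u) (by linarith [(hr t u).1])
        (by linarith [(hr t u).2]) hδ1
      linarith
    linarith
  refine le_of_forall_pos_le_add fun e he => ?_
  have hS0 : 0 ≤ S := integral_nonneg fun t => integral_nonneg fun u => sq_nonneg _
  have h6 := key (min 1 (e / (8 * (S + 1)))) (by positivity) (min_le_left _ _)
  have h7 : 8 * min 1 (e / (8 * (S + 1))) * S ≤ e := by
    have h8 : min 1 (e / (8 * (S + 1))) ≤ e / (8 * (S + 1)) := min_le_right _ _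
    have h9 : 8 * (e / (8 * (S + 1))) * S ≤ e := by
      rw [mul_div_assoc', mul_div_mul_left _ _ (by norm_num), div_mul_eq_mul_div,
        div_le_iff₀ (by positivity)]
      nlinarith
    nlinarith
  linarith

lemma Good.energyQ_lt_top {θ : Cyl n → ℝ} {c C : ℝ} (hθ : IsC1 θ) (hc : 0 < c)
    (hC : C < 1) (hcC : ∀ u, c ≤ θ u ∧ θ u ≤ C) (hb : ∀ r : bdry n, θ r.1 = b r) {a : ℝ}
    {γ : Meas n} (hγ : γ ∈ F1 n) {π : TimeI T → Meas n} (h : Good β J b γ a π) :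
    energyQ π < ⊤ := by
  obtain ⟨K, hK⟩ := Good.energy_term_le (T := T) (β := β) (J := J) hθ hc hC hcC hb a
  refine lt_of_le_of_lt (Finset.sum_le_sum fun k _ => iSup_le fun H =>
    EReal.coe_le_coe_iff.2 (hK γ hγ π h k H.1 H.2)) ?_
  rw [Finset.sum_const, ← EReal.coe_nsmul]
  exact EReal.coe_lt_top _

end EnergyFinite

/-! ### A Poincaré inequality for the Dirichlet mollifier -/

section Poincare

variable {n : ℕ}

/-- The function `1 - cos (πz/2)`. -/
def ver (z : ℝ) : ℝ := 1 - Real.cos (Real.pi / 2 * z)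

lemma continuous_ver : Continuous ver := by unfold ver; fun_prop

lemma ver_periodic : Function.Periodic ver 4 := fun z => by
  simp only [ver, mul_add, ax_period, Real.cos_add_two_pi]

/-- The bound `1 - cos x ≥ 2x²/π²`, valid for `|x| ≤ π`, at `x = πz/2`. -/
lemma sq_le_ver {z : ℝ} (hz : |z| ≤ 2) : z ^ 2 / 2 ≤ ver z := by
  have h := Real.cos_le_one_sub_mul_cos_sq (x := Real.pi / 2 * z) (by
    rw [abs_mul, abs_of_pos (by positivity)]
    nlinarith [Real.pi_pos])
  have e : 2 / Real.pi ^ 2 * (Real.pi / 2 * z) ^ 2 = z ^ 2 / 2 := by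
    field_simp
  rw [e] at h
  simp only [ver]
  linarith

/-- Young's inequality with parameter `l`: a distance is traded for a small constant plus a large
multiple of the quantity whose moment under the kernel is `1 / (N + 1)`. -/
lemma abs_div_le_ver {z l : ℝ} (hl : 0 < l) (hz : |z| ≤ 2) :
    |z| / (4 * l) ≤ l + ver z / (32 * l ^ 3) := by
  have h1 : z ^ 2 / (64 * l ^ 3) ≤ ver z / (32 * l ^ 3) := by
    rw [div_le_div_iff₀ (by positivity) (by positivity)]
    nlinarith [sq_le_ver hz, pow_pos hl 3]
  have h2 : |z| / (4 * l) ≤ l + z ^ 2 / (64 * l ^ 3) := by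
    have e : l + z ^ 2 / (64 * l ^ 3) - |z| / (4 * l) = (8 * l ^ 2 - |z|) ^ 2 / (64 * l ^ 3) := by
      rw [← sq_abs z]
      field_simp
      ring
    have : 0 ≤ (8 * l ^ 2 - |z|) ^ 2 / (64 * l ^ 3) := by positivity
    linarith
  linarith

/-- Integrate `|D| ≤ 1/(4l) + l D²` between the two points. The energy receives the small
coefficient `l`; the large `1/(4l)` multiplies only the distance. -/
lemma abs_sub_le_of_deriv {g D : ℝ → ℝ}
    (hd : ∀ s ∈ Icc (-1 : ℝ) 1, HasDerivWithinAt g (D s) (Icc (-1) 1) s) (hD : Continuous D)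
    {l : ℝ} (hl : 0 < l) {x x' : ℝ} (hx : x ∈ Icc (-1 : ℝ) 1) (hx' : x' ∈ Icc (-1 : ℝ) 1) :
    |g x - g x'| ≤ |x - x'| / (4 * l) + l * ∫ s in (-1 : ℝ)..1, D s ^ 2 := by
  wlog hxx : x' ≤ x generalizing x x'
  · rw [abs_sub_comm, abs_sub_comm x]
    exact this hx' hx (le_of_not_ge hxx)
  have hsub : Icc x' x ⊆ Icc (-1 : ℝ) 1 := Icc_subset_Icc hx'.1 hx.2
  have hi : ∀ {f : ℝ → ℝ} {a c : ℝ}, Continuous f → IntervalIntegrable f volume a c :=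
    fun hf => hf.intervalIntegrable _ _
  have h1 := intervalIntegral.integral_eq_sub_of_hasDerivAt_of_le hxx
    (fun s hs => ((hd s (hsub hs)).continuousWithinAt).mono hsub)
    (fun s hs => (hd s (hsub (Ioo_subset_Icc_self hs))).hasDerivAt
      (Icc_mem_nhds (hx'.1.trans_lt hs.1) (hs.2.trans_le hx.2))) (hi hD)
  rw [← h1]
  have h2 : ∀ s, |D s| ≤ 1 / (4 * l) + l * D s ^ 2 := fun s => by
    have e : 1 / (4 * l) + l * D s ^ 2 - |D s| = (1 - 2 * l * |D s|) ^ 2 / (4 * l) := by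
      rw [← sq_abs (D s)]
      field_simp
      ring
    have : 0 ≤ (1 - 2 * l * |D s|) ^ 2 / (4 * l) := by positivity
    linarith
  have h3 : |∫ s in x'..x, D s| ≤ ∫ s in x'..x, |D s| :=
    intervalIntegral.abs_integral_le_integral_abs hxx
  have h4 : ∫ s in x'..x, |D s| ≤ ∫ s in x'..x, (1 / (4 * l) + l * D s ^ 2) :=
    intervalIntegral.integral_mono_on hxx (hi hD.abs) (hi (by fun_prop)) fun s _ => h2 s
  have h5 : ∫ s in x'..x, (1 / (4 * l) + l * D s ^ 2) =
      (x - x') * (1 / (4 * l)) + l * ∫ s in x'..x, D s ^ 2 := by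
    rw [intervalIntegral.integral_add (hi continuous_const) (hi (by fun_prop)),
      intervalIntegral.integral_const, intervalIntegral.integral_const_mul, smul_eq_mul]
  have h6 : ∫ s in x'..x, D s ^ 2 ≤ ∫ s in (-1 : ℝ)..1, D s ^ 2 :=
    intervalIntegral.integral_mono_interval hx'.1 hxx hx.2
      (ae_of_all _ fun s => sq_nonneg (D s)) (hi (by fun_prop))
  rw [abs_of_nonneg (sub_nonneg.2 hxx)]
  have h7 : (x - x') * (1 / (4 * l)) = (x - x') / (4 * l) := by ring
  have h8 := mul_le_mul_of_nonneg_left h6 hl.le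
  linarith

/-- The axial energy of `f` on the line through `y`. -/
def axEnergy (f : Cyl n → ℝ) (y : Fin n → UnitAddCircle) : ℝ :=
  ∫ x : Icc (-1 : ℝ) 1, pderiv 0 f (x, y) ^ 2

lemma IsC1.continuous_axEnergy {f : Cyl n → ℝ} (hf : IsC1 f) : Continuous (axEnergy f) := by
  refine continuous_parametric_integral_of_continuous (μ := volume)
    (f := fun y (x : Icc (-1 : ℝ) 1) => pderiv 0 f (x, y) ^ 2) ?_ (s := univ) isCompact_univ |>.congr
      fun y => by simp [axEnergy]
  exact ((hf.contD 0).comp continuous_swap).pow 2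

lemma integral_axEnergy {f : Cyl n → ℝ} (hf : IsC1 f) :
    ∫ u : Cyl n, axEnergy f u.2 = 2 * ∫ u, pderiv 0 f u ^ 2 := by
  have h1 : ∫ u : Cyl n, pderiv 0 f u ^ 2 = ∫ y, axEnergy f y :=
    integral_prod_symm _ (integrable_of_continuous ((hf.contD 0).pow 2))
  have h2 := integral_prod_mul (μ := (volume : Measure (Icc (-1 : ℝ) 1)))
    (ν := (volume : Measure (Fin n → UnitAddCircle))) (fun _ => (1 : ℝ)) (axEnergy f)
  have h3 : ∫ _ : Icc (-1 : ℝ) 1, (1 : ℝ) = 2 := by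
    rw [integral_Icc_subtype (by norm_num)]
    norm_num
  simp only [one_mul, h3] at h2
  rw [h1, ← h2]
  rfl

lemma IsC1.abs_sub_axial_le {f : Cyl n → ℝ} (hf : IsC1 f) {l : ℝ} (hl : 0 < l)
    (x x' : Icc (-1 : ℝ) 1) (y : Fin n → UnitAddCircle) :
    |f (x, y) - f (x', y)| ≤ |(x : ℝ) - x'| / (4 * l) + l * axEnergy f y := by
  have hm : (-1 : ℝ) ≤ 1 := by norm_num
  have h := abs_sub_le_of_deriv (g := fun s => f (line 0 (x, y) s))
    (D := fun s => pderiv 0 f (line 0 (x, y) s))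
    (fun s hs => HasPD.line (hf.hasPD 0) (x, y) hs)
    ((hf.contD 0).comp ((continuous_line 0).comp (Continuous.prodMk_right _))) hl x.2 x'.2
  simp only [line_zero, projIcc_val] at h
  rwa [← integral_Icc_subtype hm (fun r => pderiv 0 f (r, y) ^ 2)] at h

lemma IsC1.axial_sub_le {f : Cyl n → ℝ} (hf : IsC1 f) {l : ℝ} (hl : 0 < l)
    (x x' : Icc (-1 : ℝ) 1) (y : Fin n → UnitAddCircle) :
    |f (x, y) - f (x', y)| ≤
      (2 * l * axEnergy f y + l) + ver ((x : ℝ) - x') / (32 * l ^ 3) := by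
  have h1 := hf.abs_sub_axial_le hl x x' y
  have h2 := abs_div_le_ver (z := (x : ℝ) - x') hl (by
    rw [abs_le]; constructor <;> linarith [x.2.1, x.2.2, x'.2.1, x'.2.2])
  have h3 : 0 ≤ axEnergy f y := integral_nonneg fun _ => sq_nonneg _
  nlinarith

/-- Odd reflection pairs `f(x)` with `-f(x')`, so here the sum has to be small. Going from `x` to an
end, where `f = 0`, and back to `x'` covers the distance `2 - x - x'` through `1`, or `2 + x + x'`
through `-1`; these agree with the argument of `ver` up to sign and the period `4`. The sign of `x +
x'` decides which end keeps the distance at most `2`. -/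
lemma IsC1.axial_add_le {f : Cyl n → ℝ} (hf : IsC1 f) (h0 : ∀ u ∈ bdry n, f u = 0) {l : ℝ}
    (hl : 0 < l) (x x' : Icc (-1 : ℝ) 1) (y : Fin n → UnitAddCircle) :
    |f (x, y) + f (x', y)| ≤
      (2 * l * axEnergy f y + l) + ver ((x : ℝ) + x' - 2) / (32 * l ^ 3) := by
  have hr := h0 _ (rightPt y).2
  have hl0 := h0 _ (leftPt y).2
  simp only [rightPt, leftPt] at hr hl0
  have htri : |f (x, y) + f (x', y)| ≤ |f (x, y)| + |f (x', y)| := abs_add_le _ _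
  rcases le_total 0 ((x : ℝ) + x') with h | h
  · have h1 := hf.abs_sub_axial_le hl x ⟨1, by norm_num, le_rfl⟩ y
    have h2 := hf.abs_sub_axial_le hl x' ⟨1, by norm_num, le_rfl⟩ y
    rw [hr, sub_zero, abs_of_nonpos (a := (x : ℝ) - _) (by linarith [x.2.2])] at h1
    rw [hr, sub_zero, abs_of_nonpos (a := (x' : ℝ) - _) (by linarith [x'.2.2])] at h2
    have h3 := abs_div_le_ver (z := (x : ℝ) + x' - 2) hl (by
      rw [abs_le]; constructor <;> linarith [x.2.2, x'.2.2])
    rw [abs_of_nonpos (by linarith [x.2.2, x'.2.2])] at h3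
    have e : -((x : ℝ) + x' - 2) / (4 * l) = -((x : ℝ) - 1) / (4 * l) + -((x' : ℝ) - 1) / (4 * l) := by
      ring
    linarith
  · have h1 := hf.abs_sub_axial_le hl x ⟨-1, le_rfl, by norm_num⟩ y
    have h2 := hf.abs_sub_axial_le hl x' ⟨-1, le_rfl, by norm_num⟩ y
    rw [hl0, sub_zero, abs_of_nonneg (a := (x : ℝ) - _) (by linarith [x.2.1])] at h1
    rw [hl0, sub_zero, abs_of_nonneg (a := (x' : ℝ) - _) (by linarith [x'.2.1])] at h2
    have h3 := abs_div_le_ver (z := (x : ℝ) + x' + 2) hl (by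
      rw [abs_le]; constructor <;> linarith [x.2.1, x'.2.1])
    rw [abs_of_nonneg (by linarith [x.2.1, x'.2.1]),
      show (x : ℝ) + x' + 2 = (x + x' - 2) + 4 by ring, ver_periodic] at h3
    have e : ((x : ℝ) + x' - 2 + 4) / (4 * l) = ((x : ℝ) - -1) / (4 * l) + ((x' : ℝ) - -1) / (4 * l) := by
      ring
    linarith

/-- The `L¹` size of the increments of `f` under a shift of the torus coordinates. -/
def shiftOsc (f : Cyl n → ℝ) (z : Fin n → UnitAddCircle) : ℝ :=
  ∫ u : Cyl n, |f u - f (u.1, u.2 - z)|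

lemma continuous_shift {f : Cyl n → ℝ} (hf : Continuous f) :
    Continuous (Function.uncurry fun (z : Fin n → UnitAddCircle) (u : Cyl n) =>
      |f u - f (u.1, u.2 - z)|) := by
  have : Continuous fun p : (Fin n → UnitAddCircle) × Cyl n => f (p.2.1, p.2.2 - p.1) :=
    hf.comp (by fun_prop)
  exact ((hf.comp continuous_snd).sub this).abs

lemma continuous_shiftOsc {f : Cyl n → ℝ} (hf : Continuous f) : Continuous (shiftOsc f) :=
  (continuous_parametric_integral_of_continuous (μ := volume) (continuous_shift hf) (s := univ)
    isCompact_univ).congr fun z => by simp [shiftOsc]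

/-- Triangle inequality and translation invariance. Subadditivity reduces a general shift to shifts
of one coordinate at a time. -/
lemma shiftOsc_add_le {f : Cyl n → ℝ} (hf : Continuous f) (z z' : Fin n → UnitAddCircle) :
    shiftOsc f (z + z') ≤ shiftOsc f z + shiftOsc f z' := by
  have hs : ∀ z, Continuous fun u : Cyl n => |f u - f (u.1, u.2 - z)| := fun z =>
    (continuous_shift hf).comp (Continuous.prodMk_right z)
  have e : shiftOsc f z' = ∫ u : Cyl n, |f (u.1, u.2 - z) - f (u.1, u.2 - z - z')| := by
    have := integral_shift (-z) fun u : Cyl n => |f u - f (u.1, u.2 - z')|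
    simp only [← sub_eq_add_neg] at this
    exact this.symm
  have hc : Continuous fun u : Cyl n => |f (u.1, u.2 - z) - f (u.1, u.2 - z - z')| :=
    (hs z').comp (g := fun u : Cyl n => |f u - f (u.1, u.2 - z')|)
      (f := fun u : Cyl n => (u.1, u.2 - z)) (by fun_prop)
  rw [e, shiftOsc, shiftOsc, ← integral_add (integrable_of_continuous (hs z))
    (integrable_of_continuous hc)]
  refine integral_mono (integrable_of_continuous (hs _))
    (integrable_of_continuous ((hs z).add hc)) fun u => ?_
  have := abs_sub_le (f u) (f (u.1, u.2 - z)) (f (u.1, u.2 - (z + z')))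
  rw [← sub_sub] at this
  simpa only [← sub_sub] using this

lemma shiftOsc_single_le {f : Cyl n → ℝ} (hf : IsC1 f) {l : ℝ} (hl : 0 < l) (i : Fin n)
    (z : UnitAddCircle) : shiftOsc f (Pi.single i z) ≤
      2 * l * (∫ u, pderiv i.succ f u ^ 2)
        + (l + tdist z / (32 * l ^ 3)) * volume.real (univ : Set (Cyl n)) := by
  -- With `|s| ≤ 1/2` the number `4s` is in the range where `ver` dominates the square, and `ver
  -- (4s)` is `tdist` of `s`.
  obtain ⟨s, hs, rfl⟩ : ∃ s : ℝ, |s| ≤ 1 / 2 ∧ (s : UnitAddCircle) = z := by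
    obtain ⟨r, rfl⟩ := QuotientAddGroup.mk_surjective z
    refine ⟨r - round r, abs_sub_round r, ?_⟩
    rw [AddCircle.coe_sub, sub_eq_self]
    exact AddCircle.coe_eq_zero_iff 1 |>.2 ⟨round r, by simp⟩
  have hv : |s| / (4 * l) ≤ l + tdist (s : UnitAddCircle) / (32 * l ^ 3) := by
    have h1 := abs_div_le_ver (z := 4 * s) hl (by rw [abs_mul]; norm_num; linarith)
    have e : ver (4 * s) = tdist (s : UnitAddCircle) := by
      rw [tdist_coe, ver]; congr 2; ring
    rw [e] at h1
    refine le_trans ?_ h1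
    rw [abs_mul]
    gcongr
    norm_num
    linarith [abs_nonneg s]
  set D : Cyl n → ℝ → ℝ := fun u r => pderiv i.succ f (line i.succ u r) ^ 2 with hD
  have hDc : Continuous (Function.uncurry D) :=
    ((hf.contD i.succ).comp (continuous_line i.succ)).pow 2
  have h1 : ∀ u : Cyl n, |f u - f (u.1, u.2 - Pi.single i (s : UnitAddCircle))| ≤
      |s| / (4 * l) + l * ∫ r in (-1 : ℝ)..1, D u r := fun u => by
    have h := abs_sub_le_of_deriv (g := fun s => f (line i.succ u s))
      (D := fun s => pderiv i.succ f (line i.succ u s))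
      (fun s _ => (HasPD.line (hf.hasPD i.succ) u (mem_univ s)).mono (subset_univ _))
      ((hf.contD i.succ).comp ((continuous_line i.succ).comp (Continuous.prodMk_right _))) hl
      (x := 0) (x' := -s) (by norm_num) (by
        rw [abs_le] at hs; constructor <;> linarith)
    simpa [line_succ, sub_eq_add_neg, AddCircle.coe_neg, Pi.single_neg, hD] using h
  have hI : Continuous fun u => ∫ r in (-1 : ℝ)..1, D u r :=
    intervalIntegral.continuous_parametric_intervalIntegral_of_continuous' hDc _ _
  -- By shift invariance the spatial integral is the same for each `r`; the factor is the length of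
  -- `[-1,1]`.
  have h2 : ∫ u, ∫ r in (-1 : ℝ)..1, D u r = 2 * ∫ u, pderiv i.succ f u ^ 2 := by
    have hm : (-1 : ℝ) ≤ 1 := by norm_num
    have h3 : ∀ u, ∫ r in (-1 : ℝ)..1, D u r = ∫ r : Icc (-1 : ℝ) 1, D u r := fun u => by
      rw [integral_Icc_subtype hm]
      refine intervalIntegral.integral_congr fun r hr => ?_
      rw [uIcc_of_le hm] at hr
      simp only [projIcc_of_mem hm hr]
    simp_rw [h3]
    have hDi : Integrable (Function.uncurry fun (u : Cyl n) (r : Icc (-1 : ℝ) 1) => D u r)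
        ((volume : Measure (Cyl n)).prod volume) :=
      (BM.of_continuous (hDc.comp (continuous_fst.prodMk
        (continuous_subtype_val.comp continuous_snd)))).integrable _
    rw [integral_integral_swap hDi]
    have h4 : ∀ r : Icc (-1 : ℝ) 1, ∫ u, D u r = ∫ u, pderiv i.succ f u ^ 2 := fun r =>
      integral_shift (Pi.single i ((r : ℝ) : UnitAddCircle)) fun u => pderiv i.succ f u ^ 2
    simp_rw [h4]
    rw [integral_Icc_subtype hm, intervalIntegral.integral_const]
    norm_num
  have h5 : shiftOsc f (Pi.single i (s : UnitAddCircle)) ≤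
      ∫ u, (|s| / (4 * l) + l * ∫ r in (-1 : ℝ)..1, D u r) :=
    integral_mono (integrable_of_continuous
      ((continuous_shift hf.cont).comp (Continuous.prodMk_right _)))
      (integrable_of_continuous (by fun_prop)) h1
  rw [integral_add (integrable_const _) (integrable_of_continuous (by fun_prop)),
    integral_const_mul, h2, integral_const, smul_eq_mul] at h5
  have h6 := mul_le_mul_of_nonneg_left hv (measureReal_nonneg (μ := (volume : Measure (Cyl n)))
    (s := univ))
  linarith

lemma shiftOsc_le {f : Cyl n → ℝ} (hf : IsC1 f) {l : ℝ} (hl : 0 < l)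
    (z : Fin n → UnitAddCircle) : shiftOsc f z ≤
      2 * l * (∑ i : Fin n, ∫ u, pderiv i.succ f u ^ 2)
        + (n * l + (∑ i, tdist (z i)) / (32 * l ^ 3)) * volume.real (univ : Set (Cyl n)) := by
  have h0 : shiftOsc f 0 = 0 := by simp [shiftOsc]
  have h1 : shiftOsc f z ≤ ∑ i, shiftOsc f (Pi.single i (z i)) := by
    conv_lhs => rw [← Finset.univ_sum_single z]
    exact Finset.le_sum_of_subadditive _ h0.le (shiftOsc_add_le hf.cont) _ _
  refine h1.trans ((Finset.sum_le_sum fun i _ => shiftOsc_single_le hf hl i (z i)).trans_eq ?_)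
  rw [Finset.sum_add_distrib, ← Finset.mul_sum, ← Finset.sum_mul, Finset.sum_add_distrib,
    ← Finset.sum_div]
  simp

lemma integral_kern_torus (N : ℕ) (u : Cyl n) (g : (Fin n → UnitAddCircle) → ℝ) :
    ∫ v : Cyl n, kern N 1 0 u v * g v.2 = ∫ z, (∏ i, tor N 0 (z i)) * g (u.2 - z) := by
  have h1 := integral_prod_mul (μ := (volume : Measure (Icc (-1 : ℝ) 1)))
    (ν := (volume : Measure (Fin n → UnitAddCircle)))
    (fun y => ax N 0 ((u.1 : ℝ) - y) + 1 * ax N 0 ((u.1 : ℝ) + y - 2))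
    (fun y => (∏ i, tor N 0 (u.2 i - y i)) * g y)
  have : (volume : Measure (Fin n → UnitAddCircle)).IsNegInvariant :=
    Measure.pi.isNegInvariant _
  rw [integral_ax_reflect, one_mul, ← integral_sub_left_eq_self _ volume u.2] at h1
  simp only [Pi.sub_apply, sub_sub_cancel] at h1
  rw [← h1]
  refine integral_congr_ae (ae_of_all _ fun v => ?_)
  simp only [kern, Pi.zero_apply, mul_assoc]

lemma integral_kern_ver (N : ℕ) (u : Cyl n) :
    ∫ v : Cyl n, (ax N 0 ((u.1 : ℝ) - v.1) * ver ((u.1 : ℝ) - v.1)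
      + ax N 0 ((u.1 : ℝ) + v.1 - 2) * ver ((u.1 : ℝ) + v.1 - 2)) *
        ∏ i, tor N 0 (u.2 i - v.2 i) = 1 / (N + 1) := by
  have h1 := integral_reflected (f := fun z => ax N 0 z * ver z)
    ((continuous_ax N 0).mul continuous_ver)
    (fun z => by simp only [ax_periodic N 0 z, ver_periodic z]) u.1
  have h2 : ∫ z in (0 : ℝ)..4, ax N 0 z * ver z = 1 / (N + 1) := by
    simp only [ver, ax, mollD_zero]
    exact integral_moll_mul (by norm_num) (by positivity) ax_period N
  have h3 := integral_cyl_prod (fun y : Icc (-1 : ℝ) 1 => ax N 0 ((u.1 : ℝ) - y) *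
    ver ((u.1 : ℝ) - y) + ax N 0 ((u.1 : ℝ) + y - 2) * ver ((u.1 : ℝ) + y - 2))
    (fun _ => tor N 0) u.2
  rw [h3, h1, h2]
  simp [integral_tor]

/-- With `A` and `B` the direct and reflected axial factors, `f - P_N f` is the average of `A (f(u)
- f(v)) + B (f(u) + f(v))`: the missing mass of the Dirichlet kernel is supplied by comparison with
the Neumann one. Passing through the intermediate point `(u₁, v₂)` isolates the shift in the torus
variables; the axial remainders are bounded by `axial_sub_le` and `axial_add_le`, whose `ver` terms
integrate to `1 / (N + 1)`. -/
lemma abs_mop_dir_sub_le (N : ℕ) {f : Cyl n → ℝ} (hf : IsC1 f) (h0 : ∀ u ∈ bdry n, f u = 0)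
    {l : ℝ} (hl : 0 < l) (u : Cyl n) :
    |mop N (-1) 0 f u - f u| ≤ (∫ v : Cyl n, kern N 1 0 u v * |f u - f (u.1, v.2)|)
      + mop N 1 0 (fun v => 2 * l * axEnergy f v.2 + l) u + 1 / (N + 1) / (32 * l ^ 3) := by
  have hk := continuous_kern_right N 1 0 u
  have hk' := continuous_kern_right N (-1) 0 u
  have hE : Continuous fun v : Cyl n => 2 * l * axEnergy f v.2 + l :=
    (continuous_const.mul (hf.continuous_axEnergy.comp continuous_snd)).add continuous_const
  have hd : Continuous fun v : Cyl n => |f u - f (u.1, v.2)| :=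
    (continuous_const.sub (hf.cont.comp (by fun_prop))).abs
  have hv : Continuous fun v : Cyl n => (ax N 0 ((u.1 : ℝ) - v.1) * ver ((u.1 : ℝ) - v.1)
      + ax N 0 ((u.1 : ℝ) + v.1 - 2) * ver ((u.1 : ℝ) + v.1 - 2)) *
        ∏ i, tor N 0 (u.2 i - v.2 i) := by
    have h1 := continuous_ax N 0
    have h2 := continuous_ver
    have h3 := continuous_tor N 0
    exact (((h1.comp (by fun_prop)).mul (h2.comp (by fun_prop))).add
      ((h1.comp (by fun_prop)).mul (h2.comp (by fun_prop)))).mul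
      (continuous_finsetProd _ fun i _ => h3.comp (by fun_prop))
  have k1 : Continuous fun v => kern N (-1) 0 u v * f v := hk'.mul hf.cont
  have k2 : Continuous fun v => kern N 1 0 u v * f u := hk.mul continuous_const
  have k3 : Continuous fun v : Cyl n => kern N 1 0 u v * |f u - f (u.1, v.2)| := hk.mul hd
  have k4 : Continuous fun v => kern N 1 0 u v * (2 * l * axEnergy f v.2 + l) := hk.mul hE
  have e1 : mop N (-1) 0 f u - f u = ∫ v, (kern N (-1) 0 u v * f v - kern N 1 0 u v * f u) := by
    rw [integral_sub (integrable_of_continuous k1) (integrable_of_continuous k2), integral_mul_const, integral_kern,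
      one_mul]
    rfl
  rw [e1, ← integral_kern_ver N u, ← integral_div, mop,
    ← integral_add (integrable_of_continuous k3) (integrable_of_continuous k4)]
  have hs : Continuous fun v : Cyl n => kern N 1 0 u v * |f u - f (u.1, v.2)|
      + kern N 1 0 u v * (2 * l * axEnergy f v.2 + l) := k3.add k4
  rw [← integral_add (integrable_of_continuous hs)
    (integrable_of_continuous (hv.div_const _))]
  refine abs_integral_le_integral_abs.trans (integral_mono (integrable_of_continuous
    (k1.sub k2).abs)
    (integrable_of_continuous (hs.add (hv.div_const _))) fun v => ?_)
  have hA := ax_nonneg N ((u.1 : ℝ) - v.1)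
  have hB := ax_nonneg N ((u.1 : ℝ) + v.1 - 2)
  have hP := prod_tor_nonneg N fun i => u.2 i - v.2 i
  have b1 := hf.axial_sub_le hl u.1 v.1 v.2
  have b2 := hf.axial_add_le h0 hl u.1 v.1 v.2
  have c1 := (abs_sub_le (f u) (f (u.1, v.2)) (f v)).trans (add_le_add_right b1 _)
  have c0 := abs_add_le (f u - f (u.1, v.2)) (f (u.1, v.2) + f v)
  rw [show f u - f (u.1, v.2) + (f (u.1, v.2) + f v) = f u + f v by ring] at c0
  have c2 := c0.trans (add_le_add_right b2 _)
  simp only [kern, Pi.zero_apply]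
  set A := ax N 0 ((u.1 : ℝ) - v.1)
  set B := ax N 0 ((u.1 : ℝ) + v.1 - 2)
  set P := ∏ i, tor N 0 (u.2 i - v.2 i)
  have e2 : (A + -1 * B) * P * f v - (A + 1 * B) * P * f u =
      -(P * (A * (f u - f v) + B * (f u + f v))) := by ring
  rw [e2, abs_neg, abs_mul, abs_of_nonneg hP]
  have h3 : |A * (f u - f v) + B * (f u + f v)| ≤ A * |f u - f v| + B * |f u + f v| := by
    refine (abs_add_le _ _).trans ?_
    rw [abs_mul, abs_mul, abs_of_nonneg hA, abs_of_nonneg hB]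
  have h4 := mul_le_mul_of_nonneg_left (h3.trans (add_le_add
    (mul_le_mul_of_nonneg_left c1 hA) (mul_le_mul_of_nonneg_left c2 hB))) hP
  refine h4.trans_eq ?_
  ring

/-- At a fixed axial coordinate the kernel integrates to the torus mollifier, so Fubini reduces the
double integral to an average of `shiftOsc`. The same identity, read backwards at the auxiliary
point `u₀`, makes the moment bound for `sqd` available. -/
lemma integral_shift_part_le (N : ℕ) {f : Cyl n → ℝ} (hf : IsC1 f) {l : ℝ} (hl : 0 < l) :
    ∫ u : Cyl n, ∫ v : Cyl n, kern N 1 0 u v * |f u - f (u.1, v.2)| ≤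
      2 * l * (∑ i : Fin n, ∫ u, pderiv i.succ f u ^ 2)
        + (n * l + (n + 1) / (N + 1) / (32 * l ^ 3)) * volume.real (univ : Set (Cyl n)) := by
  have ht : Continuous fun z : Fin n → UnitAddCircle => ∏ i, tor N 0 (z i) :=
    continuous_finsetProd _ fun i _ => (continuous_tor N 0).comp (continuous_apply i)
  have e1 : ∀ u : Cyl n, ∫ v : Cyl n, kern N 1 0 u v * |f u - f (u.1, v.2)| =
      ∫ z, (∏ i, tor N 0 (z i)) * |f u - f (u.1, u.2 - z)| := fun u =>
    integral_kern_torus N u fun y => |f u - f (u.1, y)|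
  simp_rw [e1]
  have hint : Integrable (Function.uncurry fun (u : Cyl n) (z : Fin n → UnitAddCircle) =>
      (∏ i, tor N 0 (z i)) * |f u - f (u.1, u.2 - z)|)
      ((volume : Measure (Cyl n)).prod volume) :=
    (BM.of_continuous ((ht.comp continuous_snd).mul
      ((continuous_shift hf.cont).comp continuous_swap))).integrable _
  rw [integral_integral_swap hint]
  simp_rw [integral_const_mul]
  let u₀ : Cyl n := (⟨0, by norm_num, by norm_num⟩, 0)
  have e2 := integral_kern_torus N u₀ fun y => shiftOsc f (u₀.2 - y)
  simp only [sub_sub_cancel] at e2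
  change ∫ z, (∏ i, tor N 0 (z i)) * shiftOsc f z ≤ _
  rw [← e2]
  set V := volume.real (univ : Set (Cyl n))
  have hV : 0 ≤ V := measureReal_nonneg
  set A := 2 * l * (∑ i : Fin n, ∫ u, pderiv i.succ f u ^ 2) + n * l * V with hA
  have hk := continuous_kern_right N 1 0 u₀
  have hs := continuous_sqd_right u₀
  have h1 : ∫ v : Cyl n, kern N 1 0 u₀ v * shiftOsc f (u₀.2 - v.2) ≤
      ∫ v, (kern N 1 0 u₀ v * A + (kern N 1 0 u₀ v * sqd u₀ v) * (V / (32 * l ^ 3))) := by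
    refine integral_mono (integrable_of_continuous (hk.mul
      ((continuous_shiftOsc hf.cont).comp (by fun_prop)))) (integrable_of_continuous
      ((hk.mul continuous_const).add ((hk.mul hs).mul continuous_const))) fun v => ?_
    have h2 := shiftOsc_le hf hl (u₀.2 - v.2)
    have h3 : ∑ i, tdist ((u₀.2 - v.2) i) ≤ sqd u₀ v := by
      simp only [sqd, Pi.sub_apply]
      linarith [Real.cos_le_one (Real.pi / 2 * ((u₀.1 : ℝ) - v.1))]
    have h4 : shiftOsc f (u₀.2 - v.2) ≤ A + sqd u₀ v * (V / (32 * l ^ 3)) := by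
      have h5 : (∑ i, tdist ((u₀.2 - v.2) i)) * (V / (32 * l ^ 3)) ≤
          sqd u₀ v * (V / (32 * l ^ 3)) := mul_le_mul_of_nonneg_right h3 (by positivity)
      refine h2.trans (le_trans (le_of_eq ?_) (add_le_add_right h5 A))
      rw [hA]; ring
    exact (mul_le_mul_of_nonneg_left h4 (kern_neu_nonneg N u₀ v)).trans_eq (by ring)
  have j1 : Continuous fun v => kern N 1 0 u₀ v * A := hk.mul continuous_const
  have j2 : Continuous fun v => (kern N 1 0 u₀ v * sqd u₀ v) * (V / (32 * l ^ 3)) :=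
    (hk.mul hs).mul continuous_const
  rw [integral_add (integrable_of_continuous j1) (integrable_of_continuous j2), integral_mul_const,
    integral_mul_const, integral_kern, one_mul] at h1
  have h6 := mul_le_mul_of_nonneg_right (integral_kern_mul_sqd_le N u₀)
    (by positivity : 0 ≤ V / (32 * l ^ 3))
  refine h1.trans ((add_le_add_right h6 A).trans_eq ?_)
  rw [hA]; ring

/-- Mollification is `L¹`-close to the identity, uniformly on sets of bounded energy. -/
lemma eventually_integral_abs_mop_sub_le {ε : ℝ} (hε : 0 < ε) : ∀ᶠ N : ℕ in atTop,
    ∀ f : Cyl n → ℝ, IsC1 f → (∀ u ∈ bdry n, f u = 0) →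
      ∫ u, |mop N (-1) 0 f u - f u| ≤ ε * (1 + ∑ k, ∫ u, pderiv k f u ^ 2) := by
  set V := volume.real (univ : Set (Cyl n))
  have hV : 0 ≤ V := measureReal_nonneg
  -- The choice of `l` gives `4l ≤ ε` for the coefficient of the energy and `(n+1) l V ≤ ε/2` for
  -- the constant; only then is `N` taken large, to beat the factor `l⁻³`.
  set l := ε / (4 + 2 * (n + 1) * V) with hl
  have hl0 : 0 < l := by positivity
  have hl1 : 4 * l ≤ ε := by
    rw [hl, mul_div_assoc', div_le_iff₀ (by positivity)]
    nlinarith [mul_nonneg hε.le (by positivity : 0 ≤ 2 * (n + 1) * V)]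
  have hl2 : (n + 1) * l * V ≤ ε / 2 := by
    rw [hl, mul_div_assoc', div_mul_eq_mul_div, div_le_div_iff₀ (by positivity) (by norm_num)]
    nlinarith
  have hlim : Tendsto (fun N : ℕ => (n + 2) * V / (32 * l ^ 3) * (1 / ((N : ℝ) + 1))) atTop
      (𝓝 0) := by
    have := (tendsto_one_div_add_atTop_nhds_zero_nat (𝕜 := ℝ)).const_mul
      ((n + 2) * V / (32 * l ^ 3))
    rwa [mul_zero] at this
  filter_upwards [hlim.eventually (gt_mem_nhds (half_pos hε))] with N hN f hf h0
  have hb : BM (mop N (-1) 0 f) := hf.bm.mop N _ _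
  have hEc : Continuous fun v : Cyl n => 2 * l * axEnergy f v.2 + l :=
    (continuous_const.mul (hf.continuous_axEnergy.comp continuous_snd)).add continuous_const
  have hE : BM fun v : Cyl n => 2 * l * axEnergy f v.2 + l := BM.of_continuous hEc
  have hT : BM fun u : Cyl n => ∫ v : Cyl n, kern N 1 0 u v * |f u - f (u.1, v.2)| := by
    refine BM.integral_right (f := fun u v : Cyl n => kern N 1 0 u v * |f u - f (u.1, v.2)|)
      (BM.of_continuous ((continuous_kern N 1 0).mul ?_))
    have : Continuous fun p : Cyl n × Cyl n => f (p.1.1, p.2.2) := hf.cont.comp (by fun_prop)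
    exact ((hf.cont.comp continuous_fst).sub this).abs
  have h1 := integral_mono ((hb.sub hf.bm).abs.integrable volume)
    (((hT.add (hE.mop N 1 0)).add (BM.const _)).integrable volume)
    (abs_mop_dir_sub_le N hf h0 hl0)
  rw [integral_add ((hT.add (hE.mop N 1 0)).integrable _) (integrable_const _),
    integral_add (hT.integrable _) ((hE.mop N 1 0).integrable _),
    integral_mop_neu N hE.1 hE.2.choose_spec] at h1
  have j1 : Continuous fun v : Cyl n => 2 * l * axEnergy f v.2 :=
    continuous_const.mul (hf.continuous_axEnergy.comp continuous_snd)
  rw [integral_add (integrable_of_continuous j1) (integrable_const _), integral_const_mul,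
    integral_axEnergy hf, integral_const, integral_const, smul_eq_mul, smul_eq_mul] at h1
  have h2 := integral_shift_part_le N hf hl0
  rw [Fin.sum_univ_succ]
  set S := ∑ i : Fin n, ∫ u, pderiv i.succ f u ^ 2
  have hS : 0 ≤ S := Finset.sum_nonneg fun i _ => integral_nonneg fun u => sq_nonneg _
  set S0 := ∫ u, pderiv 0 f u ^ 2
  have hS0 : 0 ≤ S0 := integral_nonneg fun u => sq_nonneg _
  have e : (n * l + (n + 1) / (N + 1) / (32 * l ^ 3)) * V + (V * l + V * (1 / (N + 1) / (32 * l ^ 3)))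
      = (n + 1) * l * V + (n + 2) * V / (32 * l ^ 3) * (1 / ((N : ℝ) + 1)) := by
    ring
  nlinarith [mul_le_mul_of_nonneg_right hl1 hS, mul_le_mul_of_nonneg_right hl1 hS0,
    mul_nonneg hl0.le hS]

end Poincare

/-! ### Strong convergence of the densities -/

section StrongConvergence

set_option linter.unusedSectionVars false

variable {n : ℕ} {T : ℝ} [hT : Fact (0 < T)] {β : ℝ} {J : KacKernel n} {b : bdry n → ℝ}

lemma integral2_const (c : ℝ) : ∫ _ : TimeI T, ∫ _ : Cyl n, c =
    volume.real (univ : Set (TimeI T)) * (volume.real (univ : Set (Cyl n)) * c) := by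
  simp only [integral_const, smul_eq_mul]

/-- The densities of paths of bounded cost are uniformly close to their mollifications. -/
lemma Good.eventually_mop_close {θ : Cyl n → ℝ} {c C : ℝ} (hθ : IsC1 θ) (hc : 0 < c)
    (hC : C < 1) (hcC : ∀ u, c ≤ θ u ∧ θ u ≤ C) (hb : ∀ r : bdry n, θ r.1 = b r) (a : ℝ)
    {ε : ℝ} (hε : 0 < ε) : ∀ᶠ M : ℕ in atTop, ∀ γ ∈ F1 n,
      ∀ (π : TimeI T → Meas n) (ρ : TimeI T → Cyl n → ℝ), Good β J b γ a π → IsDensity π ρ →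
        ∫ t, ∫ u, |mop M (-1) 0 (fun v => ρ t v - θ v) u - (ρ t u - θ u)| ≤ ε := by
  obtain ⟨K, hK0, hK⟩ := energy_bound (T := T) β J hθ hc hC hcC hb a
  set S := ∑ k, ∫ u, pderiv k θ u ^ 2 with hS
  have hS0 : 0 ≤ S := Finset.sum_nonneg fun k _ => integral_nonneg fun u => sq_nonneg _
  set τ := volume.real (univ : Set (TimeI T)) with hτ
  have hτ0 : 0 ≤ τ := measureReal_nonneg
  set L := τ * (1 + 2 * S) + 2 * K with hL
  have hL0 : 0 ≤ L := by positivity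
  filter_upwards [eventually_integral_abs_mop_sub_le (n := n) (ε := ε / (L + 1)) (by positivity)]
    with M hM γ hγ π ρ hπ hρ
  set w : TimeI T → Cyl n → ℝ := fun t v => ρ t v - θ v with hw
  have hwb : BM (Function.uncurry w) := hρ.bm_sub hθ.bm
  -- The function `ρ - θ` has no classical gradient, so the Poincaré inequality at scale `M` is
  -- applied to its mollification at a finer scale `N`, whose energy is bounded uniformly, and `N →
  -- ∞` at fixed `M`.
  set f : ℕ → TimeI T → Cyl n → ℝ := fun N t => mop N (-1) 0 (w t) with hf
  have hfb : ∀ N, BM (Function.uncurry (f N)) := fun N => bm_mop_param N (-1) 0 hwb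
  have hlim := tendsto_integral2_mop (Or.inr rfl) hwb
  have hlim' : Tendsto (fun N : ℕ => ε / (L + 1) * L + 2 * ∫ t, ∫ u, |f N t u - w t u|) atTop
      (𝓝 (ε / (L + 1) * L + 2 * 0)) := (hlim.const_mul 2).const_add _
  have hfin : ε / (L + 1) * L + 2 * 0 ≤ ε := by
    rw [mul_zero, add_zero, div_mul_eq_mul_div, div_le_iff₀ (by positivity)]
    nlinarith
  refine (ge_of_tendsto hlim' ?_).trans hfin
  filter_upwards [hK 1 one_pos le_rfl] with N hN
  obtain ⟨hr, hwf⟩ := hN γ hγ π ρ hπ hρ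
  have hp := hρ.bm_wform hθ one_pos hr
  have hQ := fun k => hρ.bm_pderiv_rhoN hθ N k
  have hDb : ∀ k, BM (Function.uncurry fun (_ : TimeI T) u => pderiv k θ u) := fun k =>
    (hθ.bm_pderiv k).comp measurable_snd
  -- the energy of the mollified densities
  have hfC : ∀ t, IsC1 (f N t) := fun t => (bm_slice hwb t).isC1_mop N _ _
  have hpd : ∀ t k u, pderiv k (f N t) u = pderiv k (rhoN N θ (ρ t)) u - pderiv k θ u := by
    intro t k u
    rw [pderiv_rhoN N hθ (hρ.bm_slice t), hf, (bm_slice hwb t).pderiv_mop, zero_add,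
      add_sub_cancel_right]
  have hpb : ∀ k, BM (Function.uncurry fun t u => pderiv k (f N t) u) := fun k => by
    have : (Function.uncurry fun t u => pderiv k (f N t) u) = fun p : TimeI T × Cyl n =>
        pderiv k (rhoN N θ (ρ p.1)) p.2 - pderiv k θ p.2 := funext fun p => hpd p.1 k p.2
    rw [this]
    exact (hQ k).sub (hDb k)
  have hEb : BM fun t => ∑ k, ∫ u, pderiv k (f N t) u ^ 2 :=
    BM.sum (s := Finset.univ) (f := fun k (t : TimeI T) => ∫ u, pderiv k (f N t) u ^ 2) fun k _ =>
      BM.integral_right (f := fun t u => pderiv k (f N t) u ^ 2) ((hpb k).pow 2)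
  have hwB : BM fun t => wform 1 N θ (ρ t) :=
    BM.integral_right (f := fun t u => dlogit 1 (rhoN N θ (ρ t) u) *
      ∑ k, pderiv k (rhoN N θ (ρ t)) u ^ 2) (hp.mul (BM.sum (s := Finset.univ)
        (f := fun k (p : TimeI T × Cyl n) => pderiv k (rhoN N θ (ρ p.1)) p.2 ^ 2)
        fun k _ => (hQ k).pow 2))
  -- The weight in `wform` is at least one, so with `δ = 1` the entropy form already controls the
  -- plain Dirichlet energy.
  have h1 : ∀ t, ∑ k, ∫ u, pderiv k (f N t) u ^ 2 ≤ 2 * wform 1 N θ (ρ t) + 2 * S := by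
    intro t
    have hC1 := isC1_rhoN N hθ (hρ.bm_slice t)
    rw [wform_eq_sum (bm_slice hp t) hC1, hS, Finset.mul_sum, Finset.mul_sum,
      ← Finset.sum_add_distrib]
    refine Finset.sum_le_sum fun k _ => ?_
    have hq := (hC1.bm_pderiv k).pow 2
    have hpq := (bm_slice hp t).mul hq
    rw [← integral_const_mul, ← integral_const_mul, ← integral_add
      ((hpq.const_mul 2).integrable _) ((((hθ.bm_pderiv k).pow 2).const_mul 2).integrable _)]
    refine integral_mono ((bm_slice (hpb k) t).pow 2 |>.integrable _)
      (((hpq.const_mul 2).add (((hθ.bm_pderiv k).pow 2).const_mul 2)).integrable _) fun u => ?_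
    have h5 := one_le_dlogit (δ := 1) (r := rhoN N θ (ρ t) u) (by linarith [(hr t u).1])
      (by linarith [(hr t u).2]) le_rfl
    simp only [hpd]
    nlinarith [sq_nonneg (pderiv k (rhoN N θ (ρ t)) u + pderiv k θ u),
      mul_le_mul_of_nonneg_right h5 (sq_nonneg (pderiv k (rhoN N θ (ρ t)) u))]
  have h2 : ∫ t, (1 + ∑ k, ∫ u, pderiv k (f N t) u ^ 2) ≤ L := by
    have := integral_mono (((BM.const 1).add hEb).integrable (volume : Measure (TimeI T)))
      (((BM.const (1 + 2 * S)).add (hwB.const_mul 2)).integrable _) fun t => by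
        have := h1 t
        change 1 + _ ≤ (1 + 2 * S) + 2 * wform 1 N θ (ρ t)
        linarith
    rw [integral_add (integrable_const _) ((hwB.const_mul 2).integrable _), integral_const,
      integral_const_mul, smul_eq_mul] at this
    refine this.trans ?_
    rw [hL]
    gcongr
  have hMf : BM (Function.uncurry fun t u => |mop M (-1) 0 (f N t) u - f N t u|) :=
    ((bm_mop_param M (-1) 0 (hfb N)).sub (hfb N)).abs
  have h3 : ∫ t, ∫ u, |mop M (-1) 0 (f N t) u - f N t u| ≤ ε / (L + 1) * L := by
    have := integral_mono ((BM.integral_right (μ := (volume : Measure (Cyl n)))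
      (f := fun t u => |mop M (-1) 0 (f N t) u - f N t u|) hMf).integrable volume)
      ((((BM.const 1).add hEb).const_mul (ε / (L + 1))).integrable volume)
      fun t => hM (f N t) (hfC t) fun u hu => mop_bdry N (w t) hu
    rw [integral_const_mul] at this
    exact this.trans (mul_le_mul_of_nonneg_left h2 (by positivity))
  -- comparison of `w` with its mollification
  have hdb : BM (Function.uncurry fun t u => f N t u - w t u) := (hfb N).sub hwb
  have hMd : BM (Function.uncurry fun t u => |mop M (-1) 0 (fun v => f N t v - w t v) u|) :=
    (bm_mop_param M (-1) 0 hdb).abs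
  have h4 : ∫ t, ∫ u, |mop M (-1) 0 (w t) u - w t u| ≤
      ∫ t, ∫ u, (|mop M (-1) 0 (f N t) u - f N t u|
        + (|mop M (-1) 0 (fun v => f N t v - w t v) u| + |f N t u - w t u|)) := by
    refine integral2_mono ((bm_mop_param M (-1) 0 hwb).sub hwb).abs
      (hMf.add (hMd.add hdb.abs)) fun t u => ?_
    obtain ⟨C1, hC1⟩ := (bm_slice (hfb N) t).2
    obtain ⟨C2, hC2⟩ := (bm_slice hwb t).2
    rw [mop_sub M (-1) 0 (bm_slice (hfb N) t).1 hC1 (bm_slice hwb t).1 hC2]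
    have := abs_add_three (mop M (-1) 0 (f N t) u - f N t u)
      (-(mop M (-1) 0 (f N t) u - mop M (-1) 0 (w t) u)) (f N t u - w t u)
    rw [abs_neg] at this
    rw [← add_assoc]
    refine le_trans (le_of_eq ?_) this
    congr 1
    ring
  have h5 : ∫ t, ∫ u, |mop M (-1) 0 (fun v => f N t v - w t v) u| ≤
      ∫ t, ∫ u, |f N t u - w t u| := by
    obtain ⟨C3, hC3⟩ := hdb.2
    exact integral_mono ((BM.integral_right (μ := (volume : Measure (Cyl n)))
      (f := fun t u => |mop M (-1) 0 (fun v => f N t v - w t v) u|) hMd).integrable volume)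
      ((BM.integral_right (μ := (volume : Measure (Cyl n)))
      (f := fun t u => |f N t u - w t u|) hdb.abs).integrable volume)
      fun t => integral_abs_mop_le M (Or.inr rfl) (bm_slice hdb t).1 fun u => hC3 (t, u)
  rw [integral2_add (f := fun t u => |mop M (-1) 0 (f N t) u - f N t u|)
    (g := fun t u => |mop M (-1) 0 (fun v => f N t v - w t v) u| + |f N t u - w t u|) hMf
    (hMd.add hdb.abs), integral2_add
    (f := fun t u => |mop M (-1) 0 (fun v => f N t v - w t v) u|)
    (g := fun t u => |f N t u - w t u|) hMd hdb.abs] at h4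
  linarith

/-- Ascoli: on a compact space, pointwise and uniform convergence agree for equicontinuous families.
Arbitrary filters are needed, since the weak topology on `Meas` is not assumed first countable. -/
lemma tendstoUniformly_of_equicontinuous {X ι : Type*} [TopologicalSpace X] [CompactSpace X]
    {l : Filter ι} {f : ι → X → ℝ} {g : X → ℝ} (hf : Equicontinuous f)
    (h : ∀ x, Tendsto (fun i => f i x) l (𝓝 (g x))) : TendstoUniformly f g l :=
  UniformFun.tendsto_iff_tendstoUniformly.1
    ((hf.tendsto_uniformFun_iff_pi l g).2 (tendsto_pi_nhds.2 h))

lemma equicontinuous_of_modulus {ι : Type*} {f : ι → TimeI T → ℝ}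
    (h : ∀ ε > 0, ∃ δ > 0, ∀ i, ∀ s t : TimeI T, |(s : ℝ) - t| < δ → |f i s - f i t| < ε) :
    Equicontinuous f := by
  intro t
  rw [Metric.equicontinuousAt_iff]
  intro ε hε
  obtain ⟨δ, hδ, H⟩ := h ε hε
  refine ⟨δ, hδ, fun s hs i => ?_⟩
  rw [Real.dist_eq]
  refine H i t s ?_
  rw [dist_comm, Subtype.dist_eq, Real.dist_eq] at hs
  exact hs

lemma abs_pair_sub_le_sup {m : Meas n} (hm : m ∈ F1 n) {F G : Cyl n → ℝ} (hF : Continuous F)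
    (hG : Continuous G) {ε : ℝ} (h : ∀ u, |F u - G u| ≤ ε) :
    |m.pair F - m.pair G| ≤ ε * volume.real (univ : Set (Cyl n)) := by
  rw [← m.pair_sub hF hG]
  refine (F1.abs_pair_le hm ((BM.of_continuous hF).sub (BM.of_continuous hG))).trans ?_
  refine (le_abs_self _).trans (abs_integral_le_const fun u => ?_)
  rw [abs_abs]
  exact h u

/-- A continuous family of continuous functions is locally uniformly continuous in the parameter. -/
lemma eventually_sup_sub_le {X : Type*} [TopologicalSpace X] {K : X → Cyl n → ℝ}
    (hK : Continuous (Function.uncurry K)) (x : X) {ε : ℝ} (hε : 0 < ε) :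
    ∀ᶠ y in 𝓝 x, ∀ u, |K y u - K x u| ≤ ε := by
  let g : C(X, C(Cyl n, ℝ)) := ContinuousMap.curry ⟨Function.uncurry K, hK⟩
  have h := g.continuous.tendsto x
  rw [Metric.tendsto_nhds] at h
  filter_upwards [h ε hε] with y hy u
  have := (ContinuousMap.dist_apply_le_dist (f := g y) (g := g x) u).trans hy.le
  rwa [Real.dist_eq] at this

/-- Equicontinuity in time comes from the weak modulus for one fixed kernel function; in space, from
uniform continuity of the kernel and densities at most one. -/
lemma Good.equicontinuous_kern {θ : Cyl n → ℝ} (hθ : Continuous θ)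
    (hb : ∀ r : bdry n, θ r.1 = b r) {a : ℝ} {γ : Meas n} {ι : Type*} {π : ι → TimeI T → Meas n}
    (hπ : ∀ i, Good β J b γ a (π i)) (M : ℕ) :
    Equicontinuous fun i (p : TimeI T × Cyl n) => (π i p.1).pair (kern M (-1) 0 p.2) := by
  set V := volume.real (univ : Set (Cyl n)) with hV
  have hV0 : 0 ≤ V := measureReal_nonneg
  intro p
  rw [Metric.equicontinuousAt_iff_right]
  intro e he
  have he' : 0 < e / (2 * (V + 1)) := by positivity
  obtain ⟨δ, hδ, hmod⟩ := Good.modulus (T := T) (β := β) (J := J) hθ hb γ a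
    (continuous_kern_right M (-1) 0 p.2) (half_pos he)
  have h1 : ∀ᶠ q : TimeI T × Cyl n in 𝓝 p, |(p.1 : ℝ) - q.1| < δ := by
    have : Continuous fun q : TimeI T × Cyl n => |(p.1 : ℝ) - q.1| := by fun_prop
    have h2 := this.tendsto p
    simp only [sub_self, abs_zero] at h2
    exact h2.eventually (gt_mem_nhds hδ)
  have h3 := (continuous_snd.tendsto p).eventually
    (eventually_sup_sub_le (K := fun u v => kern M (-1) 0 u v) (continuous_kern M (-1) 0) p.2 he')
  filter_upwards [h1, h3] with q hq1 hq2 i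
  rw [Real.dist_eq]
  have h4 := hmod (π i) (hπ i) p.1 q.1 hq1
  have h5 := abs_pair_sub_le_sup ((hπ i).mem q.1) (continuous_kern_right M (-1) 0 q.2)
    (continuous_kern_right M (-1) 0 p.2) hq2
  have h6 : e / (2 * (V + 1)) * V < e / 2 := by
    rw [div_mul_eq_mul_div, div_lt_div_iff₀ (by positivity) (by norm_num)]
    nlinarith
  have h7 := abs_sub_le ((π i p.1).pair (kern M (-1) 0 p.2))
    ((π i q.1).pair (kern M (-1) 0 p.2)) ((π i q.1).pair (kern M (-1) 0 q.2))
  rw [abs_sub_comm ((π i q.1).pair (kern M (-1) 0 p.2))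
    ((π i q.1).pair (kern M (-1) 0 q.2))] at h7
  linarith

lemma Good.tendstoUniformly_kern {θ : Cyl n → ℝ} (hθ : Continuous θ)
    (hb : ∀ r : bdry n, θ r.1 = b r) {a : ℝ} {γ : Meas n} {ι : Type*} {l : Filter ι}
    {π : ι → TimeI T → Meas n} {x : TimeI T → Meas n} (hπ : ∀ i, Good β J b γ a (π i))
    (h : ∀ t F, Continuous F → Tendsto (fun i => (π i t).pair F) l (𝓝 ((x t).pair F))) (M : ℕ) :
    TendstoUniformly (fun i (p : TimeI T × Cyl n) => (π i p.1).pair (kern M (-1) 0 p.2))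
      (fun p => (x p.1).pair (kern M (-1) 0 p.2)) l := by
  have heq := Good.equicontinuous_kern hθ hb hπ M
  have hp : ∀ p : TimeI T × Cyl n, Tendsto (fun i => (π i p.1).pair (kern M (-1) 0 p.2)) l
      (𝓝 ((x p.1).pair (kern M (-1) 0 p.2))) :=
    fun p => h p.1 _ (continuous_kern_right M (-1) 0 p.2)
  exact tendstoUniformly_of_equicontinuous heq hp

/-- Pointwise weak convergence of paths of bounded cost implies strong convergence. -/
lemma Good.tendsto_density {θ : Cyl n → ℝ} {c C : ℝ} (hθ : IsC1 θ) (hc : 0 < c)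
    (hC : C < 1) (hcC : ∀ u, c ≤ θ u ∧ θ u ≤ C) (hb : ∀ r : bdry n, θ r.1 = b r) {a : ℝ}
    {γ : Meas n} (hγ : γ ∈ F1 n) {ι : Type*} {l : Filter ι} {π : ι → TimeI T → Meas n}
    {x : TimeI T → Meas n} {ρ : ι → TimeI T → Cyl n → ℝ} {r : TimeI T → Cyl n → ℝ}
    (hπ : ∀ i, Good β J b γ a (π i)) (hρ : ∀ i, IsDensity (π i) (ρ i)) (hr : IsDensity x r)
    (h : ∀ t F, Continuous F → Tendsto (fun i => (π i t).pair F) l (𝓝 ((x t).pair F))) :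
    Tendsto (fun i => ∫ t, ∫ u, |ρ i t u - r t u|) l (𝓝 0) := by
  set V := volume.real (univ : Set (Cyl n)) with hV
  have hV0 : 0 ≤ V := measureReal_nonneg
  set τ := volume.real (univ : Set (TimeI T)) with hτ
  have hτ0 : 0 ≤ τ := measureReal_nonneg
  rw [Metric.tendsto_nhds]
  intro ε hε
  -- One scale `M` serves all the paths and the limit; what remains is convergence of the densities
  -- mollified at this fixed scale, which is uniform.
  obtain ⟨M, hM1, hM2⟩ := ((Good.eventually_mop_close (T := T) (β := β) (J := J) hθ hc hC hcC hb a
    (by positivity : 0 < ε / 4)).and ((tendsto_integral2_mop (Or.inr rfl)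
      (hr.bm_sub hθ.bm)).eventually (gt_mem_nhds (by positivity : 0 < ε / 4)))).exists
  have hunif := Good.tendstoUniformly_kern hθ.cont hb hπ h M
  rw [Metric.tendstoUniformly_iff] at hunif
  have he2 : 0 < ε / (4 * (τ * V + 1)) := by positivity
  filter_upwards [hunif _ he2] with i hi
  rw [Real.dist_eq, sub_zero, abs_of_nonneg (integral_nonneg fun t => integral_nonneg fun u =>
    abs_nonneg _)]
  have g1 := hM1 γ hγ (π i) (ρ i) (hπ i) (hρ i)
  have hw := (hρ i).bm_sub hθ.bm
  have hw' := hr.bm_sub hθ.bm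
  have g2 : ∫ t, ∫ u, |ρ i t u - r t u| ≤ ∫ t, ∫ u,
      (|mop M (-1) 0 (fun v => ρ i t v - θ v) u - (ρ i t u - θ u)|
      + (|mop M (-1) 0 (fun v => r t v - θ v) u - (r t u - θ u)| + ε / (4 * (τ * V + 1)))) := by
    refine integral2_mono ((hρ i).bm.sub hr.bm).abs (((bm_mop_param M (-1) 0 hw).sub hw).abs.add
      (((bm_mop_param M (-1) 0 hw').sub hw').abs.add (BM.const _))) fun t u => ?_
    have k1 := (hi (t, u)).le
    rw [Real.dist_eq, ← (hρ i).mop_eq_pair, ← hr.mop_eq_pair] at k1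
    have k2 := mop_sub M (-1) 0 ((hρ i).meas_slice t) ((hρ i).abs_le t) hθ.bm.1
      hθ.bm.2.choose_spec u
    have k3 := mop_sub M (-1) 0 (hr.meas_slice t) (hr.abs_le t) hθ.bm.1 hθ.bm.2.choose_spec u
    have k4 := abs_add_three (-(mop M (-1) 0 (fun v => ρ i t v - θ v) u - (ρ i t u - θ u)))
      (mop M (-1) 0 (fun v => r t v - θ v) u - (r t u - θ u))
      (-(mop M (-1) 0 (r t) u - mop M (-1) 0 (ρ i t) u))
    rw [abs_neg, abs_neg] at k4
    have k5 : -(mop M (-1) 0 (fun v => ρ i t v - θ v) u - (ρ i t u - θ u))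
      + (mop M (-1) 0 (fun v => r t v - θ v) u - (r t u - θ u))
      + -(mop M (-1) 0 (r t) u - mop M (-1) 0 (ρ i t) u) = ρ i t u - r t u := by
      rw [k2, k3]; ring
    rw [k5] at k4
    linarith
  rw [integral2_add (f := fun t u =>
      |mop M (-1) 0 (fun v => ρ i t v - θ v) u - (ρ i t u - θ u)|)
    (g := fun t u => |mop M (-1) 0 (fun v => r t v - θ v) u - (r t u - θ u)|
      + ε / (4 * (τ * V + 1))) ((bm_mop_param M (-1) 0 hw).sub hw).abs
      (((bm_mop_param M (-1) 0 hw').sub hw').abs.add (BM.const _)),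
    integral2_add (f := fun t u => |mop M (-1) 0 (fun v => r t v - θ v) u - (r t u - θ u)|)
      (g := fun _ _ => ε / (4 * (τ * V + 1)))
      ((bm_mop_param M (-1) 0 hw').sub hw').abs (BM.const _), integral2_const] at g2
  have g3 : τ * (V * (ε / (4 * (τ * V + 1)))) ≤ ε / 4 := by
    rw [← mul_assoc, mul_div_assoc', div_le_div_iff₀ (by positivity) (by norm_num)]
    nlinarith [mul_nonneg hτ0 hV0]
  linarith

end StrongConvergence

/-! ### Passage to the limit in the rate functionals -/

section Limits

set_option linter.unusedSectionVars false

variable {n : ℕ} {T : ℝ} [hT : Fact (0 < T)] {β : ℝ} {J : KacKernel n} {b : bdry n → ℝ}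

/-- Each term is Lipschitz for the `L¹` distance of densities: `σ` is Lipschitz on `[0,1]`, and the
gradient of `J^neum ⋆ ρ` depends on `ρ` in a Lipschitz way from `L¹` to the sup norm. The surface
term does not involve `ρ` and cancels. -/
lemma spat_lipschitz (β : ℝ) (J : KacKernel n) (b : bdry n → ℝ) (B : ℝ) : ∃ C, 0 ≤ C ∧
    ∀ V : Fin (n + 1) → Cyl n → ℝ, (∀ k, IsC1 (V k)) → (∀ k u, |V k u| ≤ B) →
      (∀ k u, |pderiv k (V k) u| ≤ B) → ∀ ρ r : Cyl n → ℝ, Measurable ρ → (∀ u, 0 ≤ ρ u) →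
      (∀ u, ρ u ≤ 1) → Measurable r → (∀ u, 0 ≤ r u) → (∀ u, r u ≤ 1) →
      |spat β J b ρ V - spat β J b r V| ≤ C * ∫ u, |ρ u - r u| := by
  obtain ⟨D, hD0, hD⟩ := pderiv_star_bound J
  obtain ⟨K, hK0, hK⟩ := J.exists_gradNeum_bound
  set vol := volume.real (univ : Set (Cyl n)) with hvol
  have hvol0 : 0 ≤ vol := measureReal_nonneg
  set c : ℝ := (n : ℝ) + 1 with hc
  have hc0 : 0 ≤ c := by positivity
  set B' := |B| with hB'
  have hB'0 : 0 ≤ B' := abs_nonneg B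
  refine ⟨(c * B' + |β| * (6 * (c * (B' * D))) + 3 * (c * (B' * B')))
    + |β| * (1 / 2 * (c * (B' * K))) * vol, by positivity,
    fun V hV hVB hVB' ρ r hρ h0 h1 hr h0' h1' => ?_⟩
  have hbr : BM ρ := BM.of_unit hρ h0 h1
  have hbr' : BM r := BM.of_unit hr h0' h1'
  have ha : ∀ u, |ρ u| ≤ 1 := fun u => by rw [abs_of_nonneg (h0 u)]; exact h1 u
  have ha' : ∀ u, |r u| ≤ 1 := fun u => by rw [abs_of_nonneg (h0' u)]; exact h1' u
  have hG := hD ρ hρ h0 h1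
  have hG' := hD r hr h0' h1'
  have hVb : ∀ k u, |V k u| ≤ B' := fun k u => (hVB k u).trans (le_abs_self B)
  set I := ∫ u, |ρ u - r u| with hI
  have hI0 : 0 ≤ I := integral_nonneg fun u => abs_nonneg _
  have hGd : ∀ k u, |pderiv k (J.star ρ) u - pderiv k (J.star r) u| ≤ K * I := by
    intro k u
    have hg : BM fun v => J.gradNeum k u v :=
      BM.of_continuous ((J.continuous_gradNeum k).comp (Continuous.prodMk_right u))
    rw [J.pderiv_star hρ ha, J.pderiv_star hr ha',
      ← integral_sub ((hg.mul hbr).integrable _) ((hg.mul hbr').integrable _), hI,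
      ← integral_const_mul]
    refine abs_integral_le_integral_abs.trans (integral_mono
      (((hg.mul hbr).sub (hg.mul hbr')).abs.integrable _)
      (((hbr.sub hbr').abs.const_mul K).integrable _) fun v => ?_)
    rw [← mul_sub, abs_mul]
    exact mul_le_mul_of_nonneg_right (hK k u v) (abs_nonneg _)
  have b1 : BM fun u => ∑ k, pderiv k (V k) u :=
    BM.sum (s := Finset.univ) (f := fun k u => pderiv k (V k) u) fun k _ => (hV k).bm_pderiv k
  have b2 : BM fun u => ∑ k, V k u * pderiv k (J.star ρ) u :=
    BM.sum (s := Finset.univ) (f := fun k u => V k u * pderiv k (J.star ρ) u)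
      fun k _ => (hV k).bm.mul (hG k).1
  have b2' : BM fun u => ∑ k, V k u * pderiv k (J.star r) u :=
    BM.sum (s := Finset.univ) (f := fun k u => V k u * pderiv k (J.star r) u)
      fun k _ => (hV k).bm.mul (hG' k).1
  have b3 : BM fun u => ∑ k, V k u * V k u :=
    BM.sum (s := Finset.univ) (f := fun k u => V k u * V k u) fun k _ => (hV k).bm.mul (hV k).bm
  have d1 : |(∫ u, ρ u * ∑ k, pderiv k (V k) u) - ∫ u, r u * ∑ k, pderiv k (V k) u| ≤
      c * B' * I := by
    rw [← integral_sub ((hbr.mul b1).integrable _) ((hbr'.mul b1).integrable _), hI,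
      ← integral_const_mul]
    refine abs_integral_le_integral_abs.trans (integral_mono
      (((hbr.mul b1).sub (hbr'.mul b1)).abs.integrable _)
      (((hbr.sub hbr').abs.const_mul _).integrable _) fun u => ?_)
    rw [← sub_mul, abs_mul, mul_comm]
    exact mul_le_mul_of_nonneg_right (abs_sum_le_card fun k =>
      (hVB' k u).trans (le_abs_self B)) (abs_nonneg _)
  have d2 : |(∫ u, mobility (ρ u) * ∑ k, V k u * pderiv k (J.star ρ) u)
      - ∫ u, mobility (r u) * ∑ k, V k u * pderiv k (J.star r) u| ≤
      6 * (c * (B' * D)) * I + 1 / 2 * (c * (B' * K)) * vol * I := by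
    rw [← integral_sub ((hbr.mobility.mul b2).integrable _) ((hbr'.mobility.mul b2').integrable _)]
    have e : 6 * (c * (B' * D)) * I + 1 / 2 * (c * (B' * K)) * vol * I =
        ∫ u, (6 * (c * (B' * D)) * |ρ u - r u| + 1 / 2 * (c * (B' * (K * I)))) := by
      rw [integral_add (((hbr.sub hbr').abs.const_mul _).integrable _) (integrable_const _),
        integral_const_mul, integral_const, smul_eq_mul]
      ring
    rw [e]
    refine abs_integral_le_integral_abs.trans (integral_mono
      (((hbr.mobility.mul b2).sub (hbr'.mobility.mul b2')).abs.integrable _)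
      ((((hbr.sub hbr').abs.const_mul _).add (BM.const _)).integrable _) fun u => ?_)
    have e2 : mobility (ρ u) * (∑ k, V k u * pderiv k (J.star ρ) u)
        - mobility (r u) * (∑ k, V k u * pderiv k (J.star r) u) =
        (mobility (ρ u) - mobility (r u)) * (∑ k, V k u * pderiv k (J.star ρ) u)
        + mobility (r u) *
          ∑ k, V k u * (pderiv k (J.star ρ) u - pderiv k (J.star r) u) := by
      simp only [mul_sub, Finset.sum_sub_distrib]
      ring
    rw [e2]
    refine (abs_add_le _ _).trans (add_le_add ?_ ?_)
    · rw [abs_mul, mul_right_comm]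
      refine mul_le_mul ?_ (abs_sum_le_card fun k => ?_) (abs_nonneg _) (by positivity)
      · exact (abs_mobility_sub_le (ha u) (ha' u)).trans_eq (by norm_num)
      · rw [abs_mul]
        exact mul_le_mul (hVb k u) ((hG k).2 u) (abs_nonneg _) hB'0
    · rw [abs_mul, abs_of_nonneg (mobility_nonneg (h0' u) (h1' u))]
      refine mul_le_mul (mobility_le _) (abs_sum_le_card fun k => ?_) (abs_nonneg _) (by norm_num)
      rw [abs_mul]
      exact mul_le_mul (hVb k u) (hGd k u) (abs_nonneg _) hB'0
  have d3 : |(∫ u, mobility (ρ u) * ∑ k, V k u * V k u)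
      - ∫ u, mobility (r u) * ∑ k, V k u * V k u| ≤ 6 * (c * (B' * B')) * I := by
    rw [← integral_sub ((hbr.mobility.mul b3).integrable _) ((hbr'.mobility.mul b3).integrable _),
      hI, ← integral_const_mul]
    refine abs_integral_le_integral_abs.trans (integral_mono
      (((hbr.mobility.mul b3).sub (hbr'.mobility.mul b3)).abs.integrable _)
      (((hbr.sub hbr').abs.const_mul _).integrable _) fun u => ?_)
    rw [← sub_mul, abs_mul, mul_right_comm]
    refine mul_le_mul ?_ (abs_sum_le_card fun k => ?_) (abs_nonneg _) (by positivity)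
    · exact (abs_mobility_sub_le (ha u) (ha' u)).trans_eq (by norm_num)
    · rw [abs_mul]
      exact mul_le_mul (hVb k u) (hVb k u) (abs_nonneg _) hB'0
  unfold spat
  set a1 := ∫ u, ρ u * ∑ k, pderiv k (V k) u
  set a1' := ∫ u, r u * ∑ k, pderiv k (V k) u
  set a2 := ∫ u, mobility (ρ u) * ∑ k, V k u * pderiv k (J.star ρ) u
  set a2' := ∫ u, mobility (r u) * ∑ k, V k u * pderiv k (J.star r) u
  set a3 := ∫ u, mobility (ρ u) * ∑ k, V k u * V k u
  set a3' := ∫ u, mobility (r u) * ∑ k, V k u * V k u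
  set s := surfaceIntegral (fun r => b r * normal1 r * V 0 r.1)
  have e3 : -a1 + s - β * a2 - 1 / 2 * a3 - (-a1' + s - β * a2' - 1 / 2 * a3') =
      -(a1 - a1') + -(β * (a2 - a2')) + -(1 / 2 * (a3 - a3')) := by ring
  rw [e3]
  refine (abs_add_three _ _ _).trans ?_
  rw [abs_neg, abs_neg, abs_neg, abs_mul, abs_mul, abs_of_pos (by norm_num : (0 : ℝ) < 1 / 2)]
  have d2' := mul_le_mul_of_nonneg_left d2 (abs_nonneg β)
  calc _ ≤ c * B' * I + |β| * (6 * (c * (B' * D)) * I + 1 / 2 * (c * (B' * K)) * vol * I)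
        + 1 / 2 * (6 * (c * (B' * B')) * I) := by gcongr
    _ = _ := by ring

lemma tendsto_integral_spat {θ : Cyl n → ℝ} (hθ : Continuous θ)
    (hb : ∀ r : bdry n, θ r.1 = b r) {ι : Type*} {l : Filter ι} {π : ι → TimeI T → Meas n}
    {x : TimeI T → Meas n} {ρ : ι → TimeI T → Cyl n → ℝ} {r : TimeI T → Cyl n → ℝ}
    (hρ : ∀ i, IsDensity (π i) (ρ i)) (hr : IsDensity x r)
    (h : Tendsto (fun i => ∫ t, ∫ u, |ρ i t u - r t u|) l (𝓝 0))
    {V : Fin (n + 1) → TimeI T → Cyl n → ℝ} (hV : ∀ k, IsCSpace 1 (V k)) :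
    Tendsto (fun i => ∫ t, spat β J b (ρ i t) fun k => V k t) l
      (𝓝 (∫ t, spat β J b (r t) fun k => V k t)) := by
  have h1 : ∀ k, ∃ C, ∀ t u, |V k t u| ≤ C ∧ |pderiv k (V k t) u| ≤ C := fun k => by
    obtain ⟨C, -, hC⟩ := exists_bound (hV k).continuous
    obtain ⟨D, -, hD⟩ := exists_bound ((hV k).2 k).2
    exact ⟨max C D, fun t u => ⟨(hC (t, u)).trans (le_max_left _ _),
      (hD (t, u)).trans (le_max_right _ _)⟩⟩
  choose B hB using h1
  obtain ⟨C, hC0, hC⟩ := spat_lipschitz β J b (∑ k, |B k|)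
  have hBk : ∀ k, B k ≤ ∑ k, |B k| := fun k => (le_abs_self _).trans
    (Finset.single_le_sum (f := fun k => |B k|) (fun k _ => abs_nonneg _) (Finset.mem_univ k))
  rw [tendsto_iff_dist_tendsto_zero]
  have h2 : Tendsto (fun i => C * ∫ t, ∫ u, |ρ i t u - r t u|) l (𝓝 0) := by
    simpa using h.const_mul C
  refine squeeze_zero (fun _ => dist_nonneg) (fun i => ?_) h2
  have i1 := ((hρ i).integral_spat (β := β) (J := J) hθ hb hV).1
  have i2 := (hr.integral_spat (β := β) (J := J) hθ hb hV).1
  have i3 : BM fun t => ∫ u, |ρ i t u - r t u| :=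
    BM.integral_right (f := fun t u => |ρ i t u - r t u|) ((hρ i).bm.sub hr.bm).abs
  rw [Real.dist_eq, ← integral_sub (i1.integrable _) (i2.integrable _), ← integral_const_mul]
  exact abs_integral_le_integral_abs.trans (integral_mono ((i1.sub i2).abs.integrable _)
    ((i3.const_mul C).integrable _) fun t => hC _ (fun k => (hV k).isC1 t)
    (fun k u => (hB k t u).1.trans (hBk k)) (fun k u => (hB k t u).2.trans (hBk k)) _ _
    ((hρ i).meas_slice t) ((hρ i).nonneg t) ((hρ i).le_one t) (hr.meas_slice t) (hr.nonneg t)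
    (hr.le_one t))

lemma mem_uniformity_path {E : Type} [UniformSpace E] {U : Set (Path T E × Path T E)} :
    U ∈ 𝓤 (Path T E) ↔ ∃ ε : ℝ, 0 < ε ∧ ∃ V ∈ 𝓤 E, skorohodEntourage ε V ⊆ U := by
  change U ∈ (skorohodBasis T E).filter ↔ _
  rw [FilterBasis.mem_filter_iff]
  constructor
  · rintro ⟨_, ⟨ε, hε, V, hV, rfl⟩, h⟩
    exact ⟨ε, hε, V, hV, h⟩
  · rintro ⟨ε, hε, V, hV, h⟩
    exact ⟨_, ⟨ε, hε, V, hV, rfl⟩, h⟩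

/-- On a set of paths which are equicontinuous through a function, Skorohod convergence implies
pointwise convergence of this function. -/
lemma tendsto_of_skorohod {E : Type} [UniformSpace E] {S : Set (Path T E)} (x : Path T E)
    {p : E → ℝ} (hp : UniformContinuous p)
    (hS : ∀ ε > 0, ∃ δ > 0, ∀ y ∈ S, ∀ s t : TimeI T, |(s : ℝ) - t| < δ →
      |p (y s) - p (y t)| < ε) (t : TimeI T) :
    Tendsto (fun y : S => p (y.1 t)) (comap Subtype.val (𝓝 x)) (𝓝 (p (x t))) := by
  rw [Metric.tendsto_nhds]
  intro ε hε
  obtain ⟨δ, hδ, h⟩ := hS (ε / 2) (half_pos hε)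
  have hV : {q : E × E | dist (p q.1) (p q.2) < ε / 2} ∈ 𝓤 E :=
    hp (Metric.dist_mem_uniformity (half_pos hε))
  have h1 : {y | (x, y) ∈ skorohodEntourage δ {q : E × E | dist (p q.1) (p q.2) < ε / 2}} ∈ 𝓝 x :=
    mem_nhds_left x (mem_uniformity_path.2 ⟨δ, hδ, _, hV, Subset.rfl⟩)
  refine eventually_comap.2 ?_
  filter_upwards [h1] with y hy
  rintro ⟨y', hy'⟩ rfl
  obtain ⟨τ, hτ, hc⟩ := hy
  have h2 := h y' hy' t (τ t) (by rw [abs_sub_comm]; exact hτ t)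
  have h3 : dist (p (x t)) (p (y' (τ t))) < ε / 2 := hc t
  rw [← Real.dist_eq] at h2
  have h4 := dist_triangle_right (p (y' t)) (p (x t)) (p (y' (τ t)))
  linarith

/-- Real levels suffice: the level `⊥` is the intersection of all of them, and the level `⊤` is the
whole space. -/
lemma lowerSemicontinuous_of_sublevel {X : Type*} [TopologicalSpace X] {f : X → EReal}
    (h : ∀ a : ℝ, IsClosed {x | f x ≤ (a : EReal)}) : LowerSemicontinuous f := by
  rw [lowerSemicontinuous_iff_isClosed_preimage]
  intro y
  induction y with
  | bot =>
    have : f ⁻¹' Iic ⊥ = ⋂ a : ℝ, {x | f x ≤ (a : EReal)} := by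
      ext x
      simp only [mem_preimage, mem_Iic, mem_iInter, mem_ofPred_eq]
      exact ⟨fun hx a => hx.trans bot_le, fun hx =>
        (EReal.eq_bot_iff_forall_lt _ |>.2 fun a => (hx (a - 1)).trans_lt
          (EReal.coe_lt_coe_iff.2 (sub_one_lt a))).le⟩
    rw [this]
    exact isClosed_iInter h
  | coe a => exact h a
  | top => simp

lemma hatI_le_of_rateI {γ : Meas n} {a : ℝ} {x : Path T (Meas n)} (h : rateI β J b γ x ≤ a)
    {F : TimeI T → Cyl n → ℝ} (hF : IsC₀ 1 2 F) : hatI β J b γ F x.toFun ≤ a := by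
  unfold rateI at h
  split_ifs at h with h1
  · have := (le_iSup (fun F : {F : TimeI T → Cyl n → ℝ // IsC₀ 1 2 F} =>
      (hatI β J b γ F.1 x.toFun : EReal)) ⟨F, hF⟩).trans h
    exact_mod_cast this
  · exact absurd h (by simp)

lemma IsDensity.integral_pair {π : TimeI T → Meas n} {ρ : TimeI T → Cyl n → ℝ}
    (h : IsDensity π ρ) (G : TimeI T → Cyl n → ℝ) :
    ∫ t, (π t).pair (G t) = ∫ t, ∫ u, ρ t u * G t u :=
  integral_congr_ae (ae_of_all _ fun t => h.pair_eq t (G t))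

/-- Sublevel sets of the rate functional are closed under pointwise weak convergence. -/
lemma rateI_le_of_tendsto {θ : Cyl n → ℝ} {c C : ℝ} (hθ : IsC1 θ) (hc : 0 < c)
    (hC : C < 1) (hcC : ∀ u, c ≤ θ u ∧ θ u ≤ C) (hb : ∀ r : bdry n, θ r.1 = b r) {a : ℝ}
    {γ : Meas n} (hγ : γ ∈ F1 n) {ι : Type*} {l : Filter ι} [l.NeBot] {y : ι → Path T (Meas n)}
    {x : Path T (Meas n)} (hy : ∀ i, rateI β J b γ (y i) ≤ a)
    (h : ∀ t F, Continuous F → Tendsto (fun i => (y i t).pair F) l (𝓝 ((x t).pair F))) :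
    rateI β J b γ x ≤ a := by
  have hg : ∀ i, Good β J b γ a (y i).toFun := fun i => Good.of_rateI (hy i)
  have hx : ∀ t, x t ∈ F1 n := fun t =>
    F1.mem_of_tendsto (Eventually.of_forall fun i => (hg i).mem t) (h t)
  choose ρ hρ using fun i => (hg i).exists_isDensity
  obtain ⟨r, hr⟩ := exists_isDensity hx fun F hF => measurable_pair_path hF
  have hs := Good.tendsto_density hθ hc hC hcC hb hγ hg hρ hr h
  have key : ∀ F : TimeI T → Cyl n → ℝ, IsC₀ 1 2 F → hatI β J b γ F x.toFun ≤ a := by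
    intro F hF
    have hFc : Continuous (Function.uncurry F) := hF.1.1.continuous
    refine le_of_tendsto (x := l) (f := fun i => hatI β J b γ F (y i).toFun) ?_
      (Eventually.of_forall fun i => hatI_le_of_rateI (hy i) hF)
    rw [hr.hatI_eq hθ.cont hb γ hF.1.2]
    simp only [fun i => (hρ i).hatI_eq (β := β) (J := J) hθ.cont hb γ hF.1.2]
    refine Tendsto.add (Tendsto.sub (Tendsto.sub_const (h _ _ (continuous_slice hFc _)) _) ?_)
      (tendsto_integral_spat hθ.cont hb hρ hr hs fun k => (hF.1.2.2 k).2)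
    rw [hr.integral_pair]
    simp only [fun i => (hρ i).integral_pair (tderiv F)]
    exact tendsto_integral2_mul (fun i => (hρ i).bm) hr.bm
      (BM.of_continuous hF.1.1.continuous_tderiv) hs
  -- The bound on the tests passes to the limit path, and the energy estimate is then applied to
  -- that path itself; this is how `Q` of the limit is seen to be finite.
  have hG : Good β J b γ a x.toFun := ⟨hx, fun N A hA => key _ (isC₀_mop N hA), fun F hF t =>
    (Meas.continuous_pair hF).continuousAt.comp_continuousWithinAt (x.right_cont t)⟩
  unfold rateI
  rw [if_pos ⟨hx, hG.energyQ_lt_top hθ hc hC hcC hb hγ⟩]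
  exact iSup_le fun F => EReal.coe_le_coe_iff.2 (key F.1 F.2)

lemma isClosed_rateI {θ : Cyl n → ℝ} {c C : ℝ} (hθ : IsC1 θ) (hc : 0 < c)
    (hC : C < 1) (hcC : ∀ u, c ≤ θ u ∧ θ u ≤ C) (hb : ∀ r : bdry n, θ r.1 = b r) (a : ℝ)
    {γ : Meas n} (hγ : γ ∈ F1 n) : IsClosed {x : Path T (Meas n) | rateI β J b γ x ≤ (a : EReal)} := by
  refine isClosed_of_closure_subset fun x hx => ?_
  have := mem_closure_iff_comap_neBot.1 hx
  refine rateI_le_of_tendsto hθ hc hC hcC hb hγ (l := comap Subtype.val (𝓝 x))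
    (y := fun y : {x : Path T (Meas n) | rateI β J b γ x ≤ (a : EReal)} => y.1)
    (fun i => i.2) fun t F hF => ?_
  refine tendsto_of_skorohod x (Meas.uniformContinuous_pair hF) (fun ε hε => ?_) t
  obtain ⟨δ, hδ, h⟩ := Good.modulus (T := T) (β := β) (J := J) hθ.cont hb γ a hF hε
  exact ⟨δ, hδ, fun y hy => h y.toFun (Good.of_rateI hy)⟩

/-- Along an ultrafilter on the set, weak compactness of `F1` gives a limit at every time.
Equicontinuity makes the limit trajectory continuous and the convergence of each pairing uniform in
time; with the identity as time change this is Skorohod convergence. -/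
lemma isCompact_rateI {θ : Cyl n → ℝ} {c C : ℝ} (hθ : IsC1 θ) (hc : 0 < c)
    (hC : C < 1) (hcC : ∀ u, c ≤ θ u ∧ θ u ≤ C) (hb : ∀ r : bdry n, θ r.1 = b r) (a : ℝ)
    {γ : Meas n} (hγ : γ ∈ F1 n) :
    IsCompact {x : Path T (Meas n) | rateI β J b γ x ≤ (a : EReal)} := by
  set S := {x : Path T (Meas n) | rateI β J b γ x ≤ (a : EReal)} with hS
  rw [isCompact_iff_ultrafilter_le_nhds]
  intro f hf
  have hSf : S ∈ (f : Filter (Path T (Meas n))) := le_principal_iff.1 hf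
  have hmod := fun {F : Cyl n → ℝ} (hF : Continuous F) {ε : ℝ} (hε : 0 < ε) =>
    Good.modulus (T := T) (β := β) (J := J) hθ.cont hb γ a hF hε
  have h1 : ∀ t, ∃ m ∈ F1 n, Tendsto (fun y : Path T (Meas n) => y t) f (𝓝 m) := fun t =>
    F1.exists_lim f (mem_of_superset hSf fun y hy => (Good.of_rateI hy).mem t)
  choose m hm hlim using h1
  have hpt : ∀ t F, Continuous F →
      Tendsto (fun y : Path T (Meas n) => (y t).pair F) f (𝓝 ((m t).pair F)) :=
    fun t F hF => Meas.tendsto_iff.1 (hlim t) F hF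
  have hmc : Continuous m := by
    refine continuous_iff_continuousAt.2 fun t => Meas.tendsto_iff.2 fun F hF => ?_
    rw [Metric.tendsto_nhds]
    intro ε hε
    obtain ⟨δ, hδ, h⟩ := hmod hF (half_pos hε)
    filter_upwards [Metric.ball_mem_nhds t hδ] with s hs
    rw [Metric.mem_ball, Subtype.dist_eq, Real.dist_eq] at hs
    refine lt_of_le_of_lt ?_ (half_lt_self hε)
    rw [Real.dist_eq]
    refine le_of_tendsto ((hpt s F hF).sub (hpt t F hF)).abs (mem_of_superset hSf fun y hy => ?_)
    exact (h y.toFun (Good.of_rateI hy) s t hs).le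
  let x : Path T (Meas n) := ⟨m, fun t => hmc.continuousWithinAt, fun t =>
    ⟨m t, hmc.continuousAt.mono_left nhdsWithin_le_nhds⟩⟩
  have hne : (comap (Subtype.val : S → Path T (Meas n)) (f : Filter (Path T (Meas n)))).NeBot :=
    comap_coe_neBot_of_le_principal hf
  have hptS : ∀ t F, Continuous F →
      Tendsto (fun y : S => (y.1 t).pair F) (comap Subtype.val (f : Filter (Path T (Meas n))))
        (𝓝 ((x t).pair F)) :=
    fun t F hF => (hpt t F hF).comp tendsto_comap
  refine ⟨x, rateI_le_of_tendsto hθ hc hC hcC hb hγ (y := fun y : S => y.1) (fun y => y.2) hptS, ?_⟩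
  intro U hU
  obtain ⟨W, hW, hWU⟩ := UniformSpace.mem_nhds_iff.1 hU
  obtain ⟨ε, hε, V, hV, hVW⟩ := mem_uniformity_path.1 hW
  obtain ⟨s, e, he, hs⟩ := Meas.mem_uniformity hV
  have h2 : ∀ F ∈ s, ∀ᶠ y in (f : Filter (Path T (Meas n))), ∀ t,
      |(m t).pair F - (y t).pair F| < e := by
    intro F _
    have heq : Equicontinuous fun (y : S) (t : TimeI T) => (y.1 t).pair F :=
      equicontinuous_of_modulus fun ε hε => by
        obtain ⟨δ, hδ, h⟩ := hmod F.continuous hε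
        exact ⟨δ, hδ, fun y => h y.1.toFun (Good.of_rateI y.2)⟩
    have h3 := Metric.tendstoUniformly_iff.1 (tendstoUniformly_of_equicontinuous
      (l := comap Subtype.val (f : Filter (Path T (Meas n)))) (g := fun t => (m t).pair F) heq
      fun t => hptS t F F.continuous) e he
    filter_upwards [eventually_comap.1 h3, hSf] with y hy hyS t
    have := hy ⟨y, hyS⟩ rfl t
    rwa [Real.dist_eq] at this
  have h4 := (Filter.eventually_all_finset s).2 h2
  filter_upwards [h4] with y hy
  refine hWU (hVW ⟨OrderIso.refl _, fun t => by simpa using hε, fun t => ?_⟩)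
  exact hs _ _ fun F hF => hy F hF t

end Limits

/-! ### Bounds for the current -/

section Current

set_option linter.unusedSectionVars false

variable {n : ℕ} {T : ℝ} [hT : Fact (0 < T)] {β : ℝ} {J : KacKernel n} {b : bdry n → ℝ}

lemma IsCSpace.bm_pderiv {V : TimeI T → Cyl n → ℝ} (hV : IsCSpace 1 V) (k : Fin (n + 1)) :
    BM (Function.uncurry fun t u => pderiv k (V t) u) := BM.of_continuous (hV.2 k).2

/-- The linear part of the functional is controlled by the energy. -/
lemma Good.linear_bound {θ : Cyl n → ℝ} {c C : ℝ} (hθ : IsC1 θ) (hc : 0 < c)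
    (hC : C < 1) (hcC : ∀ u, c ≤ θ u ∧ θ u ≤ C) (hb : ∀ r : bdry n, θ r.1 = b r) (a : ℝ) :
    ∃ K : ℝ, ∀ γ ∈ F1 n, ∀ (π : TimeI T → Meas n) (ρ : TimeI T → Cyl n → ℝ),
      Good β J b γ a π → IsDensity π ρ → ∀ V : Fin (n + 1) → TimeI T → Cyl n → ℝ,
      (∀ k, IsCSpace 1 (V k)) →
      |-(∫ t, ∫ u, ρ t u * ∑ k, pderiv k (V k t) u)
        + ∫ t, surfaceIntegral (fun r => b r * normal1 r * V 0 t r.1)| ≤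
        K + ∑ k, ∫ t, ∫ u, V k t u ^ 2 := by
  obtain ⟨K, hK0, hK⟩ := energy_bound (T := T) β J hθ hc hC hcC hb a
  refine ⟨K, fun γ hγ π ρ hπ hρ V hV => ?_⟩
  have hVb : ∀ k, BM (Function.uncurry (V k)) := fun k => BM.of_continuous (hV k).continuous
  have hdiv : BM (Function.uncurry fun t u => ∑ k, pderiv k (V k t) u) :=
    BM.sum (s := Finset.univ) (f := fun k (p : TimeI T × Cyl n) => pderiv k (V k p.1) p.2)
      fun k _ => (hV k).bm_pderiv k
  have hsurf := continuous_surface hθ.cont (hV 0).continuous hb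
  have hlim := (tendsto_integral2_mul (fun N => hρ.bm_rhoN hθ.bm N) hρ.bm hdiv
    (hρ.tendsto_rhoN hθ.bm)).neg.add_const
      (∫ t, surfaceIntegral (fun r => b r * normal1 r * V 0 t r.1))
  refine le_of_tendsto hlim.abs ?_
  filter_upwards [hK 1 one_pos le_rfl] with N hN
  obtain ⟨hr, hwf⟩ := hN γ hγ π ρ hπ hρ
  have hp := hρ.bm_wform hθ one_pos hr
  have hQ := fun k => hρ.bm_pderiv_rhoN hθ N k
  have hR := hρ.bm_rhoN hθ.bm N
  -- The field `V` need not vanish on `Γ`. The boundary term of the integration by parts equals the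
  -- given surface integral, because `ρ^N = θ = b` on `Γ`.
  have h1 : ∀ t, -(∫ u, rhoN N θ (ρ t) u * ∑ k, pderiv k (V k t) u)
      + surfaceIntegral (fun r => b r * normal1 r * V 0 t r.1) =
      ∑ k, ∫ u, pderiv k (rhoN N θ (ρ t)) u * V k t u := by
    intro t
    have hC1 := isC1_rhoN N hθ (hρ.bm_slice t)
    have hV1 := fun k => (hV k).isC1 t
    simp only [Finset.mul_sum]
    rw [integral_finsetSum _ fun k _ => (hC1.bm.mul ((hV1 k).bm_pderiv k)).integrable _]
    have h2 := fun k => integral_mul_pderiv k hC1.cont (hV1 k).cont (hC1.contD k)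
      ((hV1 k).contD k) (hC1.hasPD k) ((hV1 k).hasPD k)
    simp only [h2]
    rw [Finset.sum_sub_distrib, sum_bdryTerm fun k u => rhoN N θ (ρ t) u * V k t u]
    have h3 : surfaceIntegral (fun r => normal1 r * (rhoN N θ (ρ t) r.1 * V 0 t r.1)) =
        surfaceIntegral (fun r => b r * normal1 r * V 0 t r.1) := by
      congr 1
      ext r
      rw [rhoN_bdry N θ (ρ t) r.2, hb r]
      ring
    rw [h3]
    ring
  have e1 : -(∫ t, ∫ u, rhoN N θ (ρ t) u * ∑ k, pderiv k (V k t) u)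
      + ∫ t, surfaceIntegral (fun r => b r * normal1 r * V 0 t r.1) =
      ∑ k, ∫ t, ∫ u, pderiv k (rhoN N θ (ρ t)) u * V k t u := by
    have i1 : BM fun t => ∫ u, rhoN N θ (ρ t) u * ∑ k, pderiv k (V k t) u :=
      BM.integral_right (f := fun t u => rhoN N θ (ρ t) u * ∑ k, pderiv k (V k t) u) (hR.mul hdiv)
    rw [← integral_neg, ← integral_add (i1.neg.integrable _) (hsurf.integrable _)]
    simp only [h1]
    exact integral_finsetSum _ fun k _ => (BM.integral_right
      (f := fun t u => pderiv k (rhoN N θ (ρ t)) u * V k t u) ((hQ k).mul (hVb k))).integrable _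
  rw [e1]
  have h4 : ∀ k, |∫ t, ∫ u, pderiv k (rhoN N θ (ρ t)) u * V k t u| ≤
      (∫ t, ∫ u, dlogit 1 (rhoN N θ (ρ t) u) * pderiv k (rhoN N θ (ρ t)) u ^ 2)
        + ∫ t, ∫ u, V k t u ^ 2 := fun k => by
    rw [← integral2_add (f := fun t u => dlogit 1 (rhoN N θ (ρ t) u) *
      pderiv k (rhoN N θ (ρ t)) u ^ 2) (g := fun t u => V k t u ^ 2)
      (hp.mul ((hQ k).pow 2)) ((hVb k).pow 2)]
    refine (abs_integral2_le (f := fun t u => pderiv k (rhoN N θ (ρ t)) u * V k t u)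
      ((hQ k).mul (hVb k))).trans (integral2_mono ((hQ k).mul (hVb k)).abs
      ((hp.mul ((hQ k).pow 2)).add ((hVb k).pow 2)) fun t u => ?_)
    have h5 := one_le_dlogit (δ := 1) (r := rhoN N θ (ρ t) u) (by linarith [(hr t u).1])
      (by linarith [(hr t u).2]) le_rfl
    have h6 := mul_le_mul_of_nonneg_right h5 (sq_nonneg (pderiv k (rhoN N θ (ρ t)) u))
    rw [abs_le]
    constructor <;> nlinarith [sq_nonneg (pderiv k (rhoN N θ (ρ t)) u + V k t u),
      sq_nonneg (pderiv k (rhoN N θ (ρ t)) u - V k t u),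
      sq_nonneg (pderiv k (rhoN N θ (ρ t)) u), sq_nonneg (V k t u)]
  refine (Finset.abs_sum_le_sum_abs _ _).trans ((Finset.sum_le_sum fun k _ => h4 k).trans ?_)
  rw [Finset.sum_add_distrib]
  refine add_le_add (le_trans (le_of_eq ?_) hwf) le_rfl
  rw [← integral_finsetSum _ fun k _ => (BM.integral_right (μ := (volume : Measure (Cyl n)))
    (f := fun t u => dlogit 1 (rhoN N θ (ρ t) u) * pderiv k (rhoN N θ (ρ t)) u ^ 2)
    (hp.mul ((hQ k).pow 2))).integrable _]
  refine integral_congr_ae (ae_of_all _ fun t => ?_)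
  exact (wform_eq_sum (bm_slice hp t) (isC1_rhoN N hθ (hρ.bm_slice t))).symm

/-- The energy estimate removes the derivative from `V` in the divergence term, so only the `L²`
norm of `V` appears. Hence the bounds on the current will involve the sup norm of the test function
and not its gradient. -/
lemma Good.integral_spat_ge {θ : Cyl n → ℝ} {c C : ℝ} (hθ : IsC1 θ) (hc : 0 < c)
    (hC : C < 1) (hcC : ∀ u, c ≤ θ u ∧ θ u ≤ C) (hb : ∀ r : bdry n, θ r.1 = b r) (a : ℝ) :
    ∃ K : ℝ, ∀ γ ∈ F1 n, ∀ (π : TimeI T → Meas n) (ρ : TimeI T → Cyl n → ℝ),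
      Good β J b γ a π → IsDensity π ρ → ∀ V : Fin (n + 1) → TimeI T → Cyl n → ℝ,
      (∀ k, IsCSpace 1 (V k)) →
      -(K + 2 * ∑ k, ∫ t, ∫ u, V k t u ^ 2) ≤ ∫ t, spat β J b (ρ t) fun k => V k t := by
  obtain ⟨K, hK⟩ := Good.linear_bound (T := T) (β := β) (J := J) hθ hc hC hcC hb a
  obtain ⟨D, hD0, hD⟩ := pderiv_star_bound J
  set v := volume.real (univ : Set (Cyl n))
  set κ := (n + 1) * (β ^ 2 * D ^ 2 / 4) * v
  refine ⟨K + volume.real (univ : Set (TimeI T)) * κ, fun γ hγ π ρ hπ hρ V hV => ?_⟩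
  have hVb : ∀ k, BM (Function.uncurry (V k)) := fun k => BM.of_continuous (hV k).continuous
  have hdiv : BM (Function.uncurry fun t u => ∑ k, pderiv k (V k t) u) :=
    BM.sum (s := Finset.univ) (f := fun k (p : TimeI T × Cyl n) => pderiv k (V k p.1) p.2)
      fun k _ => (hV k).bm_pderiv k
  have i1 : BM fun t => ∫ u, ρ t u * ∑ k, pderiv k (V k t) u :=
    BM.integral_right (f := fun t u => ρ t u * ∑ k, pderiv k (V k t) u) (hρ.bm.mul hdiv)
  have i2 := continuous_surface hθ.cont (hV 0).continuous hb
  have hV2 : ∀ k, BM fun t => ∫ u, V k t u ^ 2 := fun k =>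
    BM.integral_right (f := fun t u => V k t u ^ 2) ((hVb k).pow 2)
  have i3 : BM fun t => ∑ k, ∫ u, V k t u ^ 2 :=
    BM.sum (s := Finset.univ) (f := fun k t => ∫ u, V k t u ^ 2) fun k _ => hV2 k
  have h1 : ∀ t, (-(∫ u, ρ t u * ∑ k, pderiv k (V k t) u)
      + surfaceIntegral (fun r => b r * normal1 r * V 0 t r.1)) +
        -((∑ k, ∫ u, V k t u ^ 2) + κ) ≤ spat β J b (ρ t) fun k => V k t := by
    intro t
    have hVt := fun k => bm_slice (hVb k) t
    have h2 := interaction_part (β := β) (hρ.meas_slice t) (hρ.nonneg t) (hρ.le_one t)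
      (hD _ (hρ.meas_slice t) (hρ.nonneg t) (hρ.le_one t)) hVt
    have hs : BM fun u => ∑ k, V k t u * V k t u :=
      BM.sum (s := Finset.univ) (f := fun k u => V k t u * V k t u) fun k _ => (hVt k).mul (hVt k)
    have h3 : ∫ u, mobility (ρ t u) * ∑ k, V k t u * V k t u ≤ ∑ k, ∫ u, V k t u ^ 2 := by
      rw [← integral_finsetSum _ fun k _ => ((hVt k).pow 2).integrable _]
      refine integral_mono (((hρ.bm_slice t).mobility.mul hs).integrable _)
        ((BM.sum (s := Finset.univ) (f := fun k u => V k t u ^ 2)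
          fun k _ => (hVt k).pow 2).integrable _) fun u => ?_
      have h4 : ∑ k, V k t u * V k t u = ∑ k, V k t u ^ 2 := by simp only [sq]
      have h5 : 0 ≤ ∑ k, V k t u ^ 2 := Finset.sum_nonneg fun k _ => sq_nonneg _
      simp only [h4]
      nlinarith [mobility_le (ρ t u)]
    change _ ≤ _ + κ at h2
    unfold spat
    beta_reduce
    linarith
  have i4 := (hρ.integral_spat (β := β) (J := J) hθ.cont hb hV).1
  have h6 := integral_mono (((i1.neg.add i2).add (i3.add (BM.const κ)).neg).integrable _)
    (i4.integrable (volume : Measure (TimeI T))) h1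
  rw [integral_add ((i1.neg.add i2).integrable _) ((i3.add (BM.const κ)).neg.integrable _),
    integral_add (i1.neg.integrable _) (i2.integrable _), integral_neg, integral_neg,
    integral_add (i3.integrable _) (integrable_const _), integral_const, smul_eq_mul,
    integral_finsetSum _ fun k _ => (hV2 k).integrable _] at h6
  have h7 := (abs_le.1 (hK γ hγ π ρ hπ hρ V hV)).1
  linarith

lemma hatJ_le_of_rateJ {γ : Meas n} {a : ℝ} {x : Path T (MeasVec n)} (h : rateJ β J b γ x ≤ a)
    {V : Fin (n + 1) → TimeI T → Cyl n → ℝ} (hV : ∀ k, IsC 1 1 (V k)) :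
    hatJ β J b V (fun t => (x t).1) (fun t => (x t).2) ≤ a := by
  unfold rateJ at h
  split_ifs at h with h1
  · have := (le_iSup (fun V : {V : Fin (n + 1) → TimeI T → Cyl n → ℝ // ∀ k, IsC 1 1 (V k)} =>
      (hatJ β J b V.1 (fun t => (x t).1) (fun t => (x t).2) : EReal)) ⟨V, hV⟩).trans h
    exact_mod_cast this
  · exact absurd h (by simp)

lemma isC_const_mul {φ ψ : ℝ → ℝ} (hφ : ∀ r, HasDerivAt φ (ψ r) r) (hψ : Continuous ψ)
    {g : Cyl n → ℝ} (hg : IsC1 g) : IsC 1 1 (fun (t : TimeI T) u => φ t * g u) := by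
  have h := isCTime_const_mul (T := T) hφ hψ hg.cont
  refine ⟨h.1, isCSpace_succ (fun k (t : TimeI T) u => φ t * pderiv k g u) h.1.continuous
    (fun k t u => (hg.hasPD k u).const_mul _) fun k => ?_⟩
  exact (isCTime_const_mul (T := T) hφ hψ (hg.contD k)).1.continuous

/-- The left limit and right continuity bound `f` near each point, and `[0,T]` is compact. For the
current no a priori bound is available, unlike for measures in `F1`. -/
lemma exists_bound_of_cadlag {f : TimeI T → ℝ} (h : ∀ t, ContinuousWithinAt f (Ici t) t)
    (h' : ∀ t, ∃ l, Tendsto f (𝓝[<] t) (𝓝 l)) : ∃ B, ∀ t, |f t| ≤ B := by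
  obtain ⟨B, hB⟩ := (isCompact_univ (X := TimeI T)).induction_on
    (p := fun s => ∃ B, ∀ t ∈ s, |f t| ≤ B) ⟨0, by simp⟩
    (fun s t hst ⟨B, hB⟩ => ⟨B, fun r hr => hB r (hst hr)⟩)
    (fun s t ⟨B, hB⟩ ⟨B', hB'⟩ => ⟨max B B', fun r hr => hr.elim
      (fun hr => (hB r hr).trans (le_max_left _ _)) fun hr => (hB' r hr).trans (le_max_right _ _)⟩)
    fun t _ => by
      obtain ⟨l, hl⟩ := h' t
      refine ⟨{s | |f s| ≤ max (|l| + 1) (|f t| + 1)}, mem_nhdsWithin_of_mem_nhds ?_, _,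
        fun r hr => hr⟩
      rw [← nhdsLT_sup_nhdsGE t]
      refine mem_sup.2 ⟨?_, ?_⟩
      · filter_upwards [hl.abs.eventually (gt_mem_nhds (lt_add_one |l|))] with s hs
        exact hs.le.trans (le_max_left _ _)
      · filter_upwards [(h t).tendsto.abs.eventually (gt_mem_nhds (lt_add_one |f t|))] with s hs
        exact hs.le.trans (le_max_right _ _)
  exact ⟨B, fun t => hB t (mem_univ t)⟩

lemma continuous_pair_fst {F : Cyl n → ℝ} (hF : Continuous F) (k : Fin (n + 1)) :
    Continuous fun e : MeasVec n => (e.1 k).pair F :=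
  (Meas.continuous_pair hF).comp ((continuous_apply k).comp continuous_fst)

/-- The test function with a single non-zero component. -/
def compTest (k : Fin (n + 1)) (g : Cyl n → ℝ) (j : Fin (n + 1)) (u : Cyl n) : ℝ :=
  if j = k then g u else 0

lemma isC1_compTest (k : Fin (n + 1)) {g : Cyl n → ℝ} (hg : IsC1 g) (j : Fin (n + 1)) :
    IsC1 (compTest k g j) := by
  unfold compTest
  split_ifs
  · exact hg
  · exact IsC1.of_hasPD (D := fun _ _ => 0) continuous_const (fun i u => HasPD.const i 0 u)
      fun _ => continuous_const

lemma sum_pair_compTest (W : Fin (n + 1) → Meas n) (k : Fin (n + 1)) (g : Cyl n → ℝ) (c : ℝ) :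
    ∑ j, (W j).pair (fun u => c * compTest k g j u) = c * (W k).pair g := by
  rw [Finset.sum_eq_single k]
  · rw [Meas.pair_smul, show compTest k g k = g from funext fun u => if_pos rfl]
  · intro j _ hj
    rw [Meas.pair_smul, show compTest k g j = fun _ => 0 from funext fun u => if_neg hj,
      Meas.pair_zero, mul_zero]
  · simp

/-- Test with a field whose only component is `φ(t) g(u)` in direction `k`. The functional of `𝒥`
has no term at time `0`, so the one-dimensional lemma applies with initial value zero and the
current starts from `0`. The constants see `g` only through `|g| ≤ 1`, which permits an extension to
continuous `g`. -/
lemma rateJ_increment_of_isC1 {θ : Cyl n → ℝ} {c C : ℝ} (hθ : IsC1 θ) (hc : 0 < c)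
    (hC : C < 1) (hcC : ∀ u, c ≤ θ u ∧ θ u ≤ C) (hb : ∀ r : bdry n, θ r.1 = b r) (a : ℝ) :
    ∃ a' D : ℝ, 0 ≤ D ∧ ∀ γ ∈ F1 n, ∀ x : Path T (MeasVec n), rateJ β J b γ x ≤ a →
      ∀ (k : Fin (n + 1)) (g : Cyl n → ℝ), IsC1 g → (∀ u, |g u| ≤ 1) →
        ((x (t0 T)).1 k).pair g = 0 ∧ ∀ s t : TimeI T, s ≤ t → ∀ l : ℝ,
          l * (((x t).1 k).pair g - ((x s).1 k).pair g) ≤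
            a' + D * (|l| * (t - s)) + D * (l ^ 2 * (t - s)) := by
  obtain ⟨K, hK⟩ := Good.integral_spat_ge (T := T) (β := β) (J := J) hθ hc hC hcC hb a
  set v := volume.real (univ : Set (Cyl n))
  have hv : 0 ≤ v := measureReal_nonneg
  refine ⟨a + K, 2 * ((n + 1) * v), by positivity, fun γ hγ x hx k g hg hg1 => ?_⟩
  have hπ := Good.of_rateJ hθ.cont hb hγ hx
  obtain ⟨ρ, hρ⟩ := hπ.exists_isDensity
  have hcont := continuous_pair_fst hg.cont k
  set w : TimeI T → ℝ := fun t => ((x t).1 k).pair g with hw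
  have w1 : ∀ t, ContinuousWithinAt w (Ici t) t := fun t =>
    hcont.continuousAt.comp_continuousWithinAt (x.right_cont t)
  obtain ⟨B, hB⟩ := exists_bound_of_cadlag w1 fun t => by
    obtain ⟨l, hl⟩ := x.left_lim t
    exact ⟨_, (hcont.tendsto l).comp hl⟩
  set f : ℝ → ℝ := fun r => w (projIcc 0 T hT.out.le r) with hf
  have f1 : Measurable f := (measurable_of_rightCont w1).comp continuous_projIcc.measurable
  have f3 : ∀ s, 0 ≤ s → ContinuousWithinAt f (Ici s) s := fun s _ =>
    (w1 (projIcc 0 T hT.out.le s)).comp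
      continuous_projIcc.continuousWithinAt fun r hr => monotone_projIcc hT.out.le hr
  have f4 : f T = w (t1 T) := by simp only [hf, projIcc_right]; rfl
  have f5 : ∀ r, T ≤ r → f r = f T := fun r hr => by
    simp only [hf, projIcc_right, projIcc_of_right_le hT.out.le hr]
  have f6 : f 0 = w (t0 T) := by simp only [hf, projIcc_left]; rfl
  have H : ∀ φ ψ : ℝ → ℝ, (∀ r, HasDerivAt φ (ψ r) r) → Continuous ψ →
      φ T * f T - φ 0 * 0 - (∫ r in (0 : ℝ)..T, ψ r * f r) ≤
        (a + K) + 2 * ((n + 1) * v) * (∫ r in (0 : ℝ)..T, |φ r|)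
          + 2 * ((n + 1) * v) * ∫ r in (0 : ℝ)..T, φ r ^ 2 := by
    intro φ ψ hφ hψ
    have hφc : Continuous φ := continuous_iff_continuousAt.2 fun r => (hφ r).continuousAt
    have hV := fun j => isC_const_mul (T := T) hφ hψ (isC1_compTest k hg j)
    have h1 := hatJ_le_of_rateJ hx hV
    rw [hρ.hatJ_eq hθ.cont hb _ fun j => (hV j).2] at h1
    simp only [fun j => (isCTime_const_mul (T := T) hφ hψ (isC1_compTest k hg j).cont).2,
      sum_pair_compTest] at h1
    have h2 := hK γ hγ _ ρ hπ hρ _ fun j => (hV j).2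
    have h3 : ∑ j, ∫ t : TimeI T, ∫ u, (φ t * compTest k g j u) ^ 2 ≤
        ((n : ℝ) + 1) * (v * ∫ t : TimeI T, φ t ^ 2) := by
      have h4 : ∀ j ∈ Finset.univ, ∫ t : TimeI T, ∫ u, (φ t * compTest k g j u) ^ 2 ≤
          v * ∫ t : TimeI T, φ t ^ 2 := fun j _ => by
        have e : ∫ t : TimeI T, ∫ _ : Cyl n, φ t ^ 2 = v * ∫ t : TimeI T, φ t ^ 2 := by
          simp only [integral_const, smul_eq_mul, integral_const_mul, v]
        rw [← e]
        have hφb : BM fun p : TimeI T × Cyl n => φ p.1 :=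
          BM.of_continuous (hφc.comp (by fun_prop))
        refine integral2_mono (f := fun t u => (φ t * compTest k g j u) ^ 2)
          (g := fun t _ => φ t ^ 2) ((hφb.mul ((isC1_compTest k hg j).bm.comp
            measurable_snd)).pow 2) (hφb.pow 2) fun t u => ?_
        rw [mul_pow]
        have h5 : compTest k g j u ^ 2 ≤ 1 := by
          unfold compTest
          split_ifs
          · exact (sq_le_one_iff_abs_le_one _).2 (hg1 u)
          · norm_num
        nlinarith [sq_nonneg (φ t)]
      have := Finset.sum_le_card_nsmul _ _ _ h4
      simpa using this
    have e3 : ∫ t : TimeI T, φ t ^ 2 = ∫ r in (0 : ℝ)..T, φ r ^ 2 := by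
      rw [integral_Icc_subtype hT.out.le]
      refine intervalIntegral.integral_congr fun r hr => ?_
      rw [uIcc_of_le hT.out.le] at hr
      simp only [projIcc_of_mem hT.out.le hr]
    have e4 : ∫ t : TimeI T, ψ t * ((x t).1 k).pair g = ∫ r in (0 : ℝ)..T, ψ r * f r := by
      rw [integral_Icc_subtype hT.out.le]
      refine intervalIntegral.integral_congr fun r hr => ?_
      rw [uIcc_of_le hT.out.le] at hr
      simp only [hf, hw, projIcc_of_mem hT.out.le hr]
    have h6 : 0 ≤ ∫ r in (0 : ℝ)..T, |φ r| :=
      intervalIntegral.integral_nonneg hT.out.le fun r _ => abs_nonneg _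
    have h7 : 0 ≤ 2 * ((n + 1) * v) * ∫ r in (0 : ℝ)..T, |φ r| := by positivity
    rw [e4, show ((t1 T : TimeI T) : ℝ) = T from rfl] at h1
    rw [e3] at h3
    rw [f4, hw]
    linarith
  have hD : (0 : ℝ) ≤ 2 * ((n + 1) * v) := by positivity
  refine ⟨?_, fun s t hst l => ?_⟩
  · have := initial_eq_of_test hT.out hD f1 (fun r => hB _) f3 f5 H
    rwa [f6] at this
  · have := increment_le_of_test hT.out hD f1 (fun r => hB _) f3 f5 H s.2.1 hst t.2.2 l
    simpa only [hf, hw, projIcc_val] using this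

/-- A current may charge `Γ` or be singular, so uniform convergence is needed. The Neumann operator
provides it up to the boundary; the Dirichlet operator does not. -/
lemma Meas.tendsto_pair_mop (m : Meas n) {g : Cyl n → ℝ} (hg : Continuous g) :
    Tendsto (fun N : ℕ => m.pair (mop N 1 0 g)) atTop (𝓝 (m.pair g)) := by
  have hb := BM.of_continuous hg
  rw [Metric.tendsto_nhds]
  intro ε hε
  have hm := m.mass_nonneg
  filter_upwards [eventually_integral_kern_mul_osc hg
    (ε := ε / (m.mass + 1)) (by positivity)] with N hN
  rw [Real.dist_eq, ← m.pair_sub (hb.isC1_mop N 1 0).cont hg]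
  refine (m.abs_pair_le fun u => (abs_mop_neu_sub_le N hg u).trans (hN u)).trans_lt ?_
  rw [div_mul_eq_mul_div, div_lt_iff₀ (by positivity)]
  nlinarith

lemma rateJ_increment {θ : Cyl n → ℝ} {c C : ℝ} (hθ : IsC1 θ) (hc : 0 < c)
    (hC : C < 1) (hcC : ∀ u, c ≤ θ u ∧ θ u ≤ C) (hb : ∀ r : bdry n, θ r.1 = b r) (a : ℝ) :
    ∃ a' D : ℝ, 0 ≤ D ∧ ∀ γ ∈ F1 n, ∀ x : Path T (MeasVec n), rateJ β J b γ x ≤ a →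
      ∀ (k : Fin (n + 1)) (g : Cyl n → ℝ), Continuous g → (∀ u, |g u| ≤ 1) →
        ((x (t0 T)).1 k).pair g = 0 ∧ ∀ s t : TimeI T, s ≤ t → ∀ l : ℝ,
          l * (((x t).1 k).pair g - ((x s).1 k).pair g) ≤
            a' + D * (|l| * (t - s)) + D * (l ^ 2 * (t - s)) := by
  obtain ⟨a', D, hD, h⟩ := rateJ_increment_of_isC1 (T := T) (β := β) (J := J) hθ hc hC hcC hb a
  refine ⟨a', D, hD, fun γ hγ x hx k g hg hg1 => ?_⟩
  have hlim := fun t => ((x t).1 k).tendsto_pair_mop hg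
  have hN := fun N : ℕ => h γ hγ x hx k (mop N 1 0 g) ((BM.of_continuous hg).isC1_mop N 1 0)
    fun u => abs_mop_le N (Or.inl rfl) hg.measurable hg1 u
  exact ⟨tendsto_nhds_unique (hlim _) (tendsto_const_nhds.congr fun N => (hN N).1.symm),
    fun s t hst l => le_of_tendsto' (((hlim t).sub (hlim s)).const_mul l)
      fun N => (hN N).2 s t hst l⟩

/-- A uniform bound and a uniform modulus of continuity for the currents of bounded cost. -/
lemma rateJ_bound_modulus {θ : Cyl n → ℝ} {c C : ℝ} (hθ : IsC1 θ) (hc : 0 < c)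
    (hC : C < 1) (hcC : ∀ u, c ≤ θ u ∧ θ u ≤ C) (hb : ∀ r : bdry n, θ r.1 = b r) (a : ℝ) :
    (∃ R : ℝ, 0 ≤ R ∧ ∀ γ ∈ F1 n, ∀ x : Path T (MeasVec n), rateJ β J b γ x ≤ a →
      ∀ (k : Fin (n + 1)) (g : Cyl n → ℝ) (M : ℝ), Continuous g → 0 < M → (∀ u, |g u| ≤ M) →
        ∀ t, |((x t).1 k).pair g| ≤ R * M) ∧
    ∀ g : Cyl n → ℝ, Continuous g → ∀ ε > 0, ∃ δ > 0, ∀ γ ∈ F1 n, ∀ x : Path T (MeasVec n),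
      rateJ β J b γ x ≤ a → ∀ (k : Fin (n + 1)) (s t : TimeI T), |(s : ℝ) - t| < δ →
        |((x s).1 k).pair g - ((x t).1 k).pair g| < ε := by
  obtain ⟨a', D, hD, h⟩ := rateJ_increment (T := T) (β := β) (J := J) hθ hc hC hcC hb a
  have hscale : ∀ (m : Meas n) (g : Cyl n → ℝ) (M : ℝ), 0 < M →
      m.pair g = M * m.pair (fun u => M⁻¹ * g u) := fun m g M hM => by
    rw [Meas.pair_smul, mul_inv_cancel_left₀ hM.ne']
  have hunit : ∀ (g : Cyl n → ℝ) (M : ℝ), 0 < M → (∀ u, |g u| ≤ M) → ∀ u, |M⁻¹ * g u| ≤ 1 :=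
    fun g M hM hg u => by
      rw [abs_mul, abs_of_pos (inv_pos.2 hM), inv_mul_le_iff₀ hM, mul_one]; exact hg u
  -- Take `l = ±1` in the increment bound between times `0` and `t`; the current vanishes at time
  -- `0`.
  refine ⟨⟨|a'| + D * T + D * T, by have := hT.out; positivity,
    fun γ hγ x hx k g M hg hM hgM t => ?_⟩, fun g hg ε hε => ?_⟩
  · obtain ⟨h0, h1⟩ := h γ hγ x hx k (fun u => M⁻¹ * g u) (continuous_const.mul hg)
      (hunit g M hM hgM)
    rw [hscale _ g M hM, abs_mul, abs_of_pos hM, mul_comm]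
    refine mul_le_mul_of_nonneg_right ?_ hM.le
    have h2 := h1 (t0 T) t t.2.1 1
    have h3 := h1 (t0 T) t t.2.1 (-1)
    rw [h0, show ((t0 T : TimeI T) : ℝ) = 0 from rfl] at h2 h3
    simp only [abs_neg, abs_one] at h2 h3
    have h4 := mul_le_mul_of_nonneg_left t.2.2 hD
    have h5 := le_abs_self a'
    rw [abs_le]
    constructor <;> linarith
  · obtain ⟨M₀, hM0, hM₀⟩ := exists_bound hg
    set M := M₀ + 1
    have hM : 0 < M := by positivity
    set e := ε / M with he
    have he0 : 0 < e := by positivity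
    -- With `l = ±L`, the constant `a'` and the time terms, at most `K(t - s) < 1`, together stay
    -- below `|a'| + 1 = L e / 2`.
    set L : ℝ := 2 * (|a'| + 1) / e with hL
    have hL0 : 0 < L := by positivity
    have hLe : L * (e / 2) = |a'| + 1 := by rw [hL]; field_simp
    set K : ℝ := D * (L + L ^ 2) + 1 with hK
    have hK0 : 0 < K := by positivity
    refine ⟨1 / K, by positivity, fun γ hγ x hx k s t hst => ?_⟩
    have h1 := (h γ hγ x hx k (fun u => M⁻¹ * g u) (continuous_const.mul hg)
      (hunit g M hM fun u => (hM₀ u).trans (by linarith))).2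
    set w : TimeI T → ℝ := fun t => ((x t).1 k).pair fun u => M⁻¹ * g u
    have key : ∀ s t : TimeI T, s ≤ t → (t : ℝ) - s < 1 / K → |w t - w s| < e := by
      intro s t hst hd
      have hst' : (0 : ℝ) ≤ t - s := sub_nonneg.2 hst
      have h2 := h1 s t hst L
      have h3 := h1 s t hst (-L)
      rw [abs_neg, neg_sq] at h3
      rw [abs_of_pos hL0] at h2 h3
      have h4 : K * (t - s) < 1 := by
        rw [lt_div_iff₀ hK0] at hd; linarith
      have h5 : D * (L * (t - s)) + D * (L ^ 2 * (t - s)) ≤ K * (t - s) := by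
        rw [hK]; nlinarith
      have h6 := le_abs_self a'
      have h7 : L * |w t - w s| < L * e := by
        rcases abs_cases (w t - w s) with hc | hc <;> rw [hc.1] <;> nlinarith
      exact lt_of_mul_lt_mul_left h7 hL0.le
    have h8 : |w s - w t| < e := by
      rcases le_total s t with hle | hle
      · rw [abs_sub_comm]; exact key s t hle (by linarith [(abs_lt.1 hst).1])
      · exact key t s hle (by linarith [(abs_lt.1 hst).2])
    rw [hscale _ g M hM, hscale ((x t).1 k) g M hM, ← mul_sub, abs_mul, abs_of_pos hM]
    rw [he, lt_div_iff₀ hM, mul_comm] at h8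
    exact h8

end Current

/-! ### Closedness of the sublevel sets of the joint functional. -/

section Closed

set_option linter.unusedSectionVars false

variable {n : ℕ} {T : ℝ} [hT : Fact (0 < T)] {β : ℝ} {J : KacKernel n} {b : bdry n → ℝ}

/-- Time integrals of an equicontinuous and bounded family of signed measures against a continuous
test function are continuous under pointwise convergence. -/
lemma tendsto_integral_pair {ι : Type*} {l : Filter ι} [l.NeBot] {w : ι → TimeI T → Meas n}
    {w₀ : TimeI T → Meas n} {R : ℝ} (hR : 0 ≤ R)
    (hbd : ∀ i (g : Cyl n → ℝ) (M : ℝ), Continuous g → 0 < M → (∀ u, |g u| ≤ M) →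
      ∀ t, |(w i t).pair g| ≤ R * M)
    (hmod : ∀ g : Cyl n → ℝ, Continuous g → ∀ ε > 0, ∃ δ > 0, ∀ i (s t : TimeI T),
      |(s : ℝ) - t| < δ → |(w i s).pair g - (w i t).pair g| < ε)
    (hlim : ∀ t g, Continuous g → Tendsto (fun i => (w i t).pair g) l (𝓝 ((w₀ t).pair g)))
    {G : TimeI T → Cyl n → ℝ} (hG : Continuous (Function.uncurry G)) :
    (∀ i, Continuous fun t => (w i t).pair (G t)) ∧ (Continuous fun t => (w₀ t).pair (G t)) ∧
      Tendsto (fun i => ∫ t, (w i t).pair (G t)) l (𝓝 (∫ t, (w₀ t).pair (G t))) := by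
  have hGs := fun t => continuous_slice hG t
  -- The time dependence of `G` is absorbed by the uniform mass bound `R`, that of the measures by
  -- the common modulus at the fixed function `G t`.
  have heq : Equicontinuous fun i t => (w i t).pair (G t) := by
    intro t
    rw [Metric.equicontinuousAt_iff_right]
    intro ε hε
    set e := ε / (2 * (R + 1)) with he
    have he0 : 0 < e := by positivity
    obtain ⟨δ, hδ, h⟩ := hmod (G t) (hGs t) (ε / 2) (half_pos hε)
    filter_upwards [Metric.ball_mem_nhds t hδ, eventually_sup_sub_le hG t he0] with s hs hsup i
    rw [Metric.mem_ball, Subtype.dist_eq, Real.dist_eq] at hs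
    have h1 := h i s t hs
    have h2 := hbd i (fun u => G s u - G t u) e ((hGs s).sub (hGs t)) he0 hsup s
    rw [Meas.pair_sub _ (hGs s) (hGs t)] at h2
    have h3 : R * e < ε / 2 := by
      rw [he, mul_div_assoc', div_lt_div_iff₀ (by positivity) two_pos]; nlinarith
    rw [Real.dist_eq, abs_sub_comm]
    have h4 := abs_sub_le ((w i s).pair (G s)) ((w i s).pair (G t)) ((w i t).pair (G t))
    linarith
  have hunif := tendstoUniformly_of_equicontinuous (l := l)
    (g := fun t => (w₀ t).pair (G t)) heq fun t => hlim t _ (hGs t)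
  have hc : ∀ i, Continuous fun t => (w i t).pair (G t) := fun i => heq.continuous i
  have hc₀ := hunif.continuous (Frequently.of_forall hc)
  refine ⟨hc, hc₀, ?_⟩
  rw [Metric.tendsto_nhds]
  intro ε hε
  set v := (volume : Measure (TimeI T)).real univ
  have hv : 0 ≤ v := measureReal_nonneg
  filter_upwards [Metric.tendstoUniformly_iff.1 hunif (ε / (v + 1)) (by positivity)] with i hi
  rw [dist_comm, dist_eq_norm, ← integral_sub ((BM.of_continuous hc₀).integrable _)
    ((BM.of_continuous (hc i)).integrable _)]
  refine (norm_integral_le_of_norm_le_const (C := ε / (v + 1))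
    (ae_of_all _ fun t => ?_)).trans_lt ?_
  · rw [← dist_eq_norm]
    exact (hi t).le
  · rw [div_mul_eq_mul_div, div_lt_iff₀ (by positivity)]
    nlinarith

/-- Skorohod limits are pointwise weak limits of both components, by equicontinuity. Terms in `W`
are linear, and uniform convergence in time handles them; terms in `σ(ρ)` use strong convergence of
the densities; the continuity equation is linear and survives pointwise limits. -/
lemma isClosed_rateJ {θ : Cyl n → ℝ} {c C : ℝ} (hθ : IsC1 θ) (hc : 0 < c)
    (hC : C < 1) (hcC : ∀ u, c ≤ θ u ∧ θ u ≤ C) (hb : ∀ r : bdry n, θ r.1 = b r) (a : ℝ)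
    {γ : Meas n} (hγ : γ ∈ F1 n) :
    IsClosed {x : Path T (MeasVec n) | rateJ β J b γ x ≤ (a : EReal)} := by
  refine isClosed_of_closure_subset fun x hx => ?_
  have hne := mem_closure_iff_comap_neBot.1 hx
  set S := {x : Path T (MeasVec n) | rateJ β J b γ x ≤ (a : EReal)} with hS
  set l : Filter S := comap Subtype.val (𝓝 x)
  obtain ⟨⟨R, hR, hbd⟩, hmod⟩ := rateJ_bound_modulus (T := T) (β := β) (J := J) hθ hc hC hcC hb a
  have hg : ∀ y : S, Good β J b γ a fun t => (y.1 t).2 := fun y => Good.of_rateJ hθ.cont hb hγ y.2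
  have h1 : ∀ k t F, Continuous F →
      Tendsto (fun y : S => ((y.1 t).1 k).pair F) l (𝓝 (((x t).1 k).pair F)) := fun k t F hF => by
    refine tendsto_of_skorohod x (p := fun e : MeasVec n => (e.1 k).pair F)
      ((Meas.uniformContinuous_pair hF).comp
        ((Pi.uniformContinuous_proj _ k).comp uniformContinuous_fst)) (fun ε hε => ?_) t
    obtain ⟨δ, hδ, h⟩ := hmod F hF ε hε
    exact ⟨δ, hδ, fun y hy => h γ hγ y hy k⟩
  have h2 : ∀ t F, Continuous F →
      Tendsto (fun y : S => ((y.1 t).2).pair F) l (𝓝 (((x t).2).pair F)) := fun t F hF => by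
    refine tendsto_of_skorohod x (p := fun e : MeasVec n => e.2.pair F)
      ((Meas.uniformContinuous_pair hF).comp uniformContinuous_snd) (fun ε hε => ?_) t
    obtain ⟨δ, hδ, h⟩ := Good.modulus (T := T) (β := β) (J := J) hθ.cont hb γ a hF hε
    exact ⟨δ, hδ, fun y hy => h _ (hg ⟨y, hy⟩)⟩
  have hxF : ∀ t, (x t).2 ∈ F1 n := fun t =>
    F1.mem_of_tendsto (Eventually.of_forall fun y => (hg y).mem t) (h2 t)
  choose ρ hρ using fun y => (hg y).exists_isDensity
  obtain ⟨r, hr⟩ := exists_isDensity hxF fun F hF => measurable_pair_path_snd hF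
  have hs := Good.tendsto_density hθ hc hC hcC hb hγ hg hρ hr h2
  have hce : ContinuityEq γ (fun t => (x t).1) fun t => (x t).2 := fun t G hG => by
    have hG1 := IsC1.of_isC₀Space hG
    refine tendsto_nhds_unique ((h2 t G hG1.cont).sub_const _)
      ((tendsto_finsetSum _ fun k _ => h1 k t _ (hG1.contD k)).congr fun y => ?_)
    exact ((Sub.of_rateJ hθ.cont hb hγ y.2).1 t G hG).symm
  have key : ∀ V : Fin (n + 1) → TimeI T → Cyl n → ℝ, (∀ k, IsC 1 1 (V k)) →
      hatJ β J b V (fun t => (x t).1) (fun t => (x t).2) ≤ a := by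
    intro V hV
    refine le_of_tendsto (x := l)
      (f := fun y : S => hatJ β J b V (fun t => (y.1 t).1) fun t => (y.1 t).2) ?_
      (Eventually.of_forall fun y => hatJ_le_of_rateJ y.2 hV)
    rw [hr.hatJ_eq hθ.cont hb _ fun k => (hV k).2]
    simp only [fun y => (hρ y).hatJ_eq (β := β) (J := J) hθ.cont hb
      (fun t => (y.1 t).1) fun k => (hV k).2]
    have h3 := fun k => tendsto_integral_pair (w := fun (y : S) t => (y.1 t).1 k)
      (w₀ := fun t => (x t).1 k) hR (fun y g M hg hM hgM => hbd γ hγ y.1 y.2 k g M hg hM hgM)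
      (fun g hg ε hε => by
        obtain ⟨δ, hδ, h⟩ := hmod g hg ε hε
        exact ⟨δ, hδ, fun y => h γ hγ y.1 y.2 k⟩) (h1 k) (hV k).1.continuous_tderiv
    refine Tendsto.add (Tendsto.sub (tendsto_finsetSum _ fun k _ =>
      h1 k _ _ (continuous_slice (hV k).1.continuous _)) ?_)
      (tendsto_integral_spat hθ.cont hb hρ hr hs fun k => (hV k).2)
    rw [integral_finsetSum _ fun k _ => (BM.of_continuous (h3 k).2.1).integrable _]
    simp only [fun y : S => integral_finsetSum (μ := (volume : Measure (TimeI T))) Finset.univ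
      fun k _ => (BM.of_continuous ((h3 k).1 y)).integrable _]
    exact tendsto_finsetSum _ fun k _ => (h3 k).2.2
  -- The continuity equation of the limit converts the bound on `𝒥` tests into the bound on
  -- mollified `ℐ` tests, and the energy estimate then shows that `Q` of the limit is finite.
  have hG : Good β J b γ a fun t => (x t).2 := by
    refine ⟨hxF, fun N A hA => ?_, fun F hF t =>
      ((Meas.continuous_pair hF).comp continuous_snd).continuousAt.comp_continuousWithinAt
        (x.right_cont t)⟩
    rw [← hatJ_eq_hatI hr hθ.cont hb hγ hce N hA]
    exact key _ (isC_gradMop N hA)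
  change rateJ β J b γ x ≤ a
  unfold rateJ
  rw [if_pos (energy_lt_top.2 ⟨hce, hxF, hG.energyQ_lt_top hθ hc hC hcC hb hγ⟩)]
  exact iSup_le fun V => EReal.coe_le_coe_iff.2 (key V.1 V.2)

end Closed

end KawasakiKac

end

theorem proposition4p2 (n : ℕ) (hn : 1 ≤ n) (T : ℝ) [hT : Fact (0 < T)] (β : ℝ) (hβ : 0 ≤ β)
    (J : KawasakiKac.KacKernel n) (b : KawasakiKac.bdry n → ℝ)
    (hb : KawasakiKac.AdmissibleBoundary b)
    (γ : KawasakiKac.Meas n) (hγ : γ ∈ KawasakiKac.F1 n) :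
    LowerSemicontinuous
      (KawasakiKac.rateJ β J b γ : KawasakiKac.Path T (KawasakiKac.MeasVec n) → EReal) ∧
    LowerSemicontinuous
      (KawasakiKac.rateI β J b γ : KawasakiKac.Path T (KawasakiKac.Meas n) → EReal) ∧
    ∀ a : ℝ, IsCompact
      {π : KawasakiKac.Path T (KawasakiKac.Meas n) | KawasakiKac.rateI β J b γ π ≤ (a : EReal)} := by
  obtain ⟨θ, c, C, hθ, hc, hC, hcC, hθb⟩ := KawasakiKac.AdmissibleBoundary.exists_isC1 hb
  exact ⟨KawasakiKac.lowerSemicontinuous_of_sublevel fun a =>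
      KawasakiKac.isClosed_rateJ hθ hc hC hcC hθb a hγ,
    KawasakiKac.lowerSemicontinuous_of_sublevel fun a =>
      KawasakiKac.isClosed_rateI hθ hc hC hcC hθb a hγ,
    fun a => KawasakiKac.isCompact_rateI hθ hc hC hcC hθb a hγ⟩
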